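/- Let $p$ be a prime and $k\ge 0$ an even integer. Let $B=\left(\frac{a,b}{\mathbb Q}\right)$, $a,b<0$, be a definite quaternion algebra over $\mathbb Q$, $R\subset B$ a $\mathbb Z$-order, and $\iota\colon B\to M_2(\mathbb Q_p)$ a homomorphism of $\mathbb Q$-algebras with $\mathbb Z_p\cdot\iota(R)=M_2(\mathbb Z_p)$ (for example, $B$ of discriminant $N^-$ prime to $p$ and $R$ an Eichler order of level $N^+$ prime to $pN^-$). Let $\Gamma\subset \mathrm{SL}_2(\mathbb Q_p)$ be the image under $\iota$ of the group of elements of reduced norm $1$ in $R[1/p]^\times$. Let $\mathcal P_k\subset\mathbb Q_p[x]$ be the polynomials of degree $\le k$, and put $(f\cdot_k g)(x)=\det(g)^{-k/2}(cx+d)^k f\!\left(\frac{ax+b}{cx+d}\right)$ for $g=\begin{pmatrix}a&b\\c&d\end{pmatrix}\in \mathrm{GL}_2(\mathbb Q_p)$. Let $V_k=\mathrm{Hom}(\mathcal P_k,\mathbb Q_p)$, with left action $(g\cdot\omega)(P)=\omega(P\cdot_k g)$ and right action $\omega\cdot g=g^{-1}\cdot\omega$. Let $\mathcal T$ be the Bruhat–Tits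 tree of $\mathrm{GL}_2(\mathbb Q_p)$, $e_0$ its oriented edge from $\begin{pmatrix}0&1\\p&0\end{pmatrix}[\mathbb Z_p^2]$ to $[\mathbb Z_p^2]$, and $e\mapsto U_e$ the $\mathrm{GL}_2(\mathbb Q_p)$-equivariant bijection from oriented edges to compact open balls in $\mathbb P^1(\mathbb Q_p)$ with $U_{e_0}=\mathbb Z_p$. Let $\Gamma_0(p\mathbb Z_p)\subset\mathrm{GL}_2(\mathbb Z_p)$ be the matrices that are upper triangular mod $p$. Let $\mathbb D_k$ be the continuous dual of the Tate algebra $\{\sum a_nx^n : a_n\to0\}$ over $\mathbb Q_p$, with the right action $(\omega\cdot g)(f)=\omega(f\cdot_k g^{-1})$ of $\mathbb Q_p^\times\Sigma_0(p)$, where $\Sigma_0(p)=\left\{\begin{pmatrix}a&b\\c&d\end{pmatrix}\in M_2(\mathbb Z_p): p\mid c,\ a\in\mathbb Z_p^\times,\ ad-bc\ne0\right\}$. For $V\in\{V_k,\mathbb D_k\}$, a form with values in $V$ is a map $\phi\colon\mathrm{GL}_2(\mathbb Q_p)\to V$ with $\phi(u\gamma g\sigma)=\phi(g)\cdot\sigma$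 for $u\in\mathbb Q_p^\times,\gamma\in\Gamma,\sigma\in\Gamma_0(p\mathbb Z_p)$; put $(U_p\phi)(g)=p^{k/2}\sum_{j=0}^{p-1}\phi(g\alpha_j)\cdot\alpha_j^{-1}$ with $\alpha_j=\begin{pmatrix}p&j\\0&1\end{pmatrix}$, and, for $V=V_k$, $(W_p\phi)(g)=\phi(gg_0)\cdot g_0^{-1}$ with $g_0=\begin{pmatrix}0&1\\p&0\end{pmatrix}$. Let $c$ be a $\Gamma$-invariant harmonic cocycle on $\mathcal T$ with values in $V_k$: a function on oriented edges with $c(\bar e)=-c(e)$, $\sum_{s(e)=v}c(e)=0$ for every vertex $v$, and $\gamma\cdot c(\gamma^{-1}e)=c(e)$ for $\gamma\in\Gamma$. Then: 1. There is a unique $V_k$-valued form $\phi_c$ with $U_p\phi_c=-p^{k/2}W_p\phi_c=p^{k/2}\phi_c$ and $c(ge_0)=g\cdot\phi_c(g)$ for all $g$. 2. Let $A_k^{\mathrm{loc}}$ be the space of $\mathbb Q_p$-valued functions on $\mathbb P^1(\mathbb Q_p)$ that are locally analytic except for a pole of order at most $k$ at $\infty$. There is a unique continuous linear form $\mu_c$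 on $A_k^{\mathrm{loc}}$ (write $\int_U f\,d\mu_c=\mu_c(f\chi_U)$) such that $\int_{U_e}P\,d\mu_c=c(e)(P)$ for all $e$ and $P\in\mathcal P_k$, and such that for some $C\ge0$ one has: $\left|\int_{U_e}x^n\,d\mu_c\right|\le C\rho^{-n+k/2}$ with $\rho=\sup_{z\in U_e}|1/z|$, for all $e$ with $\infty\in U_e$, $0\notin U_e$ and all integers $n\le k$; and $\left|\int_{U_e}(x-a)^n\,d\mu_c\right|\le C\rho^{n-k/2}$ with $\rho=\operatorname{diam}U_e$, for all $e$ with $\infty\notin U_e$, all $a\in U_e$ and all $n\ge0$. 3. There is a unique $\mathbb D_k$-valued form $\Phi_c$ with $U_p\Phi_c=p^{k/2}\Phi_c$ and $\Phi_c(g)|_{\mathcal P_k}=\phi_c(g)$ for all $g$, and it satisfies $$\Phi_c(g)(x^i)=m(\mu_c,g,i)=\int_{g\mathbb Z_p}(x^i\cdot_k g^{-1})\,d\mu_c\qquad\text{for all } g\in\mathrm{GL}_2(\mathbb Q_p),\ i\ge0.$$ -/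

import Mathlib

open scoped Quaternion Pointwise ZeroAtInfty Topology
open Filter

noncomputable section

namespace OverconvergentLift

/-! ### The group `Γ` attached to an order in a definite rational quaternion algebra -/

section Quaternionic

variable {a b : ℚ}

/-- A `ℤ`-order of `ℍ[ℚ,a,b]`: a subring, finitely generated over `ℤ`, spanning over `ℚ`. -/
def IsOrder (R : Subring ℍ[ℚ,a,b]) : Prop :=
  R.toAddSubgroup.FG ∧ Submodule.span ℚ (R : Set ℍ[ℚ,a,b]) = ⊤

/-- The ring `R[1/p]`. -/
def invertP (p : ℕ) (R : Subring ℍ[ℚ,a,b]) : Subring ℍ[ℚ,a,b] where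
  carrier := {x | ∃ n : ℕ, (p : ℚ) ^ n • x ∈ R}
  zero_mem' := ⟨0, by simp⟩
  one_mem' := ⟨0, by simp⟩
  neg_mem' := by
    rintro x ⟨n, hx⟩
    exact ⟨n, by simpa only [smul_neg] using R.neg_mem hx⟩
  add_mem' := by
    rintro x y ⟨n, hx⟩ ⟨m, hy⟩
    refine ⟨n + m, ?_⟩
    have h1 : (p : ℚ) ^ (n + m) • x = (p ^ m) • ((p : ℚ) ^ n • x) := by
      rw [← Nat.cast_smul_eq_nsmul ℚ, smul_smul]; push_cast; ring_nf
    have h2 : (p : ℚ) ^ (n + m) • y = (p ^ n) • ((p : ℚ) ^ m • y) := by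
      rw [← Nat.cast_smul_eq_nsmul ℚ, smul_smul]; push_cast; ring_nf
    rw [smul_add, h1, h2]
    exact R.add_mem (R.nsmul_mem hx _) (R.nsmul_mem hy _)
  mul_mem' := by
    rintro x y ⟨n, hx⟩ ⟨m, hy⟩
    refine ⟨n + m, ?_⟩
    have h : (p : ℚ) ^ (n + m) • (x * y) = ((p : ℚ) ^ n • x) * ((p : ℚ) ^ m • y) := by
      rw [smul_mul_smul_comm, pow_add]
    rw [h]
    exact R.mul_mem hx hy

/-- The units of reduced norm one in a subring; the reduced norm of `x` is `x * star x`. -/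
def normOneUnits (S : Subring ℍ[ℚ,a,b]) : Subgroup Sˣ where
  carrier := {u | ((u : S) : ℍ[ℚ,a,b]) * star ((u : S) : ℍ[ℚ,a,b]) = 1}
  one_mem' := by simp
  mul_mem' := by
    intro u v hu hv
    simp only [Set.mem_ofPred_eq, Units.val_mul, Subring.coe_mul, star_mul] at *
    rw [mul_assoc, ← mul_assoc _ (star _) (star _), hv, one_mul, hu]
  inv_mem' := by
    intro u hu
    simp only [Set.mem_ofPred_eq] at *
    have h1 : ((u⁻¹ : Sˣ) : S).1 * (u : S).1 = 1 := by
      rw [← Subring.coe_mul, Units.inv_mul, Subring.coe_one]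
    have h2 : star (u : S).1 = ((u⁻¹ : Sˣ) : S).1 := by
      calc star (u : S).1 = ((u⁻¹ : Sˣ) : S).1 * (u : S).1 * star (u : S).1 := by rw [h1, one_mul]
        _ = _ := by rw [mul_assoc, hu, mul_one]
    rw [← h2, star_star, h2, h1]

/-- `Γ`: the image in `GL₂(ℚ_p)` of the units of reduced norm one of `R[1/p]`. -/
def Gam {p : ℕ} [Fact p.Prime] (R : Subring ℍ[ℚ,a,b])
    (ι : ℍ[ℚ,a,b] →ₐ[ℚ] Matrix (Fin 2) (Fin 2) ℚ_[p]) : Subgroup (GL (Fin 2) ℚ_[p]) :=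
  (normOneUnits (invertP p R)).map
    (Units.map ((ι : ℍ[ℚ,a,b] →* Matrix (Fin 2) (Fin 2) ℚ_[p]).comp
      ((invertP p R).subtype : invertP p R →* ℍ[ℚ,a,b])))

/-- `ι` identifies `R ⊗ ℤ_p` with `M₂(ℤ_p)`. -/
def IsSplitting {p : ℕ} [Fact p.Prime] (R : Subring ℍ[ℚ,a,b])
    (ι : ℍ[ℚ,a,b] →ₐ[ℚ] Matrix (Fin 2) (Fin 2) ℚ_[p]) : Prop :=
  (Submodule.span ℤ_[p] (ι '' (R : Set ℍ[ℚ,a,b])) : Set (Matrix (Fin 2) (Fin 2) ℚ_[p])) =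
    {M | ∀ i j, ‖M i j‖ ≤ 1}

end Quaternionic

variable (p : ℕ) [Fact p.Prime]

/-! ### The Bruhat–Tits tree -/

/-- `ℤ_p`-lattices in `ℚ_p²`. -/
abbrev Lat : Type := {L : Submodule ℤ_[p] (Fin 2 → ℚ_[p]) // L.IsLattice ℚ_[p]}

/-- The scaling action of `ℚ_pˣ` on lattices. -/
instance : MulAction ℚ_[p]ˣ (Lat p) where
  smul u L := ⟨u • L.1, haveI := L.2; inferInstance⟩
  one_smul L := Subtype.ext (one_smul _ L.1)
  mul_smul u v L := Subtype.ext (mul_smul u v L.1)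

/-- Vertices: homothety classes of lattices. -/
def Vert : Type := MulAction.orbitRel.Quotient ℚ_[p]ˣ (Lat p)

variable {p}

/-- The homothety class of a lattice. -/
def Lat.cls (L : Lat p) : Vert p := Quotient.mk _ L

/-- `g L`, by matrix multiplication. -/
def Lat.act (g : GL (Fin 2) ℚ_[p]) (L : Lat p) : Lat p :=
  ⟨L.1.map ((Matrix.mulVecLin (g : Matrix (Fin 2) (Fin 2) ℚ_[p])).restrictScalars ℤ_[p]), by
    refine ⟨L.2.fg.map _, ?_⟩
    have h := Submodule.map_span (Matrix.mulVecLin (g : Matrix (Fin 2) (Fin 2) ℚ_[p])) (L.1 : Set _)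
    rw [L.2.span_eq_top, Submodule.map_top] at h
    have h2 : LinearMap.range (Matrix.mulVecLin (g : Matrix (Fin 2) (Fin 2) ℚ_[p])) = ⊤ := by
      rw [LinearMap.range_eq_top]
      intro v
      refine ⟨Matrix.mulVec ((g⁻¹ : GL (Fin 2) ℚ_[p]) : Matrix (Fin 2) (Fin 2) ℚ_[p]) v, ?_⟩
      simp only [Matrix.mulVecLin_apply, Matrix.mulVec_mulVec]
      rw [← Units.val_mul, mul_inv_cancel, Units.val_one, Matrix.one_mulVec]
    rw [h2] at h
    simpa using h.symm⟩

lemma Lat.mem_act (g : GL (Fin 2) ℚ_[p]) (L : Lat p) (v : Fin 2 → ℚ_[p]) :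
    v ∈ (L.act g).1 ↔ ∃ w ∈ L.1, (g : Matrix (Fin 2) (Fin 2) ℚ_[p]).mulVec w = v := Iff.rfl

instance : MulAction (GL (Fin 2) ℚ_[p]) (Lat p) where
  smul g L := L.act g
  one_smul L := by
    refine Subtype.ext (Submodule.ext fun v => (Lat.mem_act _ _ _).trans ?_)
    simp
  mul_smul g h L := by
    refine Subtype.ext (Submodule.ext fun v => (Lat.mem_act _ _ _).trans ?_)
    constructor
    · rintro ⟨w, hw, rfl⟩
      exact ⟨_, ⟨w, hw, rfl⟩, Matrix.mulVec_mulVec w g.1 h.1⟩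
    · rintro ⟨_, ⟨w, hw, rfl⟩, rfl⟩
      exact ⟨w, hw, (Matrix.mulVec_mulVec w g.1 h.1).symm⟩

lemma Lat.mem_smul (g : GL (Fin 2) ℚ_[p]) (L : Lat p) (v : Fin 2 → ℚ_[p]) :
    v ∈ (g • L).1 ↔ ∃ w ∈ L.1, (g : Matrix (Fin 2) (Fin 2) ℚ_[p]).mulVec w = v := Iff.rfl

lemma Lat.mem_scale (u : ℚ_[p]ˣ) (L : Lat p) (v : Fin 2 → ℚ_[p]) :
    v ∈ (u • L).1 ↔ ∃ w ∈ L.1, (u : ℚ_[p]) • w = v := Iff.rfl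

instance : SMulCommClass (GL (Fin 2) ℚ_[p]) ℚ_[p]ˣ (Lat p) where
  smul_comm g u L := by
    refine Subtype.ext (Submodule.ext fun v => ?_)
    rw [Lat.mem_smul, Lat.mem_scale]
    constructor
    · rintro ⟨_, ⟨w, hw, rfl⟩, rfl⟩
      exact ⟨_, ⟨w, hw, rfl⟩, (Matrix.mulVec_smul _ (u : ℚ_[p]) w).symm⟩
    · rintro ⟨_, ⟨w, hw, rfl⟩, rfl⟩
      exact ⟨_, ⟨w, hw, rfl⟩, Matrix.mulVec_smul _ (u : ℚ_[p]) w⟩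

/-- The action `g [L] = [g L]` on vertices. -/
instance : MulAction (GL (Fin 2) ℚ_[p]) (Vert p) where
  smul g := Quotient.map (fun L => g • L) (by
    rintro _ L ⟨u, rfl⟩
    exact ⟨u, (smul_comm g u L).symm⟩)
  one_smul v := by
    induction v using Quotient.inductionOn with
    | h L => exact congrArg Lat.cls (one_smul _ L)
  mul_smul g h v := by
    induction v using Quotient.inductionOn with
    | h L => exact congrArg Lat.cls (mul_smul g h L)

/-- `p`, as a unit of `ℚ_p`. -/
def pUnit : ℚ_[p]ˣ :=
  Units.mk0 (p : ℚ_[p]) (by exact_mod_cast (Fact.out : p.Prime).ne_zero)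

/-- `v` and `w` are joined by an edge: `pL ⊊ L' ⊊ L` for some `L ∈ v`, `L' ∈ w`. -/
def Joined (v w : Vert p) : Prop :=
  ∃ L L' : Lat p, L.cls = v ∧ L'.cls = w ∧
    ((pUnit : ℚ_[p]ˣ) • L).1 < L'.1 ∧ L'.1 < L.1

lemma Lat.scale_le {u : ℚ_[p]ˣ} (hu : ‖(u : ℚ_[p])‖ ≤ 1) (L : Lat p) : (u • L).1 ≤ L.1 := by
  rintro _ ⟨w, hw, rfl⟩
  exact L.1.smul_mem (⟨(u : ℚ_[p]), hu⟩ : ℤ_[p]) hw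

lemma Lat.scale_mono (u : ℚ_[p]ˣ) {L L' : Lat p} (h : L.1 ≤ L'.1) : (u • L).1 ≤ (u • L').1 := by
  rintro _ ⟨w, hw, rfl⟩
  exact ⟨w, h hw, rfl⟩

lemma Lat.scale_lt (u : ℚ_[p]ˣ) {L L' : Lat p} (h : L.1 < L'.1) : (u • L).1 < (u • L').1 := by
  refine lt_of_le_not_ge (Lat.scale_mono u h.le) fun h' => h.not_ge ?_
  simpa using Lat.scale_mono u⁻¹ h'

lemma Lat.smul_mono (g : GL (Fin 2) ℚ_[p]) {L L' : Lat p} (h : L.1 ≤ L'.1) :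
    (g • L).1 ≤ (g • L').1 := by
  rintro _ ⟨w, hw, rfl⟩
  exact ⟨w, h hw, rfl⟩

lemma Lat.smul_lt (g : GL (Fin 2) ℚ_[p]) {L L' : Lat p} (h : L.1 < L'.1) :
    (g • L).1 < (g • L').1 := by
  refine lt_of_le_not_ge (Lat.smul_mono g h.le) fun h' => h.not_ge ?_
  simpa using Lat.smul_mono g⁻¹ h'

lemma Lat.cls_scale (u : ℚ_[p]ˣ) (L : Lat p) : (u • L).cls = L.cls :=
  Quotient.sound ⟨u, rfl⟩

lemma Joined.symm {v w : Vert p} : Joined v w → Joined w v := by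
  rintro ⟨L, L', rfl, rfl, h1, h2⟩
  exact ⟨L', pUnit • L, rfl, Lat.cls_scale _ _, Lat.scale_lt _ h2, h1⟩

lemma Joined.irrefl (v : Vert p) : ¬ Joined v v := by
  rintro ⟨L, L', h, h', h1, h2⟩
  obtain ⟨u, rfl⟩ : ∃ u : ℚ_[p]ˣ, u • L = L' := Quotient.exact (h'.trans h.symm)
  by_cases hu : 1 ≤ ‖(u : ℚ_[p])‖
  · refine h2.not_ge ?_
    have : (u⁻¹ • (u • L)).1 ≤ (u • L).1 := Lat.scale_le (by
      rw [Units.val_inv_eq_inv_val, norm_inv]; exact inv_le_one_of_one_le₀ hu) _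
    simpa using this
  · refine h1.not_ge ?_
    have hp : ‖((pUnit⁻¹ * u : ℚ_[p]ˣ) : ℚ_[p])‖ ≤ 1 := by
      have hu1 : ‖(u : ℚ_[p])‖ ≤ (p : ℝ) ^ (-1 : ℤ) := by
        have := (Padic.norm_le_pow_iff_norm_lt_pow_add_one (u : ℚ_[p]) (-1)).2
        simpa using this (by simpa using not_le.1 hu)
      have hp0 : (0 : ℝ) < p := by exact_mod_cast (Fact.out : p.Prime).pos
      rw [Units.val_mul, Units.val_inv_eq_inv_val, norm_mul, norm_inv, pUnit, Units.val_mk0,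
        Padic.norm_p, inv_inv]
      calc (p : ℝ) * ‖(u : ℚ_[p])‖ ≤ p * (p : ℝ) ^ (-1 : ℤ) := by gcongr
        _ = 1 := by rw [zpow_neg_one, mul_inv_cancel₀ hp0.ne']
    have := Lat.scale_mono (pUnit : ℚ_[p]ˣ) (Lat.scale_le hp L)
    simpa [smul_smul] using this

variable (p) in
/-- The Bruhat–Tits tree of `GL₂(ℚ_p)`.  Its oriented edges are the darts `e`, with source `e.fst`,
target `e.snd` and opposite edge `e.symm`. -/
def tree : SimpleGraph (Vert p) where
  Adj := Joined
  symm := ⟨fun _ _ h => h.symm⟩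
  loopless := ⟨fun v h => Joined.irrefl v h⟩

variable (p) in
/-- Oriented edges of the tree. -/
abbrev Edge : Type := (tree p).Dart

lemma Joined.act (g : GL (Fin 2) ℚ_[p]) {v w : Vert p} : Joined v w → Joined (g • v) (g • w) := by
  rintro ⟨L, L', rfl, rfl, h1, h2⟩
  refine ⟨g • L, g • L', rfl, rfl, ?_, Lat.smul_lt g h2⟩
  rw [← smul_comm]
  exact Lat.smul_lt g h1

instance : MulAction (GL (Fin 2) ℚ_[p]) (Edge p) where
  smul g e := ⟨(g • e.fst, g • e.snd), Joined.act g e.adj⟩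
  one_smul e := SimpleGraph.Dart.ext _ _ (Prod.ext (one_smul _ e.fst) (one_smul _ e.snd))
  mul_smul g h e :=
    SimpleGraph.Dart.ext _ _ (Prod.ext (mul_smul g h e.fst) (mul_smul g h e.snd))

variable (p) in
/-- The standard lattice `ℤ_p²`. -/
def stdLat : Lat p :=
  ⟨Submodule.span ℤ_[p] (Set.range (Pi.basisFun ℚ_[p] (Fin 2))), by
    refine ⟨Submodule.fg_span (Set.finite_range _), ?_⟩
    rw [Submodule.span_span_of_tower, Module.Basis.span_eq]⟩

variable (p) in
/-- The matrix `(0 1; p 0)`. -/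
def g0 : GL (Fin 2) ℚ_[p] :=
  Matrix.GeneralLinearGroup.mkOfDetNeZero !![0, 1; (p : ℚ_[p]), 0] (by
    simpa [Matrix.det_fin_two] using (Fact.out : p.Prime).ne_zero)

lemma mem_stdLat (v : Fin 2 → ℚ_[p]) : v ∈ (stdLat p).1 ↔ ∀ i, ‖v i‖ ≤ 1 := by
  rw [stdLat, Module.Basis.mem_span_iff_repr_mem]
  refine forall_congr' fun i => ?_
  rw [Pi.basisFun_repr]
  exact ⟨fun ⟨x, hx⟩ => hx ▸ x.2, fun h => ⟨⟨v i, h⟩, rfl⟩⟩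

lemma mem_g0_stdLat (v : Fin 2 → ℚ_[p]) :
    v ∈ (g0 p • stdLat p).1 ↔ ‖v 0‖ ≤ 1 ∧ ‖v 1 / p‖ ≤ 1 := by
  have hp : (p : ℚ_[p]) ≠ 0 := by exact_mod_cast (Fact.out : p.Prime).ne_zero
  have e : ∀ w : Fin 2 → ℚ_[p],
      (g0 p : Matrix (Fin 2) (Fin 2) ℚ_[p]).mulVec w = ![w 1, p * w 0] := fun w => by
    ext i
    fin_cases i <;> simp [g0, Matrix.GeneralLinearGroup.mkOfDetNeZero, Matrix.mulVec,
      dotProduct, Fin.sum_univ_two]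
  rw [Lat.mem_smul]
  constructor
  · rintro ⟨w, hw, rfl⟩
    have hw := (mem_stdLat w).1 hw
    rw [e]
    simpa [mul_div_cancel_left₀ _ hp] using And.intro (hw 1) (hw 0)
  · rintro ⟨h0, h1⟩
    refine ⟨![v 1 / p, v 0], (mem_stdLat _).2 (Fin.forall_fin_two.2 ⟨h1, h0⟩), ?_⟩
    rw [e]
    ext i
    fin_cases i <;> simp [mul_div_cancel₀ _ hp]

variable (p) in
/-- The oriented edge `e₀` with source `v₁ = (0 1; p 0) v₀` and target `v₀ = [ℤ_p²]`. -/
def e0 : Edge p :=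
  ⟨(g0 p • (stdLat p).cls, (stdLat p).cls), by
    refine Joined.symm ⟨stdLat p, g0 p • stdLat p, rfl, rfl, ?_, ?_⟩
    · refine SetLike.lt_iff_le_and_exists.2 ⟨?_, ![1, 0], ?_, ?_⟩
      · rintro _ ⟨w, hw, rfl⟩
        have hw := (mem_stdLat w).1 hw
        have hp : (p : ℚ_[p]) ≠ 0 := by exact_mod_cast (Fact.out : p.Prime).ne_zero
        refine (mem_g0_stdLat _).2 ⟨?_, ?_⟩
        on_goal 2 =>
          show ‖(p : ℚ_[p]) * w 1 / p‖ ≤ 1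
          rw [mul_div_cancel_left₀ _ hp]
          exact hw 1
        show ‖(p : ℚ_[p]) * w 0‖ ≤ 1
        rw [norm_mul]
        exact mul_le_one₀ (Padic.norm_p_lt_one).le (norm_nonneg _) (hw 0)
      · exact (mem_g0_stdLat _).2 (by simp)
      · rintro ⟨w, hw, h⟩
        have hw := (mem_stdLat w).1 hw 0
        have h : (p : ℚ_[p]) * w 0 = 1 := congrFun h 0
        have := congrArg norm h
        rw [norm_mul, norm_one] at this
        exact absurd this (mul_lt_one_of_nonneg_of_lt_one_left (norm_nonneg _)
          Padic.norm_p_lt_one hw).ne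
    · refine SetLike.lt_iff_le_and_exists.2 ⟨fun v hv => ?_, ![0, 1], (mem_stdLat _).2 ?_, ?_⟩
      · obtain ⟨h0, h1⟩ := (mem_g0_stdLat v).1 hv
        refine (mem_stdLat v).2 (Fin.forall_fin_two.2 ⟨h0, ?_⟩)
        have := mul_le_one₀ (Padic.norm_p_lt_one (p := p)).le (norm_nonneg _) h1
        have hp : (p : ℚ_[p]) ≠ 0 := by exact_mod_cast (Fact.out : p.Prime).ne_zero
        rwa [← norm_mul, mul_div_cancel₀ _ hp] at this
      · simp [Fin.forall_fin_two]
      · intro h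
        have := ((mem_g0_stdLat _).1 h).2
        simp only [Matrix.cons_val_one, Matrix.cons_val_fin_one, one_div] at this
        rw [norm_inv, Padic.norm_p, inv_inv] at this
        have hp := (Fact.out : p.Prime).one_lt
        exact absurd this (not_le.2 (by exact_mod_cast hp))⟩

/-! ### Polynomials of degree at most `k` and their dual -/

variable (p) in
/-- `𝒫_k`: polynomials over `ℚ_p` of degree at most `k`. -/
abbrev Pk (k : ℕ) : Type := Polynomial.degreeLE ℚ_[p] k

variable (p) in
/-- `V_k`, the linear dual of `𝒫_k`. -/
abbrev Vk (k : ℕ) : Type := Module.Dual ℚ_[p] (Pk p k)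

open Polynomial in
/-- The right action `(P ·_k g)(x) = det(g)^{-k/2} (cx+d)^k P((ax+b)/(cx+d))` on `𝒫_k`, written
out as `det(g)^{-k/2} ∑ Pᵢ (ax+b)^i (cx+d)^{k-i}`. -/
def polyAct (k : ℕ) (g : GL (Fin 2) ℚ_[p]) : Pk p k →ₗ[ℚ_[p]] Pk p k where
  toFun P := ⟨((g : Matrix (Fin 2) (Fin 2) ℚ_[p]).det ^ (k / 2))⁻¹ •
      ∑ i ∈ Finset.range (k + 1), P.1.coeff i •
        ((C (g 0 0) * X + C (g 0 1)) ^ i * (C (g 1 0) * X + C (g 1 1)) ^ (k - i)), by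
    refine Submodule.smul_mem _ _ (Submodule.sum_mem _ fun i hi => Submodule.smul_mem _ _ ?_)
    rw [Polynomial.mem_degreeLE]
    have hik : i ≤ k := Nat.lt_succ_iff.1 (Finset.mem_range.1 hi)
    calc ((C (g 0 0) * X + C (g 0 1)) ^ i * (C (g 1 0) * X + C (g 1 1)) ^ (k - i)).degree
        ≤ i • (1 : WithBot ℕ) + (k - i) • (1 : WithBot ℕ) :=
          (degree_mul_le _ _).trans (add_le_add
            (degree_pow_le_of_le _ degree_linear_le |>.trans (by simp))
            (degree_pow_le_of_le _ degree_linear_le |>.trans (by simp)))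
      _ = k := by
        rw [← add_smul, Nat.add_sub_cancel' hik]; simp⟩
  map_add' P Q := Subtype.ext (by
    simp [add_smul, Finset.sum_add_distrib, smul_add])
  map_smul' r P := Subtype.ext (by
    simp only [Submodule.coe_smul, Polynomial.coeff_smul, smul_eq_mul, mul_smul, RingHom.id_apply,
      ← Finset.smul_sum]
    rw [smul_comm])

/-- The left action of `GL₂(ℚ_p)` on `V_k`: `(g · ω)(P) = ω(P ·_k g)`. -/
def leftAct (k : ℕ) (g : GL (Fin 2) ℚ_[p]) (ω : Vk p k) : Vk p k := ω.comp (polyAct k g)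

/-- The right action of `GL₂(ℚ_p)` on `V_k`: `(ω · g)(P) = ω(P ·_k g⁻¹)`. -/
def rightAct (k : ℕ) (ω : Vk p k) (g : GL (Fin 2) ℚ_[p]) : Vk p k := ω.comp (polyAct k g⁻¹)

/-- `c ∈ C_h(Γ, V_k)`: a `Γ`-invariant harmonic cocycle on the tree with values in `V_k`. -/
structure IsHarmonicCocycle (Γ : Subgroup (GL (Fin 2) ℚ_[p])) (k : ℕ) (c : Edge p → Vk p k) :
    Prop where
  alternating : ∀ e : Edge p, c e.symm = -c e
  harmonic : ∀ v : Vert p, ∑ᶠ e : {e : Edge p // e.fst = v}, c e = 0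
  invariant : ∀ γ ∈ Γ, ∀ e : Edge p, leftAct k γ (c (γ⁻¹ • e)) = c e

/-! ### The Tate algebra and rigid analytic distributions -/

variable (p) in
/-- The Tate algebra in one variable: power series `∑ aₙ xⁿ` with `aₙ → 0`, given by their sequences
of coefficients, with the norm `sup ‖aₙ‖`. -/
abbrev Tate : Type := C₀(ℕ, ℚ_[p])

/-- The value `∑ aₙ zⁿ` of an element of the Tate algebra (for `‖z‖ ≤ 1`). -/
def Tate.eval (F : Tate p) (z : ℚ_[p]) : ℚ_[p] := ∑' n, F n * z ^ n

/-- A polynomial, as an element of the Tate algebra. -/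
def polyToTate : Polynomial ℚ_[p] →ₗ[ℚ_[p]] Tate p where
  toFun P := ⟨⟨fun n => P.coeff n, continuous_of_discreteTopology⟩, by
    rw [cocompact_eq_atTop]
    refine tendsto_const_nhds.congr' ?_
    filter_upwards [eventually_gt_atTop P.natDegree] with n hn
    exact (Polynomial.coeff_eq_zero_of_natDegree_lt hn).symm⟩
  map_add' P Q := by ext n; exact Polynomial.coeff_add P Q n
  map_smul' r P := by ext n; exact Polynomial.coeff_smul r P n

variable (p) in
/-- `Γ₀(pℤ_p)`, inside `GL₂(ℚ_p)`. -/
def Gamma0 : Set (GL (Fin 2) ℚ_[p]) :=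
  {g | ∃ σ : GL (Fin 2) ℤ_[p], (p : ℤ_[p]) ∣ σ 1 0 ∧
    g = Matrix.GeneralLinearGroup.map PadicInt.Coe.ringHom σ}

variable (p) in
/-- The monoid `Σ₀(p)`. -/
def Sigma0 : Set (Matrix (Fin 2) (Fin 2) ℤ_[p]) :=
  {σ | (p : ℤ_[p]) ∣ σ 1 0 ∧ IsUnit (σ 0 0) ∧ σ.det ≠ 0}

variable (p) in
/-- `ℚ_pˣ Σ₀(p)`, inside `GL₂(ℚ_p)`. -/
def QSigma0 : Set (GL (Fin 2) ℚ_[p]) :=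
  {g | ∃ u : ℚ_[p]ˣ, ∃ σ ∈ Sigma0 p,
    (g : Matrix (Fin 2) (Fin 2) ℚ_[p]) = (u : ℚ_[p]) • σ.map (fun x => (x : ℚ_[p]))}

/-- The power series expansion of
`det(g)^{-k/2} (-cx+a)^k ((dx-b)/(-cx+a))^i`, i.e. of `g ·_k xⁱ`. -/
def actMonomial (k : ℕ) (g : GL (Fin 2) ℚ_[p]) (i : ℕ) : PowerSeries ℚ_[p] :=
  PowerSeries.C (((g : Matrix (Fin 2) (Fin 2) ℚ_[p]).det ^ (k / 2))⁻¹) *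
    (PowerSeries.C (g 0 0) - PowerSeries.C (g 1 0) * PowerSeries.X) ^ k *
    ((PowerSeries.C (g 1 1) * PowerSeries.X - PowerSeries.C (g 0 1)) *
      (PowerSeries.C (g 0 0) - PowerSeries.C (g 1 0) * PowerSeries.X)⁻¹) ^ i

/-- Restricted power series with coefficients in `ℤ_p`. -/
def intTate : Subring (PowerSeries ℚ_[p]) :=
  PowerSeries.IsRestricted.subring 1 ⊓ (PowerSeries.map (PadicInt.Coe.ringHom (p := p))).range

lemma mem_intTate {f : PowerSeries ℚ_[p]} : f ∈ intTate ↔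
    Tendsto (fun n => PowerSeries.coeff n f) atTop (𝓝 0) ∧ ∀ n, ‖PowerSeries.coeff n f‖ ≤ 1 := by
  have h1 : f ∈ PowerSeries.IsRestricted.subring (1 : ℝ) ↔
      Tendsto (fun n => PowerSeries.coeff n f) atTop (𝓝 0) := by
    refine (show _ ↔ PowerSeries.IsRestricted 1 f from Iff.rfl).trans ?_
    rw [PowerSeries.isRestricted_iff']
    simp only [one_pow, mul_one]
    exact tendsto_zero_iff_norm_tendsto_zero.symm
  have h2 : f ∈ (PowerSeries.map (PadicInt.Coe.ringHom (p := p))).range ↔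
      ∀ n, ‖PowerSeries.coeff n f‖ ≤ 1 := by
    constructor
    · rintro ⟨F, rfl⟩ n
      rw [PowerSeries.coeff_map]
      exact (PowerSeries.coeff n F).2
    · intro h
      have h' : ∀ n, ∃ z : ℤ_[p], (z : ℚ_[p]) = PowerSeries.coeff n f := fun n => ⟨⟨_, h n⟩, rfl⟩
      choose z hz using h'
      refine ⟨PowerSeries.mk z, ?_⟩
      ext n
      rw [PowerSeries.coeff_map, PowerSeries.coeff_mk]
      exact hz n
  rw [intTate, Subring.mem_inf, h1, h2]

lemma inv_linear {a c : ℚ_[p]} (ha : a ≠ 0) :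
    (PowerSeries.C a - PowerSeries.C c * PowerSeries.X)⁻¹ =
      PowerSeries.C a⁻¹ * PowerSeries.mk fun n => (c / a) ^ n := by
  symm
  rw [PowerSeries.eq_inv_iff_mul_eq_one (by simpa using ha)]
  ext n
  cases n with
  | zero => simp [mul_sub, ha]
  | succ n =>
    have : (PowerSeries.C a⁻¹ * PowerSeries.mk fun n => (c / a) ^ n) *
        (PowerSeries.C a - PowerSeries.C c * PowerSeries.X) =
        PowerSeries.C a * (PowerSeries.C a⁻¹ * PowerSeries.mk fun n => (c / a) ^ n) -
        PowerSeries.C c * (PowerSeries.C a⁻¹ * PowerSeries.mk fun n => (c / a) ^ n) *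
          PowerSeries.X := by ring
    rw [this, map_sub, PowerSeries.coeff_succ_mul_X, PowerSeries.coeff_C_mul,
      PowerSeries.coeff_C_mul, PowerSeries.coeff_C_mul, PowerSeries.coeff_C_mul,
      PowerSeries.coeff_mk, PowerSeries.coeff_mk, PowerSeries.coeff_one]
    simp only [Nat.succ_ne_zero, if_false]
    rw [pow_succ]
    field_simp
    ring

lemma QSigma0.norms {g : GL (Fin 2) ℚ_[p]} (hg : g ∈ QSigma0 p) :
    g 0 0 ≠ 0 ∧ ‖g 1 0 / g 0 0‖ < 1 ∧ ‖g 0 1 / g 0 0‖ ≤ 1 ∧ ‖g 1 1 / g 0 0‖ ≤ 1 := by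
  obtain ⟨u, σ, ⟨hc, ha, -⟩, h⟩ := hg
  have e : ∀ i j, g i j = u * (σ i j : ℚ_[p]) := fun i j => by
    rw [show g i j = (g : Matrix (Fin 2) (Fin 2) ℚ_[p]) i j from rfl, h]; rfl
  have hu : (u : ℚ_[p]) ≠ 0 := u.ne_zero
  have ha1 : ‖(σ 0 0 : ℚ_[p])‖ = 1 := by simpa using PadicInt.isUnit_iff.1 ha
  have ha0 : (σ 0 0 : ℚ_[p]) ≠ 0 := by
    intro h0; rw [h0, norm_zero] at ha1; exact zero_ne_one ha1
  have hc1 : ‖(σ 1 0 : ℚ_[p])‖ < 1 := by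
    simpa using (PadicInt.norm_lt_one_iff_dvd (σ 1 0)).2 hc
  have q : ∀ i j, ‖g i j / g 0 0‖ = ‖(σ i j : ℚ_[p])‖ := fun i j => by
    rw [e, e, mul_div_mul_left _ _ hu, norm_div, ha1, div_one]
  refine ⟨?_, ?_, ?_, ?_⟩
  · rw [e]; exact mul_ne_zero hu ha0
  · rw [q]; exact hc1
  · rw [q]; exact (σ 0 1).2
  · rw [q]; exact (σ 1 1).2

/-- The coefficients of the monomials' images tend to zero and are uniformly bounded. -/
lemma actMonomial_bound (k : ℕ) {g : GL (Fin 2) ℚ_[p]} (hg : g ∈ QSigma0 p) (i : ℕ) :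
    Tendsto (fun n => PowerSeries.coeff n (actMonomial k g i)) atTop (𝓝 0) ∧
    ∀ n, ‖PowerSeries.coeff n (actMonomial k g i)‖ ≤
      ‖((g : Matrix (Fin 2) (Fin 2) ℚ_[p]).det ^ (k / 2))⁻¹ * g 0 0 ^ k‖ := by
  obtain ⟨ha, hc, hb, hd⟩ := QSigma0.norms hg
  have hC : ∀ {z : ℚ_[p]}, ‖z‖ ≤ 1 → PowerSeries.C z ∈ intTate (p := p) := fun {z} hz =>
    mem_intTate.2 ⟨tendsto_const_nhds.congr' (by
      filter_upwards [eventually_gt_atTop 0] with n hn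
      simp [PowerSeries.coeff_C, hn.ne']), fun n => by
      rw [PowerSeries.coeff_C]; split_ifs <;> simp [hz]⟩
  have hX : (PowerSeries.X : PowerSeries ℚ_[p]) ∈ intTate (p := p) :=
    mem_intTate.2 ⟨tendsto_const_nhds.congr' (by
      filter_upwards [eventually_gt_atTop 1] with n hn
      simp [PowerSeries.coeff_X, hn.ne']), fun n => by
      rw [PowerSeries.coeff_X]; split_ifs <;> simp⟩
  have hG : (PowerSeries.mk fun n => (g 1 0 / g 0 0) ^ n) ∈ intTate (p := p) :=
    mem_intTate.2 ⟨by
      simpa using tendsto_pow_atTop_nhds_zero_of_norm_lt_one hc, fun n => by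
      rw [PowerSeries.coeff_mk, norm_pow]; exact pow_le_one₀ (norm_nonneg _) hc.le⟩
  set A := (PowerSeries.C 1 - PowerSeries.C (g 1 0 / g 0 0) * PowerSeries.X) ^ k *
    ((PowerSeries.C (g 1 1 / g 0 0) * PowerSeries.X - PowerSeries.C (g 0 1 / g 0 0)) *
      PowerSeries.mk fun n => (g 1 0 / g 0 0) ^ n) ^ i with hA
  have hAm : A ∈ intTate (p := p) :=
    mul_mem (pow_mem (sub_mem (hC (by simp)) (mul_mem (hC hc.le) hX)) _)
      (pow_mem (mul_mem (sub_mem (mul_mem (hC hd) hX) (hC hb)) hG) _)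
  have e1 : PowerSeries.C (g 0 0) - PowerSeries.C (g 1 0) * PowerSeries.X =
      PowerSeries.C (g 0 0) * (PowerSeries.C 1 - PowerSeries.C (g 1 0 / g 0 0) * PowerSeries.X) := by
    rw [mul_sub, ← mul_assoc, ← map_mul, ← map_mul, mul_div_cancel₀ _ ha, mul_one]
  have e2 : (PowerSeries.C (g 1 1) * PowerSeries.X - PowerSeries.C (g 0 1)) *
      (PowerSeries.C (g 0 0) - PowerSeries.C (g 1 0) * PowerSeries.X)⁻¹ =
      (PowerSeries.C (g 1 1 / g 0 0) * PowerSeries.X - PowerSeries.C (g 0 1 / g 0 0)) *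
      PowerSeries.mk fun n => (g 1 0 / g 0 0) ^ n := by
    rw [inv_linear ha, ← mul_assoc, sub_mul, mul_right_comm, ← map_mul, ← map_mul,
      ← div_eq_mul_inv, ← div_eq_mul_inv]
  have e : actMonomial k g i = PowerSeries.C
      (((g : Matrix (Fin 2) (Fin 2) ℚ_[p]).det ^ (k / 2))⁻¹ * g 0 0 ^ k) * A := by
    rw [actMonomial, e2, e1, mul_pow, map_mul, map_pow, hA]
    ring
  obtain ⟨t, b⟩ := mem_intTate.1 hAm
  rw [e]
  refine ⟨?_, fun n => ?_⟩
  · simp only [PowerSeries.coeff_C_mul]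
    simpa only [mul_zero] using
      t.const_mul (((g : Matrix (Fin 2) (Fin 2) ℚ_[p]).det ^ (k / 2))⁻¹ * g 0 0 ^ k)
  · rw [PowerSeries.coeff_C_mul, norm_mul]
    exact mul_le_of_le_one_right (norm_nonneg _) (b n)

lemma Tate.norm_apply_le (F : Tate p) (n : ℕ) : ‖F n‖ ≤ ‖F‖ := by
  rw [← ZeroAtInftyContinuousMap.norm_toBCF_eq_norm]
  exact F.toBCF.norm_coe_le_norm n

lemma Tate.tendsto (F : Tate p) : Tendsto (fun n => F n) atTop (𝓝 0) := by
  have := F.zero_at_infty'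
  rwa [cocompact_eq_atTop] at this

/-- If the power series `qᵢ` have uniformly bounded coefficients then `∑ Fᵢ qᵢ` converges
coefficientwise, for `F` in the Tate algebra. -/
lemma summable_coeff {q : ℕ → PowerSeries ℚ_[p]} {M : ℝ}
    (hq : ∀ i n, ‖PowerSeries.coeff n (q i)‖ ≤ M) (F : Tate p) (n : ℕ) :
    Summable fun i => F i * PowerSeries.coeff n (q i) := by
  refine NonarchimedeanAddGroup.summable_of_tendsto_cofinite_zero ?_
  rw [Nat.cofinite_eq_atTop]
  refine squeeze_zero_norm (a := fun i => ‖F i‖ * M) (fun i => ?_) ?_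
  · rw [norm_mul]; exact mul_le_mul_of_nonneg_left (hq i n) (norm_nonneg _)
  · simpa using (tendsto_zero_iff_norm_tendsto_zero.1 F.tendsto).mul_const M

/-- The continuous left action of `g ∈ ℚ_pˣ Σ₀(p)` on the Tate algebra,
`(g ·_k F)(x) = det(g)^{-k/2} (-cx+a)^k F((dx-b)/(-cx+a))`, that is `∑ Fᵢ (g ·_k xⁱ)`.  (This
expression is unchanged if `g` is replaced by a scalar multiple.) -/
def tateAct (k : ℕ) (g : GL (Fin 2) ℚ_[p]) (hg : g ∈ QSigma0 p) : Tate p →L[ℚ_[p]] Tate p :=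
  LinearMap.mkContinuous
    { toFun := fun F => ⟨⟨fun n => ∑' i, F i * PowerSeries.coeff n (actMonomial k g i),
          continuous_of_discreteTopology⟩, by
        rw [cocompact_eq_atTop]
        set M := ‖((g : Matrix (Fin 2) (Fin 2) ℚ_[p]).det ^ (k / 2))⁻¹ * g 0 0 ^ k‖
        have hM : ∀ i n, ‖PowerSeries.coeff n (actMonomial k g i)‖ ≤ M :=
          fun i n => (actMonomial_bound k hg i).2 n
        rw [Metric.tendsto_atTop]
        intro ε hε
        have h1 : Tendsto (fun i => ‖F i‖ * M) atTop (𝓝 0) := by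
          simpa using (tendsto_zero_iff_norm_tendsto_zero.1 F.tendsto).mul_const M
        obtain ⟨N, hN⟩ := eventually_atTop.1 (h1.eventually (gt_mem_nhds (half_pos hε)))
        have h2 : ∀ᶠ n in atTop, ∀ i ∈ Finset.range N,
            ‖F i * PowerSeries.coeff n (actMonomial k g i)‖ < ε / 2 := by
          rw [Filter.eventually_all_finset]
          intro i _
          have : Tendsto (fun n => ‖F i * PowerSeries.coeff n (actMonomial k g i)‖) atTop (𝓝 0) := by
            simpa using ((actMonomial_bound k hg i).1.const_mul (F i)).norm
          exact this.eventually (gt_mem_nhds (half_pos hε))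
        obtain ⟨N', hN'⟩ := eventually_atTop.1 h2
        refine ⟨N', fun n hn => ?_⟩
        rw [dist_zero_right]
        refine lt_of_le_of_lt ?_ (half_lt_self hε)
        refine IsUltrametricDist.norm_tsum_le_of_forall_le_of_nonneg (half_pos hε).le fun i => ?_
        by_cases hi : i < N
        · exact (hN' n hn i (Finset.mem_range.2 hi)).le
        · refine le_trans ?_ (hN i (not_lt.1 hi)).le
          rw [norm_mul]
          exact mul_le_mul_of_nonneg_left (hM i n) (norm_nonneg _)⟩
      map_add' := fun F G => by
        ext n
        have hM := fun i n => (actMonomial_bound k hg i).2 n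
        simpa [add_mul] using (summable_coeff hM F n).tsum_add (summable_coeff hM G n)
      map_smul' := fun r F => by
        ext n
        simpa [mul_assoc] using tsum_mul_left (a := r)
          (f := fun i => F i * PowerSeries.coeff n (actMonomial k g i)) }
    ‖((g : Matrix (Fin 2) (Fin 2) ℚ_[p]).det ^ (k / 2))⁻¹ * g 0 0 ^ k‖ (fun F => by
      rw [← ZeroAtInftyContinuousMap.norm_toBCF_eq_norm]
      refine (BoundedContinuousFunction.norm_le (by positivity)).2 fun n => ?_
      refine IsUltrametricDist.norm_tsum_le_of_forall_le_of_nonneg (by positivity) fun i => ?_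
      rw [norm_mul, mul_comm]
      exact mul_le_mul ((actMonomial_bound k hg i).2 n) (Tate.norm_apply_le F i)
        (norm_nonneg _) (norm_nonneg _))

variable (p) in
/-- `𝔻_k`: the continuous dual of the Tate algebra. -/
abbrev Dk : Type := Tate p →L[ℚ_[p]] ℚ_[p]

/-- The moment `ω(xⁱ)`. -/
def Dk.mom (ω : Dk p) (i : ℕ) : ℚ_[p] := ω (polyToTate (Polynomial.X ^ i))

/-- The weight `k` right action of `ℚ_pˣ Σ₀(p)` on `𝔻_k`: `(ω · g)(F) = ω(g ·_k F)`. -/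
def distAct (k : ℕ) (ω : Dk p) (g : GL (Fin 2) ℚ_[p]) (hg : g ∈ QSigma0 p) : Dk p :=
  ω.comp (tateAct k g hg)

/-- The projection `π : 𝔻_k → V_k`, restriction to `𝒫_k`. -/
def specialize (k : ℕ) (ω : Dk p) : Vk p k :=
  ω.toLinearMap.comp (polyToTate.comp (Polynomial.degreeLE ℚ_[p] k).subtype)

lemma Gamma0_subset : Gamma0 p ⊆ QSigma0 p := by
  rintro _ ⟨σ, hc, rfl⟩
  refine ⟨1, σ, ⟨hc, ?_, ?_⟩, ?_⟩
  · have hdet : IsUnit (σ : Matrix (Fin 2) (Fin 2) ℤ_[p]).det :=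
      (Matrix.isUnit_iff_isUnit_det _).1 σ.isUnit
    by_contra h
    have h1 : σ 0 0 ∈ IsLocalRing.maximalIdeal ℤ_[p] := (IsLocalRing.mem_maximalIdeal _).2 h
    have h2 : σ 1 0 ∈ IsLocalRing.maximalIdeal ℤ_[p] := by
      rw [PadicInt.maximalIdeal_eq_span_p, Ideal.mem_span_singleton]; exact hc
    refine (IsLocalRing.mem_maximalIdeal _).1 ?_ hdet
    rw [Matrix.det_fin_two]
    exact Ideal.sub_mem _ (Ideal.mul_mem_right _ _ h1) (Ideal.mul_mem_left _ _ h2)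
  · exact ((Matrix.isUnit_iff_isUnit_det _).1 σ.isUnit).ne_zero
  · ext i j
    simp
    rfl

/-- The matrix `α_j = (p j; 0 1)`. -/
def alpha (j : ℕ) : GL (Fin 2) ℚ_[p] :=
  Matrix.GeneralLinearGroup.mkOfDetNeZero !![(p : ℚ_[p]), (j : ℚ_[p]); 0, 1] (by
    simpa [Matrix.det_fin_two] using (Fact.out : p.Prime).ne_zero)

lemma alpha_inv_mem (j : ℕ) : (alpha j : GL (Fin 2) ℚ_[p])⁻¹ ∈ QSigma0 p := by
  have hp : (p : ℚ_[p]) ≠ 0 := by exact_mod_cast (Fact.out : p.Prime).ne_zero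
  refine ⟨pUnit⁻¹, !![1, -(j : ℤ_[p]); 0, (p : ℤ_[p])], ⟨by simp, by simp, ?_⟩, ?_⟩
  · simpa [Matrix.det_fin_two] using (Fact.out : p.Prime).ne_zero
  · rw [Matrix.coe_units_inv, Matrix.inv_def]
    ext i j
    fin_cases i <;> fin_cases j <;>
      simp [alpha, Matrix.GeneralLinearGroup.mkOfDetNeZero, pUnit, Matrix.det_fin_two,
        Matrix.adjugate_fin_two, hp]

/-! ### Automorphic forms -/

/-- `φ ∈ 𝐀_k(Γ)`: a `Γ`-invariant `p`-adic automorphic form with values in `V_k`. -/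
structure IsForm (Γ : Subgroup (GL (Fin 2) ℚ_[p])) (k : ℕ) (φ : GL (Fin 2) ℚ_[p] → Vk p k) :
    Prop where
  left_invariant : ∀ (u : ℚ_[p]ˣ), ∀ γ ∈ Γ, ∀ g,
    φ (Matrix.GeneralLinearGroup.scalar (Fin 2) u * γ * g) = φ g
  right_equivariant : ∀ σ ∈ Gamma0 p, ∀ g, φ (g * σ) = rightAct k (φ g) σ

/-- `Φ ∈ 𝒜_k(Γ)`: a `Γ`-invariant `p`-adic automorphic form with values in `𝔻_k`. -/
structure IsRigidForm (Γ : Subgroup (GL (Fin 2) ℚ_[p])) (k : ℕ) (Φ : GL (Fin 2) ℚ_[p] → Dk p) :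
    Prop where
  left_invariant : ∀ (u : ℚ_[p]ˣ), ∀ γ ∈ Γ, ∀ g,
    Φ (Matrix.GeneralLinearGroup.scalar (Fin 2) u * γ * g) = Φ g
  right_equivariant : ∀ σ (hσ : σ ∈ Gamma0 p), ∀ g,
    Φ (g * σ) = distAct k (Φ g) σ (Gamma0_subset hσ)

/-- `U_p` on `V_k`-valued forms. -/
def Up (k : ℕ) (φ : GL (Fin 2) ℚ_[p] → Vk p k) (g : GL (Fin 2) ℚ_[p]) : Vk p k :=
  (p : ℚ_[p]) ^ (k / 2) • ∑ j ∈ Finset.range p, rightAct k (φ (g * alpha j)) (alpha j)⁻¹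

/-- `U_p` on `𝔻_k`-valued forms. -/
def UpRigid (k : ℕ) (Φ : GL (Fin 2) ℚ_[p] → Dk p) (g : GL (Fin 2) ℚ_[p]) : Dk p :=
  (p : ℚ_[p]) ^ (k / 2) •
    ∑ j ∈ Finset.range p, distAct k (Φ (g * alpha j)) (alpha j)⁻¹ (alpha_inv_mem j)

/-- The Atkin–Lehner involution `W_p`. -/
def Wp (k : ℕ) (φ : GL (Fin 2) ℚ_[p] → Vk p k) (g : GL (Fin 2) ℚ_[p]) : Vk p k :=
  rightAct k (φ (g * g0 p)) (g0 p)⁻¹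

/-- `φ` is the automorphic form corresponding to the harmonic cocycle `c`: it is the `p`-new form
with `U_p φ = p^{k/2} φ` such that `c(g e₀) = g · φ(g)` for all `g`. -/
structure Corresponds (Γ : Subgroup (GL (Fin 2) ℚ_[p])) (k : ℕ) (c : Edge p → Vk p k)
    (φ : GL (Fin 2) ℚ_[p] → Vk p k) : Prop where
  form : IsForm Γ k φ
  new_at_p : ∀ g, Up k φ g = -((p : ℚ_[p]) ^ (k / 2) • Wp k φ g)
  eigen : ∀ g, Up k φ g = (p : ℚ_[p]) ^ (k / 2) • φ g
  cocycle : ∀ g : GL (Fin 2) ℚ_[p], c (g • e0 p) = leftAct k g (φ g)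

/-- `Φ ∈ 𝒜_k(Γ)` is a lift of `φ` with `U_p Φ = p^{k/2} Φ`. -/
structure IsEigenLift (Γ : Subgroup (GL (Fin 2) ℚ_[p])) (k : ℕ)
    (φ : GL (Fin 2) ℚ_[p] → Vk p k) (Φ : GL (Fin 2) ℚ_[p] → Dk p) : Prop where
  form : IsRigidForm Γ k Φ
  lifts : ∀ g, specialize k (Φ g) = φ g
  eigen : ∀ g, UpRigid k Φ g = (p : ℚ_[p]) ^ (k / 2) • Φ g

/-! ### Locally analytic functions and measures -/

variable (p) in
/-- `A_k^loc`: functions on `ℙ¹(ℚ_p)` that are locally analytic, except for a pole of order at most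
`k` at `∞`.  Such a function is given by its restriction to `ℚ_p`; the condition at `∞` is that
`t ^ k * f (1 / t)` extends analytically to `t = 0`. -/
def AkLoc (k : ℕ) : Submodule ℚ_[p] (ℚ_[p] → ℚ_[p]) where
  carrier := {f | (∀ x, AnalyticAt ℚ_[p] f x) ∧
    ∃ h : ℚ_[p] → ℚ_[p], AnalyticAt ℚ_[p] h 0 ∧ ∀ᶠ t in 𝓝[≠] 0, t ^ k * f t⁻¹ = h t}
  zero_mem' := ⟨fun _ => analyticAt_const, 0, analyticAt_const, by simp⟩
  add_mem' := by
    rintro f₁ f₂ ⟨h₁, q₁, a₁, e₁⟩ ⟨h₂, q₂, a₂, e₂⟩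
    refine ⟨fun x => (h₁ x).add (h₂ x), q₁ + q₂, a₁.add a₂, ?_⟩
    filter_upwards [e₁, e₂] with t t₁ t₂
    simp [mul_add, t₁, t₂]
  smul_mem' := by
    rintro r f ⟨h, q, a, e⟩
    refine ⟨fun x => analyticAt_const.mul (h x), fun t => r * q t, analyticAt_const.mul a, ?_⟩
    filter_upwards [e] with t ht
    simp [← ht, mul_left_comm]

/-- `(f ·_k g)(x) = det(g)^{-k/2} (cx+d)^k f((ax+b)/(cx+d))`. -/
def slash (k : ℕ) (f : ℚ_[p] → ℚ_[p]) (g : GL (Fin 2) ℚ_[p]) (x : ℚ_[p]) : ℚ_[p] :=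
  ((g : Matrix (Fin 2) (Fin 2) ℚ_[p]).det ^ (k / 2))⁻¹ * (g 1 0 * x + g 1 1) ^ k *
    f ((g 0 0 * x + g 0 1) / (g 1 0 * x + g 1 1))

open Classical in
/-- The ball `g ℤ_p` in `ℙ¹(ℚ_p)`. -/
def ball (g : GL (Fin 2) ℚ_[p]) : Set (OnePoint ℚ_[p]) :=
  g • ((fun x : ℚ_[p] => (x : OnePoint ℚ_[p])) '' {x | ‖x‖ ≤ 1})

/-- The ball `U_e` of the edge `e`: the `GL₂(ℚ_p)`-equivariant assignment with `U_{e₀} = ℤ_p`. -/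
def edgeBall (e : Edge p) : Set (OnePoint ℚ_[p]) :=
  {z | ∃ g : GL (Fin 2) ℚ_[p], g • e0 p = e ∧ z ∈ ball g}

open Classical in
/-- `f χ_U`. -/
def cut (U : Set (OnePoint ℚ_[p])) (f : ℚ_[p] → ℚ_[p]) (x : ℚ_[p]) : ℚ_[p] :=
  if (x : OnePoint ℚ_[p]) ∈ U then f x else 0

open Classical in
/-- `∫_U f dμ = μ(f χ_U)`, for a linear form `μ` on `A_k^loc` and `f χ_U ∈ A_k^loc`. -/
def integral {k : ℕ} (μ : AkLoc p k →ₗ[ℚ_[p]] ℚ_[p]) (U : Set (OnePoint ℚ_[p]))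
    (f : ℚ_[p] → ℚ_[p]) : ℚ_[p] :=
  if h : cut U f ∈ AkLoc p k then μ ⟨cut U f, h⟩ else 0

/-- Continuity of a linear form on `A_k^loc`, the locally convex inductive limit of the finite
products of the Banach spaces of functions `F ·_k g⁻¹`, `F` in the Tate algebra, on the balls
`g ℤ_p`: its restriction to each of these Banach spaces is bounded. -/
def IsMeasure {k : ℕ} (μ : AkLoc p k →ₗ[ℚ_[p]] ℚ_[p]) : Prop :=
  ∀ g : GL (Fin 2) ℚ_[p], ∃ C : ℝ, ∀ F : Tate p,
    ‖integral μ (ball g) (slash k F.eval g⁻¹)‖ ≤ C * ‖F‖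

/-- `μ = μ_c`: the measure on `A_k^loc` attached to the harmonic cocycle `c`, characterized by its
values on polynomials of degree at most `k` and by its growth. -/
structure IsMeasureOf {k : ℕ} (c : Edge p → Vk p k) (μ : AkLoc p k →ₗ[ℚ_[p]] ℚ_[p]) : Prop where
  continuous : IsMeasure μ
  interpolation : ∀ (e : Edge p) (P : Pk p k),
    integral μ (edgeBall e) (fun x => P.1.eval x) = c e P
  growth : ∃ C : ℝ, 0 ≤ C ∧ ∀ e : Edge p,
    (OnePoint.infty ∈ edgeBall e → ((0 : ℚ_[p]) : OnePoint ℚ_[p]) ∉ edgeBall e →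
      ∀ n : ℤ, n ≤ k → ‖integral μ (edgeBall e) (fun x => x ^ n)‖ ≤
        C * sSup {r : ℝ | ∃ x : ℚ_[p], (x : OnePoint ℚ_[p]) ∈ edgeBall e ∧ r = ‖x⁻¹‖} ^
          (-n + (k / 2 : ℕ))) ∧
    (OnePoint.infty ∉ edgeBall e →
      ∀ a : ℚ_[p], (a : OnePoint ℚ_[p]) ∈ edgeBall e →
      ∀ n : ℕ, ‖integral μ (edgeBall e) (fun x => (x - a) ^ n)‖ ≤
        C * Metric.diam {x : ℚ_[p] | (x : OnePoint ℚ_[p]) ∈ edgeBall e} ^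
          ((n : ℤ) - (k / 2 : ℕ)))

end OverconvergentLift

end

noncomputable section

namespace OverconvergentLift

variable {p : ℕ} [Fact p.Prime]

/-! ### Matrices -/

/-! The group `GL₂(ℚ_p)` permutes the oriented edges transitively and the stabilizer of `e₀` is
`ℚ_pˣ Γ₀(pℤ_p)`, so a cocycle is the same thing as the function `g ↦ g⁻¹ · c(g e₀)`. The edges
leaving the target of `g e₀` are the `g α_j e₀` and the reversed edge `g g₀ e₀`. Hence harmonicity
becomes the `U_p`-eigenvalue equation (`Up_formOf`), and the sign under reversal becomes the
`W_p`-equation (`Wp_formOf`). This is part 1, `existsUnique_corresponds`.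

The lift is a fixed point of the contraction `p^{-k/2} U_p`. The matrix `α_j⁻¹` acts on the Tate
algebra by `F ↦ p^{-k/2} F(px + j)`, which multiplies the `n`-th coefficient of an integral
expansion by `p^{n - k/2}`. On distributions killed by `𝒫_k` only `n ≥ k + 1` matters, so each of
the `p` summands has norm at most `|p|^{k/2+1} < 1`, and by the ultrametric inequality so has their
sum (`norm_sum_distAct_alpha_inv_le`). Extending `φ_c(g)` by zero on `xⁿ`, `n > k`, and iterating
converges to a lift (`exists_normUp_eq`). Two bounded fixed points with the same restriction to
`𝒫_k` coincide (`eq_of_normUp_eq`); the same principle yields the equivariance under `Γ₀(pℤ_p)` and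
`Γ` of the limit.

All of this needs boundedness in `g`, which follows from the finiteness of `Γ \ GL₂(ℚ_p) / ℚ_pˣ
Γ₀(pℤ_p)` (`exists_finite_invariant`). Here definiteness enters. By the pigeonhole principle every
primitive integral `g` with `|det g| = p^{-m}` admits a nonzero `x` in the order with `g⁻¹ ι(x)`
integral and reduced norm at most a constant times `p^m`. As the norm is also divisible by `p^m` up
to a fixed denominator, only finitely many cofactors occur, and two matrices whose short elements
satisfy suitable congruences are in the same double coset.

A fixed family `Φ` is a measure in disguise. If `f` has expansion `F` on `g ℤ_p`, that is `f = F ·_k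
g⁻¹` there, its integral over `g ℤ_p` is `Φ(g)(F)`; the equation `p^{-k/2} U_p Φ = Φ` says exactly
that this is additive when `g ℤ_p` is cut into the balls `g α_j ℤ_p` (`intSum_succ`). By compactness
every `f` in `A_k^loc` has expansions on the pieces of some finite subdivision (`exists_hasExp`).
The sum over `g ℤ_p` and its complement `g g₀ ℤ_p` does not depend on `g` (`totalInt_eq`), which
gives the measure together with the moment formula (`integral_measureOf`).

Conversely a measure gives such a family, `distOf`. The growth condition on `μ_c` says precisely
that the distributions on balls not containing both `0` and `∞` are uniformly bounded
(`growth_of_bounded`, `IsMeasureOf.bounded`). These balls are stable under subdivision and include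
`ℤ_p` and its complement, so the contraction argument also proves the uniqueness of the measure
(`IsMeasureOf.unique`). Hence any `μ_c` is the measure built from the lift. -/

lemma coe_p_ne_zero : (p : ℚ_[p]) ≠ 0 := by
  exact_mod_cast (Fact.out : p.Prime).ne_zero

lemma norm_p_zpow (s : ℤ) : ‖(p : ℚ_[p]) ^ s‖ = (p : ℝ) ^ (-s) := by
  rw [norm_zpow, Padic.norm_p, inv_zpow, zpow_neg]

lemma mul_entry (g h : GL (Fin 2) ℚ_[p]) (i j : Fin 2) :
    (g * h) i j = g i 0 * h 0 j + g i 1 * h 1 j := by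
  rw [Units.val_mul, Matrix.mul_apply, Fin.sum_univ_two]

lemma det_entry (g : GL (Fin 2) ℚ_[p]) :
    (g : Matrix (Fin 2) (Fin 2) ℚ_[p]).det = g 0 0 * g 1 1 - g 0 1 * g 1 0 :=
  Matrix.det_fin_two _

lemma det_val_ne_zero (g : GL (Fin 2) ℚ_[p]) :
    (g : Matrix (Fin 2) (Fin 2) ℚ_[p]).det ≠ 0 :=
  ((Matrix.isUnit_iff_isUnit_det _).1 g.isUnit).ne_zero

lemma det_entry_ne_zero (g : GL (Fin 2) ℚ_[p]) : g 0 0 * g 1 1 - g 0 1 * g 1 0 ≠ 0 := by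
  rw [← det_entry]; exact det_val_ne_zero g

lemma inv_entry (g : GL (Fin 2) ℚ_[p]) :
    g⁻¹ 0 0 = (g : Matrix (Fin 2) (Fin 2) ℚ_[p]).det⁻¹ * g 1 1 ∧
    g⁻¹ 0 1 = -((g : Matrix (Fin 2) (Fin 2) ℚ_[p]).det⁻¹ * g 0 1) ∧
    g⁻¹ 1 0 = -((g : Matrix (Fin 2) (Fin 2) ℚ_[p]).det⁻¹ * g 1 0) ∧
    g⁻¹ 1 1 = (g : Matrix (Fin 2) (Fin 2) ℚ_[p]).det⁻¹ * g 0 0 := by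
  have h : ∀ i j, g⁻¹ i j = ((g : Matrix (Fin 2) (Fin 2) ℚ_[p])⁻¹) i j := fun i j => by
    rw [← Matrix.coe_units_inv]
  simp only [h, Matrix.inv_def, Matrix.adjugate_fin_two, Ring.inverse_eq_inv', Matrix.smul_apply,
    smul_eq_mul]
  simp

lemma GL_ext {g h : GL (Fin 2) ℚ_[p]} (h00 : g 0 0 = h 0 0) (h01 : g 0 1 = h 0 1)
    (h10 : g 1 0 = h 1 0) (h11 : g 1 1 = h 1 1) : g = h := by
  refine Units.ext (Matrix.ext fun i j => ?_)
  fin_cases i <;> fin_cases j <;> assumption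

lemma scalar_entry (u : ℚ_[p]ˣ) :
    (Matrix.GeneralLinearGroup.scalar (Fin 2) u) 0 0 = (u : ℚ_[p]) ∧
    (Matrix.GeneralLinearGroup.scalar (Fin 2) u) 0 1 = (0 : ℚ_[p]) ∧
    (Matrix.GeneralLinearGroup.scalar (Fin 2) u) 1 0 = (0 : ℚ_[p]) ∧
    (Matrix.GeneralLinearGroup.scalar (Fin 2) u) 1 1 = (u : ℚ_[p]) := by
  simp [Matrix.GeneralLinearGroup.scalar]

lemma scalar_comm (u : ℚ_[p]ˣ) (g : GL (Fin 2) ℚ_[p]) :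
    Matrix.GeneralLinearGroup.scalar (Fin 2) u * g =
      g * Matrix.GeneralLinearGroup.scalar (Fin 2) u := by
  obtain ⟨h1, h2, h3, h4⟩ := scalar_entry u
  apply GL_ext <;> simp only [mul_entry, h1, h2, h3, h4] <;> ring

/-- The matrix `(p ^ s, a; 0, 1)`. -/
def aff (s : ℤ) (a : ℚ_[p]) : GL (Fin 2) ℚ_[p] :=
  Matrix.GeneralLinearGroup.mkOfDetNeZero !![(p : ℚ_[p]) ^ s, a; 0, 1] (by
    simpa [Matrix.det_fin_two] using zpow_ne_zero s coe_p_ne_zero)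

lemma aff_entry (s : ℤ) (a : ℚ_[p]) :
    aff s a 0 0 = (p : ℚ_[p]) ^ s ∧ aff s a 0 1 = a ∧ aff s a 1 0 = 0 ∧ aff s a 1 1 = 1 := by
  simp [aff, Matrix.GeneralLinearGroup.mkOfDetNeZero]

lemma alpha_eq_aff (j : ℕ) : (alpha j : GL (Fin 2) ℚ_[p]) = aff 1 j := by
  obtain ⟨h1, h2, h3, h4⟩ := aff_entry 1 (j : ℚ_[p])
  apply GL_ext <;> simp only [h1, h2, h3, h4] <;>
    simp [alpha, Matrix.GeneralLinearGroup.mkOfDetNeZero]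

lemma alpha_entry (j : ℕ) : (alpha j : GL (Fin 2) ℚ_[p]) 0 0 = (p : ℚ_[p]) ∧
    (alpha j : GL (Fin 2) ℚ_[p]) 0 1 = (j : ℚ_[p]) ∧ (alpha j : GL (Fin 2) ℚ_[p]) 1 0 = 0 ∧
    (alpha j : GL (Fin 2) ℚ_[p]) 1 1 = 1 := by
  simp [alpha, Matrix.GeneralLinearGroup.mkOfDetNeZero]

lemma g0_entry : g0 p 0 0 = 0 ∧ g0 p 0 1 = 1 ∧ g0 p 1 0 = (p : ℚ_[p]) ∧ g0 p 1 1 = 0 := by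
  simp [g0, Matrix.GeneralLinearGroup.mkOfDetNeZero]

lemma aff_mul (s t : ℤ) (a b : ℚ_[p]) : aff s a * aff t b = aff (s + t) (a + (p : ℚ_[p]) ^ s * b) := by
  obtain ⟨h1, h2, h3, h4⟩ := aff_entry s a
  obtain ⟨k1, k2, k3, k4⟩ := aff_entry t b
  obtain ⟨l1, l2, l3, l4⟩ := aff_entry (s + t) (a + (p : ℚ_[p]) ^ s * b)
  apply GL_ext <;> simp only [mul_entry, h1, h2, h3, h4, k1, k2, k3, k4, l1, l2, l3, l4,
    zpow_add₀ coe_p_ne_zero] <;> ring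

lemma g0_mul_g0 : g0 p * g0 p = Matrix.GeneralLinearGroup.scalar (Fin 2) pUnit := by
  obtain ⟨h1, h2, h3, h4⟩ := g0_entry (p := p)
  obtain ⟨k1, k2, k3, k4⟩ := scalar_entry (p := p) pUnit
  apply GL_ext <;> simp only [mul_entry, h1, h2, h3, h4, k1, k2, k3, k4] <;> simp [pUnit]

/-- Integrality, divisibility by `p` and invertibility are all norm conditions over `ℤ_p`; in this
form membership is checked by ultrametric estimates on the entries. -/
lemma mem_Gamma0 {g : GL (Fin 2) ℚ_[p]} : g ∈ Gamma0 p ↔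
    (∀ i j, ‖g i j‖ ≤ 1) ∧ ‖g 1 0‖ < 1 ∧ ‖g 0 0 * g 1 1 - g 0 1 * g 1 0‖ = 1 := by
  constructor
  · rintro ⟨σ, hc, rfl⟩
    have e : ∀ i j, (Matrix.GeneralLinearGroup.map PadicInt.Coe.ringHom σ :
        GL (Fin 2) ℚ_[p]) i j = ((σ i j : ℤ_[p]) : ℚ_[p]) := fun i j => rfl
    refine ⟨fun i j => by rw [e]; exact (σ i j).2, ?_, ?_⟩
    · rw [e]
      simpa using (PadicInt.norm_lt_one_iff_dvd (σ 1 0)).2 hc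
    · have h : IsUnit (σ : Matrix (Fin 2) (Fin 2) ℤ_[p]).det :=
        (Matrix.isUnit_iff_isUnit_det _).1 σ.isUnit
      rw [Matrix.det_fin_two, PadicInt.isUnit_iff] at h
      simp only [e]
      exact_mod_cast h
  · rintro ⟨h1, h2, h3⟩
    set M : Matrix (Fin 2) (Fin 2) ℤ_[p] := Matrix.of fun i j => ⟨g i j, h1 i j⟩ with hM
    have hu : IsUnit M.det := by
      rw [Matrix.det_fin_two, PadicInt.isUnit_iff]
      exact_mod_cast h3
    refine ⟨Matrix.GeneralLinearGroup.mk'' M hu, ?_, ?_⟩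
    · refine (PadicInt.norm_lt_one_iff_dvd _).1 ?_
      exact_mod_cast h2
    · ext i j
      rfl

lemma Gamma0_mul {g h : GL (Fin 2) ℚ_[p]} (hg : g ∈ Gamma0 p) (hh : h ∈ Gamma0 p) :
    g * h ∈ Gamma0 p := by
  obtain ⟨σ, hc, rfl⟩ := hg
  obtain ⟨τ, hd, rfl⟩ := hh
  refine ⟨σ * τ, ?_, (map_mul _ _ _).symm⟩
  have : (σ * τ) 1 0 = σ 1 0 * τ 0 0 + σ 1 1 * τ 1 0 := by
    rw [Units.val_mul, Matrix.mul_apply, Fin.sum_univ_two]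
  rw [this]
  exact dvd_add (hc.mul_right _) (hd.mul_left _)

lemma Gamma0_inv {g : GL (Fin 2) ℚ_[p]} (hg : g ∈ Gamma0 p) : g⁻¹ ∈ Gamma0 p := by
  obtain ⟨h1, h2, h3⟩ := mem_Gamma0.1 hg
  obtain ⟨e1, e2, e3, e4⟩ := inv_entry g
  have hd : ‖(g : Matrix (Fin 2) (Fin 2) ℚ_[p]).det⁻¹‖ = 1 := by
    rw [norm_inv, det_entry, h3, inv_one]
  refine mem_Gamma0.2 ⟨fun i j => ?_, ?_, ?_⟩
  · fin_cases i <;> fin_cases j <;>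
      simp only [Fin.zero_eta, Fin.mk_one, e1, e2, e3, e4, norm_neg, norm_mul, hd, one_mul, h1]
  · simp only [e3, norm_neg, norm_mul, hd, one_mul, h2]
  · rw [e1, e2, e3, e4, show ∀ d a b c e : ℚ_[p], d * a * (d * e) - -(d * b) * -(d * c) =
      d * d * (e * a - b * c) from fun _ _ _ _ _ => by ring, norm_mul, norm_mul, hd, h3]
    norm_num

/-! ### Balls -/

/-- The point `g⁻¹x = (dx - b)/(a - cx)` must lie in `ℤ_p`. Cleared of denominators the condition
stays correct at the pole, because numerator and denominator cannot both vanish. -/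
lemma coe_mem_ball (g : GL (Fin 2) ℚ_[p]) (x : ℚ_[p]) :
    (x : OnePoint ℚ_[p]) ∈ ball g ↔ ‖g 1 1 * x - g 0 1‖ ≤ ‖g 0 0 - g 1 0 * x‖ := by
  classical
  obtain ⟨e1, e2, e3, e4⟩ := inv_entry g
  have hd : ‖(g : Matrix (Fin 2) (Fin 2) ℚ_[p]).det⁻¹‖ ≠ 0 :=
    norm_ne_zero_iff.2 (inv_ne_zero (det_val_ne_zero g))
  have hd0 := inv_ne_zero (det_val_ne_zero g)
  rw [ball, Set.mem_smul_set_iff_inv_smul_mem, OnePoint.smul_some_eq_ite]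
  set d := (g : Matrix (Fin 2) (Fin 2) ℚ_[p]).det⁻¹
  have E1 : g⁻¹ 1 0 * x + g⁻¹ 1 1 = d * (g 0 0 - g 1 0 * x) := by rw [e3, e4]; ring
  have E2 : g⁻¹ 0 0 * x + g⁻¹ 0 1 = d * (g 1 1 * x - g 0 1) := by rw [e1, e2]; ring
  rw [E1, E2, mul_div_mul_left _ _ hd0]
  by_cases h : g 0 0 - g 1 0 * x = 0
  · rw [h, mul_zero, if_pos rfl, norm_zero]
    refine ⟨fun ⟨y, _, hy⟩ => absurd hy (OnePoint.coe_ne_infty y), fun h' => ?_⟩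
    have h' : g 1 1 * x - g 0 1 = 0 := norm_le_zero_iff.1 h'
    exfalso
    apply det_entry_ne_zero g
    linear_combination g 1 1 * h + g 1 0 * h'
  · rw [if_neg (mul_ne_zero hd0 h)]
    simp only [Set.mem_image, Set.mem_ofPred_eq, OnePoint.coe_eq_coe]
    rw [exists_eq_right, norm_div, div_le_one (norm_pos_iff.2 h)]

lemma infty_mem_ball (g : GL (Fin 2) ℚ_[p]) :
    OnePoint.infty ∈ ball g ↔ ‖g 1 1‖ ≤ ‖g 1 0‖ := by
  classical
  obtain ⟨e1, e2, e3, e4⟩ := inv_entry g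
  have hd0 := inv_ne_zero (det_val_ne_zero g)
  rw [ball, Set.mem_smul_set_iff_inv_smul_mem, OnePoint.smul_infty_eq_ite, e1, e3]
  by_cases h : g 1 0 = 0
  · rw [h, mul_zero, neg_zero, if_pos rfl, norm_zero]
    refine ⟨fun ⟨y, _, hy⟩ => absurd hy (OnePoint.coe_ne_infty y), fun h' => ?_⟩
    exfalso
    apply det_entry_ne_zero g
    rw [h, norm_le_zero_iff.1 h']
    ring
  · rw [if_neg (neg_ne_zero.2 (mul_ne_zero hd0 h))]
    simp only [Set.mem_image, Set.mem_ofPred_eq, OnePoint.coe_eq_coe]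
    rw [exists_eq_right, norm_div, norm_neg, norm_mul, norm_mul,
      mul_div_mul_left _ _ (norm_ne_zero_iff.2 hd0), div_le_one (norm_pos_iff.2 h)]

lemma padic_norm_sub_le_max (x y : ℚ_[p]) : ‖x - y‖ ≤ max ‖x‖ ‖y‖ := by
  rw [sub_eq_add_neg, ← norm_neg y]
  exact IsUltrametricDist.norm_add_le_max _ _

/-! ### Normal forms and decompositions of balls -/

/-- Avoiding `∞` means `|c| < |d|`, so `d` can be taken out as a scalar. The ball is then the disc
around `b/d` of radius `|det g / d²|`, and in an ultrametric disc every point, in particular the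
prescribed `x`, is a centre. -/
lemma exists_aff {g : GL (Fin 2) ℚ_[p]} (h : OnePoint.infty ∉ ball g) {x : ℚ_[p]}
    (hx : (x : OnePoint ℚ_[p]) ∈ ball g) :
    ∃ (u : ℚ_[p]ˣ) (s : ℤ), ∃ σ ∈ Gamma0 p,
      g = Matrix.GeneralLinearGroup.scalar (Fin 2) u * aff s x * σ := by
  rw [infty_mem_ball, not_le] at h
  rw [coe_mem_ball] at hx
  have hd : g 1 1 ≠ 0 := norm_pos_iff.1 ((norm_nonneg _).trans_lt h)
  have hdet := det_entry_ne_zero g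
  set a := g 0 0
  set b := g 0 1
  set c := g 1 0
  set d := g 1 1
  -- the size of `det g / d ^ 2`
  set D := (a * d - b * c) / d ^ 2 with hD
  have hD0 : D ≠ 0 := div_ne_zero hdet (pow_ne_zero _ hd)
  set s := D.valuation with hs
  have hsD : ‖D‖ = ‖(p : ℚ_[p]) ^ s‖ := by
    rw [norm_p_zpow, Padic.norm_eq_zpow_neg_valuation hD0]
  have hps : (p : ℚ_[p]) ^ s ≠ 0 := zpow_ne_zero _ coe_p_ne_zero
  -- With `a - cx = dD - c(x - b/d)`, a larger distance would make both terms smaller than `|d| |x -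
  -- b/d| = |dx - b|`, against membership in the ball.
  have hxb : ‖x - b / d‖ ≤ ‖D‖ := by
    have h1 : a - c * x = (a * d - b * c) / d - c * (x - b / d) := by field_simp; ring
    have h2 : d * x - b = d * (x - b / d) := by field_simp
    rw [h1, h2, norm_mul] at hx
    by_contra! hlt
    have hxp : 0 < ‖x - b / d‖ := (norm_nonneg _).trans_lt hlt
    have h3 : ‖(a * d - b * c) / d‖ < ‖d‖ * ‖x - b / d‖ := by
      rw [show (a * d - b * c) / d = d * D by rw [hD]; field_simp, norm_mul]
      exact mul_lt_mul_of_pos_left hlt (norm_pos_iff.2 hd)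
    have h4 : ‖c * (x - b / d)‖ < ‖d‖ * ‖x - b / d‖ := by
      rw [norm_mul]; exact mul_lt_mul_of_pos_right h hxp
    exact absurd hx (not_le.2 ((padic_norm_sub_le_max _ _).trans_lt (max_lt h3 h4)))
  refine ⟨Units.mk0 d hd, s, (Matrix.GeneralLinearGroup.scalar (Fin 2) (Units.mk0 d hd) *
    aff s x)⁻¹ * g, ?_, by rw [mul_inv_cancel_left]⟩
  obtain ⟨u1, u2, u3, u4⟩ := scalar_entry (Units.mk0 d hd)
  obtain ⟨a1, a2, a3, a4⟩ := aff_entry s x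
  obtain ⟨i1, i2, i3, i4⟩ := inv_entry (Matrix.GeneralLinearGroup.scalar (Fin 2) (Units.mk0 d hd) *
    aff s x)
  rw [det_entry] at i1 i2 i3 i4
  simp only [mul_entry, u1, u2, u3, u4, a1, a2, a3, a4, Units.val_mk0, mul_zero, add_zero, zero_mul,
    zero_add, mul_one, sub_zero, neg_zero] at i1 i2 i3 i4
  set τ := (Matrix.GeneralLinearGroup.scalar (Fin 2) (Units.mk0 d hd) * aff s x)⁻¹ with hτ
  have e00 : (τ * g) 0 0 = (D + (b / d - x) * (c / d)) / (p : ℚ_[p]) ^ s := by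
    rw [mul_entry, i1, i2]; change _ * a + _ * c = _; rw [hD]; field_simp; ring
  have e01 : (τ * g) 0 1 = (b / d - x) / (p : ℚ_[p]) ^ s := by
    rw [mul_entry, i1, i2]; change _ * b + _ * d = _; field_simp; ring
  have e10 : (τ * g) 1 0 = c / d := by
    rw [mul_entry, i3, i4]; change _ * a + _ * c = _; field_simp; ring
  have e11 : (τ * g) 1 1 = 1 := by
    rw [mul_entry, i3, i4]; change _ * b + _ * d = _; field_simp; ring
  have hcd : ‖c / d‖ < 1 := by rw [norm_div]; exact (div_lt_one (norm_pos_iff.2 hd)).2 h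
  have hbx : ‖(b / d - x) / (p : ℚ_[p]) ^ s‖ ≤ 1 := by
    rw [norm_div, ← hsD, norm_sub_rev]; exact div_le_one_of_le₀ hxb (norm_nonneg _)
  have hDs : ‖D / (p : ℚ_[p]) ^ s‖ = 1 := by
    rw [norm_div, ← hsD, div_self (norm_ne_zero_iff.2 hD0)]
  refine mem_Gamma0.2 ⟨fun i j => ?_, ?_, ?_⟩
  · fin_cases i <;> fin_cases j
    · simp only [Fin.zero_eta]
      rw [e00, add_div, mul_div_right_comm]
      refine (IsUltrametricDist.norm_add_le_max _ _).trans (max_le hDs.le ?_)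
      rw [norm_mul]
      exact mul_le_one₀ hbx (norm_nonneg _) hcd.le
    · simp only [Fin.zero_eta, Fin.mk_one]; rw [e01]; exact hbx
    · simp only [Fin.zero_eta, Fin.mk_one]; rw [e10]; exact hcd.le
    · simp only [Fin.mk_one]; rw [e11, norm_one]
  · rw [e10]; exact hcd
  · rw [e00, e01, e10, e11, show (D + (b / d - x) * (c / d)) / (p : ℚ_[p]) ^ s * 1 -
      (b / d - x) / (p : ℚ_[p]) ^ s * (c / d) = D / (p : ℚ_[p]) ^ s by ring, hDs]

lemma exists_mem_ball_of_infty_notMem {g : GL (Fin 2) ℚ_[p]} (h : OnePoint.infty ∉ ball g) :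
    ∃ x : ℚ_[p], (x : OnePoint ℚ_[p]) ∈ ball g := by
  rw [infty_mem_ball, not_le] at h
  have hd : g 1 1 ≠ 0 := norm_pos_iff.1 ((norm_nonneg _).trans_lt h)
  refine ⟨g 0 1 / g 1 1, ?_⟩
  rw [coe_mem_ball, mul_div_cancel₀ _ hd, sub_self, norm_zero]
  exact norm_nonneg _

/-- The value group is `p^ℤ`, so a factor `p` exchanges strict and weak inequalities. -/
lemma norm_mul_p_le_iff {x y : ℚ_[p]} (hy : x ≠ 0 ∨ y ≠ 0) : ‖x * p‖ < ‖y‖ ↔ ‖x‖ ≤ ‖y‖ := by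
  have hp0 : (0 : ℝ) < p := by exact_mod_cast (Fact.out : p.Prime).pos
  have hp1 : (1 : ℝ) < p := by exact_mod_cast (Fact.out : p.Prime).one_lt
  rw [norm_mul, Padic.norm_p, ← div_eq_mul_inv, div_lt_iff₀ hp0]
  by_cases h0 : x = 0
  · subst h0
    simp only [norm_zero, norm_nonneg, iff_true]
    exact mul_pos (norm_pos_iff.2 (hy.resolve_left (by simp))) hp0
  by_cases h1 : y = 0
  · subst h1
    simp [h0]
  rw [Padic.norm_eq_zpow_neg_valuation h0, Padic.norm_eq_zpow_neg_valuation h1,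
    ← zpow_add_one₀ hp0.ne', zpow_lt_zpow_iff_right₀ hp1, zpow_le_zpow_iff_right₀ hp1]
  omega

/-- The map `z ↦ 1/(pz)` given by `g0` carries `ℤ_p` onto its complement in the projective line.
This and the next lemma express that reversing an edge complements its ball. -/
lemma infty_mem_ball_mul_g0 (g : GL (Fin 2) ℚ_[p]) :
    OnePoint.infty ∈ ball (g * g0 p) ↔ OnePoint.infty ∉ ball g := by
  obtain ⟨h1, h2, h3, h4⟩ := g0_entry (p := p)
  rw [infty_mem_ball, infty_mem_ball, ← not_lt]
  simp only [mul_entry, h1, h2, h3, h4, mul_zero, mul_one, zero_add, add_zero]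
  rw [norm_mul_p_le_iff]
  by_contra! h
  apply det_entry_ne_zero g
  rw [h.1, h.2]; ring

lemma coe_mem_ball_mul_g0 (g : GL (Fin 2) ℚ_[p]) (x : ℚ_[p]) :
    (x : OnePoint ℚ_[p]) ∈ ball (g * g0 p) ↔ (x : OnePoint ℚ_[p]) ∉ ball g := by
  obtain ⟨h1, h2, h3, h4⟩ := g0_entry (p := p)
  rw [coe_mem_ball, coe_mem_ball, ← not_lt]
  simp only [mul_entry, h1, h2, h3, h4, mul_zero, mul_one, zero_add, add_zero]
  rw [show g 0 1 * (p : ℚ_[p]) - g 1 1 * p * x = -(g 1 1 * x - g 0 1) * p by ring,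
    norm_sub_rev (g 1 0 * x), norm_mul_p_le_iff, norm_neg]
  by_contra! h
  apply det_entry_ne_zero g
  linear_combination g 1 1 * h.2 - g 1 0 * h.1

/-- For `z` in `ℤ_p` there is exactly one `j < p` with `z ∈ j + p ℤ_p`. -/
lemma exists_digit {z : ℚ_[p]} (hz : ‖z‖ ≤ 1) : ∃ j < p, ‖z - j‖ < 1 := by
  obtain ⟨j, hj, h⟩ := PadicInt.exists_mem_range (⟨z, hz⟩ : ℤ_[p])
  refine ⟨j, hj, ?_⟩
  rw [PadicInt.maximalIdeal_eq_span_p, Ideal.mem_span_singleton] at h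
  have := (PadicInt.norm_lt_one_iff_dvd _).2 h
  exact_mod_cast this

/-- The integer `i - j` is divisible by `p` and smaller than `p` in absolute value. -/
lemma digit_unique {z : ℚ_[p]} {i j : ℕ} (hi : i < p) (hj : j < p) (h1 : ‖z - i‖ < 1)
    (h2 : ‖z - j‖ < 1) : i = j := by
  have h : ‖(((i : ℤ) - j : ℤ) : ℚ_[p])‖ < 1 := by
    push_cast
    rw [show (i : ℚ_[p]) - j = (z - j) - (z - i) by ring]
    exact (padic_norm_sub_le_max _ _).trans_lt (max_lt h2 h1)
  rw [Padic.norm_intCast_lt_one_iff] at h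
  have := Int.emod_emod_of_dvd (i - j : ℤ) (dvd_refl (p : ℤ))
  obtain ⟨t, ht⟩ := h
  have : t = 0 := by
    by_contra h0
    rcases lt_or_gt_of_ne h0 with h0 | h0 <;> nlinarith
  subst this
  omega

lemma norm_le_inv_iff {x y : ℚ_[p]} (h : x ≠ 0 ∨ y ≠ 0) : ‖x‖ ≤ ‖(p : ℚ_[p]) * y‖ ↔ ‖x‖ < ‖y‖ := by
  rw [← not_lt, mul_comm, norm_mul_p_le_iff h.symm, not_le]

/-- In the coordinate `w = g⁻¹x` the subball is the residue disc `j + pℤ_p`. -/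
lemma coe_mem_ball_mul_alpha {g : GL (Fin 2) ℚ_[p]} {j : ℕ} {x : ℚ_[p]} :
    (x : OnePoint ℚ_[p]) ∈ ball (g * alpha j) ↔ g 0 0 - g 1 0 * x ≠ 0 ∧
      ‖(g 1 1 * x - g 0 1) / (g 0 0 - g 1 0 * x) - j‖ < 1 := by
  obtain ⟨h1, h2, h3, h4⟩ := alpha_entry (p := p) j
  rw [coe_mem_ball]
  simp only [mul_entry, h1, h2, h3, h4, mul_zero, mul_one, add_zero]
  rw [show (g 1 0 * j + g 1 1) * x - (g 0 0 * j + g 0 1) =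
    (g 1 1 * x - g 0 1) - j * (g 0 0 - g 1 0 * x) by ring,
    show g 0 0 * (p : ℚ_[p]) - g 1 0 * p * x = p * (g 0 0 - g 1 0 * x) by ring]
  have hne : g 0 0 - g 1 0 * x ≠ 0 ∨ g 1 1 * x - g 0 1 ≠ 0 := by
    by_contra! h
    apply det_entry_ne_zero g
    linear_combination g 1 1 * h.1 + g 1 0 * h.2
  set A := g 0 0 - g 1 0 * x
  set B := g 1 1 * x - g 0 1
  by_cases hA : A = 0
  · simp [hA, hne.resolve_left (not_not.2 hA)]
  · rw [norm_le_inv_iff (Or.inr hA), show B - j * A = A * (B / A - j) by field_simp, norm_mul,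
      mul_lt_iff_lt_one_right (norm_pos_iff.2 hA)]
    exact ⟨fun h => ⟨hA, h⟩, fun h => h.2⟩

lemma infty_mem_ball_mul_alpha {g : GL (Fin 2) ℚ_[p]} {j : ℕ} :
    OnePoint.infty ∈ ball (g * alpha j) ↔ g 1 0 ≠ 0 ∧ ‖-g 1 1 / g 1 0 - j‖ < 1 := by
  obtain ⟨h1, h2, h3, h4⟩ := alpha_entry (p := p) j
  rw [infty_mem_ball]
  simp only [mul_entry, h1, h2, h3, h4, mul_zero, mul_one, add_zero]
  rw [mul_comm (g 1 0) (p : ℚ_[p])]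
  have hne : g 1 0 ≠ 0 ∨ g 1 1 ≠ 0 := by
    by_contra! h
    apply det_entry_ne_zero g
    rw [h.1, h.2]; ring
  by_cases hA : g 1 0 = 0
  · simp [hA, hne.resolve_left (not_not.2 hA)]
  · rw [norm_le_inv_iff (Or.inr hA), show g 1 0 * j + g 1 1 = g 1 0 * -(-g 1 1 / g 1 0 - j) by
      field_simp; ring, norm_mul, norm_neg, mul_lt_iff_lt_one_right (norm_pos_iff.2 hA)]
    exact ⟨fun h => ⟨hA, h⟩, fun h => h.2⟩

/-- Sorting the coordinate `g⁻¹z` by its first digit cuts the ball into `p` pieces; this is the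
subdivision on which all integrals rest. -/
lemma exists_mem_ball_mul_alpha_iff {g : GL (Fin 2) ℚ_[p]} {z : OnePoint ℚ_[p]} :
    (∃ j < p, z ∈ ball (g * alpha j)) ↔ z ∈ ball g := by
  have key : ∀ A B : ℚ_[p], A ≠ 0 ∨ B ≠ 0 → ((∃ j < p, A ≠ 0 ∧ ‖B / A - j‖ < 1) ↔ ‖B‖ ≤ ‖A‖) := by
    intro A B hne
    constructor
    · rintro ⟨j, -, hA, h⟩
      have : ‖B / A‖ ≤ 1 := by
        rw [show B / A = (B / A - j) + j by ring]
        exact (IsUltrametricDist.norm_add_le_max _ _).trans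
          (max_le h.le (IsUltrametricDist.norm_natCast_le_one _ _))
      rwa [norm_div, div_le_one (norm_pos_iff.2 hA)] at this
    · intro h
      have hA : A ≠ 0 := by
        rintro rfl
        simp only [ne_eq, not_true_eq_false, false_or] at hne
        exact hne (by simpa using h)
      obtain ⟨j, hj, h'⟩ := exists_digit (z := B / A) (by
        rw [norm_div]; exact div_le_one_of_le₀ h (norm_nonneg _))
      exact ⟨j, hj, hA, h'⟩
  induction z using OnePoint.rec with
  | infty =>
    simp only [infty_mem_ball_mul_alpha]
    rw [key, infty_mem_ball, norm_neg]
    by_contra! h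
    apply det_entry_ne_zero g
    rw [h.1, neg_eq_zero.1 h.2]; ring
  | coe x =>
    simp only [coe_mem_ball_mul_alpha]
    rw [key, coe_mem_ball]
    by_contra! h
    apply det_entry_ne_zero g
    linear_combination g 1 1 * h.1 + g 1 0 * h.2

lemma ball_mul_alpha_subset (g : GL (Fin 2) ℚ_[p]) {j : ℕ} (hj : j < p) :
    ball (g * alpha j) ⊆ ball g := fun _ h => exists_mem_ball_mul_alpha_iff.1 ⟨j, hj, h⟩

lemma ball_mul_alpha_disjoint {g : GL (Fin 2) ℚ_[p]} {i j : ℕ} (hi : i < p) (hj : j < p)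
    {x : ℚ_[p]} (h1 : (x : OnePoint ℚ_[p]) ∈ ball (g * alpha i))
    (h2 : (x : OnePoint ℚ_[p]) ∈ ball (g * alpha j)) : i = j := by
  rw [coe_mem_ball_mul_alpha] at h1 h2
  exact digit_unique hi hj h1.2 h2.2

lemma ball_scalar_mul (u : ℚ_[p]ˣ) (g : GL (Fin 2) ℚ_[p]) :
    ball (Matrix.GeneralLinearGroup.scalar (Fin 2) u * g) = ball g := by
  obtain ⟨u1, u2, u3, u4⟩ := scalar_entry u
  have hu : (0 : ℝ) < ‖(u : ℚ_[p])‖ := norm_pos_iff.2 u.ne_zero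
  ext z
  induction z using OnePoint.rec with
  | infty =>
    simp only [infty_mem_ball, mul_entry, u3, u4, zero_mul, zero_add, norm_mul]
    exact mul_le_mul_iff_right₀ hu
  | coe x =>
    simp only [coe_mem_ball, mul_entry, u1, u2, u3, u4, zero_mul, zero_add, add_zero, mul_assoc,
      ← mul_sub, norm_mul]
    exact mul_le_mul_iff_right₀ hu

lemma Gamma0_smul_mem {σ : GL (Fin 2) ℚ_[p]} (hσ : σ ∈ Gamma0 p) {z : ℚ_[p]} (hz : ‖z‖ ≤ 1) :
    ‖σ 1 0 * z + σ 1 1‖ = 1 ∧ ‖(σ 0 0 * z + σ 0 1) / (σ 1 0 * z + σ 1 1)‖ ≤ 1 := by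
  obtain ⟨h1, h2, h3⟩ := mem_Gamma0.1 hσ
  have h11 : ‖σ 1 1‖ = 1 := by
    refine le_antisymm (h1 1 1) ?_
    by_contra! h
    have : ‖σ 0 0 * σ 1 1 - σ 0 1 * σ 1 0‖ < 1 := by
      refine (padic_norm_sub_le_max _ _).trans_lt (max_lt ?_ ?_)
      · rw [norm_mul]; exact mul_lt_one_of_nonneg_of_lt_one_right (h1 0 0) (norm_nonneg _) h
      · rw [norm_mul]; exact mul_lt_one_of_nonneg_of_lt_one_right (h1 0 1) (norm_nonneg _) h2
    exact this.ne h3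
  have hden : ‖σ 1 0 * z + σ 1 1‖ = 1 := by
    have : ‖σ 1 0 * z‖ < 1 := by
      rw [norm_mul]; exact mul_lt_one_of_nonneg_of_lt_one_left (norm_nonneg _) h2 hz
    rw [IsUltrametricDist.norm_add_eq_max_of_norm_ne_norm (by rw [h11]; exact this.ne), h11,
      max_eq_right this.le]
  refine ⟨hden, ?_⟩
  rw [norm_div, hden, div_one]
  refine (IsUltrametricDist.norm_add_le_max _ _).trans (max_le ?_ (h1 0 1))
  rw [norm_mul]
  exact mul_le_one₀ (h1 0 0) (norm_nonneg _) hz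

/-- Both `σ` and `σ⁻¹` map `ℤ_p` into itself. -/
lemma ball_mul_Gamma0 (g : GL (Fin 2) ℚ_[p]) {σ : GL (Fin 2) ℚ_[p]} (hσ : σ ∈ Gamma0 p) :
    ball (g * σ) = ball g := by
  classical
  have key : ∀ τ ∈ Gamma0 p, τ • ((fun x : ℚ_[p] => (x : OnePoint ℚ_[p])) '' {x | ‖x‖ ≤ 1}) ⊆
      (fun x : ℚ_[p] => (x : OnePoint ℚ_[p])) '' {x | ‖x‖ ≤ 1} := by
    rintro τ hτ _ ⟨_, ⟨z, hz, rfl⟩, rfl⟩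
    obtain ⟨h1, h2⟩ := Gamma0_smul_mem hτ hz
    refine ⟨_, h2, ?_⟩
    change _ = τ • (z : OnePoint ℚ_[p])
    rw [OnePoint.smul_some_eq_ite, if_neg]
    exact norm_ne_zero_iff.1 (by rw [h1]; exact one_ne_zero)
  rw [ball, ball, mul_smul]
  congr 1
  convert subset_antisymm (key σ hσ) ?_
  have := key σ⁻¹ (Gamma0_inv hσ)
  rwa [Set.subset_smul_set_iff]

/-! ### Evaluation on the Tate algebra -/

lemma summable_of_tendsto {u : ℕ → ℚ_[p]} (hu : Tendsto u atTop (𝓝 0)) {z : ℚ_[p]}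
    (hz : ‖z‖ ≤ 1) : Summable fun n => u n * z ^ n := by
  refine NonarchimedeanAddGroup.summable_of_tendsto_cofinite_zero ?_
  rw [Nat.cofinite_eq_atTop]
  refine squeeze_zero_norm (a := fun i => ‖u i‖) (fun i => ?_) (tendsto_zero_iff_norm_tendsto_zero.1 hu)
  rw [norm_mul, norm_pow]
  exact mul_le_of_le_one_right (norm_nonneg _) (pow_le_one₀ (norm_nonneg _) hz)

lemma Tate.summable (F : Tate p) {z : ℚ_[p]} (hz : ‖z‖ ≤ 1) : Summable fun n => F n * z ^ n :=
  summable_of_tendsto F.tendsto hz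

lemma Tate.eval_add (F G : Tate p) {z : ℚ_[p]} (hz : ‖z‖ ≤ 1) :
    (F + G).eval z = F.eval z + G.eval z := by
  simp only [Tate.eval, ← (F.summable hz).tsum_add (G.summable hz)]
  exact tsum_congr fun n => add_mul _ _ _

lemma Tate.eval_smul (r : ℚ_[p]) (F : Tate p) (z : ℚ_[p]) : (r • F).eval z = r * F.eval z := by
  simp only [Tate.eval, ← tsum_mul_left]
  exact tsum_congr fun n => mul_assoc _ _ _

lemma Tate.eval_zero (z : ℚ_[p]) : (0 : Tate p).eval z = 0 := by
  simpa using Tate.eval_smul 0 (0 : Tate p) z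

lemma Tate.norm_eval_le (F : Tate p) {z : ℚ_[p]} (hz : ‖z‖ ≤ 1) : ‖F.eval z‖ ≤ ‖F‖ := by
  refine IsUltrametricDist.norm_tsum_le_of_forall_le_of_nonneg (norm_nonneg _) fun n => ?_
  rw [norm_mul, norm_pow]
  exact (mul_le_of_le_one_right (norm_nonneg _) (pow_le_one₀ (norm_nonneg _) hz)).trans
    (F.norm_apply_le n)

lemma Tate.norm_le {F : Tate p} {C : ℝ} (hC : 0 ≤ C) (h : ∀ n, ‖F n‖ ≤ C) : ‖F‖ ≤ C := by
  rw [← ZeroAtInftyContinuousMap.norm_toBCF_eq_norm]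
  exact (BoundedContinuousFunction.norm_le hC).2 h

/-- Evaluation at a point of `ℤ_p`, as a continuous linear form on the Tate algebra. -/
def evalL (z : ℚ_[p]) (hz : ‖z‖ ≤ 1) : Dk p :=
  LinearMap.mkContinuous
    { toFun := fun F => F.eval z
      map_add' := fun F G => F.eval_add G hz
      map_smul' := fun r F => F.eval_smul r z } 1
    (fun F => by simpa using F.norm_eval_le hz)

lemma evalL_apply (z : ℚ_[p]) (hz : ‖z‖ ≤ 1) (F : Tate p) : evalL z hz F = F.eval z := rfl

lemma polyToTate_apply (P : Polynomial ℚ_[p]) (n : ℕ) : polyToTate P n = P.coeff n := rfl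

lemma eval_polyToTate (P : Polynomial ℚ_[p]) (z : ℚ_[p]) :
    (polyToTate P).eval z = P.eval z := by
  rw [Tate.eval, Polynomial.eval_eq_sum_range]
  refine (tsum_eq_sum fun n hn => ?_)
  rw [polyToTate_apply, Polynomial.coeff_eq_zero_of_natDegree_lt (by simpa using hn), zero_mul]

/-- The truncation of an element of the Tate algebra to degree `< N`. -/
def Tate.trunc (F : Tate p) (N : ℕ) : Polynomial ℚ_[p] :=
  ∑ i ∈ Finset.range N, Polynomial.monomial i (F i)

lemma Tate.coeff_trunc (F : Tate p) (N n : ℕ) :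
    (F.trunc N).coeff n = if n < N then F n else 0 := by
  simp [Tate.trunc, Polynomial.finsetSum_coeff, Polynomial.coeff_monomial]

lemma Tate.trunc_add (F G : Tate p) (N : ℕ) : (F + G).trunc N = F.trunc N + G.trunc N := by
  ext n
  rw [Polynomial.coeff_add, Tate.coeff_trunc, Tate.coeff_trunc, Tate.coeff_trunc]
  split_ifs <;> simp

lemma Tate.trunc_smul (r : ℚ_[p]) (F : Tate p) (N : ℕ) : (r • F).trunc N = r • F.trunc N := by
  ext n
  rw [Polynomial.coeff_smul, Tate.coeff_trunc, Tate.coeff_trunc]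
  split_ifs <;> simp

lemma Tate.trunc_mem (F : Tate p) (k : ℕ) : F.trunc (k + 1) ∈ Polynomial.degreeLE ℚ_[p] k := by
  rw [Polynomial.mem_degreeLE, Polynomial.degree_le_iff_coeff_zero]
  intro n hn
  rw [Tate.coeff_trunc, if_neg]
  have : k < n := by exact_mod_cast hn
  omega

lemma Tate.norm_sub_trunc_le (F : Tate p) {N : ℕ} {C : ℝ} (hC : 0 ≤ C)
    (h : ∀ n, N ≤ n → ‖F n‖ ≤ C) : ‖F - polyToTate (F.trunc N)‖ ≤ C := by
  refine Tate.norm_le hC fun n => ?_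
  rw [ZeroAtInftyContinuousMap.sub_apply, polyToTate_apply, Tate.coeff_trunc]
  split_ifs with hn
  · simpa using hC
  · simpa using h n (not_lt.1 hn)

lemma Tate.norm_trunc_le (F : Tate p) (N : ℕ) : ‖polyToTate (F.trunc N)‖ ≤ ‖F‖ := by
  refine Tate.norm_le (norm_nonneg _) fun n => ?_
  rw [polyToTate_apply, Tate.coeff_trunc]
  split_ifs
  · exact F.norm_apply_le n
  · simp

lemma Tate.tendsto_trunc (F : Tate p) :
    Tendsto (fun N => polyToTate (F.trunc N)) atTop (𝓝 F) := by
  rw [Metric.tendsto_atTop]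
  intro ε hε
  obtain ⟨N, hN⟩ := Metric.tendsto_atTop.1 F.tendsto (ε / 2) (half_pos hε)
  refine ⟨N, fun n hn => ?_⟩
  rw [dist_comm, dist_eq_norm]
  refine (F.norm_sub_trunc_le (half_pos hε).le fun m hm => ?_).trans_lt (half_lt_self hε)
  have := hN m (hn.trans hm)
  rw [dist_zero_right] at this
  exact this.le

lemma polyToTate_trunc (F : Tate p) (N : ℕ) :
    polyToTate (F.trunc N) = ∑ i ∈ Finset.range N, F i • polyToTate (Polynomial.X ^ i) := by
  rw [Tate.trunc, map_sum]
  refine Finset.sum_congr rfl fun i _ => ?_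
  rw [← Polynomial.C_mul_X_pow_eq_monomial, ← Polynomial.smul_eq_C_mul, map_smul]

/-- A continuous linear map on the Tate algebra is determined by its values on monomials. -/
lemma Tate.clm_ext {E : Type*} [NormedAddCommGroup E] [NormedSpace ℚ_[p] E]
    {S T : Tate p →L[ℚ_[p]] E}
    (h : ∀ i, S (polyToTate (Polynomial.X ^ i)) = T (polyToTate (Polynomial.X ^ i))) : S = T := by
  ext1 F
  refine tendsto_nhds_unique ((S.continuous.tendsto F).comp F.tendsto_trunc)
    (((T.continuous.tendsto F).comp F.tendsto_trunc).congr fun N => ?_)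
  simp only [Function.comp_apply, polyToTate_trunc, map_sum, map_smul, h]

/-- The monomials are an orthonormal basis of the Tate algebra, so bounding moments bounds the
operator norm. This turns the growth condition on a measure into a norm estimate. -/
lemma Dk.norm_le_of_mom {ω : Dk p} {C : ℝ} (hC : 0 ≤ C) (h : ∀ i, ‖ω.mom i‖ ≤ C) : ‖ω‖ ≤ C := by
  refine ω.opNorm_le_bound hC fun F => ?_
  refine le_of_tendsto ((ω.continuous.tendsto F).comp F.tendsto_trunc).norm
    (Eventually.of_forall fun N => ?_)
  simp only [Function.comp_apply, polyToTate_trunc, map_sum, map_smul]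
  refine IsUltrametricDist.norm_sum_le_of_forall_le_of_nonneg (by positivity) fun i _ => ?_
  rw [smul_eq_mul, norm_mul, mul_comm]
  exact mul_le_mul (h i) (F.norm_apply_le i) (norm_nonneg _) hC

/-- An element of the Tate algebra vanishing at all small powers of `p` is zero. -/
lemma Tate.eq_zero_of_eval {F : Tate p} (h : ∀ᶠ s : ℕ in atTop, F.eval ((p : ℚ_[p]) ^ s) = 0) :
    F = 0 := by
  by_contra hF
  have hex : ∃ m, F m ≠ 0 := by
    by_contra! h0
    exact hF (by ext n; simpa using h0 n)
  classical
  set m := Nat.find hex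
  have hm : F m ≠ 0 := Nat.find_spec hex
  have hlt : ∀ n < m, F n = 0 := fun n hn => not_not.1 (Nat.find_min hex hn)
  have hp1 : ‖(p : ℚ_[p])‖ < 1 := Padic.norm_p_lt_one
  -- At a small point `z` the first nonzero term `F m * z ^ m` dominates the tail, which is at most
  -- `‖F‖ |z|^{m+1}`.
  have hlim : Tendsto (fun s : ℕ => ‖F‖ * ‖(p : ℚ_[p])‖ ^ s) atTop (𝓝 0) := by
    simpa using (tendsto_pow_atTop_nhds_zero_of_lt_one (norm_nonneg _) hp1).const_mul ‖F‖
  obtain ⟨s, hs, hs'⟩ := (h.and (hlim.eventually (gt_mem_nhds (norm_pos_iff.2 hm)))).exists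
  have hz : ‖(p : ℚ_[p]) ^ s‖ ≤ 1 := by rw [norm_pow]; exact pow_le_one₀ (norm_nonneg _) hp1.le
  have hz0 : 0 < ‖(p : ℚ_[p]) ^ s‖ := norm_pos_iff.2 (pow_ne_zero _ coe_p_ne_zero)
  set z := (p : ℚ_[p]) ^ s
  have hsum := (F.summable hz).sum_add_tsum_nat_add (m + 1)
  rw [show ∑' n, F n * z ^ n = 0 from hs, Finset.sum_range_succ, Finset.sum_eq_zero
    (fun n hn => by rw [hlt n (Finset.mem_range.1 hn), zero_mul]), zero_add] at hsum
  have h1 : ‖∑' n, F (n + (m + 1)) * z ^ (n + (m + 1))‖ ≤ ‖F‖ * ‖z‖ * ‖z‖ ^ m := by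
    refine IsUltrametricDist.norm_tsum_le_of_forall_le_of_nonneg (by positivity) fun n => ?_
    rw [norm_mul, norm_pow, mul_assoc]
    refine mul_le_mul (F.norm_apply_le _) ?_ (by positivity) (norm_nonneg _)
    rw [show n + (m + 1) = n + 1 + m by ring, pow_add]
    refine mul_le_mul_of_nonneg_right ?_ (by positivity)
    rw [pow_succ]
    exact mul_le_of_le_one_left (norm_nonneg _) (pow_le_one₀ (norm_nonneg _) hz)
  rw [← neg_eq_iff_add_eq_zero] at hsum
  rw [← hsum, norm_neg, norm_mul, norm_pow] at h1
  have h2 := le_of_mul_le_mul_right h1 (by positivity)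
  rw [norm_pow] at h2
  exact absurd h2 (not_le.2 hs')

/-- Identities in the Tate algebra reduce to identities of functions. Only large `s` are tested, so
that the finitely many poles of the fractional linear maps involved can be avoided. -/
lemma Tate.ext_eval {F G : Tate p}
    (h : ∀ᶠ s : ℕ in atTop, F.eval ((p : ℚ_[p]) ^ s) = G.eval ((p : ℚ_[p]) ^ s)) : F = G := by
  rw [← sub_eq_zero]
  refine Tate.eq_zero_of_eval (h.mono fun s hs => ?_)
  have hz : ‖(p : ℚ_[p]) ^ s‖ ≤ 1 := by
    rw [norm_pow]; exact pow_le_one₀ (norm_nonneg _) Padic.norm_p_lt_one.le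
  rw [← evalL_apply _ hz, map_sub, evalL_apply, evalL_apply, hs, sub_self]

lemma norm_p_pow_le_one (s : ℕ) : ‖(p : ℚ_[p]) ^ s‖ ≤ 1 := by
  rw [norm_pow]; exact pow_le_one₀ (norm_nonneg _) Padic.norm_p_lt_one.le

lemma eventually_pow_ne (x : ℚ_[p]) : ∀ᶠ s : ℕ in atTop, (p : ℚ_[p]) ^ s ≠ x := by
  by_cases hx : ∃ s : ℕ, (p : ℚ_[p]) ^ s = x
  · obtain ⟨s, rfl⟩ := hx
    filter_upwards [eventually_gt_atTop s] with t ht h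
    have := congrArg norm h
    rw [norm_pow, norm_pow] at this
    exact (pow_lt_pow_right_of_lt_one₀ (norm_pos_iff.2 coe_p_ne_zero) Padic.norm_p_lt_one ht).ne this
  · push Not at hx
    exact Eventually.of_forall hx

lemma eventually_linear_ne_zero (g : GL (Fin 2) ℚ_[p]) :
    ∀ᶠ s : ℕ in atTop, g 1 0 * (p : ℚ_[p]) ^ s + g 1 1 ≠ 0 := by
  by_cases h : g 1 0 = 0
  · refine Eventually.of_forall fun s h' => det_entry_ne_zero g ?_
    rw [h, zero_mul, zero_add] at h'
    rw [h, h']; ring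
  · filter_upwards [eventually_pow_ne (-g 1 1 / g 1 0)] with s hs h'
    exact hs (by field_simp; linear_combination h')

/-! ### Evaluation of restricted power series -/

/-- The value `∑ fₙ zⁿ`. -/
def psEval (f : PowerSeries ℚ_[p]) (z : ℚ_[p]) : ℚ_[p] := ∑' n, PowerSeries.coeff n f * z ^ n

/-- The power series whose coefficients tend to zero. -/
def restricted (p : ℕ) [Fact p.Prime] : Subring (PowerSeries ℚ_[p]) :=
  PowerSeries.IsRestricted.subring 1

lemma mem_restricted {f : PowerSeries ℚ_[p]} :
    f ∈ restricted p ↔ Tendsto (fun n => PowerSeries.coeff n f) atTop (𝓝 0) := by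
  refine (show _ ↔ PowerSeries.IsRestricted 1 f from Iff.rfl).trans ?_
  rw [PowerSeries.isRestricted_iff']
  simp only [one_pow, mul_one]
  exact tendsto_zero_iff_norm_tendsto_zero.symm

lemma tsum_mul_tsum_antidiagonal {u v : ℕ → ℚ_[p]} (hu : Summable u) (hv : Summable v) :
    (∑' n, u n) * ∑' n, v n = ∑' n, ∑ ij ∈ Finset.HasAntidiagonal.antidiagonal n, u ij.1 * v ij.2 :=
  haveI : NonarchimedeanRing ℚ_[p] := ⟨NonarchimedeanAddGroup.is_nonarchimedean⟩
  hu.tsum_mul_tsum_eq_tsum_sum_antidiagonal hv (hu.mul_of_nonarchimedean hv)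

lemma coeff_mul_mul_pow (f g : PowerSeries ℚ_[p]) (z : ℚ_[p]) (n : ℕ) :
    PowerSeries.coeff n (f * g) * z ^ n = ∑ ij ∈ Finset.HasAntidiagonal.antidiagonal n,
      PowerSeries.coeff ij.1 f * z ^ ij.1 * (PowerSeries.coeff ij.2 g * z ^ ij.2) := by
  rw [PowerSeries.coeff_mul, Finset.sum_mul]
  refine Finset.sum_congr rfl fun ij hij => ?_
  rw [← Finset.HasAntidiagonal.mem_antidiagonal.1 hij, pow_add]
  ring

/-- The Cauchy product formula holds because summable families in a nonarchimedean ring have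
summable products. It allows the formal expansion `actMonomial` to be evaluated factor by factor. -/
lemma psEval_mul {f g : PowerSeries ℚ_[p]} (hf : f ∈ restricted p) (hg : g ∈ restricted p)
    {z : ℚ_[p]} (hz : ‖z‖ ≤ 1) : psEval (f * g) z = psEval f z * psEval g z := by
  unfold psEval
  rw [tsum_mul_tsum_antidiagonal (summable_of_tendsto (mem_restricted.1 hf) hz)
    (summable_of_tendsto (mem_restricted.1 hg) hz)]
  exact tsum_congr fun n => coeff_mul_mul_pow f g z n

lemma psEval_coe (P : Polynomial ℚ_[p]) (z : ℚ_[p]) :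
    (P : PowerSeries ℚ_[p]) ∈ restricted p ∧ psEval (P : PowerSeries ℚ_[p]) z = P.eval z := by
  constructor
  · rw [mem_restricted]
    exact (polyToTate P).tendsto.congr fun n => (Polynomial.coeff_coe P n).symm
  · rw [← eval_polyToTate]
    exact tsum_congr fun n => by rw [Polynomial.coeff_coe, polyToTate_apply]

lemma psEval_pow {f : PowerSeries ℚ_[p]} (hf : f ∈ restricted p)
    {z : ℚ_[p]} (hz : ‖z‖ ≤ 1) (n : ℕ) : psEval (f ^ n) z = psEval f z ^ n := by
  induction n with
  | zero =>
    rw [pow_zero, pow_zero]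
    have := (psEval_coe (1 : Polynomial ℚ_[p]) z).2
    simpa using this
  | succ n ih => rw [pow_succ, pow_succ, psEval_mul (pow_mem hf n) hf hz, ih]

lemma psEval_linear (a b z : ℚ_[p]) :
    PowerSeries.C a - PowerSeries.C b * PowerSeries.X ∈ restricted p ∧
    psEval (PowerSeries.C a - PowerSeries.C b * PowerSeries.X) z = a - b * z := by
  have h := psEval_coe (Polynomial.C a - Polynomial.C b * Polynomial.X) z
  simpa using h

lemma psEval_actMonomial {k : ℕ} {g : GL (Fin 2) ℚ_[p]} (hg : g ∈ QSigma0 p) (i : ℕ) {z : ℚ_[p]}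
    (hz : ‖z‖ ≤ 1) : psEval (actMonomial k g i) z =
      ((g : Matrix (Fin 2) (Fin 2) ℚ_[p]).det ^ (k / 2))⁻¹ * (g 0 0 - g 1 0 * z) ^ k *
        ((g 1 1 * z - g 0 1) / (g 0 0 - g 1 0 * z)) ^ i := by
  obtain ⟨ha, hc, hb, hd⟩ := QSigma0.norms hg
  obtain ⟨r1, e1⟩ := psEval_linear (g 0 0) (g 1 0) z
  obtain ⟨r2, e2⟩ := psEval_linear (-g 0 1) (-g 1 1) z
  obtain ⟨r3, e3⟩ := psEval_coe (Polynomial.C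
    (((g : Matrix (Fin 2) (Fin 2) ℚ_[p]).det ^ (k / 2))⁻¹)) z
  rw [Polynomial.coe_C] at r3 e3
  rw [Polynomial.eval_C] at e3
  have hne : PowerSeries.constantCoeff
      (PowerSeries.C (g 0 0) - PowerSeries.C (g 1 0) * PowerSeries.X) ≠ 0 := by simpa using ha
  have r4 : (PowerSeries.C (g 0 0) - PowerSeries.C (g 1 0) * PowerSeries.X)⁻¹ ∈ restricted p := by
    rw [inv_linear ha, mem_restricted]
    simp only [PowerSeries.coeff_C_mul, PowerSeries.coeff_mk]
    simpa using (tendsto_pow_atTop_nhds_zero_of_norm_lt_one hc).const_mul (g 0 0)⁻¹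
  have e4 : psEval (PowerSeries.C (g 0 0) - PowerSeries.C (g 1 0) * PowerSeries.X)⁻¹ z =
      (g 0 0 - g 1 0 * z)⁻¹ := by
    refine eq_inv_of_mul_eq_one_left ?_
    rw [← e1, ← psEval_mul r4 r1 hz, PowerSeries.inv_mul_cancel _ hne]
    simpa using (psEval_coe (1 : Polynomial ℚ_[p]) z).2
  have e5 : PowerSeries.C (g 1 1) * PowerSeries.X - PowerSeries.C (g 0 1) =
      PowerSeries.C (-g 0 1) - PowerSeries.C (-g 1 1) * PowerSeries.X := by
    simp only [map_neg]; ring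
  rw [actMonomial, e5, psEval_mul (mul_mem r3 (pow_mem r1 k)) (pow_mem (mul_mem r2 r4) i) hz,
    psEval_mul r3 (pow_mem r1 k) hz, psEval_pow r1 hz, psEval_pow (mul_mem r2 r4) hz,
    psEval_mul r2 r4 hz, e1, e2, e3, e4]
  ring

/-! ### The slash operator -/

/-- Inverting the determinant gives `det(g)^{k/2}`, while the factor `det(g)⁻¹` in the entries of
`g⁻¹` gives `det(g)^{-k}`. For even `k` they combine to `det(g)^{-k/2}`, the normalization in
`actMonomial`. -/
lemma slash_inv {k : ℕ} (hk : Even k) (f : ℚ_[p] → ℚ_[p]) (g : GL (Fin 2) ℚ_[p]) (x : ℚ_[p]) :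
    slash k f g⁻¹ x = ((g : Matrix (Fin 2) (Fin 2) ℚ_[p]).det ^ (k / 2))⁻¹ *
      (g 0 0 - g 1 0 * x) ^ k * f ((g 1 1 * x - g 0 1) / (g 0 0 - g 1 0 * x)) := by
  obtain ⟨e1, e2, e3, e4⟩ := inv_entry g
  have hd := det_val_ne_zero g
  have hdi : (g⁻¹ : GL (Fin 2) ℚ_[p]).1.det = (g : Matrix (Fin 2) (Fin 2) ℚ_[p]).det⁻¹ := by
    rw [Matrix.coe_units_inv, Matrix.det_nonsing_inv, Ring.inverse_eq_inv']
  rw [slash, hdi, e1, e2, e3, e4]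
  set d := (g : Matrix (Fin 2) (Fin 2) ℚ_[p]).det
  rw [show d⁻¹ * g 1 1 * x + -(d⁻¹ * g 0 1) = d⁻¹ * (g 1 1 * x - g 0 1) by ring,
    show -(d⁻¹ * g 1 0) * x + d⁻¹ * g 0 0 = d⁻¹ * (g 0 0 - g 1 0 * x) by ring,
    mul_div_mul_left _ _ (inv_ne_zero hd), mul_pow]
  congr 1
  obtain ⟨m, rfl⟩ := hk
  rw [show (m + m) / 2 = m by omega, inv_pow, inv_pow, inv_inv, pow_add]
  field_simp

/-- Only `h` has to be regular at `x`: if `g` has its pole at `h x`, both sides contain the same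
quotient by zero and still agree. -/
lemma slash_mul (k : ℕ) (f : ℚ_[p] → ℚ_[p]) (g h : GL (Fin 2) ℚ_[p]) {x : ℚ_[p]}
    (hx : h 1 0 * x + h 1 1 ≠ 0) : slash k (slash k f g) h x = slash k f (g * h) x := by
  simp only [slash, mul_entry, Units.val_mul, Matrix.det_mul]
  have e1 : g 1 0 * ((h 0 0 * x + h 0 1) / (h 1 0 * x + h 1 1)) + g 1 1 =
      ((g 1 0 * h 0 0 + g 1 1 * h 1 0) * x + (g 1 0 * h 0 1 + g 1 1 * h 1 1)) /
        (h 1 0 * x + h 1 1) := by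
    rw [eq_div_iff hx, add_mul, mul_assoc, div_mul_cancel₀ _ hx]; ring
  have e2 : g 0 0 * ((h 0 0 * x + h 0 1) / (h 1 0 * x + h 1 1)) + g 0 1 =
      ((g 0 0 * h 0 0 + g 0 1 * h 1 0) * x + (g 0 0 * h 0 1 + g 0 1 * h 1 1)) /
        (h 1 0 * x + h 1 1) := by
    rw [eq_div_iff hx, add_mul, mul_assoc, div_mul_cancel₀ _ hx]; ring
  rw [e1, e2, div_div_div_cancel_right₀ hx, div_pow, mul_pow, mul_inv]
  have := pow_ne_zero k hx
  generalize (h 1 0 * x + h 1 1) ^ k = D at *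
  field_simp

lemma slash_one (k : ℕ) (f : ℚ_[p] → ℚ_[p]) (x : ℚ_[p]) : slash k f 1 x = f x := by
  simp [slash]

lemma slash_add (k : ℕ) (f₁ f₂ : ℚ_[p] → ℚ_[p]) (g : GL (Fin 2) ℚ_[p]) (x : ℚ_[p]) :
    slash k (f₁ + f₂) g x = slash k f₁ g x + slash k f₂ g x := by
  simp only [slash, Pi.add_apply]; ring

lemma slash_smul (k : ℕ) (r : ℚ_[p]) (f : ℚ_[p] → ℚ_[p]) (g : GL (Fin 2) ℚ_[p]) (x : ℚ_[p]) :
    slash k (r • f) g x = r * slash k f g x := by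
  simp only [slash, Pi.smul_apply, smul_eq_mul]; ring

lemma slash_scalar {k : ℕ} (hk : Even k) (f : ℚ_[p] → ℚ_[p]) (u : ℚ_[p]ˣ) (x : ℚ_[p]) :
    slash k f (Matrix.GeneralLinearGroup.scalar (Fin 2) u) x = f x := by
  obtain ⟨u1, u2, u3, u4⟩ := scalar_entry u
  rw [slash, det_entry, u1, u2, u3, u4]
  obtain ⟨m, rfl⟩ := hk
  rw [show (m + m) / 2 = m by omega]
  have := u.ne_zero
  simp only [zero_mul, zero_add, add_zero, sub_zero, mul_pow]
  rw [mul_div_cancel_left₀ _ this, pow_add]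
  field_simp

/-- On `ℤ_p` the denominator has constant absolute value `|a|`, since `|c| < |a|`. Thus `g⁻¹` maps
`ℤ_p` into itself without a pole. -/
lemma QSigma0.denom {g : GL (Fin 2) ℚ_[p]} (hg : g ∈ QSigma0 p) {z : ℚ_[p]} (hz : ‖z‖ ≤ 1) :
    g 0 0 - g 1 0 * z ≠ 0 ∧ ‖(g 1 1 * z - g 0 1) / (g 0 0 - g 1 0 * z)‖ ≤ 1 := by
  obtain ⟨ha, hc, hb, hd⟩ := QSigma0.norms hg
  have hden : ‖g 0 0 - g 1 0 * z‖ = ‖g 0 0‖ := by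
    have : ‖g 1 0 * z‖ < ‖g 0 0‖ := by
      rw [norm_div, div_lt_one (norm_pos_iff.2 ha)] at hc
      rw [norm_mul]
      exact (mul_le_of_le_one_right (norm_nonneg _) hz).trans_lt hc
    rw [sub_eq_add_neg, IsUltrametricDist.norm_add_eq_max_of_norm_ne_norm (by
      rw [norm_neg]; exact this.ne'), norm_neg, max_eq_left this.le]
  have h0 : g 0 0 - g 1 0 * z ≠ 0 := norm_ne_zero_iff.1 (by rw [hden]; exact norm_ne_zero_iff.2 ha)
  refine ⟨h0, ?_⟩
  rw [norm_div, hden]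
  rw [norm_div, div_le_one (norm_pos_iff.2 ha)] at hb hd
  refine div_le_one_of_le₀ ((padic_norm_sub_le_max _ _).trans (max_le ?_ hb)) (norm_nonneg _)
  rw [norm_mul]
  exact (mul_le_of_le_one_right (norm_nonneg _) hz).trans hd

lemma tateAct_apply (k : ℕ) {g : GL (Fin 2) ℚ_[p]} (hg : g ∈ QSigma0 p) (F : Tate p) (n : ℕ) :
    tateAct k g hg F n = ∑' i, F i * PowerSeries.coeff n (actMonomial k g i) := rfl

/-- Both sides are continuous linear forms in `F`, so monomials suffice, and there the claim is the
evaluation of the series `actMonomial`. -/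
lemma eval_tateAct {k : ℕ} (hk : Even k) {g : GL (Fin 2) ℚ_[p]} (hg : g ∈ QSigma0 p) (F : Tate p)
    {z : ℚ_[p]} (hz : ‖z‖ ≤ 1) : (tateAct k g hg F).eval z = slash k F.eval g⁻¹ z := by
  obtain ⟨-, hw⟩ := QSigma0.denom hg hz
  rw [slash_inv hk]
  set w := (g 1 1 * z - g 0 1) / (g 0 0 - g 1 0 * z)
  set r := ((g : Matrix (Fin 2) (Fin 2) ℚ_[p]).det ^ (k / 2))⁻¹ * (g 0 0 - g 1 0 * z) ^ k
  suffices h : (evalL z hz).comp (tateAct k g hg) = r • evalL w hw from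
    congrArg (fun T : Dk p => T F) h
  refine Tate.clm_ext fun i => ?_
  rw [ContinuousLinearMap.comp_apply, smul_apply, evalL_apply, evalL_apply,
    eval_polyToTate, Polynomial.eval_pow, Polynomial.eval_X, smul_eq_mul,
    ← psEval_actMonomial hg i hz]
  refine tsum_congr fun n => ?_
  rw [tateAct_apply, tsum_eq_single i]
  · rw [polyToTate_apply, Polynomial.coeff_X_pow_self, one_mul]
  · intro j hj
    rw [polyToTate_apply, Polynomial.coeff_X_pow, if_neg hj, zero_mul]

lemma norm_tateAct_coeff_le (k : ℕ) {g : GL (Fin 2) ℚ_[p]} (hg : g ∈ QSigma0 p) (F : Tate p) :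
    ‖tateAct k g hg F‖ ≤
      ‖((g : Matrix (Fin 2) (Fin 2) ℚ_[p]).det ^ (k / 2))⁻¹ * g 0 0 ^ k‖ * ‖F‖ := by
  refine Tate.norm_le (by positivity) fun n => ?_
  refine IsUltrametricDist.norm_tsum_le_of_forall_le_of_nonneg (by positivity) fun i => ?_
  rw [norm_mul, mul_comm]
  exact mul_le_mul ((actMonomial_bound k hg i).2 n) (F.norm_apply_le i)
    (norm_nonneg _) (norm_nonneg _)

lemma tateAct_mul {k : ℕ} (hk : Even k) {g h : GL (Fin 2) ℚ_[p]} (hg : g ∈ QSigma0 p)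
    (hh : h ∈ QSigma0 p) (hgh : g * h ∈ QSigma0 p) (F : Tate p) :
    tateAct k (g * h) hgh F = tateAct k g hg (tateAct k h hh F) := by
  refine Tate.ext_eval (Eventually.of_forall fun s => ?_)
  have hz := norm_p_pow_le_one (p := p) s
  set z := (p : ℚ_[p]) ^ s
  obtain ⟨h0, hw⟩ := QSigma0.denom hg hz
  rw [eval_tateAct hk _ _ hz, eval_tateAct hk _ _ hz, mul_inv_rev, ← slash_mul]
  · rw [slash_inv hk _ g, slash_inv hk _ g, eval_tateAct hk hh F hw]
  · obtain ⟨e1, e2, e3, e4⟩ := inv_entry g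
    rw [e3, e4, show ∀ d a b c : ℚ_[p], -(d * a) * b + d * c = d * (c - a * b) from
      fun _ _ _ _ => by ring]
    exact mul_ne_zero (inv_ne_zero (det_val_ne_zero g)) h0

lemma distAct_mul {k : ℕ} (hk : Even k) {g h : GL (Fin 2) ℚ_[p]} (hg : g ∈ QSigma0 p)
    (hh : h ∈ QSigma0 p) (hgh : g * h ∈ QSigma0 p) (ω : Dk p) :
    distAct k ω (g * h) hgh = distAct k (distAct k ω g hg) h hh := by
  ext1 F
  simp only [distAct, ContinuousLinearMap.comp_apply, tateAct_mul hk hg hh hgh]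

/-- Homogenization in degree `k`: the automorphy factor is split as `(cz+d)^i (cz+d)^{k-i}` for each
monomial, which is where the degree bound is needed. -/
lemma eval_polyAct (k : ℕ) (g : GL (Fin 2) ℚ_[p]) (P : Pk p k) {z : ℚ_[p]}
    (hz : g 1 0 * z + g 1 1 ≠ 0) :
    (polyAct k g P).1.eval z = slash k (fun x => P.1.eval x) g z := by
  have hP : P.1.natDegree < k + 1 :=
    Nat.lt_succ_of_le (Polynomial.natDegree_le_of_degree_le (Polynomial.mem_degreeLE.1 P.2))
  change Polynomial.eval z (_ • ∑ i ∈ Finset.range (k + 1), _) = _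
  simp only [slash]
  rw [Polynomial.eval_smul, smul_eq_mul, mul_assoc]
  refine congrArg _ ?_
  rw [Polynomial.eval_finsetSum, Polynomial.eval_eq_sum_range' hP, Finset.mul_sum]
  refine Finset.sum_congr rfl fun i hi => ?_
  have hik : i ≤ k := Nat.lt_succ_iff.1 (Finset.mem_range.1 hi)
  simp only [Polynomial.eval_smul, Polynomial.eval_mul, Polynomial.eval_pow, Polynomial.eval_add,
    Polynomial.eval_C, Polynomial.eval_X, smul_eq_mul]
  have hkp : (g 1 0 * z + g 1 1) ^ k = (g 1 0 * z + g 1 1) ^ i * (g 1 0 * z + g 1 1) ^ (k - i) := by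
    rw [← pow_add, Nat.add_sub_cancel' hik]
  have hi0 := pow_ne_zero i hz
  rw [div_pow, hkp]
  generalize (g 1 0 * z + g 1 1) ^ i = D at *
  field_simp

lemma polyToTate_injective : Function.Injective (polyToTate (p := p)) := by
  intro P Q h
  ext n
  exact congrArg (fun F : Tate p => F n) h

lemma polyAct_mul (k : ℕ) (g h : GL (Fin 2) ℚ_[p]) (P : Pk p k) :
    polyAct k h (polyAct k g P) = polyAct k (g * h) P := by
  refine Subtype.ext (polyToTate_injective (Tate.ext_eval ?_))
  filter_upwards [eventually_linear_ne_zero h, eventually_linear_ne_zero (g * h)] with s h1 h2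
  rw [eval_polyToTate, eval_polyToTate, eval_polyAct _ _ _ h1, eval_polyAct _ _ _ h2,
    ← slash_mul _ _ _ _ h1]
  simp only [slash]
  congr 1
  refine eval_polyAct k g P ?_
  intro h0
  apply h2
  rw [mul_entry, mul_entry]
  have h3 := congrArg (· * (h 1 0 * (p : ℚ_[p]) ^ s + h 1 1)) h0
  simp only [add_mul, mul_assoc, div_mul_cancel₀ _ h1, zero_mul] at h3
  linear_combination h3

lemma polyAct_one (k : ℕ) (P : Pk p k) : polyAct k 1 P = P := by
  refine Subtype.ext (polyToTate_injective (Tate.ext_eval (Eventually.of_forall fun s => ?_)))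
  rw [eval_polyToTate, eval_polyToTate, eval_polyAct, slash_one]
  simp

lemma polyAct_scalar {k : ℕ} (hk : Even k) (u : ℚ_[p]ˣ) (P : Pk p k) :
    polyAct k (Matrix.GeneralLinearGroup.scalar (Fin 2) u) P = P := by
  refine Subtype.ext (polyToTate_injective (Tate.ext_eval (Eventually.of_forall fun s => ?_)))
  rw [eval_polyToTate, eval_polyToTate, eval_polyAct, slash_scalar hk]
  obtain ⟨u1, u2, u3, u4⟩ := scalar_entry u
  rw [u3, u4, zero_mul, zero_add]
  exact u.ne_zero

lemma leftAct_mul (k : ℕ) (g h : GL (Fin 2) ℚ_[p]) (ω : Vk p k) :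
    leftAct k (g * h) ω = leftAct k g (leftAct k h ω) := by
  ext1 P
  simp only [leftAct, LinearMap.comp_apply, polyAct_mul]

lemma leftAct_one (k : ℕ) (ω : Vk p k) : leftAct k 1 ω = ω := by
  ext1 P
  simp only [leftAct, LinearMap.comp_apply, polyAct_one]

lemma leftAct_scalar {k : ℕ} (hk : Even k) (u : ℚ_[p]ˣ) (ω : Vk p k) :
    leftAct k (Matrix.GeneralLinearGroup.scalar (Fin 2) u) ω = ω := by
  ext1 P
  simp only [leftAct, LinearMap.comp_apply, polyAct_scalar hk]

lemma rightAct_eq (k : ℕ) (g : GL (Fin 2) ℚ_[p]) (ω : Vk p k) :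
    rightAct k ω g = leftAct k g⁻¹ ω := rfl

/-- The actions on polynomials and on the Tate algebra are the same on functions, so restriction of
distributions to `𝒫_k` is equivariant. -/
lemma tateAct_polyToTate {k : ℕ} (hk : Even k) {g : GL (Fin 2) ℚ_[p]} (hg : g ∈ QSigma0 p)
    (P : Pk p k) : tateAct k g hg (polyToTate P.1) = polyToTate (polyAct k g⁻¹ P).1 := by
  refine Tate.ext_eval ?_
  filter_upwards [eventually_linear_ne_zero g⁻¹] with s hs
  rw [eval_tateAct hk _ _ (norm_p_pow_le_one s), eval_polyToTate, eval_polyAct _ _ _ hs]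
  simp only [slash, eval_polyToTate]

lemma specialize_apply (k : ℕ) (ω : Dk p) (P : Pk p k) : specialize k ω P = ω (polyToTate P.1) :=
  rfl

lemma specialize_distAct {k : ℕ} (hk : Even k) {g : GL (Fin 2) ℚ_[p]} (hg : g ∈ QSigma0 p)
    (ω : Dk p) : specialize k (distAct k ω g hg) = rightAct k (specialize k ω) g := by
  ext1 P
  rw [specialize_apply, distAct, ContinuousLinearMap.comp_apply, tateAct_polyToTate hk]
  rfl

/-! ### Finiteness of the double coset space -/

section Finiteness

variable {a b : ℚ}

/-- The reduced norm form. -/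
def nrd (x : ℍ[ℚ,a,b]) : ℚ := x.re ^ 2 - a * x.imI ^ 2 - b * x.imJ ^ 2 + a * b * x.imK ^ 2

lemma mul_star_eq (x : ℍ[ℚ,a,b]) : x * star x = algebraMap ℚ _ (nrd x) := by
  have e : algebraMap ℚ ℍ[ℚ,a,b] (nrd x) = ⟨nrd x, 0, 0, 0⟩ := rfl
  rw [e]
  ext
  · simp [nrd]; ring
  all_goals simp; ring

lemma star_mul_eq (x : ℍ[ℚ,a,b]) : star x * x = algebraMap ℚ _ (nrd x) := by
  have e : algebraMap ℚ ℍ[ℚ,a,b] (nrd x) = ⟨nrd x, 0, 0, 0⟩ := rfl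
  rw [e]
  ext
  · simp [nrd]; ring
  all_goals simp; ring

/-- For `a, b < 0` the four coefficients of the norm form are positive. This is the definiteness
that makes the double coset space finite. -/
lemma nrd_pos (ha : a < 0) (hb : b < 0) {x : ℍ[ℚ,a,b]} (hx : x ≠ 0) : 0 < nrd x := by
  have hab : 0 < a * b := mul_pos_of_neg_of_neg ha hb
  have h1 := mul_nonneg (neg_pos.2 ha).le (sq_nonneg x.imI)
  have h2 := mul_nonneg (neg_pos.2 hb).le (sq_nonneg x.imJ)
  have h3 := mul_nonneg hab.le (sq_nonneg x.imK)
  have h0 := sq_nonneg x.re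
  rw [nrd]
  by_contra! hle
  apply hx
  have e0 : x.re ^ 2 = 0 := by linarith
  have e1 : -a * x.imI ^ 2 = 0 := by linarith
  have e2 : -b * x.imJ ^ 2 = 0 := by linarith
  have e3 : a * b * x.imK ^ 2 = 0 := by linarith
  ext
  · simpa using e0
  · simpa [ha.ne] using e1
  · simpa [hb.ne] using e2
  · simpa [hab.ne', ha.ne, hb.ne] using e3

/-- The quaternion with given integral coordinates. -/
def intQuat (a b : ℚ) (c : Fin 4 → ℤ) : ℍ[ℚ,a,b] := ⟨c 0, c 1, c 2, c 3⟩

lemma exists_smul_mem_of_span {R : Subring ℍ[ℚ,a,b]}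
    (hR : Submodule.span ℚ (R : Set ℍ[ℚ,a,b]) = ⊤) (x : ℍ[ℚ,a,b]) :
    ∃ n : ℕ, 0 < n ∧ (n : ℚ) • x ∈ R := by
  have hx : x ∈ Submodule.span ℚ (R : Set ℍ[ℚ,a,b]) := hR ▸ Submodule.mem_top
  induction hx using Submodule.span_induction with
  | mem x h => exact ⟨1, one_pos, by simpa using h⟩
  | zero => exact ⟨1, one_pos, by simp⟩
  | add x y _ _ hx hy =>
    obtain ⟨n, hn, hx⟩ := hx
    obtain ⟨m, hm, hy⟩ := hy
    refine ⟨n * m, Nat.mul_pos hn hm, ?_⟩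
    have e : ((n * m : ℕ) : ℚ) • (x + y) = m • ((n : ℚ) • x) + n • ((m : ℚ) • y) := by
      rw [← Nat.cast_smul_eq_nsmul ℚ, ← Nat.cast_smul_eq_nsmul ℚ, smul_smul, smul_smul, smul_add]
      push_cast
      rw [mul_comm]
    rw [e]
    exact R.add_mem (R.nsmul_mem hx _) (R.nsmul_mem hy _)
  | smul q x _ hx =>
    obtain ⟨n, hn, hx⟩ := hx
    refine ⟨q.den * n, Nat.mul_pos q.den_pos hn, ?_⟩
    have e : ((q.den * n : ℕ) : ℚ) • q • x = q.num • ((n : ℚ) • x) := by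
      rw [← Int.cast_smul_eq_zsmul ℚ, smul_smul, smul_smul]
      push_cast
      congr 1
      rw [mul_right_comm, mul_comm (q.den : ℚ), Rat.mul_den_eq_num]
    rw [e]
    exact R.zsmul_mem hx _

/-- The order contains a multiple of the standard lattice spanned by `1, i, j, ij`; the search for
short elements takes place in that sublattice, where coordinates are integers. -/
lemma exists_smul_intQuat_mem {R : Subring ℍ[ℚ,a,b]}
    (hR : Submodule.span ℚ (R : Set ℍ[ℚ,a,b]) = ⊤) :
    ∃ n : ℕ, 0 < n ∧ ∀ c, (n : ℚ) • intQuat a b c ∈ R := by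
  obtain ⟨n₀, h₀, m₀⟩ := exists_smul_mem_of_span hR ⟨1, 0, 0, 0⟩
  obtain ⟨n₁, h₁, m₁⟩ := exists_smul_mem_of_span hR ⟨0, 1, 0, 0⟩
  obtain ⟨n₂, h₂, m₂⟩ := exists_smul_mem_of_span hR ⟨0, 0, 1, 0⟩
  obtain ⟨n₃, h₃, m₃⟩ := exists_smul_mem_of_span hR ⟨0, 0, 0, 1⟩
  refine ⟨n₀ * n₁ * n₂ * n₃, by positivity, fun c => ?_⟩
  have e : ((n₀ * n₁ * n₂ * n₃ : ℕ) : ℚ) • intQuat a b c =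
      (c 0 * n₁ * n₂ * n₃) • ((n₀ : ℚ) • (⟨1, 0, 0, 0⟩ : ℍ[ℚ,a,b])) +
      (c 1 * n₀ * n₂ * n₃) • ((n₁ : ℚ) • (⟨0, 1, 0, 0⟩ : ℍ[ℚ,a,b])) +
      (c 2 * n₀ * n₁ * n₃) • ((n₂ : ℚ) • (⟨0, 0, 1, 0⟩ : ℍ[ℚ,a,b])) +
      (c 3 * n₀ * n₁ * n₂) • ((n₃ : ℚ) • (⟨0, 0, 0, 1⟩ : ℍ[ℚ,a,b])) := by
    simp only [← Int.cast_smul_eq_zsmul ℚ]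
    ext <;> simp [intQuat] <;> ring
  rw [e]
  exact R.add_mem (R.add_mem (R.add_mem (R.zsmul_mem m₀ _) (R.zsmul_mem m₁ _))
    (R.zsmul_mem m₂ _)) (R.zsmul_mem m₃ _)

/-! ### Reduced trace and norm under the splitting -/

lemma norm_splitting_le {R : Subring ℍ[ℚ,a,b]}
    {ι : ℍ[ℚ,a,b] →ₐ[ℚ] Matrix (Fin 2) (Fin 2) ℚ_[p]} (hι : IsSplitting R ι) {x : ℍ[ℚ,a,b]}
    (hx : x ∈ R) (i j : Fin 2) : ‖ι x i j‖ ≤ 1 := by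
  have h : ι x ∈ (Submodule.span ℤ_[p] (ι '' (R : Set ℍ[ℚ,a,b])) :
    Set (Matrix (Fin 2) (Fin 2) ℚ_[p])) := Submodule.subset_span ⟨x, hx, rfl⟩
  rw [hι] at h
  exact h i j

/-- With `X`, `Y` the two images, anticommutation and cyclicity of the trace give `tr(XYY) =
-tr(XYY)`, while `Y²` is a nonzero scalar. -/
lemma trace_eq_zero_of_anticomm (ι : ℍ[ℚ,a,b] →ₐ[ℚ] Matrix (Fin 2) (Fin 2) ℚ_[p])
    {x y : ℍ[ℚ,a,b]} {β : ℚ} (hβ : β ≠ 0) (hy : y * y = algebraMap ℚ _ β) (hxy : x * y = -(y * x)) :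
    (ι x).trace = 0 := by
  have h1 : (ι x * ι y * ι y).trace = -(ι x * ι y * ι y).trace := by
    conv_lhs => rw [← map_mul, hxy, map_neg, map_mul, Matrix.neg_mul, Matrix.trace_neg,
      Matrix.mul_assoc, Matrix.trace_mul_comm]
  have h2 : (ι x * ι y * ι y).trace = (β : ℚ) • (ι x).trace := by
    rw [mul_assoc, ← map_mul ι y, hy, AlgHom.commutes, Algebra.algebraMap_eq_smul_one,
      Matrix.mul_smul, Matrix.mul_one, Matrix.trace_smul]
  have h3 : (ι x * ι y * ι y).trace = 0 := self_eq_neg.1 h1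
  rw [h2] at h3
  exact (smul_eq_zero.1 h3).resolve_left hβ

lemma trace_splitting (ha : a < 0) (hb : b < 0)
    (ι : ℍ[ℚ,a,b] →ₐ[ℚ] Matrix (Fin 2) (Fin 2) ℚ_[p]) (x : ℍ[ℚ,a,b]) :
    (ι x).trace = 2 * (x.re : ℚ_[p]) := by
  have hi : (ι (⟨0, 1, 0, 0⟩ : ℍ[ℚ,a,b])).trace = 0 :=
    trace_eq_zero_of_anticomm ι (y := ⟨0, 0, 1, 0⟩) hb.ne (by ext <;> simp) (by ext <;> simp)
  have hj : (ι (⟨0, 0, 1, 0⟩ : ℍ[ℚ,a,b])).trace = 0 :=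
    trace_eq_zero_of_anticomm ι (y := ⟨0, 1, 0, 0⟩) ha.ne (by ext <;> simp) (by ext <;> simp)
  have hk : (ι (⟨0, 0, 0, 1⟩ : ℍ[ℚ,a,b])).trace = 0 :=
    trace_eq_zero_of_anticomm ι (y := ⟨0, 1, 0, 0⟩) ha.ne (by ext <;> simp) (by ext <;> simp)
  have e : x = x.re • (1 : ℍ[ℚ,a,b]) + x.imI • (⟨0, 1, 0, 0⟩ : ℍ[ℚ,a,b]) +
      x.imJ • (⟨0, 0, 1, 0⟩ : ℍ[ℚ,a,b]) + x.imK • (⟨0, 0, 0, 1⟩ : ℍ[ℚ,a,b]) := by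
    ext <;> simp
  conv_lhs => rw [e]
  simp only [map_add, map_smul, map_one, Matrix.trace_add, Matrix.trace_smul, hi, hj, hk,
    smul_zero, add_zero, Matrix.trace_one, Fintype.card_fin]
  rw [Algebra.smul_def, mul_comm]
  simp

/-- Since traces match, the conjugate `tr(x) - x` goes to the adjugate matrix; comparing `x x̄` with
`M · adj M` gives the norm. -/
lemma det_splitting (ha : a < 0) (hb : b < 0)
    (ι : ℍ[ℚ,a,b] →ₐ[ℚ] Matrix (Fin 2) (Fin 2) ℚ_[p]) (x : ℍ[ℚ,a,b]) :
    (ι x).det = (nrd x : ℚ_[p]) := by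
  have ht := trace_splitting ha hb ι x
  have hs : ι (star x) = (ι x).adjugate := by
    have e : star x = (2 * x.re) • (1 : ℍ[ℚ,a,b]) - x := by ext <;> simp <;> ring
    rw [Matrix.trace_fin_two] at ht
    rw [e, map_sub, map_smul, map_one, Matrix.adjugate_fin_two]
    have h2 : ((2 * x.re : ℚ) • (1 : ℚ_[p])) = 2 * (x.re : ℚ_[p]) := by
      rw [Algebra.smul_def, mul_one]; simp
    ext i j
    fin_cases i <;> fin_cases j <;> simp [h2, ← ht]
  have h : ι x * ι (star x) = algebraMap ℚ _ (nrd x) := by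
    rw [← map_mul, mul_star_eq, AlgHom.commutes]
  rw [hs, Matrix.mul_adjugate, Algebra.algebraMap_eq_smul_one] at h
  have := congrFun (congrFun h 0) 0
  simp only [Matrix.smul_apply, Matrix.one_apply_eq, smul_eq_mul, mul_one] at this
  rw [this, Algebra.smul_def, mul_one]
  simp

/-- If `g` is integral with a unit entry, then the condition on an integral column `v` that
`g⁻¹ v` be integral amounts to one linear congruence. -/
lemma exists_linear_form {g : GL (Fin 2) ℚ_[p]} (h1 : ∀ i j, ‖g i j‖ ≤ 1)
    (h2 : ∃ i j, ‖g i j‖ = 1) : ∃ r₀ r₁ : ℤ_[p], ∀ v₀ v₁ : ℤ_[p],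
      ‖((r₀ * v₀ + r₁ * v₁ : ℤ_[p]) : ℚ_[p])‖ ≤ ‖g 0 0 * g 1 1 - g 0 1 * g 1 0‖ →
      ‖g 1 1 * v₀ - g 0 1 * v₁‖ ≤ ‖g 0 0 * g 1 1 - g 0 1 * g 1 0‖ ∧
      ‖g 0 0 * v₁ - g 1 0 * v₀‖ ≤ ‖g 0 0 * g 1 1 - g 0 1 * g 1 0‖ := by
  set D := g 0 0 * g 1 1 - g 0 1 * g 1 0 with hD
  -- The rows of the adjugate are dependent modulo `D`: for instance `d(a v₁ - c v₀) = D v₁ - c(d v₀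
  -- - b v₁)`. If one entry of a row is a unit, the congruence for that row implies the other one.
  have key : ∀ (e v y s t : ℚ_[p]), ‖e‖ = 1 → ‖v‖ ≤ 1 → ‖y‖ ≤ 1 → ‖s‖ ≤ ‖D‖ →
      e * t = D * v - y * s → ‖t‖ ≤ ‖D‖ := by
    intro e v y s t he hv hy hs h
    have : ‖e * t‖ ≤ ‖D‖ := by
      rw [h]
      refine (padic_norm_sub_le_max _ _).trans (max_le ?_ ?_)
      · rw [norm_mul]; exact mul_le_of_le_one_right (norm_nonneg _) hv
      · rw [norm_mul]; exact (mul_le_of_le_one_left (norm_nonneg _) hy).trans hs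
    rwa [norm_mul, he, one_mul] at this
  have row0 : (‖g 1 1‖ = 1 ∨ ‖g 0 1‖ = 1) → ∃ r₀ r₁ : ℤ_[p], ∀ v₀ v₁ : ℤ_[p],
      ‖((r₀ * v₀ + r₁ * v₁ : ℤ_[p]) : ℚ_[p])‖ ≤ ‖D‖ →
      ‖g 1 1 * v₀ - g 0 1 * v₁‖ ≤ ‖D‖ ∧ ‖g 0 0 * v₁ - g 1 0 * v₀‖ ≤ ‖D‖ := by
    intro hu
    refine ⟨⟨g 1 1, h1 1 1⟩, -⟨g 0 1, h1 0 1⟩, fun v₀ v₁ h => ?_⟩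
    have h : ‖g 1 1 * v₀ - g 0 1 * v₁‖ ≤ ‖D‖ := by
      refine le_of_eq_of_le (congrArg norm ?_) h
      change _ = g 1 1 * (v₀ : ℚ_[p]) + -g 0 1 * (v₁ : ℚ_[p])
      ring
    refine ⟨h, ?_⟩
    rcases hu with hu | hu
    · exact key _ v₁ (g 1 0) _ _ hu v₁.2 (h1 _ _) h (by rw [hD]; ring)
    · exact key _ v₀ (g 0 0) _ _ hu v₀.2 (h1 _ _) h (by rw [hD]; ring)
  have row1 : (‖g 0 0‖ = 1 ∨ ‖g 1 0‖ = 1) → ∃ r₀ r₁ : ℤ_[p], ∀ v₀ v₁ : ℤ_[p],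
      ‖((r₀ * v₀ + r₁ * v₁ : ℤ_[p]) : ℚ_[p])‖ ≤ ‖D‖ →
      ‖g 1 1 * v₀ - g 0 1 * v₁‖ ≤ ‖D‖ ∧ ‖g 0 0 * v₁ - g 1 0 * v₀‖ ≤ ‖D‖ := by
    intro hu
    refine ⟨-⟨g 1 0, h1 1 0⟩, ⟨g 0 0, h1 0 0⟩, fun v₀ v₁ h => ?_⟩
    have h : ‖g 0 0 * v₁ - g 1 0 * v₀‖ ≤ ‖D‖ := by
      refine le_of_eq_of_le (congrArg norm ?_) h
      change _ = -g 1 0 * (v₀ : ℚ_[p]) + g 0 0 * (v₁ : ℚ_[p])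
      ring
    refine ⟨?_, h⟩
    rcases hu with hu | hu
    · exact key _ v₀ (g 0 1) _ _ hu v₀.2 (h1 _ _) h (by rw [hD]; ring)
    · exact key _ v₁ (g 1 1) _ _ hu v₁.2 (h1 _ _) h (by rw [hD]; ring)
  obtain ⟨i, j, hij⟩ := h2
  fin_cases i <;> fin_cases j
  · exact row1 (Or.inl hij)
  · exact row0 (Or.inr hij)
  · exact row1 (Or.inr hij)
  · exact row0 (Or.inl hij)

/-- Divide by an entry of largest norm. -/
lemma exists_scalar_primitive (g : GL (Fin 2) ℚ_[p]) : ∃ u : ℚ_[p]ˣ,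
    (∀ i j, ‖(Matrix.GeneralLinearGroup.scalar (Fin 2) u * g) i j‖ ≤ 1) ∧
    ∃ i j, ‖(Matrix.GeneralLinearGroup.scalar (Fin 2) u * g) i j‖ = 1 := by
  obtain ⟨⟨i₀, j₀⟩, -, hmax⟩ := Finset.exists_max_image (Finset.univ : Finset (Fin 2 × Fin 2))
    (fun ij => ‖g ij.1 ij.2‖) ⟨(0, 0), Finset.mem_univ _⟩
  have hle : ∀ i j, ‖g i j‖ ≤ ‖g i₀ j₀‖ := fun i j => hmax (i, j) (Finset.mem_univ _)
  have h0 : g i₀ j₀ ≠ 0 := by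
    intro h0
    have hz : ∀ i j, g i j = 0 := fun i j => by
      have := hle i j
      rw [h0, norm_zero] at this
      exact norm_le_zero_iff.1 this
    apply det_entry_ne_zero g
    rw [hz, hz 0 1]; ring
  have e : ∀ i j, (Matrix.GeneralLinearGroup.scalar (Fin 2) (Units.mk0 _ (inv_ne_zero h0)) * g) i j
      = (g i₀ j₀)⁻¹ * g i j := by
    intro i j
    obtain ⟨u1, u2, u3, u4⟩ := scalar_entry (Units.mk0 _ (inv_ne_zero h0))
    rw [mul_entry]
    fin_cases i
    · simp only [Fin.zero_eta, u1, u2, Units.val_mk0, zero_mul, add_zero]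
    · simp only [Fin.mk_one, u3, u4, Units.val_mk0, zero_mul, zero_add]
  refine ⟨Units.mk0 _ (inv_ne_zero h0), fun i j => ?_, i₀, j₀, ?_⟩
  · rw [e, norm_mul, norm_inv, inv_mul_eq_div]
    exact div_le_one_of_le₀ (hle i j) (norm_nonneg _)
  · rw [e, inv_mul_cancel₀ h0, norm_one]

/-- A short element `x` of the order with `g⁻¹ ι(x)` integral, by the pigeonhole principle. -/
lemma exists_short {R : Subring ℍ[ℚ,a,b]} {ι : ℍ[ℚ,a,b] →ₐ[ℚ] Matrix (Fin 2) (Fin 2) ℚ_[p]}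
    (hι : IsSplitting R ι) {n : ℕ} (hn : ∀ c, (n : ℚ) • intQuat a b c ∈ R)
    {g : GL (Fin 2) ℚ_[p]} (h1 : ∀ i j, ‖g i j‖ ≤ 1) (h2 : ∃ i j, ‖g i j‖ = 1) {m : ℕ}
    (hm : ‖g 0 0 * g 1 1 - g 0 1 * g 1 0‖ = (p : ℝ) ^ (-(m : ℤ))) :
    ∃ c : Fin 4 → ℤ, c ≠ 0 ∧ (∀ i, c i ^ 2 ≤ (p : ℤ) ^ m) ∧
      ∀ i j, ‖(g⁻¹.1 * ι ((n : ℚ) • intQuat a b c)) i j‖ ≤ 1 := by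
  obtain ⟨r₀, r₁, hr⟩ := exists_linear_form h1 h2
  have hN : NeZero (p ^ m) := ⟨pow_ne_zero _ (Fact.out : p.Prime).ne_zero⟩
  let E : (Fin 4 → ℤ) → Fin 2 → Fin 2 → ℤ_[p] := fun c i j =>
    ⟨ι ((n : ℚ) • intQuat a b c) i j, norm_splitting_le hι (hn c) i j⟩
  have hE : ∀ c c' i j, E (c - c') i j = E c i j - E c' i j := by
    intro c c' i j
    apply Subtype.ext
    have : intQuat a b (c - c') = intQuat a b c - intQuat a b c' := by
      ext <;> simp [intQuat]
    change ι ((n : ℚ) • intQuat a b (c - c')) i j = ι _ i j - ι _ i j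
    rw [this, smul_sub, map_sub, Matrix.sub_apply]
  -- The box `[0, T]⁴` has `(T+1)⁴` points, more than the `p^{2m}` possible values of the two
  -- congruences, one for each column. The differences have squared coordinates at most `T² ≤ p^m`.
  set T := Nat.sqrt (p ^ m) with hT
  let F : (Fin 4 → Fin (T + 1)) → Fin 2 → ZMod (p ^ m) := fun c j =>
    PadicInt.toZModPow m (r₀ * E (fun i => (c i : ℕ)) 0 j + r₁ * E (fun i => (c i : ℕ)) 1 j)
  have hcard : Fintype.card (Fin 2 → ZMod (p ^ m)) < Fintype.card (Fin 4 → Fin (T + 1)) := by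
    simp only [Fintype.card_fun, ZMod.card, Fintype.card_fin]
    have : p ^ m < (T + 1) * (T + 1) := Nat.lt_succ_sqrt _
    calc (p ^ m) ^ 2 < ((T + 1) * (T + 1)) ^ 2 := Nat.pow_lt_pow_left this (by norm_num)
      _ = (T + 1) ^ 4 := by ring
  obtain ⟨c, c', hne, heq⟩ := Fintype.exists_ne_map_eq_of_card_lt F hcard
  set d : Fin 4 → ℤ := (fun i => ((c i : ℕ) : ℤ)) - fun i => ((c' i : ℕ) : ℤ) with hd
  refine ⟨d, ?_, fun i => ?_, ?_⟩
  · intro h0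
    apply hne
    funext i
    have := congrFun h0 i
    simp only [hd, Pi.sub_apply, Pi.zero_apply] at this
    exact Fin.ext (by omega)
  · have hT2 : (T : ℤ) * T ≤ (p : ℤ) ^ m := by exact_mod_cast Nat.sqrt_le (p ^ m)
    have b1 := (c i).2
    have b2 := (c' i).2
    have : |d i| ≤ T := by
      simp only [hd, Pi.sub_apply]
      rw [abs_le]
      constructor <;> omega
    calc d i ^ 2 = |d i| ^ 2 := (sq_abs _).symm
      _ ≤ (T : ℤ) ^ 2 := pow_le_pow_left₀ (abs_nonneg _) this 2
      _ ≤ _ := by rw [sq]; exact hT2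
  · have hcol : ∀ j, ‖g 1 1 * E d 0 j - g 0 1 * E d 1 j‖ ≤ ‖g 0 0 * g 1 1 - g 0 1 * g 1 0‖ ∧
        ‖g 0 0 * E d 1 j - g 1 0 * E d 0 j‖ ≤ ‖g 0 0 * g 1 1 - g 0 1 * g 1 0‖ := by
      intro j
      refine hr _ _ ?_
      rw [hm]
      have h0 : PadicInt.toZModPow m (r₀ * E d 0 j + r₁ * E d 1 j) = 0 := by
        have := congrFun heq j
        simp only [F] at this
        rw [← sub_eq_zero, ← map_sub] at this
        rw [← this, hd, hE, hE]
        congr 1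
        ring
      rw [← RingHom.mem_ker, PadicInt.ker_toZModPow] at h0
      exact (PadicInt.norm_le_pow_iff_mem_span_pow _ _).2 h0
    have hD0 := det_entry_ne_zero g
    have hDp := norm_pos_iff.2 hD0
    obtain ⟨e1, e2, e3, e4⟩ := inv_entry g
    rw [det_entry] at e1 e2 e3 e4
    intro i j
    rw [Matrix.mul_apply, Fin.sum_univ_two]
    change ‖g⁻¹ i 0 * E d 0 j + g⁻¹ i 1 * E d 1 j‖ ≤ 1
    obtain ⟨l1, l2⟩ := hcol j
    fin_cases i
    · simp only [Fin.zero_eta]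
      rw [e1, e2, show ∀ D x y z w : ℚ_[p], D⁻¹ * x * y + -(D⁻¹ * z) * w = (x * y - z * w) / D from
        fun _ _ _ _ _ => by ring, norm_div, div_le_one hDp]
      exact l1
    · simp only [Fin.mk_one]
      rw [e3, e4, show ∀ D x y z w : ℚ_[p], -(D⁻¹ * x) * y + D⁻¹ * z * w = (z * w - x * y) / D from
        fun _ _ _ _ _ => by ring, norm_div, div_le_one hDp]
      exact l2

lemma nrd_smul_intQuat (n : ℕ) (c : Fin 4 → ℤ) : nrd ((n : ℚ) • intQuat a b c) =
    n ^ 2 * ((c 0 : ℚ) ^ 2 - a * c 1 ^ 2 - b * c 2 ^ 2 + a * b * c 3 ^ 2) := by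
  simp [nrd, intQuat]; ring

/-- The denominators of `a` and `b` are the only ones occurring in the norm of an integral
quaternion. -/
lemma exists_int_nrd (n : ℕ) (c : Fin 4 → ℤ) : ∃ Z : ℤ,
    ((a.den * b.den : ℕ) : ℚ) * nrd ((n : ℚ) • intQuat a b c) = Z := by
  refine ⟨n ^ 2 * (a.den * b.den * c 0 ^ 2 - a.num * b.den * c 1 ^ 2 - a.den * b.num * c 2 ^ 2 +
    a.num * b.num * c 3 ^ 2), ?_⟩
  have h1 : (a.num : ℚ) = a * a.den := (Rat.mul_den_eq_num a).symm
  have h2 : (b.num : ℚ) = b * b.den := (Rat.mul_den_eq_num b).symm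
  rw [nrd_smul_intQuat]
  push_cast
  rw [h1, h2]
  ring

lemma norm_det_le_one {M : Matrix (Fin 2) (Fin 2) ℚ_[p]} (h : ∀ i j, ‖M i j‖ ≤ 1) :
    ‖M.det‖ ≤ 1 := by
  rw [Matrix.det_fin_two]
  refine (padic_norm_sub_le_max _ _).trans (max_le ?_ ?_) <;> rw [norm_mul] <;>
    exact mul_le_one₀ (h _ _) (norm_nonneg _) (h _ _)

lemma exists_norm_eq_pow {x : ℚ_[p]} (hx : x ≠ 0) (h : ‖x‖ ≤ 1) :
    ∃ m : ℕ, ‖x‖ = (p : ℝ) ^ (-(m : ℤ)) := by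
  have hp1 : (1 : ℝ) < p := by exact_mod_cast (Fact.out : p.Prime).one_lt
  rw [Padic.norm_eq_zpow_neg_valuation hx] at h ⊢
  rw [← zpow_zero (p : ℝ), zpow_le_zpow_iff_right₀ hp1] at h
  exact ⟨(Padic.valuation x).toNat, by rw [Int.toNat_of_nonneg (by omega)]⟩

/-- The numerator of the norm of an element of `g M₂(ℤ_p)` is divisible by `det g`. -/
lemma dvd_of_integral (ha : a < 0) (hb : b < 0)
    (ι : ℍ[ℚ,a,b] →ₐ[ℚ] Matrix (Fin 2) (Fin 2) ℚ_[p]) {g : GL (Fin 2) ℚ_[p]} {m D : ℕ}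
    (hm : ‖g.1.det‖ = (p : ℝ) ^ (-(m : ℤ))) {x : ℍ[ℚ,a,b]} {Z : ℤ} (hZ : (D : ℚ) * nrd x = Z)
    (h : ∀ i j, ‖(g⁻¹.1 * ι x) i j‖ ≤ 1) : ((p ^ m : ℕ) : ℤ) ∣ Z := by
  suffices h : ‖(Z : ℚ_[p])‖ ≤ (p : ℝ) ^ (-(m : ℤ)) by
    have := (Padic.norm_int_le_pow_iff_dvd Z m).1 h
    exact_mod_cast this
  have e : (Z : ℚ_[p]) = (D : ℚ_[p]) * (ι x).det := by
    rw [det_splitting ha hb]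
    exact_mod_cast congrArg (fun q : ℚ => (q : ℚ_[p])) hZ.symm
  have e2 : (ι x).det = g.1.det * (g⁻¹.1 * ι x).det := by
    rw [← Matrix.det_mul, ← Matrix.mul_assoc, ← Units.val_mul, mul_inv_cancel, Units.val_one,
      Matrix.one_mul]
  rw [e, e2, norm_mul, norm_mul, hm]
  calc ‖(D : ℚ_[p])‖ * ((p : ℝ) ^ (-(m : ℤ)) * ‖(g⁻¹.1 * ι x).det‖)
      ≤ 1 * ((p : ℝ) ^ (-(m : ℤ)) * 1) :=
        mul_le_mul (IsUltrametricDist.norm_natCast_le_one _ _)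
          (mul_le_mul_of_nonneg_left (norm_det_le_one h) (by positivity)) (by positivity) zero_le_one
    _ = _ := by ring

lemma intQuat_ne_zero {n : ℕ} (hn0 : 0 < n) {c : Fin 4 → ℤ} (hc : c ≠ 0) :
    (n : ℚ) • intQuat a b c ≠ 0 := by
  intro h0
  have h0 := (smul_eq_zero.1 h0).resolve_left (by exact_mod_cast hn0.ne')
  apply hc
  have e := QuaternionAlgebra.ext_iff.1 h0
  simp only [intQuat, QuaternionAlgebra.re_zero, QuaternionAlgebra.imI_zero,
    QuaternionAlgebra.imJ_zero, QuaternionAlgebra.imK_zero, Int.cast_eq_zero] at e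
  funext i
  fin_cases i
  exacts [e.1, e.2.1, e.2.2.1, e.2.2.2]

lemma nrd_le_of_sq_le (ha : a < 0) (hb : b < 0) (n : ℕ) {c : Fin 4 → ℤ} {T : ℕ}
    (hc : ∀ i, c i ^ 2 ≤ (T : ℤ)) :
    nrd ((n : ℚ) • intQuat a b c) ≤ n ^ 2 * (T * (1 - a - b + a * b)) := by
  have hab : 0 < a * b := mul_pos_of_neg_of_neg ha hb
  have hcb' : ∀ i, (c i : ℚ) ^ 2 ≤ T := fun i => by exact_mod_cast hc i
  have t1 := mul_le_mul_of_nonneg_left (hcb' 1) (neg_pos.2 ha).le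
  have t2 := mul_le_mul_of_nonneg_left (hcb' 2) (neg_pos.2 hb).le
  have t3 := mul_le_mul_of_nonneg_left (hcb' 3) hab.le
  have t0 := hcb' 0
  rw [nrd_smul_intQuat]
  refine mul_le_mul_of_nonneg_left ?_ (sq_nonneg _)
  linarith

/-- The short element has norm of size at most a constant times `p^m`, yet its numerator is
divisible by `p^m = |det|⁻¹` because it is `g` times an integral matrix. The cofactor `A` is
therefore bounded independently of `g`. -/
lemma exists_data (ha : a < 0) (hb : b < 0) {R : Subring ℍ[ℚ,a,b]}
    {ι : ℍ[ℚ,a,b] →ₐ[ℚ] Matrix (Fin 2) (Fin 2) ℚ_[p]}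
    (hι : IsSplitting R ι) {n : ℕ} (hn0 : 0 < n) (hn : ∀ c, (n : ℚ) • intQuat a b c ∈ R) :
    ∃ B : ℕ, ∀ g : GL (Fin 2) ℚ_[p], ∃ (u : ℚ_[p]ˣ) (m A : ℕ) (c : Fin 4 → ℤ), 0 < A ∧ A ≤ B ∧
      ((a.den * b.den : ℕ) : ℚ) * nrd ((n : ℚ) • intQuat a b c) = p ^ m * A ∧
      (∀ i j, ‖((Matrix.GeneralLinearGroup.scalar (Fin 2) u * g)⁻¹.1 *
        ι ((n : ℚ) • intQuat a b c)) i j‖ ≤ 1) ∧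
      ‖(Matrix.GeneralLinearGroup.scalar (Fin 2) u * g).1.det‖ = (p : ℝ) ^ (-(m : ℤ)) := by
  have hp0 : (0 : ℚ) < p := by exact_mod_cast (Fact.out : p.Prime).pos
  refine ⟨⌈((a.den * b.den : ℕ) : ℚ) * n ^ 2 * (1 - a - b + a * b)⌉₊, fun g => ?_⟩
  obtain ⟨u, h1, h2⟩ := exists_scalar_primitive g
  obtain ⟨m, hm⟩ := exists_norm_eq_pow (det_val_ne_zero _) (norm_det_le_one h1)
  obtain ⟨c, hc0, hcb, hci⟩ := exists_short hι hn h1 h2 (by rw [← det_entry]; exact hm)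
  obtain ⟨Z, hZ⟩ := exists_int_nrd (a := a) (b := b) n c
  have hpos := nrd_pos ha hb (intQuat_ne_zero (a := a) (b := b) hn0 hc0)
  have hle := nrd_le_of_sq_le ha hb n (c := c) (T := p ^ m) (by exact_mod_cast hcb)
  obtain ⟨A, hA⟩ := dvd_of_integral ha hb ι hm hZ hci
  have hD : 0 < a.den * b.den := Nat.mul_pos a.den_pos b.den_pos
  suffices H : 0 < A.toNat ∧ A.toNat ≤ ⌈((a.den * b.den : ℕ) : ℚ) * n ^ 2 * (1 - a - b + a * b)⌉₊ ∧
      ((a.den * b.den : ℕ) : ℚ) * nrd ((n : ℚ) • intQuat a b c) = p ^ m * A.toNat from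
    ⟨u, m, A.toNat, c, H.1, H.2.1, H.2.2, hci, hm⟩
  clear hm hci h1 h2
  generalize a.den * b.den = D at *
  generalize nrd ((n : ℚ) • intQuat a b c) = ν at *
  have hD' : (0 : ℚ) < D := by exact_mod_cast hD
  have hZpos : 0 < Z := by
    have : (0 : ℚ) < Z := by rw [← hZ]; positivity
    exact_mod_cast this
  have hppos : (0 : ℤ) < ((p ^ m : ℕ) : ℤ) := by
    exact_mod_cast pow_pos (Fact.out : p.Prime).pos m
  have hApos : 0 < A := by
    rw [hA] at hZpos
    exact pos_of_mul_pos_right hZpos hppos.le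
  have hAcast : ((A.toNat : ℕ) : ℚ) = A := by exact_mod_cast Int.toNat_of_nonneg hApos.le
  have hAZ : (D : ℚ) * ν = p ^ m * A.toNat := by
    rw [hZ, hA, hAcast]
    push_cast
    ring
  refine ⟨by omega, ?_, hAZ⟩
  have : (A.toNat : ℚ) ≤ (D : ℚ) * n ^ 2 * (1 - a - b + a * b) := by
    have hpm : (0 : ℚ) < (p : ℚ) ^ m := pow_pos hp0 m
    refine le_of_mul_le_mul_left ?_ hpm
    rw [← hAZ]
    refine (mul_le_mul_of_nonneg_left hle hD'.le).trans_eq ?_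
    push_cast
    ring
  exact_mod_cast this.trans (Nat.le_ceil _)

/-- Write `x = x' + N y` with `y` in the order. Then `x x'⁻¹ = 1 + N y x̄' / nrd x'`, and since `nrd
x' = p^m A / D` with `A ∣ N`, only a power of `p` remains in the denominator. -/
lemma smul_mul_star_mem {R : Subring ℍ[ℚ,a,b]} {n : ℕ} (hn : ∀ c, (n : ℚ) • intQuat a b c ∈ R)
    {D m A N : ℕ} (hA0 : 0 < A) {c c' d : Fin 4 → ℤ} (hp0 : (p : ℚ) ≠ 0) (hD0 : (D : ℚ) ≠ 0)
    (hA : (D : ℚ) * nrd ((n : ℚ) • intQuat a b c') = p ^ m * A)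
    (hN : A ∣ N) (hd : ∀ i, c i - c' i = N * d i) :
    (p : ℚ) ^ m • ((nrd ((n : ℚ) • intQuat a b c'))⁻¹ •
      ((n : ℚ) • intQuat a b c * star ((n : ℚ) • intQuat a b c'))) ∈ R := by
  obtain ⟨t, rfl⟩ := hN
  set x' := (n : ℚ) • intQuat a b c' with hx'
  have hA0' : (A : ℚ) ≠ 0 := by exact_mod_cast hA0.ne'
  have hq : nrd x' ≠ 0 := by
    intro h0
    rw [h0, mul_zero] at hA
    exact mul_ne_zero (pow_ne_zero _ hp0) hA0' hA.symm
  have hstar : star x' ∈ R := by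
    have e : star x' = (n : ℚ) • intQuat a b ![c' 0, -c' 1, -c' 2, -c' 3] := by
      ext <;> simp [hx', intQuat]
    rw [e]
    exact hn _
  have hsplit : (n : ℚ) • intQuat a b c = x' + ((A * t : ℕ) : ℚ) • ((n : ℚ) • intQuat a b d) := by
    have hd' : ∀ i, (c i : ℚ) = c' i + (A * t : ℕ) * d i := fun i => by
      have := hd i
      have h2 : c i = c' i + (A * t : ℕ) * d i := by linarith
      exact_mod_cast h2
    ext <;> simp [hx', intQuat, hd'] <;> ring
  have e : (p : ℚ) ^ m • ((nrd x')⁻¹ • ((n : ℚ) • intQuat a b c * star x')) =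
      (p ^ m) • (1 : ℍ[ℚ,a,b]) + (D * t) • (((n : ℚ) • intQuat a b d) * star x') := by
    rw [hsplit, add_mul, mul_star_eq, smul_mul_assoc, Algebra.algebraMap_eq_smul_one, smul_add,
      smul_smul, smul_add, smul_smul, smul_smul, smul_smul, inv_mul_cancel₀ hq, mul_one,
      ← Nat.cast_smul_eq_nsmul ℚ, ← Nat.cast_smul_eq_nsmul ℚ]
    push_cast
    congr 2
    have : (p : ℚ) ^ m = D * nrd x' / A := by rw [hA]; field_simp
    rw [this]
    field_simp
  rw [e]
  exact R.add_mem (R.nsmul_mem R.one_mem _) (R.nsmul_mem (R.mul_mem (hn _) hstar) _)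

/-- A product of elements of the order that are congruent gives an element of `Γ`. -/
lemma exists_mem_Gam {R : Subring ℍ[ℚ,a,b]} {ι : ℍ[ℚ,a,b] →ₐ[ℚ] Matrix (Fin 2) (Fin 2) ℚ_[p]}
    {n : ℕ} (hn : ∀ c, (n : ℚ) • intQuat a b c ∈ R)
    {D m m' A N : ℕ} (hA0 : 0 < A) {c c' d : Fin 4 → ℤ} (hD0 : (D : ℚ) ≠ 0)
    (hA : (D : ℚ) * nrd ((n : ℚ) • intQuat a b c) = p ^ m * A)
    (hA' : (D : ℚ) * nrd ((n : ℚ) • intQuat a b c') = p ^ m' * A)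
    (hN : A ∣ N) (hd : ∀ i, c i - c' i = N * d i) {s : ℤ} (hs : (m : ℤ) - m' = 2 * s) :
    ∃ γ ∈ Gam R ι, (p : ℚ_[p]) ^ s • (γ.1 * ι ((n : ℚ) • intQuat a b c')) =
      ι ((n : ℚ) • intQuat a b c) := by
  have hp0 : (p : ℚ) ≠ 0 := by exact_mod_cast (Fact.out : p.Prime).ne_zero
  have m1 := smul_mul_star_mem hn hA0 hp0 hD0 hA' hN hd
  have m2 := smul_mul_star_mem hn hA0 hp0 hD0 hA hN (c := c') (c' := c) (d := -d) (fun i => by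
    have := hd i
    simp only [Pi.neg_apply]
    linarith)
  have hA0' : (A : ℚ) ≠ 0 := by exact_mod_cast hA0.ne'
  set x := (n : ℚ) • intQuat a b c
  set x' := (n : ℚ) • intQuat a b c'
  have hqne : ∀ {q : ℚ} {l : ℕ}, (D : ℚ) * q = p ^ l * A → q ≠ 0 := by
    rintro q l h rfl
    rw [mul_zero] at h
    exact mul_ne_zero (pow_ne_zero _ hp0) hA0' h.symm
  have hq := hqne hA
  have hq' := hqne hA'
  -- The cofactors `A` agree, so the norms differ by an even power of `p`, which the scalar `p ^
  -- (-s)` can absorb.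
  have hratio : nrd x = (p : ℚ) ^ (2 * s) * nrd x' := by
    have h1 : (p : ℚ) ^ (2 * s) = p ^ m / p ^ m' := by
      rw [← hs, zpow_sub₀ hp0, zpow_natCast, zpow_natCast]
    have hpm' : (p : ℚ) ^ m' ≠ 0 := pow_ne_zero _ hp0
    refine mul_left_cancel₀ hD0 ?_
    rw [h1, mul_left_comm, hA, hA']
    field_simp
  have mem_of : ∀ (l : ℕ) (t : ℤ) (z : ℍ[ℚ,a,b]), (p : ℚ) ^ l • z ∈ R →
      (p : ℚ) ^ t • z ∈ invertP p R := by
    intro l t z hz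
    refine ⟨l + t.natAbs, ?_⟩
    have e : (p : ℚ) ^ (l + t.natAbs) • (p : ℚ) ^ t • z =
        (p ^ (t.natAbs + t).toNat) • ((p : ℚ) ^ l • z) := by
      rw [← Nat.cast_smul_eq_nsmul ℚ, smul_smul, smul_smul]
      congr 1
      push_cast
      rw [← zpow_natCast, ← zpow_natCast, ← zpow_natCast, ← zpow_add₀ hp0, ← zpow_add₀ hp0]
      congr 1
      have : 0 ≤ (t.natAbs : ℤ) + t := by omega
      push_cast
      rw [Int.toNat_of_nonneg (by simpa using this)]
      ring
    rw [e]
    exact R.nsmul_mem hz _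
  -- This is `p^{-s} x x'⁻¹`, of norm one; `y'` is its inverse, and both lie in `R[1/p]` by the
  -- congruence between `x` and `x'`.
  set y : ℍ[ℚ,a,b] := (p : ℚ) ^ (-s) • ((nrd x')⁻¹ • (x * star x')) with hy
  set y' : ℍ[ℚ,a,b] := (p : ℚ) ^ s • ((nrd x)⁻¹ • (x' * star x)) with hy'
  have hyy' : y * y' = 1 := by
    rw [hy, hy', smul_mul_smul_comm, smul_mul_smul_comm, show x * star x' * (x' * star x) =
      x * (star x' * x') * star x by noncomm_ring, star_mul_eq, ← Algebra.commutes, mul_assoc,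
      mul_star_eq, ← map_mul, Algebra.algebraMap_eq_smul_one, smul_smul, smul_smul]
    rw [← zpow_add₀ hp0, neg_add_cancel, zpow_zero, one_mul, mul_mul_mul_comm,
      inv_mul_cancel₀ hq', inv_mul_cancel₀ hq, one_mul, one_smul]
  have hyy : y' * y = 1 := by
    rw [hy, hy', smul_mul_smul_comm, smul_mul_smul_comm, show x' * star x * (x * star x') =
      x' * (star x * x) * star x' by noncomm_ring, star_mul_eq, ← Algebra.commutes, mul_assoc,
      mul_star_eq, ← map_mul, Algebra.algebraMap_eq_smul_one, smul_smul, smul_smul]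
    rw [← zpow_add₀ hp0, add_neg_cancel, zpow_zero, one_mul, mul_mul_mul_comm,
      inv_mul_cancel₀ hq', inv_mul_cancel₀ hq, one_mul, one_smul]
  have hnorm : y * star y = 1 := by
    have e : star y = (p : ℚ) ^ (-s) • ((nrd x')⁻¹ • (x' * star x)) := by
      rw [hy, QuaternionAlgebra.star_smul, QuaternionAlgebra.star_smul, star_mul, star_star]
    rw [e, hy, smul_mul_smul_comm, smul_mul_smul_comm, show x * star x' * (x' * star x) =
      x * (star x' * x') * star x by noncomm_ring, star_mul_eq, ← Algebra.commutes, mul_assoc,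
      mul_star_eq, ← map_mul, Algebra.algebraMap_eq_smul_one, smul_smul, smul_smul]
    rw [hratio, ← zpow_add₀ hp0]
    have : (p : ℚ) ^ (-s + -s) * ((nrd x')⁻¹ * (nrd x')⁻¹ * (nrd x' * ((p : ℚ) ^ (2 * s) * nrd x')))
        = 1 := by
      have h2 : (p : ℚ) ^ (-s + -s) * (p : ℚ) ^ (2 * s) = 1 := by
        rw [← zpow_add₀ hp0, show -s + -s + 2 * s = 0 by ring, zpow_zero]
      calc _ = ((p : ℚ) ^ (-s + -s) * (p : ℚ) ^ (2 * s)) *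
            (((nrd x')⁻¹ * nrd x') * ((nrd x')⁻¹ * nrd x')) := by ring
        _ = 1 := by rw [h2, inv_mul_cancel₀ hq']; norm_num
    rw [mul_assoc, this, one_smul]
  let U : (invertP p R)ˣ := ⟨⟨y, mem_of m' _ _ m1⟩, ⟨y', mem_of m _ _ m2⟩, Subtype.ext hyy',
    Subtype.ext hyy⟩
  refine ⟨_, Subgroup.mem_map.2 ⟨U, hnorm, rfl⟩, ?_⟩
  change (p : ℚ_[p]) ^ s • (ι y * ι x') = ι x
  rw [← map_mul]
  have e : y * x' = (p : ℚ) ^ (-s) • x := by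
    rw [hy, smul_mul_assoc, smul_mul_assoc, mul_assoc, star_mul_eq, ← Algebra.commutes,
      Algebra.algebraMap_eq_smul_one, smul_mul_assoc, one_mul, smul_smul (nrd x')⁻¹,
      inv_mul_cancel₀ hq', one_smul]
  rw [e, map_smul]
  ext i j
  change (p : ℚ_[p]) ^ s * (((p : ℚ) ^ (-s)) • (ι x i j)) = ι x i j
  rw [Algebra.smul_def, ← mul_assoc, eq_ratCast]
  push_cast
  rw [← zpow_add₀ coe_p_ne_zero, add_neg_cancel, zpow_zero, one_mul]

lemma scalar_mul_entry (u : ℚ_[p]ˣ) (g : GL (Fin 2) ℚ_[p]) (i j : Fin 2) :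
    (Matrix.GeneralLinearGroup.scalar (Fin 2) u * g) i j = u * g i j := by
  obtain ⟨u1, u2, u3, u4⟩ := scalar_entry u
  rw [mul_entry]
  fin_cases i
  · simp only [Fin.zero_eta, u1, u2, zero_mul, add_zero]
  · simp only [Fin.mk_one, u3, u4, zero_mul, zero_add]

/-- The group identity behind the finiteness proof: if `X` and `X'` differ by `sγ`, then the
quotient of the integral parts `(tg)⁻¹X` and `(t'g')⁻¹X'` moves `g` to a translate of `g'`, scalars
being central. -/
lemma mul_quotient_eq {G : Type*} [Group G] {s t t' γ X X' g g' : G}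
    (ht' : ∀ z, z * t' = t' * z) (hX : X = s * γ * X') :
    g * (((t * g)⁻¹ * X) * ((t' * g')⁻¹ * X')⁻¹) = t⁻¹ * s * t' * γ * g' := by
  rw [mul_assoc (t⁻¹ * s) t' γ, ← ht' γ, hX]
  group

/-- The principal congruence subgroup of level `p` lies in `Γ₀(pℤ_p)`. -/
lemma mem_Gamma0_of_sub_one {σ : GL (Fin 2) ℚ_[p]}
    (h : ∀ i j, ‖σ i j - (1 : Matrix (Fin 2) (Fin 2) ℚ_[p]) i j‖ < 1) : σ ∈ Gamma0 p := by
  have h00 : ‖σ 0 0 - 1‖ < 1 := by simpa using h 0 0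
  have h01 : ‖σ 0 1‖ < 1 := by simpa using h 0 1
  have h10 : ‖σ 1 0‖ < 1 := by simpa using h 1 0
  have h11 : ‖σ 1 1 - 1‖ < 1 := by simpa using h 1 1
  have key : ∀ {x : ℚ_[p]}, ‖x - 1‖ < 1 → ‖x‖ = 1 := by
    intro x hx
    rw [show x = (x - 1) + 1 by ring, IsUltrametricDist.norm_add_eq_max_of_norm_ne_norm (by
      rw [norm_one]; exact hx.ne), norm_one, max_eq_right hx.le]
  refine mem_Gamma0.2 ⟨fun i j => ?_, h10, key ?_⟩
  · fin_cases i <;> fin_cases j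
    exacts [(key h00).le, h01.le, h10.le, (key h11).le]
  · have e : σ 0 0 * σ 1 1 - σ 0 1 * σ 1 0 - 1 =
        (σ 0 0 * (σ 1 1 - 1) + (σ 0 0 - 1)) - σ 0 1 * σ 1 0 := by ring
    rw [e]
    refine (padic_norm_sub_le_max _ _).trans_lt (max_lt ?_ ?_)
    · refine (IsUltrametricDist.norm_add_le_max _ _).trans_lt (max_lt ?_ h00)
      rw [norm_mul, key h00, one_mul]; exact h11
    · rw [norm_mul]
      exact mul_lt_one_of_nonneg_of_lt_one_left (norm_nonneg _) h01 h10.le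

/-- The set `Γ \ GL₂(ℚ_p) / ℚ_pˣ Γ₀(p)` is finite. -/
theorem exists_finite_invariant (ha : a < 0) (hb : b < 0) {R : Subring ℍ[ℚ,a,b]} (hR : IsOrder R)
    {ι : ℍ[ℚ,a,b] →ₐ[ℚ] Matrix (Fin 2) (Fin 2) ℚ_[p]} (hι : IsSplitting R ι) :
    ∃ (X : Type) (_ : Finite X) (inv : GL (Fin 2) ℚ_[p] → X), ∀ g g', inv g = inv g' →
      ∃ u : ℚ_[p]ˣ, ∃ γ ∈ Gam R ι, ∃ σ ∈ Gamma0 p,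
        g * σ = Matrix.GeneralLinearGroup.scalar (Fin 2) u * γ * g' := by
  obtain ⟨n, hn0, hn⟩ := exists_smul_intQuat_mem hR.2
  obtain ⟨B, hB⟩ := exists_data ha hb hι hn0 hn
  choose u m A c hA0 hAB hA hint hdet using hB
  -- Every cofactor `A g ≤ B` divides `B!`, so one modulus serves for all `g`.
  set N := B.factorial with hN
  have hNpos : 0 < N := Nat.factorial_pos B
  have hN0 : NeZero N := ⟨hNpos.ne'⟩
  have hNp : (N : ℚ_[p]) ≠ 0 := by exact_mod_cast hNpos.ne'
  have hp0 : (0 : ℝ) < p := by exact_mod_cast (Fact.out : p.Prime).pos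
  have hp1 : (1 : ℝ) < p := by exact_mod_cast (Fact.out : p.Prime).one_lt
  obtain ⟨e, he⟩ : ∃ e : ℕ, (p : ℝ) ^ (-(e : ℤ)) < ‖(N : ℚ_[p])‖ := by
    obtain ⟨e, he⟩ := exists_pow_lt_of_lt_one (norm_pos_iff.2 hNp) (inv_lt_one_of_one_lt₀ hp1)
    exact ⟨e, by rwa [zpow_neg, zpow_natCast, ← inv_pow]⟩
  have hpe : NeZero (p ^ e) := ⟨pow_ne_zero _ (Fact.out : p.Prime).ne_zero⟩
  let H : GL (Fin 2) ℚ_[p] → Fin 2 → Fin 2 → ℤ_[p] := fun g i j => ⟨_, hint g i j⟩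
  -- The invariant records the parity of `m`, the cofactor, the coordinates of the short element
  -- modulo `N`, and its integral part `g⁻¹ι(x)` modulo `p^e`. The first three produce an element of
  -- `Γ`, the last one an element of `Γ₀(pℤ_p)`.
  refine ⟨ZMod 2 × Fin (B + 1) × (Fin 4 → ZMod N) × (Fin 2 → Fin 2 → ZMod (p ^ e)), inferInstance,
    fun g => (m g, ⟨A g, Nat.lt_succ_of_le (hAB g)⟩, fun i => c g i,
      fun i j => PadicInt.toZModPow e (H g i j)), fun g g' hgg' => ?_⟩
  simp only [Prod.mk.injEq, Fin.mk.injEq] at hgg'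
  obtain ⟨hm, hAA, hcc, hHH⟩ := hgg'
  have hD0 : ((a.den * b.den : ℕ) : ℚ) ≠ 0 := by
    exact_mod_cast (Nat.mul_pos a.den_pos b.den_pos).ne'
  have hd : ∀ i, ∃ d : ℤ, c g i - c g' i = N * d := fun i => by
    have := congrFun hcc i
    rw [ZMod.intCast_eq_intCast_iff_dvd_sub] at this
    obtain ⟨d, hd⟩ := this
    exact ⟨-d, by rw [mul_neg, ← hd]; ring⟩
  choose d hd using hd
  obtain ⟨s, hs⟩ : ∃ s : ℤ, (m g : ℤ) - m g' = 2 * s := by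
    have : (((m g : ℤ)) : ZMod 2) = ((m g' : ℤ) : ZMod 2) := by exact_mod_cast hm
    rw [ZMod.intCast_eq_intCast_iff_dvd_sub] at this
    obtain ⟨t, ht⟩ := this
    push_cast at ht
    exact ⟨-t, by linarith⟩
  obtain ⟨γ, hγ, hγx⟩ := exists_mem_Gam (ι := ι) hn (hA0 g') (m := m g) hD0
    (by rw [hA g, hAA]) (hA g') (Nat.dvd_factorial (hA0 g') (hAB g')) hd hs
  set x := (n : ℚ) • intQuat a b (c g)
  set x' := (n : ℚ) • intQuat a b (c g')
  have hxdet : ∀ g, (ι ((n : ℚ) • intQuat a b (c g))).det ≠ 0 := by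
    intro g
    rw [det_splitting ha hb]
    have : nrd ((n : ℚ) • intQuat a b (c g)) ≠ 0 := by
      intro h0
      have := hA g
      rw [h0, mul_zero] at this
      have h1 : (p : ℚ) ^ m g ≠ 0 := pow_ne_zero _ (by exact_mod_cast (Fact.out : p.Prime).ne_zero)
      have h2 : (A g : ℚ) ≠ 0 := by exact_mod_cast (hA0 g).ne'
      exact mul_ne_zero h1 h2 this.symm
    exact_mod_cast this
  set X := Matrix.GeneralLinearGroup.mkOfDetNeZero _ (hxdet g)
  set X' := Matrix.GeneralLinearGroup.mkOfDetNeZero _ (hxdet g')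
  set g₁ := Matrix.GeneralLinearGroup.scalar (Fin 2) (u g) * g with hg₁
  set g₁' := Matrix.GeneralLinearGroup.scalar (Fin 2) (u g') * g' with hg₁'
  have hX : X = Matrix.GeneralLinearGroup.scalar (Fin 2) (pUnit ^ s) * γ * X' := by
    have h : ∀ i j, (p : ℚ_[p]) ^ s * (γ * X') i j = X i j := fun i j =>
      congrFun (congrFun hγx i) j
    refine Units.ext (Matrix.ext fun i j => ?_)
    rw [mul_assoc, scalar_mul_entry, Units.val_zpow_eq_zpow_val, ← h i j]
    rfl
  -- Cancelling `p^m` in `D · nrd x' = p^m A` leaves `|D| |det| = |A|`, and `A` divides `N`.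
  have hHdet : ‖(g₁'⁻¹ * X').1.det‖ ≥ ‖(N : ℚ_[p])‖ := by
    have e1 : X'.1.det = g₁'.1.det * (g₁'⁻¹ * X').1.det := by
      rw [← Matrix.det_mul, ← Units.val_mul, mul_inv_cancel_left]
    have e2 : X'.1.det = (nrd x' : ℚ_[p]) := det_splitting ha hb ι x'
    have e3 : ((a.den * b.den : ℕ) : ℚ_[p]) * (nrd x' : ℚ_[p]) = (p : ℚ_[p]) ^ m g' * A g' := by
      exact_mod_cast congrArg (fun q : ℚ => (q : ℚ_[p])) (hA g')
    have e4 := congrArg norm e3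
    rw [← e2, e1, norm_mul, norm_mul, norm_mul, hdet g', norm_pow, Padic.norm_p, inv_pow,
      zpow_neg, zpow_natCast] at e4
    have hpm : (0 : ℝ) < ((p : ℝ) ^ m g')⁻¹ := by positivity
    have e5 : ‖((a.den * b.den : ℕ) : ℚ_[p])‖ * ‖(g₁'⁻¹ * X').1.det‖ = ‖(A g' : ℚ_[p])‖ := by
      refine mul_left_cancel₀ hpm.ne' ?_
      rw [← e4]; ring
    have e6 : ‖(N : ℚ_[p])‖ ≤ ‖(A g' : ℚ_[p])‖ := by
      obtain ⟨t, ht⟩ := Nat.dvd_factorial (hA0 g') (hAB g')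
      rw [hN, ht]
      push_cast
      rw [norm_mul]
      exact mul_le_of_le_one_right (norm_nonneg _) (IsUltrametricDist.norm_natCast_le_one _ _)
    refine e6.trans ?_
    rw [← e5]
    exact mul_le_of_le_one_left (norm_nonneg _) (IsUltrametricDist.norm_natCast_le_one _ _)
  have hsub : ∀ i j, ‖(g₁⁻¹ * X) i j - (g₁'⁻¹ * X') i j‖ < ‖(N : ℚ_[p])‖ := by
    intro i j
    have h0 := congrFun (congrFun hHH i) j
    rw [← sub_eq_zero, ← map_sub, ← RingHom.mem_ker, PadicInt.ker_toZModPow] at h0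
    exact ((PadicInt.norm_le_pow_iff_mem_span_pow _ _).2 h0).trans_lt he
  -- With `Y`, `Z` the two integral parts, `ZY⁻¹ - 1 = (Z - Y)Y⁻¹`. Here `Y⁻¹` has entries of norm
  -- at most `|N|⁻¹` and `Z - Y` has entries of norm less than `|N|`.
  have hσ : (g₁⁻¹ * X) * (g₁'⁻¹ * X')⁻¹ ∈ Gamma0 p := by
    refine mem_Gamma0_of_sub_one fun i j => ?_
    have hint' : ∀ i j, ‖(g₁'⁻¹ * X') i j‖ ≤ 1 := fun i j => hint g' i j
    set Y := g₁'⁻¹ * X'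
    set Z := g₁⁻¹ * X
    obtain ⟨i1, i2, i3, i4⟩ := inv_entry Y
    have hNpos' : 0 < ‖(N : ℚ_[p])‖ := norm_pos_iff.2 hNp
    have hinv : ∀ i j, ‖Y⁻¹ i j‖ ≤ ‖(N : ℚ_[p])‖⁻¹ := by
      have hd1 : ‖Y.1.det⁻¹‖ ≤ ‖(N : ℚ_[p])‖⁻¹ := by
        rw [norm_inv]; exact inv_anti₀ hNpos' hHdet
      have : ∀ i j, ‖Y.1.det⁻¹ * Y i j‖ ≤ ‖(N : ℚ_[p])‖⁻¹ := fun i j => by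
        rw [norm_mul]
        exact (mul_le_of_le_one_right (norm_nonneg _) (hint' i j)).trans hd1
      intro i j
      fin_cases i <;> fin_cases j <;> simp only [Fin.zero_eta, Fin.mk_one, i1, i2, i3, i4,
        norm_neg] <;> exact this _ _
    have hone : (1 : Matrix (Fin 2) (Fin 2) ℚ_[p]) i j = (Y * Y⁻¹) i j := by
      rw [mul_inv_cancel]; rfl
    rw [hone, mul_entry Z, mul_entry Y, show ∀ a b c d e f : ℚ_[p], a * b + c * d - (e * b + f * d) =
      (a - e) * b + (c - f) * d from fun _ _ _ _ _ _ => by ring]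
    have : ∀ t, ‖(Z i t - Y i t) * Y⁻¹ t j‖ < 1 := fun t => by
      rw [norm_mul]
      calc ‖Z i t - Y i t‖ * ‖Y⁻¹ t j‖ ≤ ‖Z i t - Y i t‖ * ‖(N : ℚ_[p])‖⁻¹ := by
            gcongr; exact hinv t j
        _ < ‖(N : ℚ_[p])‖ * ‖(N : ℚ_[p])‖⁻¹ :=
            mul_lt_mul_of_pos_right (hsub i t) (inv_pos.2 hNpos')
        _ = 1 := mul_inv_cancel₀ hNpos'.ne'
    exact (IsUltrametricDist.norm_add_le_max _ _).trans_lt (max_lt (this 0) (this 1))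
  refine ⟨(u g)⁻¹ * (pUnit ^ s) * u g', γ, hγ, _, hσ, ?_⟩
  rw [map_mul, map_mul, map_inv]
  exact mul_quotient_eq (fun z => (scalar_comm _ z).symm) hX

end Finiteness

/-! ### The tree -/

lemma mulVec_entry (M : Matrix (Fin 2) (Fin 2) ℚ_[p]) (w : Fin 2 → ℚ_[p]) (i : Fin 2) :
    M.mulVec w i = M i 0 * w 0 + M i 1 * w 1 := by
  simp [Matrix.mulVec, dotProduct, Fin.sum_univ_two]

lemma mem_smul_stdLat (g : GL (Fin 2) ℚ_[p]) (v : Fin 2 → ℚ_[p]) :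
    v ∈ (g • stdLat p).1 ↔ ∀ i, ‖(g⁻¹.1.mulVec v) i‖ ≤ 1 := by
  rw [Lat.mem_smul]
  constructor
  · rintro ⟨w, hw, rfl⟩
    rw [Matrix.mulVec_mulVec, ← Units.val_mul, inv_mul_cancel, Units.val_one, Matrix.one_mulVec]
    exact (mem_stdLat w).1 hw
  · intro h
    refine ⟨_, (mem_stdLat _).2 h, ?_⟩
    rw [Matrix.mulVec_mulVec, ← Units.val_mul, mul_inv_cancel, Units.val_one, Matrix.one_mulVec]

lemma integral_of_smul_stdLat_le {g : GL (Fin 2) ℚ_[p]} (h : (g • stdLat p).1 ≤ (stdLat p).1)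
    (i j : Fin 2) : ‖g i j‖ ≤ 1 := by
  have h1 := (mem_stdLat _).1 (h ((Lat.mem_smul g (stdLat p) _).2 ⟨Pi.single j 1,
    (mem_stdLat _).2 fun i => by
      by_cases hij : i = j
      · subst hij; simp
      · simp [hij], rfl⟩)) i
  rwa [Matrix.mulVec_single_one] at h1

/-- The stabilizer of the standard lattice is `GL₂(ℤ_p)`, stated by norms to match `mem_Gamma0`. -/
lemma smul_stdLat_eq_iff {g : GL (Fin 2) ℚ_[p]} : g • stdLat p = stdLat p ↔
    (∀ i j, ‖g i j‖ ≤ 1) ∧ ‖g.1.det‖ = 1 := by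
  constructor
  · intro h
    have h1 := integral_of_smul_stdLat_le (g := g) (by rw [h])
    have h' : g⁻¹ • stdLat p = stdLat p := by
      conv_lhs => rw [← h]
      rw [inv_smul_smul]
    have h2 := integral_of_smul_stdLat_le (g := g⁻¹) (by rw [h'])
    refine ⟨h1, le_antisymm (norm_det_le_one h1) ?_⟩
    have h3 : ‖g.1.det‖ * ‖g⁻¹.1.det‖ = 1 := by
      rw [← norm_mul, ← Matrix.det_mul, ← Units.val_mul, mul_inv_cancel, Units.val_one,
        Matrix.det_one, norm_one]
    have h4 := norm_det_le_one (M := g⁻¹.1) h2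
    nlinarith [norm_nonneg g.1.det]
  · rintro ⟨h1, h2⟩
    have key : ∀ g : GL (Fin 2) ℚ_[p], (∀ i j, ‖g i j‖ ≤ 1) →
        (g • stdLat p).1 ≤ (stdLat p).1 := by
      rintro g h1 _ ⟨w, hw, rfl⟩
      have hw := (mem_stdLat w).1 hw
      refine (mem_stdLat _).2 fun i => ?_
      change ‖g.1.mulVec w i‖ ≤ 1
      rw [mulVec_entry]
      refine (IsUltrametricDist.norm_add_le_max _ _).trans (max_le ?_ ?_) <;> rw [norm_mul] <;>
        exact mul_le_one₀ (h1 _ _) (norm_nonneg _) (hw _)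
    have h3 : ∀ i j, ‖g⁻¹ i j‖ ≤ 1 := by
      obtain ⟨e1, e2, e3, e4⟩ := inv_entry g
      intro i j
      fin_cases i <;> fin_cases j <;> simp only [Fin.zero_eta, Fin.mk_one, e1, e2, e3, e4,
        norm_neg, norm_mul, norm_inv, h2, inv_one, one_mul, h1]
    refine Subtype.ext (le_antisymm (key g h1) ?_)
    have := Lat.smul_mono g (key g⁻¹ h3)
    rwa [smul_inv_smul] at this

lemma scalar_smul_lat (u : ℚ_[p]ˣ) (L : Lat p) :
    Matrix.GeneralLinearGroup.scalar (Fin 2) u • L = u • L := by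
  have e : ∀ w : Fin 2 → ℚ_[p],
      (Matrix.GeneralLinearGroup.scalar (Fin 2) u).1.mulVec w = (u : ℚ_[p]) • w := by
    intro w
    obtain ⟨u1, u2, u3, u4⟩ := scalar_entry u
    ext i
    rw [mulVec_entry]
    fin_cases i
    · simp only [Fin.zero_eta, u1, u2, zero_mul, add_zero, Pi.smul_apply, smul_eq_mul]
    · simp only [Fin.mk_one, u3, u4, zero_mul, zero_add, Pi.smul_apply, smul_eq_mul]
  refine Subtype.ext (Submodule.ext fun v => ?_)
  rw [Lat.mem_smul, Lat.mem_scale]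
  simp only [e]

lemma cls_eq_iff {L L' : Lat p} : L.cls = L'.cls ↔ ∃ u : ℚ_[p]ˣ, u • L' = L :=
  ⟨fun h => Quotient.exact h, fun ⟨u, hu⟩ => hu ▸ Lat.cls_scale u L'⟩

lemma smul_cls (g : GL (Fin 2) ℚ_[p]) (L : Lat p) : g • L.cls = (g • L).cls := rfl

lemma scalar_smul_vert (u : ℚ_[p]ˣ) (v : Vert p) :
    Matrix.GeneralLinearGroup.scalar (Fin 2) u • v = v := by
  induction v using Quotient.inductionOn with
  | h L =>
    change (Matrix.GeneralLinearGroup.scalar (Fin 2) u • L).cls = L.cls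
    rw [scalar_smul_lat, Lat.cls_scale]

/-- A lattice is free of rank two; the columns of `h` are a `ℤ_p`-basis of it. -/
lemma exists_smul_stdLat (L : Lat p) : ∃ h : GL (Fin 2) ℚ_[p], h • stdLat p = L := by
  have := L.2
  have hfr : Module.finrank ℤ_[p] L.1 = 2 := by
    rw [Submodule.IsLattice.finrank_of_pi (K := ℚ_[p]) L.1, Fintype.card_fin]
  let β := Module.finBasisOfFinrankEq ℤ_[p] L.1 hfr
  let B := β.extendOfIsLattice ℚ_[p]
  have hB : ∀ j, B j = (β j).1 := fun j => Module.Basis.extendOfIsLattice_apply ℚ_[p] β j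
  have hinv : IsUnit ((Pi.basisFun ℚ_[p] (Fin 2)).toMatrix B) := by
    have := (Pi.basisFun ℚ_[p] (Fin 2)).invertibleToMatrix B
    exact isUnit_of_invertible _
  have hent : ∀ i j, (Pi.basisFun ℚ_[p] (Fin 2)).toMatrix B i j = (β j).1 i := fun i j => by
    rw [Module.Basis.toMatrix_apply, Pi.basisFun_repr, hB]
  refine ⟨hinv.unit, Subtype.ext (Submodule.ext fun v => ?_)⟩
  have hmul : ∀ w : Fin 2 → ℚ_[p], hinv.unit.1.mulVec w = w 0 • (β 0).1 + w 1 • (β 1).1 := by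
    intro w
    ext i
    rw [mulVec_entry, IsUnit.unit_spec, hent, hent]
    simp [mul_comm]
  rw [Lat.mem_smul]
  constructor
  · rintro ⟨w, hw, rfl⟩
    have hw := (mem_stdLat w).1 hw
    rw [hmul]
    exact L.1.add_mem (L.1.smul_mem (⟨w 0, hw 0⟩ : ℤ_[p]) (β 0).2)
      (L.1.smul_mem (⟨w 1, hw 1⟩ : ℤ_[p]) (β 1).2)
  · intro hv
    have hs := β.sum_repr ⟨v, hv⟩
    rw [Fin.sum_univ_two] at hs
    have hs := congrArg Subtype.val hs
    refine ⟨![((β.repr ⟨v, hv⟩ 0 : ℤ_[p]) : ℚ_[p]), ((β.repr ⟨v, hv⟩ 1 : ℤ_[p]) : ℚ_[p])],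
      (mem_stdLat _).2 (Fin.forall_fin_two.2 ⟨(β.repr ⟨v, hv⟩ 0).2, (β.repr ⟨v, hv⟩ 1).2⟩), ?_⟩
    rw [hmul]
    exact hs

lemma exists_smul_stdLat_cls (v : Vert p) : ∃ h : GL (Fin 2) ℚ_[p], h • (stdLat p).cls = v := by
  induction v using Quotient.inductionOn with
  | h L =>
    obtain ⟨h, rfl⟩ := exists_smul_stdLat L
    exact ⟨h, rfl⟩

lemma norm_div_p_le_one_iff (x : ℚ_[p]) : ‖x / p‖ ≤ 1 ↔ ‖x‖ < 1 := by
  have hp := coe_p_ne_zero (p := p)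
  have := norm_le_inv_iff (p := p) (x := x) (y := 1) (Or.inr one_ne_zero)
  rw [mul_one, norm_one] at this
  rw [norm_div, div_le_one (norm_pos_iff.2 hp), this]

lemma mem_p_stdLat (v : Fin 2 → ℚ_[p]) :
    v ∈ ((pUnit : ℚ_[p]ˣ) • stdLat p).1 ↔ ∀ i, ‖v i‖ < 1 := by
  have hp := coe_p_ne_zero (p := p)
  rw [Lat.mem_scale]
  constructor
  · rintro ⟨w, hw, rfl⟩ i
    have := (mem_stdLat w).1 hw i
    rw [← norm_div_p_le_one_iff (p := p)]
    change ‖(p : ℚ_[p]) * w i / p‖ ≤ 1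
    rwa [mul_div_cancel_left₀ _ hp]
  · intro h
    refine ⟨fun i => v i / p, (mem_stdLat _).2 fun i => (norm_div_p_le_one_iff _).2 (h i), ?_⟩
    ext i
    change (p : ℚ_[p]) * (v i / p) = v i
    rw [mul_div_cancel₀ _ hp]

lemma mem_alpha_stdLat (j : ℕ) (v : Fin 2 → ℚ_[p]) :
    v ∈ ((alpha j : GL (Fin 2) ℚ_[p]) • stdLat p).1 ↔ ‖v 1‖ ≤ 1 ∧ ‖v 0 - j * v 1‖ < 1 := by
  have hp := coe_p_ne_zero (p := p)
  obtain ⟨a1, a2, a3, a4⟩ := alpha_entry (p := p) j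
  obtain ⟨i1, i2, i3, i4⟩ := inv_entry (alpha j : GL (Fin 2) ℚ_[p])
  have hd : (alpha j : GL (Fin 2) ℚ_[p]).1.det = p := by rw [det_entry, a1, a2, a3, a4]; ring
  rw [hd, a4] at i1
  rw [hd, a2] at i2
  rw [hd, a3] at i3
  rw [hd, a1] at i4
  rw [mem_smul_stdLat, Fin.forall_fin_two, mulVec_entry, mulVec_entry]
  rw [show (alpha j : GL (Fin 2) ℚ_[p])⁻¹.1 0 0 = _ from i1,
    show (alpha j : GL (Fin 2) ℚ_[p])⁻¹.1 0 1 = _ from i2,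
    show (alpha j : GL (Fin 2) ℚ_[p])⁻¹.1 1 0 = _ from i3,
    show (alpha j : GL (Fin 2) ℚ_[p])⁻¹.1 1 1 = _ from i4, and_comm, ← norm_div_p_le_one_iff (p := p)]
  rw [show -((p : ℚ_[p])⁻¹ * 0) * v 0 + (p : ℚ_[p])⁻¹ * p * v 1 = v 1 by field_simp; ring,
    show (p : ℚ_[p])⁻¹ * 1 * v 0 + -((p : ℚ_[p])⁻¹ * j) * v 1 = (v 0 - j * v 1) / p by
      field_simp; ring]

/-- Intermediate lattices correspond to lines in `𝔽_p²`, of which there are `p + 1`. A vector `v` of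
`L` outside `pℤ_p²` spans the line. -/
lemma lattice_between {L : Lat p} (h1 : ((pUnit : ℚ_[p]ˣ) • stdLat p).1 < L.1)
    (h2 : L.1 < (stdLat p).1) : L = g0 p • stdLat p ∨ ∃ j < p, L = (alpha j : GL (Fin 2) ℚ_[p]) • stdLat p := by
  obtain ⟨hle, v, hvL, hv⟩ := SetLike.lt_iff_le_and_exists.1 h1
  have hint : ∀ w ∈ L.1, ∀ i, ‖w i‖ ≤ 1 := fun w hw => (mem_stdLat w).1 (h2.le hw)
  have hsmul : ∀ (r : ℚ_[p]) (w : Fin 2 → ℚ_[p]), ‖r‖ ≤ 1 → w ∈ L.1 → r • w ∈ L.1 :=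
    fun r w hr hw => L.1.smul_mem (⟨r, hr⟩ : ℤ_[p]) hw
  have hdet : ∀ w ∈ L.1, ‖v 0 * w 1 - v 1 * w 0‖ < 1 := by
    intro w hw
    have hle1 : ‖v 0 * w 1 - v 1 * w 0‖ ≤ 1 := by
      refine (padic_norm_sub_le_max _ _).trans (max_le ?_ ?_) <;> rw [norm_mul]
      exacts [mul_le_one₀ (hint _ hvL _) (norm_nonneg _) (hint _ hw _),
        mul_le_one₀ (hint _ hvL _) (norm_nonneg _) (hint _ hw _)]
    -- If `det(v, w)` were a unit, Cramer's rule would write every integral vector in terms of `v`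
    -- and `w`, and `L` would be the whole standard lattice.
    refine lt_of_le_of_ne hle1 fun heq => h2.not_ge fun z hz => ?_
    have hz := (mem_stdLat z).1 hz
    set D := v 0 * w 1 - v 1 * w 0 with hD
    have hD0 : D ≠ 0 := norm_ne_zero_iff.1 (by rw [heq]; exact one_ne_zero)
    have e : z = ((z 0 * w 1 - z 1 * w 0) / D) • v + ((v 0 * z 1 - v 1 * z 0) / D) • w := by
      ext i
      fin_cases i
      · simp only [Fin.zero_eta, Pi.add_apply, Pi.smul_apply, smul_eq_mul]
        field_simp
        rw [hD]; ring
      · simp only [Fin.mk_one, Pi.add_apply, Pi.smul_apply, smul_eq_mul]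
        field_simp
        rw [hD]; ring
    rw [e]
    refine L.1.add_mem (hsmul _ _ ?_ hvL) (hsmul _ _ ?_ hw) <;> rw [norm_div, heq, div_one] <;>
      refine (padic_norm_sub_le_max _ _).trans (max_le ?_ ?_) <;> rw [norm_mul]
    exacts [mul_le_one₀ (hz _) (norm_nonneg _) (hint _ hw _),
      mul_le_one₀ (hz _) (norm_nonneg _) (hint _ hw _),
      mul_le_one₀ (hint _ hvL _) (norm_nonneg _) (hz _),
      mul_le_one₀ (hint _ hvL _) (norm_nonneg _) (hz _)]
  have hvint := hint _ hvL
  -- Modulo `p` the line is spanned by `(1, 0)`, which is the lattice of `g0`, or by `(j, 1)`, where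
  -- `j` is the residue of `v 0 / v 1`.
  by_cases hu : ‖v 1‖ < 1
  · left
    have hu0 : ‖v 0‖ = 1 := by
      refine le_antisymm (hvint 0) ?_
      by_contra! h
      exact hv ((mem_p_stdLat v).2 (Fin.forall_fin_two.2 ⟨h, hu⟩))
    have hv0 : v 0 ≠ 0 := norm_ne_zero_iff.1 (by rw [hu0]; exact one_ne_zero)
    refine Subtype.ext (le_antisymm (fun w hw => ?_) fun w hw => ?_)
    · rw [mem_g0_stdLat, norm_div_p_le_one_iff]
      refine ⟨hint w hw 0, ?_⟩
      have e : v 0 * w 1 = (v 0 * w 1 - v 1 * w 0) + v 1 * w 0 := by ring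
      have e2 : ‖w 1‖ = ‖v 0 * w 1‖ := by rw [norm_mul, hu0, one_mul]
      rw [e2, e]
      refine (IsUltrametricDist.norm_add_le_max _ _).trans_lt (max_lt (hdet w hw) ?_)
      rw [norm_mul]
      exact mul_lt_one_of_nonneg_of_lt_one_left (norm_nonneg _) hu (hint w hw 0)
    · rw [mem_g0_stdLat, norm_div_p_le_one_iff] at hw
      have hr : ‖w 0 / v 0‖ ≤ 1 := by rw [norm_div, hu0, div_one]; exact hw.1
      have e : w = (w 0 / v 0) • v + ![0, w 1 - w 0 / v 0 * v 1] := by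
        ext i
        fin_cases i
        · simp [hv0]
        · simp
      rw [e]
      refine L.1.add_mem (hsmul _ _ hr hvL) (hle ((mem_p_stdLat _).2
        (Fin.forall_fin_two.2 ⟨by simp, ?_⟩)))
      change ‖w 1 - w 0 / v 0 * v 1‖ < 1
      refine (padic_norm_sub_le_max _ _).trans_lt (max_lt hw.2 ?_)
      rw [norm_mul]
      exact mul_lt_one_of_nonneg_of_lt_one_right hr (norm_nonneg _) hu
  · right
    have hu1 : ‖v 1‖ = 1 := le_antisymm (hvint 1) (not_lt.1 hu)
    have hv1 : v 1 ≠ 0 := norm_ne_zero_iff.1 (by rw [hu1]; exact one_ne_zero)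
    have hq : ‖v 0 / v 1‖ ≤ 1 := by rw [norm_div, hu1, div_one]; exact hvint 0
    obtain ⟨j, hj, hjd⟩ := exists_digit hq
    refine ⟨j, hj, Subtype.ext (le_antisymm (fun w hw => ?_) fun w hw => ?_)⟩
    · rw [mem_alpha_stdLat]
      refine ⟨hint w hw 1, ?_⟩
      have e : w 0 - j * w 1 = (v 0 / v 1 - j) * w 1 - (v 0 * w 1 - v 1 * w 0) / v 1 := by
        field_simp; ring
      rw [e]
      refine (padic_norm_sub_le_max _ _).trans_lt (max_lt ?_ ?_)
      · rw [norm_mul]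
        exact mul_lt_one_of_nonneg_of_lt_one_left (norm_nonneg _) hjd (hint w hw 1)
      · rw [norm_div, hu1, div_one]; exact hdet w hw
    · rw [mem_alpha_stdLat] at hw
      have hr : ‖w 1 / v 1‖ ≤ 1 := by rw [norm_div, hu1, div_one]; exact hw.1
      have e : w = (w 1 / v 1) • v + ![w 0 - w 1 / v 1 * v 0, 0] := by
        ext i
        fin_cases i
        · simp
        · simp [hv1]
      rw [e]
      refine L.1.add_mem (hsmul _ _ hr hvL) (hle ((mem_p_stdLat _).2
        (Fin.forall_fin_two.2 ⟨?_, by simp⟩)))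
      change ‖w 0 - w 1 / v 1 * v 0‖ < 1
      have e : w 0 - w 1 / v 1 * v 0 = (w 0 - j * w 1) - (v 0 / v 1 - j) * w 1 := by
        field_simp; ring
      rw [e]
      refine (padic_norm_sub_le_max _ _).trans_lt (max_lt hw.2 ?_)
      rw [norm_mul]
      exact mul_lt_one_of_nonneg_of_lt_one_left (norm_nonneg _) hjd hw.1

lemma edge_ext {e e' : Edge p} (h1 : e.fst = e'.fst) (h2 : e.snd = e'.snd) : e = e' :=
  SimpleGraph.Dart.ext _ _ (Prod.ext h1 h2)

lemma smul_fst (g : GL (Fin 2) ℚ_[p]) (e : Edge p) : (g • e).fst = g • e.fst := rfl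

lemma smul_snd (g : GL (Fin 2) ℚ_[p]) (e : Edge p) : (g • e).snd = g • e.snd := rfl

lemma smul_edge_symm (g : GL (Fin 2) ℚ_[p]) (e : Edge p) : (g • e).symm = g • e.symm := rfl

lemma e0_fst : (e0 p).fst = g0 p • (stdLat p).cls := rfl

lemma scalar_smul_edge (u : ℚ_[p]ˣ) (e : Edge p) :
    Matrix.GeneralLinearGroup.scalar (Fin 2) u • e = e :=
  edge_ext (by rw [smul_fst, scalar_smul_vert]) (by rw [smul_snd, scalar_smul_vert])

lemma g0_smul_e0 : g0 p • e0 p = (e0 p).symm := by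
  refine edge_ext ?_ ?_
  · change g0 p • g0 p • (stdLat p).cls = (stdLat p).cls
    rw [smul_smul, g0_mul_g0, scalar_smul_vert]
  · rfl

/-- The matrix `τ` is in `GL₂(ℤ_p)`, so `α_j` moves the source of `e₀` to its target. -/
lemma alpha_mul_g0 (j : ℕ) : ∃ τ : GL (Fin 2) ℚ_[p], τ 0 0 = (j : ℚ_[p]) ∧ τ 0 1 = 1 ∧ τ 1 0 = 1 ∧
    τ 1 1 = 0 ∧ alpha j * g0 p = Matrix.GeneralLinearGroup.scalar (Fin 2) pUnit * τ := by
  obtain ⟨a1, a2, a3, a4⟩ := alpha_entry (p := p) j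
  obtain ⟨b1, b2, b3, b4⟩ := g0_entry (p := p)
  obtain ⟨τ, t1, t2, t3, t4⟩ : ∃ τ : GL (Fin 2) ℚ_[p], τ 0 0 = j ∧ τ 0 1 = 1 ∧ τ 1 0 = 1 ∧
      τ 1 1 = 0 :=
    ⟨Matrix.GeneralLinearGroup.mkOfDetNeZero !![(j : ℚ_[p]), 1; 1, 0]
      (by simp [Matrix.det_fin_two]), rfl, rfl, rfl, rfl⟩
  refine ⟨τ, t1, t2, t3, t4, GL_ext ?_ ?_ ?_ ?_⟩ <;>
    rw [mul_entry, scalar_mul_entry, pUnit, Units.val_mk0] <;>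
    simp only [a1, a2, a3, a4, b1, b2, b3, b4, t1, t2, t3, t4] <;> ring

lemma alpha_smul_e0_fst (j : ℕ) : ((alpha j : GL (Fin 2) ℚ_[p]) • e0 p).fst = (stdLat p).cls := by
  rw [smul_fst, e0_fst, smul_smul]
  obtain ⟨τ, t1, t2, t3, t4, h⟩ := alpha_mul_g0 (p := p) j
  rw [h, mul_smul, scalar_smul_vert, smul_cls, smul_stdLat_eq_iff.2]
  refine ⟨fun i j => ?_, ?_⟩
  · fin_cases i <;> fin_cases j <;> simp only [Fin.zero_eta, Fin.mk_one, t1, t2, t3, t4, norm_zero,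
      norm_one, le_refl, zero_le_one]
    exact IsUltrametricDist.norm_natCast_le_one _ _
  · rw [det_entry, t1, t2, t3, t4]; simp

/-- After translation the source is the standard vertex, and its neighbours are read off from
`lattice_between`: one reversed edge and `p` forward edges. -/
lemma edge_of_fst_eq {e : Edge p} {g : GL (Fin 2) ℚ_[p]} (he : e.fst = g • (stdLat p).cls) :
    e = (g * g0 p) • e0 p ∨ ∃ j < p, e = (g * alpha j) • e0 p := by
  wlog hg : g = 1 generalizing e g
  · have := this (e := g⁻¹ • e) (g := 1) (by rw [smul_fst, he, inv_smul_smul, one_smul]) rfl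
    rw [one_mul] at this
    rcases this with h | ⟨j, hj, h⟩
    · left; rw [mul_smul, ← h, smul_inv_smul]
    · right; refine ⟨j, hj, ?_⟩
      rw [one_mul] at h
      rw [mul_smul, ← h, smul_inv_smul]
  subst hg
  rw [one_smul] at he
  simp only [one_mul]
  obtain ⟨L, L', hL, hL', h1, h2⟩ : Joined e.fst e.snd := e.adj
  rw [he] at hL
  obtain ⟨u, rfl⟩ := cls_eq_iff.1 hL
  have h1 := Lat.scale_lt u⁻¹ h1
  have h2 := Lat.scale_lt u⁻¹ h2
  rw [smul_smul, smul_smul, mul_right_comm, inv_mul_cancel, one_mul] at h1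
  rw [inv_smul_smul] at h2
  rcases lattice_between h1 h2 with h | ⟨j, hj, h⟩
  · left
    rw [g0_smul_e0]
    refine edge_ext he ?_
    rw [← hL', ← Lat.cls_scale u⁻¹, h]
    rfl
  · right
    refine ⟨j, hj, edge_ext ?_ ?_⟩
    · rw [he, alpha_smul_e0_fst]
    · rw [← hL', ← Lat.cls_scale u⁻¹, h]
      rfl

/-- `GL₂(ℚ_p)` acts transitively on oriented edges. -/
lemma exists_smul_e0 (e : Edge p) : ∃ g : GL (Fin 2) ℚ_[p], g • e0 p = e := by
  obtain ⟨h, hh⟩ := exists_smul_stdLat_cls e.fst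
  rcases edge_of_fst_eq hh.symm with h | ⟨j, -, h⟩
  exacts [⟨_, h.symm⟩, ⟨_, h.symm⟩]

lemma exists_scalar_of_smul_cls_eq {g h : GL (Fin 2) ℚ_[p]}
    (hgh : g • h • (stdLat p).cls = h • (stdLat p).cls) :
    ∃ u : ℚ_[p]ˣ, (∀ i j, ‖(h⁻¹ * (Matrix.GeneralLinearGroup.scalar (Fin 2) u * g) * h) i j‖ ≤ 1) ∧
      ‖(h⁻¹ * (Matrix.GeneralLinearGroup.scalar (Fin 2) u * g) * h).1.det‖ = 1 := by
  obtain ⟨u, hu⟩ := cls_eq_iff.1 hgh.symm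
  refine ⟨u, smul_stdLat_eq_iff.1 ?_⟩
  rw [mul_smul, mul_smul, mul_smul, scalar_smul_lat]
  have hu : u • g • h • stdLat p = h • stdLat p := hu
  rw [hu, inv_smul_smul]

lemma g0_inv_entry : (g0 p)⁻¹ 0 0 = 0 ∧ (g0 p)⁻¹ 0 1 = (p : ℚ_[p])⁻¹ ∧ (g0 p)⁻¹ 1 0 = 1 ∧
    (g0 p)⁻¹ 1 1 = 0 := by
  have hp := coe_p_ne_zero (p := p)
  obtain ⟨b1, b2, b3, b4⟩ := g0_entry (p := p)
  obtain ⟨c1, c2, c3, c4⟩ := inv_entry (g0 p)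
  have hd : (g0 p).1.det = -p := by rw [det_entry, b1, b2, b3, b4]; ring
  rw [c1, c2, c3, c4, hd, b1, b2, b3, b4, inv_neg]
  refine ⟨mul_zero _, by rw [mul_one, neg_neg], ?_, mul_zero _⟩
  rw [neg_mul, neg_neg, inv_mul_cancel₀ hp]

/-- The stabilizer of `e₀` is `ℚ_pˣ Γ₀(p)`. -/
lemma exists_of_smul_e0_eq {g : GL (Fin 2) ℚ_[p]} (hg : g • e0 p = e0 p) :
    ∃ u : ℚ_[p]ˣ, ∃ σ ∈ Gamma0 p, g = Matrix.GeneralLinearGroup.scalar (Fin 2) u * σ := by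
  have hs : g • (1 : GL (Fin 2) ℚ_[p]) • (stdLat p).cls = (1 : GL (Fin 2) ℚ_[p]) • (stdLat p).cls := by
    rw [one_smul]
    exact congrArg (fun e : Edge p => e.snd) hg
  have hf : g • g0 p • (stdLat p).cls = g0 p • (stdLat p).cls :=
    congrArg (fun e : Edge p => e.fst) hg
  obtain ⟨u, hu1, hu2⟩ := exists_scalar_of_smul_cls_eq hs
  obtain ⟨v, hv1, hv2⟩ := exists_scalar_of_smul_cls_eq hf
  rw [inv_one, one_mul, mul_one] at hu1 hu2
  have hsc : ∀ (u : ℚ_[p]ˣ) (g : GL (Fin 2) ℚ_[p]),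
      ‖(Matrix.GeneralLinearGroup.scalar (Fin 2) u * g).1.det‖ = ‖(u : ℚ_[p])‖ ^ 2 * ‖g.1.det‖ := by
    intro u g
    rw [det_entry, scalar_mul_entry, scalar_mul_entry, scalar_mul_entry, scalar_mul_entry,
      det_entry, ← norm_pow, ← norm_mul]
    congr 1
    ring
  have hgdet : (0 : ℝ) < ‖g.1.det‖ := norm_pos_iff.2 (det_val_ne_zero g)
  -- The two endpoints a priori need different scalars. Comparing determinants shows that they have
  -- equal norm, so one scalar makes both conditions hold.
  have huv : ‖(u : ℚ_[p])‖ = ‖(v : ℚ_[p])‖ := by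
    have h3 : ‖(g0 p)⁻¹.1.det‖ * ‖(g0 p).1.det‖ = 1 := by
      rw [← norm_mul, ← Matrix.det_mul, ← Units.val_mul, inv_mul_cancel, Units.val_one,
        Matrix.det_one, norm_one]
    rw [Units.val_mul, Matrix.det_mul, norm_mul, Units.val_mul ((g0 p)⁻¹), Matrix.det_mul, norm_mul,
      mul_right_comm, h3, one_mul, hsc] at hv2
    rw [hsc, ← hv2] at hu2
    have := mul_right_cancel₀ hgdet.ne' hu2
    exact (pow_left_inj₀ (norm_nonneg _) (norm_nonneg _) two_ne_zero).1 this
  refine ⟨u⁻¹, Matrix.GeneralLinearGroup.scalar (Fin 2) u * g, ?_, ?_⟩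
  · refine mem_Gamma0.2 ⟨hu1, ?_, by rw [← det_entry]; exact hu2⟩
    -- the lower left entry, read off from the condition at the source
    have h01 := hv1 0 1
    obtain ⟨b1, b2, b3, b4⟩ := g0_entry (p := p)
    obtain ⟨c1, c2, c3, c4⟩ := g0_inv_entry (p := p)
    have hp := coe_p_ne_zero (p := p)
    rw [mul_entry ((g0 p)⁻¹ * (Matrix.GeneralLinearGroup.scalar (Fin 2) v * g)) (g0 p),
      mul_entry (g0 p)⁻¹ (Matrix.GeneralLinearGroup.scalar (Fin 2) v * g),
      mul_entry (g0 p)⁻¹ (Matrix.GeneralLinearGroup.scalar (Fin 2) v * g),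
      scalar_mul_entry, scalar_mul_entry, scalar_mul_entry, scalar_mul_entry,
      c1, c2, b2, b4] at h01
    rw [scalar_mul_entry, ← norm_div_p_le_one_iff, mul_div_assoc, norm_mul, huv, ← norm_mul]
    refine le_of_eq_of_le (congrArg norm ?_) h01
    field_simp
    ring
  · rw [← mul_assoc, ← map_mul, inv_mul_cancel, map_one, one_mul]

/-- Conjugation by `g0` turns `(a b; c d)` into `(d c/p; pb a)`, which is again in `GL₂(ℤ_p)`
because `p ∣ c`; so both endpoints are fixed. -/
lemma Gamma0_smul_e0 {σ : GL (Fin 2) ℚ_[p]} (hσ : σ ∈ Gamma0 p) : σ • e0 p = e0 p := by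
  obtain ⟨h1, h2, h3⟩ := mem_Gamma0.1 hσ
  obtain ⟨b1, b2, b3, b4⟩ := g0_entry (p := p)
  have hp := coe_p_ne_zero (p := p)
  have hdet : ‖σ.1.det‖ = 1 := by rw [det_entry]; exact h3
  refine edge_ext ?_ ?_
  · change σ • g0 p • (stdLat p).cls = g0 p • (stdLat p).cls
    rw [← inv_smul_eq_iff, smul_smul, smul_smul, smul_cls, smul_stdLat_eq_iff.2]
    obtain ⟨c1, c2, c3, c4⟩ := g0_inv_entry (p := p)
    refine ⟨fun i j => ?_, ?_⟩
    · have hc := (norm_div_p_le_one_iff (σ 1 0)).2 h2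
      have hb : ‖(p : ℚ_[p]) * σ 0 1‖ ≤ 1 := by
        rw [norm_mul]
        exact mul_le_one₀ Padic.norm_p_lt_one.le (norm_nonneg _) (h1 _ _)
      rw [mul_entry, mul_entry, mul_entry]
      fin_cases i <;> fin_cases j <;>
        simp only [Fin.zero_eta, Fin.mk_one, c1, c2, c3, c4, b1, b2, b3, b4]
      · refine le_of_eq_of_le (congrArg norm ?_) (h1 1 1); field_simp; try ring
      · refine le_of_eq_of_le (congrArg norm ?_) hc; field_simp; try ring
      · refine le_of_eq_of_le (congrArg norm ?_) hb; field_simp; try ring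
      · refine le_of_eq_of_le (congrArg norm ?_) (h1 0 0); field_simp; try ring
    · rw [Units.val_mul, Units.val_mul, Matrix.det_mul, Matrix.det_mul, mul_right_comm,
        ← Matrix.det_mul, ← Units.val_mul, inv_mul_cancel, Units.val_one, Matrix.det_one, one_mul]
      exact hdet
  · change σ • (stdLat p).cls = (stdLat p).cls
    rw [smul_cls, smul_stdLat_eq_iff.2 ⟨h1, hdet⟩]

/-- The definition ranges over all matrices carrying `e₀` to the edge. They differ by the stabilizer
`ℚ_pˣ Γ₀(pℤ_p)`, which preserves `ℤ_p`, so they all give one ball. -/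
lemma edgeBall_smul_e0 (g : GL (Fin 2) ℚ_[p]) : edgeBall (g • e0 p) = ball g := by
  ext z
  constructor
  · rintro ⟨h, he, hz⟩
    have : (g⁻¹ * h) • e0 p = e0 p := by rw [mul_smul, he, inv_smul_smul]
    obtain ⟨u, σ, hσ, e⟩ := exists_of_smul_e0_eq this
    rw [inv_mul_eq_iff_eq_mul] at e
    rwa [e, ← mul_assoc, ← scalar_comm, mul_assoc, ball_scalar_mul, ball_mul_Gamma0 _ hσ] at hz
  · intro hz
    exact ⟨g, rfl, hz⟩

lemma alpha_smul_injective {g : GL (Fin 2) ℚ_[p]} {i j : ℕ} (hi : i < p) (hj : j < p)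
    (h : (g * alpha i) • e0 p = (g * alpha j) • e0 p) : i = j := by
  rw [mul_smul, mul_smul, smul_left_cancel_iff] at h
  have hb : ball (alpha i : GL (Fin 2) ℚ_[p]) = ball (alpha j) := by
    rw [← edgeBall_smul_e0, h, edgeBall_smul_e0]
  have hmem : (((i : ℚ_[p])) : OnePoint ℚ_[p]) ∈ ball (alpha i : GL (Fin 2) ℚ_[p]) := by
    obtain ⟨a1, a2, a3, a4⟩ := alpha_entry (p := p) i
    rw [coe_mem_ball, a1, a2, a3, a4]
    simp
  refine ball_mul_alpha_disjoint (g := 1) hi hj (x := i) ?_ ?_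
  · rwa [one_mul]
  · rwa [one_mul, ← hb]

/-- The edges are told apart by their balls: one is the complement of `g ℤ_p`, the other is
contained in `g ℤ_p`. -/
lemma alpha_smul_ne_g0 {g : GL (Fin 2) ℚ_[p]} {j : ℕ} (hj : j < p) :
    (g * g0 p) • e0 p ≠ (g * alpha j) • e0 p := by
  intro h
  have hb : ball (g * g0 p) = ball (g * alpha j) := by
    rw [← edgeBall_smul_e0, h, edgeBall_smul_e0]
  have hsub := ball_mul_alpha_subset g hj
  rw [← hb] at hsub
  by_cases hinf : OnePoint.infty ∈ ball g
  · have h1 : OnePoint.infty ∉ ball (g * g0 p) := fun h => (infty_mem_ball_mul_g0 g).1 h hinf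
    obtain ⟨x, hx⟩ := exists_mem_ball_of_infty_notMem h1
    exact (coe_mem_ball_mul_g0 g x).1 hx (hsub hx)
  · exact hinf (hsub ((infty_mem_ball_mul_g0 g).2 hinf))

/-- Harmonicity, in terms of the matrices `α_j`. -/
lemma IsHarmonicCocycle.sum_alpha {Γ : Subgroup (GL (Fin 2) ℚ_[p])} {k : ℕ} {c : Edge p → Vk p k}
    (hc : IsHarmonicCocycle Γ k c) (g : GL (Fin 2) ℚ_[p]) :
    ∑ j ∈ Finset.range p, c ((g * alpha j) • e0 p) = c (g • e0 p) := by
  classical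
  have h : ∑ᶠ e : ({e : Edge p | e.fst = g • (stdLat p).cls} : Set (Edge p)), c e = 0 :=
    hc.harmonic (g • (stdLat p).cls)
  rw [finsum_set_coe_eq_finsum_mem {e : Edge p | e.fst = g • (stdLat p).cls}] at h
  -- The finite sum over the star of the vertex has the reversed edge as one term; alternation turns
  -- it into `-c(g e₀)`.
  have hset : {e : Edge p | e.fst = g • (stdLat p).cls} =
      ↑(insert ((g * g0 p) • e0 p) ((Finset.range p).image fun j => (g * alpha j) • e0 p)) := by
    ext e
    simp only [Set.mem_ofPred_eq, Finset.coe_insert, Finset.coe_image, Set.mem_insert_iff,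
      Set.mem_image, Finset.mem_coe, Finset.mem_range]
    constructor
    · intro he
      rcases edge_of_fst_eq he with h | ⟨j, hj, h⟩
      · exact Or.inl h
      · exact Or.inr ⟨j, hj, h.symm⟩
    · rintro (rfl | ⟨j, -, rfl⟩)
      · rw [mul_smul, smul_fst, g0_smul_e0]; rfl
      · rw [mul_smul, smul_fst, alpha_smul_e0_fst]
  rw [hset, finsum_mem_coe_finset, Finset.sum_insert, Finset.sum_image] at h
  · have h2 : c ((g * g0 p) • e0 p) = -c (g • e0 p) := by
      rw [mul_smul, g0_smul_e0, ← smul_edge_symm, hc.alternating]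
    rw [h2, neg_add_eq_zero] at h
    exact h.symm
  · intro i hi j hj hij
    exact alpha_smul_injective (Finset.mem_range.1 hi) (Finset.mem_range.1 hj) hij
  · rw [Finset.mem_image]
    rintro ⟨j, hj, h⟩
    exact alpha_smul_ne_g0 (Finset.mem_range.1 hj) h.symm

/-! ### The form of a harmonic cocycle -/

lemma rightAct_alpha_inv {k : ℕ} (ω : Vk p k) (j : ℕ) :
    rightAct k ω (alpha j)⁻¹ = leftAct k (alpha j) ω := by rw [rightAct_eq, inv_inv]

lemma leftAct_sum {ι : Type*} (k : ℕ) (g : GL (Fin 2) ℚ_[p]) (s : Finset ι) (f : ι → Vk p k) :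
    leftAct k g (∑ i ∈ s, f i) = ∑ i ∈ s, leftAct k g (f i) := by
  ext1 P
  simp [leftAct, LinearMap.comp_apply, LinearMap.sum_apply]

/-- The form attached to a cocycle. -/
def formOf (k : ℕ) (c : Edge p → Vk p k) (g : GL (Fin 2) ℚ_[p]) : Vk p k :=
  leftAct k g⁻¹ (c (g • e0 p))

section formOf

variable {Γ : Subgroup (GL (Fin 2) ℚ_[p])} {k : ℕ} {c : Edge p → Vk p k}

lemma IsHarmonicCocycle.map_smul (hc : IsHarmonicCocycle Γ k c) {γ : GL (Fin 2) ℚ_[p]}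
    (hγ : γ ∈ Γ) (e : Edge p) : c (γ • e) = leftAct k γ (c e) := by
  have := hc.invariant γ hγ (γ • e)
  rw [inv_smul_smul] at this
  exact this.symm

lemma leftAct_formOf (g : GL (Fin 2) ℚ_[p]) : leftAct k g (formOf k c g) = c (g • e0 p) := by
  rw [formOf, ← leftAct_mul, mul_inv_cancel, leftAct_one]

lemma formOf_left (hk : Even k) (hc : IsHarmonicCocycle Γ k c) (u : ℚ_[p]ˣ)
    {γ : GL (Fin 2) ℚ_[p]} (hγ : γ ∈ Γ) (g : GL (Fin 2) ℚ_[p]) :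
    formOf k c (Matrix.GeneralLinearGroup.scalar (Fin 2) u * γ * g) = formOf k c g := by
  have h1 : (Matrix.GeneralLinearGroup.scalar (Fin 2) u * γ * g)⁻¹ * γ =
      Matrix.GeneralLinearGroup.scalar (Fin 2) u⁻¹ * g⁻¹ := by
    rw [mul_inv_rev, mul_inv_rev, ← map_inv, mul_assoc, mul_assoc, scalar_comm,
      ← mul_assoc γ⁻¹, inv_mul_cancel, one_mul, scalar_comm]
  rw [formOf, mul_assoc, mul_smul, scalar_smul_edge, mul_smul, hc.map_smul hγ, ← leftAct_mul,
    ← mul_assoc, h1, leftAct_mul, leftAct_scalar hk, formOf]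

lemma formOf_right {σ : GL (Fin 2) ℚ_[p]} (hσ : σ ∈ Gamma0 p) (g : GL (Fin 2) ℚ_[p]) :
    formOf k c (g * σ) = rightAct k (formOf k c g) σ := by
  rw [formOf, mul_smul, Gamma0_smul_e0 hσ, mul_inv_rev, leftAct_mul, rightAct_eq, formOf]

/-- Each summand `φ(gα_j) · α_j⁻¹` is `g⁻¹ · c(gα_j e₀)`, so the eigenvalue equation is harmonicity
at the target of `g e₀`. -/
lemma Up_formOf (hc : IsHarmonicCocycle Γ k c) (g : GL (Fin 2) ℚ_[p]) :
    Up k (formOf k c) g = (p : ℚ_[p]) ^ (k / 2) • formOf k c g := by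
  have h1 : ∀ j, rightAct k (formOf k c (g * alpha j)) (alpha j)⁻¹ =
      leftAct k g⁻¹ (c ((g * alpha j) • e0 p)) := by
    intro j
    rw [rightAct_alpha_inv, formOf, ← leftAct_mul, mul_inv_rev, mul_inv_cancel_left]
  have h2 : Up k (formOf k c) g = (p : ℚ_[p]) ^ (k / 2) •
      ∑ j ∈ Finset.range p, rightAct k (formOf k c (g * alpha j)) (alpha j)⁻¹ := rfl
  rw [h2, Finset.sum_congr rfl fun j _ => h1 j, ← leftAct_sum, hc.sum_alpha g, formOf]

lemma leftAct_neg (g : GL (Fin 2) ℚ_[p]) (ω : Vk p k) : leftAct k g (-ω) = -leftAct k g ω := rfl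

/-- Because `g0` reverses `e₀`, this is the alternation of the cocycle. -/
lemma Wp_formOf (hc : IsHarmonicCocycle Γ k c) (g : GL (Fin 2) ℚ_[p]) :
    Wp k (formOf k c) g = -formOf k c g := by
  have h2 : Wp k (formOf k c) g = rightAct k (formOf k c (g * g0 p)) (g0 p)⁻¹ := rfl
  have h3 : c ((g * g0 p) • e0 p) = -c (g • e0 p) := by
    rw [mul_smul, g0_smul_e0, ← smul_edge_symm, hc.alternating]
  rw [h2, rightAct_eq, inv_inv, formOf, ← leftAct_mul, mul_inv_rev, mul_inv_cancel_left, h3,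
    leftAct_neg, formOf]

/-- There is exactly one `p`-new form with `c (g e₀) = g · φ(g)`. -/
theorem existsUnique_corresponds (hk : Even k) (hc : IsHarmonicCocycle Γ k c) :
    ∃! φ : GL (Fin 2) ℚ_[p] → Vk p k, Corresponds Γ k c φ := by
  refine ⟨formOf k c, ⟨⟨fun u γ hγ g => formOf_left hk hc u hγ g,
    fun σ hσ g => formOf_right hσ g⟩, fun g => ?_, Up_formOf hc, fun g => ?_⟩, fun φ hφ => ?_⟩
  · rw [Up_formOf hc, Wp_formOf hc, smul_neg, neg_neg]
  · rw [leftAct_formOf]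
  · funext g
    rw [formOf, hφ.cocycle, ← leftAct_mul, inv_mul_cancel, leftAct_one]

end formOf

/-! ### The contraction property of `U_p` -/

lemma QSigma0_mul {g h : GL (Fin 2) ℚ_[p]} (hg : g ∈ QSigma0 p) (hh : h ∈ QSigma0 p) :
    g * h ∈ QSigma0 p := by
  obtain ⟨u, σ, ⟨h1, h2, h3⟩, e⟩ := hg
  obtain ⟨v, τ, ⟨k1, k2, k3⟩, f⟩ := hh
  refine ⟨u * v, σ * τ, ⟨?_, ?_, ?_⟩, ?_⟩
  · rw [Matrix.mul_apply, Fin.sum_univ_two]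
    exact dvd_add (h1.mul_right _) (k1.mul_left _)
  · rw [Matrix.mul_apply, Fin.sum_univ_two]
    by_contra hn
    have m1 : σ 0 0 * τ 0 0 + σ 0 1 * τ 1 0 ∈ IsLocalRing.maximalIdeal ℤ_[p] :=
      (IsLocalRing.mem_maximalIdeal _).2 hn
    have m2 : τ 1 0 ∈ IsLocalRing.maximalIdeal ℤ_[p] := by
      rw [PadicInt.maximalIdeal_eq_span_p, Ideal.mem_span_singleton]; exact k1
    have m3 := Ideal.sub_mem _ m1 (Ideal.mul_mem_left _ (σ 0 1) m2)
    rw [add_sub_cancel_right] at m3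
    exact (IsLocalRing.mem_maximalIdeal _).1 m3 (h2.mul k2)
  · rw [Matrix.det_mul]
    exact mul_ne_zero h3 k3
  · rw [Units.val_mul, e, f, Matrix.smul_mul, Matrix.mul_smul, smul_smul, Units.val_mul]
    refine congrArg _ ?_
    ext i j
    simp [Matrix.mul_apply, Fin.sum_univ_two]

lemma distAct_sub (k : ℕ) (ω η : Dk p) {g : GL (Fin 2) ℚ_[p]} (hg : g ∈ QSigma0 p) :
    distAct k (ω - η) g hg = distAct k ω g hg - distAct k η g hg := rfl

lemma distAct_sum {ι : Type*} (k : ℕ) (s : Finset ι) (ω : ι → Dk p) {g : GL (Fin 2) ℚ_[p]}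
    (hg : g ∈ QSigma0 p) :
    distAct k (∑ i ∈ s, ω i) g hg = ∑ i ∈ s, distAct k (ω i) g hg := by
  ext1 F
  simp [distAct, ContinuousLinearMap.comp_apply, sum_apply]

lemma norm_distAct_le_of_mem_Gamma0 (k : ℕ) (ω : Dk p) {σ : GL (Fin 2) ℚ_[p]} (hσ : σ ∈ Gamma0 p) :
    ‖distAct k ω σ (Gamma0_subset hσ)‖ ≤ ‖ω‖ := by
  refine ContinuousLinearMap.opNorm_le_bound _ (norm_nonneg ω) fun F => ?_
  refine (ω.le_opNorm _).trans (mul_le_mul_of_nonneg_left ?_ (norm_nonneg _))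
  refine (norm_tateAct_coeff_le k (Gamma0_subset hσ) F).trans
    (mul_le_of_le_one_left (norm_nonneg _) ?_)
  obtain ⟨h1, h2, h3⟩ := mem_Gamma0.1 hσ
  rw [norm_mul, norm_inv, norm_pow, norm_pow, det_entry, h3, one_pow, inv_one, one_mul]
  exact pow_le_one₀ (norm_nonneg _) (h1 0 0)

lemma alpha_det (j : ℕ) : (alpha j : GL (Fin 2) ℚ_[p]).1.det = p := by
  obtain ⟨a1, a2, a3, a4⟩ := alpha_entry (p := p) j
  rw [det_entry, a1, a2, a3, a4]
  ring

lemma alpha_inv_entry (j : ℕ) : (alpha j : GL (Fin 2) ℚ_[p])⁻¹ 0 0 = (p : ℚ_[p])⁻¹ ∧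
    (alpha j : GL (Fin 2) ℚ_[p])⁻¹ 0 1 = -((p : ℚ_[p])⁻¹ * j) ∧
    (alpha j : GL (Fin 2) ℚ_[p])⁻¹ 1 0 = 0 ∧ (alpha j : GL (Fin 2) ℚ_[p])⁻¹ 1 1 = 1 := by
  have hp := coe_p_ne_zero (p := p)
  obtain ⟨a1, a2, a3, a4⟩ := alpha_entry (p := p) j
  obtain ⟨c1, c2, c3, c4⟩ := inv_entry (alpha j : GL (Fin 2) ℚ_[p])
  rw [c1, c2, c3, c4, alpha_det, a1, a2, a3, a4]
  exact ⟨mul_one _, rfl, by rw [mul_zero, neg_zero], inv_mul_cancel₀ hp⟩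

/-- The action of `α_j⁻¹` is `F ↦ p^{-k/2} F(px + j)`. Writing it as a rescaling by `p` of a
polynomial with integer coefficients isolates the factor `pⁿ` in degree `n`. -/
lemma actMonomial_alpha_inv {k : ℕ} (hk : Even k) (j i : ℕ) :
    actMonomial k (alpha j : GL (Fin 2) ℚ_[p])⁻¹ i =
      PowerSeries.C ((p : ℚ_[p])⁻¹ ^ (k / 2)) * PowerSeries.rescale (p : ℚ_[p])
        (PowerSeries.map (Int.castRingHom ℚ_[p]) ((PowerSeries.X + PowerSeries.C (j : ℤ)) ^ i)) := by
  have hp := coe_p_ne_zero (p := p)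
  obtain ⟨c1, c2, c3, c4⟩ := alpha_inv_entry (p := p) j
  have hdet : (alpha j : GL (Fin 2) ℚ_[p])⁻¹.1.det = (p : ℚ_[p])⁻¹ := by
    rw [det_entry, c1, c2, c3, c4]; ring
  have hR : PowerSeries.rescale (p : ℚ_[p]) (PowerSeries.map (Int.castRingHom ℚ_[p])
      ((PowerSeries.X + PowerSeries.C (j : ℤ)) ^ i)) =
      (PowerSeries.C (p : ℚ_[p]) * PowerSeries.X + PowerSeries.C (j : ℚ_[p])) ^ i := by
    rw [map_pow, map_pow]
    congr 1
    ext n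
    rw [PowerSeries.coeff_rescale, PowerSeries.coeff_map, map_add, map_add, map_add, PowerSeries.coeff_C_mul,
      PowerSeries.coeff_X, PowerSeries.coeff_X, PowerSeries.coeff_C, PowerSeries.coeff_C]
    rcases n with _ | _ | n <;> simp
  have h : (PowerSeries.C (p : ℚ_[p])⁻¹ : PowerSeries ℚ_[p])⁻¹ = PowerSeries.C (p : ℚ_[p]) := by
    rw [PowerSeries.inv_eq_iff_mul_eq_one (by simpa using hp), ← map_mul, mul_inv_cancel₀ hp,
      map_one]
  rw [hR, actMonomial, hdet, c1, c2, c3, c4, map_zero, zero_mul, sub_zero, map_one, one_mul, h]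
  congr 1
  · rw [← map_pow, ← map_mul, ← inv_pow, inv_inv]
    congr 1
    obtain ⟨m, rfl⟩ := hk
    rw [← two_mul, Nat.mul_div_cancel_left _ two_pos, two_mul, pow_add, ← mul_assoc, ← mul_pow,
      mul_inv_cancel₀ hp, one_pow, one_mul]
  · congr 1
    rw [sub_mul, ← map_mul, neg_mul, mul_right_comm, inv_mul_cancel₀ hp, one_mul, map_neg,
      sub_neg_eq_add, mul_comm]

/-- In degree `n ≥ k + 1` the factor `pⁿ` outweighs `p^{-k/2}` and leaves at least `k/2 + 1` powers
of `p`. -/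
lemma norm_coeff_tateAct_alpha_inv_le {k : ℕ} (hk : Even k) (j : ℕ) (F : Tate p) {n : ℕ}
    (hn : k + 1 ≤ n) : ‖tateAct k (alpha j)⁻¹ (alpha_inv_mem j) F n‖ ≤
      ‖(p : ℚ_[p])‖ ^ (k / 2 + 1) * ‖F‖ := by
  have hp := coe_p_ne_zero (p := p)
  have hp0 : 0 < ‖(p : ℚ_[p])‖ := norm_pos_iff.2 hp
  rw [tateAct_apply]
  refine IsUltrametricDist.norm_tsum_le_of_forall_le_of_nonneg (by positivity) fun i => ?_
  rw [norm_mul, mul_comm]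
  refine mul_le_mul ?_ (F.norm_apply_le i) (norm_nonneg _) (by positivity)
  rw [actMonomial_alpha_inv hk, PowerSeries.coeff_C_mul, PowerSeries.coeff_rescale,
    PowerSeries.coeff_map, norm_mul, norm_mul, norm_pow, norm_pow, norm_inv]
  have h1 : ‖(Int.castRingHom ℚ_[p])
      (PowerSeries.coeff n ((PowerSeries.X + PowerSeries.C (j : ℤ)) ^ i))‖ ≤ 1 :=
    Padic.norm_int_le_one _
  calc ‖(p : ℚ_[p])‖⁻¹ ^ (k / 2) * (‖(p : ℚ_[p])‖ ^ n * _)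
      ≤ ‖(p : ℚ_[p])‖⁻¹ ^ (k / 2) * (‖(p : ℚ_[p])‖ ^ (k / 2 + (k / 2 + 1)) * 1) := by
        refine mul_le_mul_of_nonneg_left (mul_le_mul ?_ h1 (norm_nonneg _) (by positivity))
          (by positivity)
        refine pow_le_pow_of_le_one hp0.le Padic.norm_p_lt_one.le ?_
        obtain ⟨m, rfl⟩ := hk
        omega
    _ = ‖(p : ℚ_[p])‖ ^ (k / 2 + 1) := by
        rw [mul_one, pow_add, ← mul_assoc, ← mul_pow, inv_mul_cancel₀ hp0.ne', one_pow, one_mul]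

/-- On distributions killed by `𝒫_k`, the operators `ω ↦ ω · α_j⁻¹` are contractions. -/
lemma norm_distAct_alpha_inv_le {k : ℕ} (hk : Even k) (j : ℕ) {ω : Dk p}
    (hω : specialize k ω = 0) : ‖distAct k ω (alpha j)⁻¹ (alpha_inv_mem j)‖ ≤
      ‖(p : ℚ_[p])‖ ^ (k / 2 + 1) * ‖ω‖ := by
  refine ContinuousLinearMap.opNorm_le_bound _ (by positivity) fun F => ?_
  rw [distAct, ContinuousLinearMap.comp_apply]
  set G := tateAct k (alpha j)⁻¹ (alpha_inv_mem j) F with hG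
  have h0 : ω (polyToTate (G.trunc (k + 1))) = 0 :=
    congrArg (fun η : Vk p k => η ⟨_, G.trunc_mem k⟩) hω
  -- The part of degree at most `k` is invisible to `ω`, so only the contracted coefficients
  -- contribute.
  have h1 : ‖G - polyToTate (G.trunc (k + 1))‖ ≤ ‖(p : ℚ_[p])‖ ^ (k / 2 + 1) * ‖F‖ :=
    G.norm_sub_trunc_le (by positivity) fun n hn => norm_coeff_tateAct_alpha_inv_le hk j F hn
  calc ‖ω G‖ = ‖ω (G - polyToTate (G.trunc (k + 1)))‖ := by rw [map_sub, h0, sub_zero]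
    _ ≤ ‖ω‖ * (‖(p : ℚ_[p])‖ ^ (k / 2 + 1) * ‖F‖) :=
      (ω.le_opNorm _).trans (mul_le_mul_of_nonneg_left h1 (norm_nonneg _))
    _ = _ := by ring

/-- By the ultrametric inequality the `p` summands cost nothing, so the normalized `U_p` contracts
as strongly as each of them. -/
lemma norm_sum_distAct_alpha_inv_le {k : ℕ} (hk : Even k) {ω : ℕ → Dk p} {M : ℝ} (hM0 : 0 ≤ M)
    (h0 : ∀ j < p, specialize k (ω j) = 0) (hM : ∀ j < p, ‖ω j‖ ≤ M) :
    ‖∑ j ∈ Finset.range p, distAct k (ω j) (alpha j)⁻¹ (alpha_inv_mem j)‖ ≤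
      ‖(p : ℚ_[p])‖ ^ (k / 2 + 1) * M := by
  refine ContinuousLinearMap.opNorm_le_bound _ (by positivity) fun F => ?_
  rw [sum_apply]
  refine IsUltrametricDist.norm_sum_le_of_forall_le_of_nonneg (by positivity) fun j hj => ?_
  have hj := Finset.mem_range.1 hj
  refine (ContinuousLinearMap.le_opNorm _ _).trans
    (mul_le_mul_of_nonneg_right ?_ (norm_nonneg _))
  exact (norm_distAct_alpha_inv_le hk j (h0 j hj)).trans
    (mul_le_mul_of_nonneg_left (hM j hj) (by positivity))

lemma norm_p_pow_lt_one (k : ℕ) : ‖(p : ℚ_[p])‖ ^ (k + 1) < 1 :=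
  pow_lt_one₀ (norm_nonneg _) Padic.norm_p_lt_one k.succ_ne_zero

/-- A bounded family of distributions killed by `𝒫_k` vanishes if each of its members is a sum of
`α_j⁻¹`-translates of other members. -/
lemma eq_zero_of_eq_sum_distAct {k : ℕ} (hk : Even k) {X : Type*} {Δ : X → Dk p} {y : X → ℕ → X}
    {M : ℝ} (hM : ∀ x, ‖Δ x‖ ≤ M) (h0 : ∀ x, specialize k (Δ x) = 0)
    (h : ∀ x, Δ x = ∑ j ∈ Finset.range p, distAct k (Δ (y x j)) (alpha j)⁻¹ (alpha_inv_mem j))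
    (x : X) : Δ x = 0 := by
  have hM0 : 0 ≤ M := (norm_nonneg (Δ x)).trans (hM x)
  have key : ∀ n : ℕ, ∀ x, ‖Δ x‖ ≤ (‖(p : ℚ_[p])‖ ^ (k / 2 + 1)) ^ n * M := by
    intro n
    induction n with
    | zero => intro x; simpa using hM x
    | succ n ih =>
      intro x
      rw [h x, pow_succ', mul_assoc]
      exact norm_sum_distAct_alpha_inv_le hk (by positivity) (fun j _ => h0 _) fun j _ => ih _
  have hlim : Tendsto (fun n : ℕ => (‖(p : ℚ_[p])‖ ^ (k / 2 + 1)) ^ n * M) atTop (𝓝 0) := by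
    simpa using (tendsto_pow_atTop_nhds_zero_of_lt_one (by positivity)
      (norm_p_pow_lt_one (p := p) (k / 2))).mul_const M
  exact (norm_le_zero_iff (a := Δ x)).1 (ge_of_tendsto' hlim fun n => key n x)

/-! ### The lift of a form to distributions -/

/-- The set `Γ \ GL₂(ℚ_p) / ℚ_pˣ Γ₀(p)` is finite. -/
def HasFiniteDoubleCosets (Γ : Subgroup (GL (Fin 2) ℚ_[p])) : Prop :=
  ∃ (X : Type) (_ : Finite X) (inv : GL (Fin 2) ℚ_[p] → X), ∀ g g', inv g = inv g' →
    ∃ u : ℚ_[p]ˣ, ∃ γ ∈ Γ, ∃ σ ∈ Gamma0 p,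
      g * σ = Matrix.GeneralLinearGroup.scalar (Fin 2) u * γ * g'

/-- A function on `GL₂(ℚ_p)` that is invariant under `ℚ_pˣ Γ` on the left and does not increase
under `Γ₀(pℤ_p)` on the right is bounded. -/
lemma HasFiniteDoubleCosets.bounded {Γ : Subgroup (GL (Fin 2) ℚ_[p])} (hΓ : HasFiniteDoubleCosets Γ)
    {f : GL (Fin 2) ℚ_[p] → ℝ}
    (hl : ∀ u : ℚ_[p]ˣ, ∀ γ ∈ Γ, ∀ g, f (Matrix.GeneralLinearGroup.scalar (Fin 2) u * γ * g) = f g)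
    (hr : ∀ σ ∈ Gamma0 p, ∀ g, f (g * σ) ≤ f g) : ∃ M, ∀ g, f g ≤ M := by
  obtain ⟨X, _, inv, h⟩ := hΓ
  have hex : ∀ x : X, ∃ m : ℝ, ∀ g, inv g = x → f g ≤ m := by
    intro x
    by_cases hx : ∃ g', inv g' = x
    · obtain ⟨g', rfl⟩ := hx
      refine ⟨f g', fun g hg => ?_⟩
      obtain ⟨u, γ, hγ, σ, hσ, e⟩ := h g g' hg
      have h1 := hr σ⁻¹ (Gamma0_inv hσ) (g * σ)
      rwa [mul_inv_cancel_right, e, hl u γ hγ] at h1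
    · exact ⟨0, fun g hg => absurd ⟨g, hg⟩ hx⟩
  choose m hm using hex
  obtain ⟨M, hM⟩ := (Set.finite_range m).bddAbove
  exact ⟨M, fun g => (hm _ g rfl).trans (hM ⟨_, rfl⟩)⟩

/-- The extension of a linear form on `𝒫_k` to the Tate algebra by zero on `xⁿ`, `n > k`. -/
def extendForm (k : ℕ) (ω : Vk p k) : Dk p :=
  LinearMap.mkContinuousOfExistsBound
    { toFun := fun F => ω ⟨F.trunc (k + 1), F.trunc_mem k⟩
      map_add' := fun F G => by
        rw [← map_add]; exact congrArg ω (Subtype.ext (F.trunc_add G _))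
      map_smul' := fun r F => by
        rw [← map_smul]; exact congrArg ω (Subtype.ext (F.trunc_smul r _)) } (by
    have hX : ∀ i ∈ Finset.range (k + 1),
        (Polynomial.X ^ i : Polynomial ℚ_[p]) ∈ Polynomial.degreeLE ℚ_[p] k := fun i hi => by
      rw [Polynomial.mem_degreeLE, Polynomial.degree_X_pow]
      exact_mod_cast Nat.lt_succ_iff.1 (Finset.mem_range.1 hi)
    refine ⟨∑ i ∈ (Finset.range (k + 1)).attach, ‖ω ⟨_, hX i.1 i.2⟩‖, fun F => ?_⟩
    have e : (⟨F.trunc (k + 1), F.trunc_mem k⟩ : Pk p k) =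
        ∑ i ∈ (Finset.range (k + 1)).attach, F i.1 • (⟨_, hX i.1 i.2⟩ : Pk p k) := by
      refine Subtype.ext ?_
      rw [AddSubmonoidClass.coe_finsetSum]
      change ∑ i ∈ Finset.range (k + 1), Polynomial.monomial i (F i) = _
      rw [← Finset.sum_attach]
      refine Finset.sum_congr rfl fun i _ => ?_
      rw [← Polynomial.C_mul_X_pow_eq_monomial, ← Polynomial.smul_eq_C_mul]
      rfl
    change ‖ω ⟨F.trunc (k + 1), F.trunc_mem k⟩‖ ≤ _
    rw [e, map_sum, Finset.sum_mul]
    refine (norm_sum_le _ _).trans (Finset.sum_le_sum fun i _ => ?_)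
    rw [map_smul, smul_eq_mul, norm_mul, mul_comm]
    exact mul_le_mul_of_nonneg_left (F.norm_apply_le _) (norm_nonneg _))

lemma extendForm_apply (k : ℕ) (ω : Vk p k) (F : Tate p) :
    extendForm k ω F = ω ⟨F.trunc (k + 1), F.trunc_mem k⟩ := rfl

lemma extendForm_polyToTate (k : ℕ) (ω : Vk p k) (P : Pk p k) :
    extendForm k ω (polyToTate P.1) = ω P := by
  rw [extendForm_apply]
  refine congrArg ω (Subtype.ext (Polynomial.ext fun n => ?_))
  rw [Tate.coeff_trunc, polyToTate_apply]
  split_ifs with h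
  · rfl
  · have := P.2
    rw [Polynomial.mem_degreeLE, Polynomial.degree_le_iff_coeff_zero] at this
    exact (this n (by exact_mod_cast (by omega : k < n))).symm

lemma specialize_extendForm (k : ℕ) (ω : Vk p k) : specialize k (extendForm k ω) = ω :=
  LinearMap.ext fun P => extendForm_polyToTate k ω P

/-- Extension by zero is not equivariant, but it is evaluation after truncation. Truncation and the
action of `Γ₀(pℤ_p)` do not increase norms, so `g ↦ ‖extendForm k (φ g)‖` is bounded on each double
coset. -/
lemma norm_extendForm_rightAct_le {k : ℕ} (hk : Even k) (ω : Vk p k) {σ : GL (Fin 2) ℚ_[p]}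
    (hσ : σ ∈ Gamma0 p) : ‖extendForm k (rightAct k ω σ)‖ ≤ ‖extendForm k ω‖ := by
  refine ContinuousLinearMap.opNorm_le_bound _ (norm_nonneg (extendForm k ω)) fun F => ?_
  have h1 : extendForm k (rightAct k ω σ) F =
      distAct k (extendForm k ω) σ (Gamma0_subset hσ) (polyToTate (F.trunc (k + 1))) := by
    rw [distAct, ContinuousLinearMap.comp_apply,
      tateAct_polyToTate hk _ (⟨_, F.trunc_mem k⟩ : Pk p k), extendForm_polyToTate]
    rfl
  rw [h1]
  exact (ContinuousLinearMap.le_opNorm _ _).trans (mul_le_mul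
    (norm_distAct_le_of_mem_Gamma0 k _ hσ) (F.norm_trunc_le _) (norm_nonneg _) (norm_nonneg (extendForm k ω)))

section Iteration

variable {k : ℕ} {Γ : Subgroup (GL (Fin 2) ℚ_[p])}

/-- The operator `p^{-k/2} U_p`. -/
def normUp (k : ℕ) (Φ : GL (Fin 2) ℚ_[p] → Dk p) (g : GL (Fin 2) ℚ_[p]) : Dk p :=
  ∑ j ∈ Finset.range p, distAct k (Φ (g * alpha j)) (alpha j)⁻¹ (alpha_inv_mem j)

lemma p_pow_ne_zero (n : ℕ) : (p : ℚ_[p]) ^ n ≠ 0 := pow_ne_zero _ coe_p_ne_zero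

lemma UpRigid_eq_iff {Φ : GL (Fin 2) ℚ_[p] → Dk p} {g : GL (Fin 2) ℚ_[p]} :
    UpRigid k Φ g = (p : ℚ_[p]) ^ (k / 2) • Φ g ↔ normUp k Φ g = Φ g := by
  have h : UpRigid k Φ g = (p : ℚ_[p]) ^ (k / 2) • normUp k Φ g := rfl
  rw [h]
  exact ⟨fun e => smul_right_injective (Dk p) (p_pow_ne_zero (k / 2)) e, fun e => by rw [e]⟩

lemma sum_rightAct_of_eigen {φ : GL (Fin 2) ℚ_[p] → Vk p k} {g : GL (Fin 2) ℚ_[p]}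
    (h : Up k φ g = (p : ℚ_[p]) ^ (k / 2) • φ g) :
    ∑ j ∈ Finset.range p, rightAct k (φ (g * alpha j)) (alpha j)⁻¹ = φ g :=
  (smul_right_inj (p_pow_ne_zero (k / 2))).1 h

lemma specialize_sum {ι : Type*} (s : Finset ι) (ω : ι → Dk p) :
    specialize k (∑ i ∈ s, ω i) = ∑ i ∈ s, specialize k (ω i) := by
  ext1 P
  simp [specialize_apply, sum_apply, LinearMap.sum_apply]

/-- Iterating the operator on any set-theoretic lift of an eigenform stays among lifts; hence
differences of iterates are killed by `𝒫_k`. -/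
lemma specialize_normUp (hk : Even k) {φ : GL (Fin 2) ℚ_[p] → Vk p k}
    {Φ : GL (Fin 2) ℚ_[p] → Dk p} (hΦ : ∀ g, specialize k (Φ g) = φ g)
    (hφ : ∀ g, Up k φ g = (p : ℚ_[p]) ^ (k / 2) • φ g) (g : GL (Fin 2) ℚ_[p]) :
    specialize k (normUp k Φ g) = φ g := by
  rw [normUp, specialize_sum, ← sum_rightAct_of_eigen (hφ g)]
  exact Finset.sum_congr rfl fun j _ => by rw [specialize_distAct hk, hΦ]

lemma normUp_sub (Φ Ψ : GL (Fin 2) ℚ_[p] → Dk p) (g : GL (Fin 2) ℚ_[p]) :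
    normUp k Φ g - normUp k Ψ g =
      ∑ j ∈ Finset.range p, distAct k (Φ (g * alpha j) - Ψ (g * alpha j)) (alpha j)⁻¹
        (alpha_inv_mem j) := by
  ext1 F
  simp only [normUp, distAct_sub, sub_apply, sum_apply, Finset.sum_sub_distrib]

lemma exists_norm_normUp_le (k : ℕ) : ∃ K : ℝ, ∀ (Φ : GL (Fin 2) ℚ_[p] → Dk p) (M : ℝ),
    (∀ g, ‖Φ g‖ ≤ M) → ∀ g, ‖normUp k Φ g‖ ≤ K * M := by
  refine ⟨∑ j ∈ Finset.range p, ‖tateAct k (alpha j : GL (Fin 2) ℚ_[p])⁻¹ (alpha_inv_mem j)‖,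
    fun Φ M hM g => ?_⟩
  rw [normUp, Finset.sum_mul]
  refine (norm_sum_le (E := Dk p) _ _).trans (Finset.sum_le_sum fun j _ => ?_)
  rw [mul_comm]
  exact (ContinuousLinearMap.opNorm_comp_le _ _).trans
    (mul_le_mul_of_nonneg_right (hM _) (norm_nonneg _))

/-- A bounded eigenform with values in `V_k` lifts to a bounded fixed point of `p^{-k/2} U_p`. -/
lemma exists_normUp_eq (hk : Even k) {φ : GL (Fin 2) ℚ_[p] → Vk p k} {M : ℝ}
    (hM : ∀ g, ‖extendForm k (φ g)‖ ≤ M)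
    (hφ : ∀ g, Up k φ g = (p : ℚ_[p]) ^ (k / 2) • φ g) :
    ∃ Φ : GL (Fin 2) ℚ_[p] → Dk p, (∃ C, ∀ g, ‖Φ g‖ ≤ C) ∧
      (∀ g, specialize k (Φ g) = φ g) ∧ ∀ g, normUp k Φ g = Φ g := by
  set Φ₀ : GL (Fin 2) ℚ_[p] → Dk p := fun g => extendForm k (φ g) with hΦ₀
  set S : ℕ → GL (Fin 2) ℚ_[p] → Dk p := fun n => (normUp k)^[n] Φ₀ with hS
  have hS1 : ∀ n g, S (n + 1) g = normUp k (S n) g := fun n g => by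
    simp only [hS, Function.iterate_succ_apply']
  have hspec : ∀ n g, specialize k (S n g) = φ g := by
    intro n
    induction n with
    | zero => exact fun g => specialize_extendForm k (φ g)
    | succ n ih =>
      intro g
      rw [hS1]
      exact specialize_normUp hk ih hφ g
  set q := ‖(p : ℚ_[p])‖ ^ (k / 2 + 1) with hq
  have hq0 : 0 ≤ q := by positivity
  have hq1 : q < 1 := norm_p_pow_lt_one _
  obtain ⟨K, hK⟩ := exists_norm_normUp_le (p := p) k
  have hM0 : 0 ≤ M := (norm_nonneg (Φ₀ 1)).trans (hM 1)
  have hKM : 0 ≤ K * M := (norm_nonneg (normUp k Φ₀ 1)).trans (hK _ M hM 1)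
  -- Only the first difference needs the crude bound `K` for the operator. All later ones are images
  -- of families killed by `𝒫_k` and shrink by `q`.
  have hdiff : ∀ n g, ‖S (n + 1) g - S n g‖ ≤ (K * M + M) * q ^ n := by
    intro n
    induction n with
    | zero =>
      intro g
      rw [pow_zero, mul_one, hS1]
      exact (norm_sub_le (normUp k Φ₀ g) (Φ₀ g)).trans (add_le_add (hK _ M hM g) (hM g))
    | succ n ih =>
      intro g
      rw [hS1, hS1 n g, normUp_sub, pow_succ', mul_left_comm]
      refine norm_sum_distAct_alpha_inv_le hk (by positivity) (fun j _ => ?_) fun j _ => ih _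
      ext1 P
      have h1 := congrArg (fun η : Vk p k => η P) (hspec (n + 1) (g * alpha j))
      have h2 := congrArg (fun η : Vk p k => η P) (hspec n (g * alpha j))
      simp only [specialize_apply] at h1 h2 ⊢
      rw [sub_apply, h1, h2, sub_self]
      rfl
  have hdist : ∀ g n, dist (S n g) (S (n + 1) g) ≤ (K * M + M) * q ^ n := fun g n => by
    exact (dist_comm _ _).trans_le ((dist_eq_norm (S (n + 1) g) (S n g)).trans_le (hdiff n g))
  have hlim : ∀ g, ∃ ω : Dk p, Tendsto (fun n => S n g) atTop (𝓝 ω) := fun g =>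
    cauchySeq_tendsto_of_complete (cauchySeq_of_le_geometric q _ hq1 (hdist g))
  choose Φ hΦ using hlim
  have hΦF : ∀ g F, Tendsto (fun n => S n g F) atTop (𝓝 (Φ g F)) := fun g F =>
    ((ContinuousLinearMap.apply ℚ_[p] ℚ_[p] F).continuous.tendsto (Φ g)).comp (hΦ g)
  refine ⟨Φ, ⟨(K * M + M) / (1 - q) + M, fun g => ?_⟩, fun g => ?_, fun g => ?_⟩
  · have h1 := dist_le_of_le_geometric_of_tendsto₀ q _ hq1 (hdist g) (hΦ g)
    have h2 : ‖Φ g - S 0 g‖ ≤ (K * M + M) / (1 - q) :=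
      (dist_eq_norm (Φ g) (S 0 g)).symm.trans_le ((dist_comm _ _).trans_le h1)
    calc ‖Φ g‖ = ‖(Φ g - S 0 g) + S 0 g‖ :=
        congrArg norm (sub_add_cancel (Φ g) (S 0 g)).symm
      _ ≤ _ := (norm_add_le (Φ g - S 0 g) (S 0 g)).trans (add_le_add h2 (hM g))
  · ext1 P
    refine tendsto_nhds_unique (hΦF g (polyToTate P.1)) (tendsto_const_nhds.congr fun n => ?_)
    rw [← specialize_apply, hspec]
  · ext1 F
    -- The fixed-point equation is the limit of `S (n + 1) = normUp k (S n)`, tested on each `F`.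
    refine tendsto_nhds_unique (f := fun n => S (n + 1) g F) (l := atTop) ?_
      ((hΦF g F).comp (tendsto_add_atTop_nat 1))
    simp only [hS1, normUp, sum_apply, distAct, ContinuousLinearMap.comp_apply]
    exact tendsto_finsetSum _ fun j _ => hΦF (g * alpha j) _

end Iteration

/-! ### Existence and uniqueness of the eigenlift -/

/-- The matrices `α_j` are permuted by `Γ₀(pℤ_p)`, up to `Γ₀(pℤ_p)` on the right. -/
lemma exists_perm_alpha {σ : GL (Fin 2) ℚ_[p]} (hσ : σ ∈ Gamma0 p) :
    ∃ (π : ℕ → ℕ) (τ : ℕ → GL (Fin 2) ℚ_[p]), (∀ j < p, π j < p) ∧ (∀ j, τ j ∈ Gamma0 p) ∧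
      (∀ j < p, σ * alpha j = alpha (π j) * τ j) ∧
      ∀ i < p, ∀ j < p, π i = π j → i = j := by
  obtain ⟨h1, h2, h3⟩ := mem_Gamma0.1 hσ
  have hd : ∀ j : ℕ, ‖σ 1 0 * j + σ 1 1‖ = 1 := by
    intro j
    have hj : ‖σ 1 0 * (j : ℚ_[p])‖ < 1 := by
      rw [norm_mul]
      exact mul_lt_one_of_nonneg_of_lt_one_left (norm_nonneg _) h2
        (IsUltrametricDist.norm_natCast_le_one _ _)
    have hd1 : ‖σ 1 1‖ = 1 := by
      refine le_antisymm (h1 1 1) (not_lt.1 fun hlt => ?_)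
      have : ‖σ 0 0 * σ 1 1 - σ 0 1 * σ 1 0‖ < 1 := by
        refine (padic_norm_sub_le_max _ _).trans_lt (max_lt ?_ ?_) <;> rw [norm_mul]
        exacts [mul_lt_one_of_nonneg_of_lt_one_right (h1 _ _) (norm_nonneg _) hlt,
          mul_lt_one_of_nonneg_of_lt_one_right (h1 _ _) (norm_nonneg _) h2]
      rw [h3] at this
      exact lt_irrefl _ this
    rw [IsUltrametricDist.norm_add_eq_max_of_norm_ne_norm (by rw [hd1]; exact hj.ne), hd1,
      max_eq_right hj.le]
  -- Take `i` to be the residue of `σ(j) = (aj + b)/(cj + d)`; then the upper right entry of the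
  -- product is divisible by `p` before division.
  have hex : ∀ j : ℕ, ∃ i < p, (alpha i)⁻¹ * σ * alpha j ∈ Gamma0 p := by
    intro j
    have hd0 : σ 1 0 * j + σ 1 1 ≠ 0 := norm_ne_zero_iff.1 (by rw [hd]; exact one_ne_zero)
    have hz : ‖(σ 0 0 * j + σ 0 1) / (σ 1 0 * j + σ 1 1)‖ ≤ 1 := by
      rw [norm_div, hd, div_one]
      refine (IsUltrametricDist.norm_add_le_max _ _).trans (max_le ?_ (h1 _ _))
      rw [norm_mul]
      exact mul_le_one₀ (h1 _ _) (norm_nonneg _) (IsUltrametricDist.norm_natCast_le_one _ _)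
    obtain ⟨i, hi, hlt⟩ := exists_digit hz
    refine ⟨i, hi, ?_⟩
    have hp := coe_p_ne_zero (p := p)
    obtain ⟨c1, c2, c3, c4⟩ := alpha_inv_entry (p := p) i
    obtain ⟨a1, a2, a3, a4⟩ := alpha_entry (p := p) j
    set τ : GL (Fin 2) ℚ_[p] := (alpha i)⁻¹ * σ * alpha j with hτ
    have t1 : τ 0 0 = σ 0 0 - i * σ 1 0 := by
      rw [hτ, mul_entry, mul_entry, mul_entry, c1, c2, a1, a3]; field_simp; ring
    have t2 : τ 0 1 = ((σ 0 0 * j + σ 0 1) - i * (σ 1 0 * j + σ 1 1)) / p := by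
      rw [hτ, mul_entry, mul_entry, mul_entry, c1, c2, a2, a4]; field_simp; ring
    have t3 : τ 1 0 = p * σ 1 0 := by
      rw [hτ, mul_entry, mul_entry, mul_entry, c3, c4, a1, a3]; ring
    have t4 : τ 1 1 = σ 1 0 * j + σ 1 1 := by
      rw [hτ, mul_entry, mul_entry, mul_entry, c3, c4, a2, a4]; ring
    have hn : ∀ m : ℕ, ‖(m : ℚ_[p])‖ ≤ 1 := fun m => IsUltrametricDist.norm_natCast_le_one _ _
    have ht2 : ‖τ 0 1‖ ≤ 1 := by
      rw [t2, norm_div_p_le_one_iff]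
      have e : (σ 0 0 * j + σ 0 1) - i * (σ 1 0 * j + σ 1 1) =
          ((σ 0 0 * j + σ 0 1) / (σ 1 0 * j + σ 1 1) - i) * (σ 1 0 * j + σ 1 1) := by
        rw [sub_mul, div_mul_cancel₀ _ hd0]
      rwa [e, norm_mul, hd, mul_one]
    have ht3 : ‖τ 1 0‖ < 1 := by
      rw [t3, norm_mul]
      exact mul_lt_one_of_nonneg_of_lt_one_left (norm_nonneg _) Padic.norm_p_lt_one (h1 _ _)
    refine mem_Gamma0.2 ⟨fun r s => ?_, ht3, ?_⟩
    · fin_cases r <;> fin_cases s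
      · change ‖τ 0 0‖ ≤ 1
        rw [t1]
        refine (padic_norm_sub_le_max _ _).trans (max_le (h1 _ _) ?_)
        rw [norm_mul]
        exact mul_le_one₀ (hn _) (norm_nonneg _) (h1 _ _)
      · exact ht2
      · exact ht3.le
      · change ‖τ 1 1‖ ≤ 1
        rw [t4, hd]
    · rw [t1, t2, t3, t4, ← h3]
      congr 1
      field_simp
      ring
  choose π hπ hτ using hex
  refine ⟨π, fun j => (alpha (π j))⁻¹ * σ * alpha j, fun j _ => hπ j, hτ, fun j _ => by
    simp only [mul_assoc, mul_inv_cancel_left], fun i hi j hj hij => ?_⟩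
  -- Equal images force `α_i⁻¹ α_j` into `Γ₀(pℤ_p)`, and its entry `(j - i)/p` is integral only if
  -- `i = j`.
  have hm := Gamma0_mul (Gamma0_inv (hτ i)) (hτ j)
  rw [hij] at hm
  have e : ((alpha (π j))⁻¹ * σ * alpha i)⁻¹ * ((alpha (π j))⁻¹ * σ * alpha j) =
      (alpha i)⁻¹ * alpha j := by group
  rw [e] at hm
  have h01 := (mem_Gamma0.1 hm).1 0 1
  obtain ⟨c1, c2, c3, c4⟩ := alpha_inv_entry (p := p) i
  obtain ⟨a1, a2, a3, a4⟩ := alpha_entry (p := p) j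
  rw [mul_entry, c1, c2, a2, a4, show (p : ℚ_[p])⁻¹ * j + -((p : ℚ_[p])⁻¹ * i) * 1 =
    ((j : ℚ_[p]) - i) / p by ring, norm_div_p_le_one_iff] at h01
  exact digit_unique hi hj h01 (by rw [sub_self, norm_zero]; exact one_pos)

section EigenLift

variable {k : ℕ} {Γ : Subgroup (GL (Fin 2) ℚ_[p])} {φ : GL (Fin 2) ℚ_[p] → Vk p k}
  {Φ Ψ : GL (Fin 2) ℚ_[p] → Dk p}

lemma specialize_sub (ω η : Dk p) : specialize k (ω - η) = specialize k ω - specialize k η := rfl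

/-- Bounded fixed points of `p^{-k/2} U_p` are determined by their restrictions to `𝒫_k`. -/
lemma eq_of_normUp_eq (hk : Even k) {S : Set (GL (Fin 2) ℚ_[p])}
    (hS : ∀ g ∈ S, ∀ j < p, g * alpha j ∈ S) {C : ℝ} (hΦC : ∀ g ∈ S, ‖Φ g‖ ≤ C)
    (hΨC : ∀ g ∈ S, ‖Ψ g‖ ≤ C) (hs : ∀ g ∈ S, specialize k (Φ g) = specialize k (Ψ g))
    (hΦ : ∀ g ∈ S, normUp k Φ g = Φ g) (hΨ : ∀ g ∈ S, normUp k Ψ g = Ψ g)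
    {g : GL (Fin 2) ℚ_[p]} (hg : g ∈ S) : Φ g = Ψ g := by
  classical
  refine sub_eq_zero.1 (eq_zero_of_eq_sum_distAct hk (X := S) (Δ := fun x => Φ x - Ψ x)
    -- The value for `j ≥ p` is irrelevant, as the recursion only uses `j < p`.
    (y := fun x j => if h : j < p then ⟨x.1 * alpha j, hS x x.2 j h⟩ else x) (M := C + C)
    (fun x => ?_) (fun x => ?_) (fun x => ?_) ⟨g, hg⟩)
  · exact (norm_sub_le (Φ x) (Ψ x)).trans (add_le_add (hΦC x x.2) (hΨC x x.2))
  · rw [specialize_sub, hs x x.2, sub_self]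
  · rw [← hΦ x x.2, ← hΨ x x.2, normUp_sub]
    refine Finset.sum_congr rfl fun j hj => ?_
    rw [dif_pos (Finset.mem_range.1 hj)]

lemma specialize_eq_of_Gamma0 (hk : Even k) (hφ : ∀ σ ∈ Gamma0 p, ∀ g, φ (g * σ) = rightAct k (φ g) σ)
    (hs : ∀ g, specialize k (Φ g) = φ g) {σ : GL (Fin 2) ℚ_[p]} (hσ : σ ∈ Gamma0 p)
    (g : GL (Fin 2) ℚ_[p]) :
    specialize k (Φ (g * σ) - distAct k (Φ g) σ (Gamma0_subset hσ)) = 0 := by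
  rw [specialize_sub, specialize_distAct hk, hs, hs, hφ σ hσ, sub_self]

/-- A bounded fixed point of `p^{-k/2} U_p` lifting a form is `Γ₀(pℤ_p)`-equivariant. -/
lemma equivariant_of_normUp_eq (hk : Even k)
    (hφ : ∀ σ ∈ Gamma0 p, ∀ g, φ (g * σ) = rightAct k (φ g) σ)
    (hs : ∀ g, specialize k (Φ g) = φ g) {C : ℝ} (hC : ∀ g, ‖Φ g‖ ≤ C)
    (hΦ : ∀ g, normUp k Φ g = Φ g) {σ : GL (Fin 2) ℚ_[p]} (hσ : σ ∈ Gamma0 p)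
    (g : GL (Fin 2) ℚ_[p]) : Φ (g * σ) = distAct k (Φ g) σ (Gamma0_subset hσ) := by
  choose π τ hπ hτ hc hinj using fun σ : Gamma0 p => exists_perm_alpha σ.2
  -- The defect `Φ(gσ) - Φ(g)·σ` is indexed by pairs because the recursion changes both components:
  -- `σα_j = α_{π j}τ_j` leads from `(σ, g)` to `(τ_j, gα_{π j})`.
  refine sub_eq_zero.1 (eq_zero_of_eq_sum_distAct hk (X := Gamma0 p × GL (Fin 2) ℚ_[p])
    (Δ := fun x => Φ (x.2 * x.1) - distAct k (Φ x.2) x.1 (Gamma0_subset x.1.2))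
    (y := fun x j => (⟨τ x.1 j, hτ x.1 j⟩, x.2 * alpha (π x.1 j))) (M := C + C)
    (fun x => ?_) (fun x => ?_) (fun x => ?_) (⟨σ, hσ⟩, g))
  · exact (norm_sub_le (Φ (x.2 * x.1)) (distAct k (Φ x.2) x.1 (Gamma0_subset x.1.2))).trans
      (add_le_add (hC _) ((norm_distAct_le_of_mem_Gamma0 k _ x.1.2).trans (hC _)))
  · exact specialize_eq_of_Gamma0 hk hφ hs x.1.2 x.2
  · obtain ⟨⟨σ, hσ⟩, g⟩ := x
    have e1 : Φ (g * σ) = ∑ j ∈ Finset.range p,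
        distAct k (Φ (g * alpha (π ⟨σ, hσ⟩ j) * τ ⟨σ, hσ⟩ j)) (alpha j)⁻¹ (alpha_inv_mem j) := by
      rw [← hΦ (g * σ)]
      refine Finset.sum_congr rfl fun j hj => ?_
      rw [mul_assoc, mul_assoc, ← hc ⟨σ, hσ⟩ j (Finset.mem_range.1 hj)]
    have e2 : distAct k (Φ g) σ (Gamma0_subset hσ) = ∑ j ∈ Finset.range p,
        distAct k (distAct k (Φ (g * alpha (π ⟨σ, hσ⟩ j))) (τ ⟨σ, hσ⟩ j)
          (Gamma0_subset (hτ ⟨σ, hσ⟩ j))) (alpha j)⁻¹ (alpha_inv_mem j) := by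
      conv_lhs => rw [← hΦ g, normUp, distAct_sum]
      symm
      have himg : (Finset.range p).image (π ⟨σ, hσ⟩) = Finset.range p := by
        refine Finset.eq_of_subset_of_card_le (fun i hi => ?_) ?_
        · obtain ⟨j, hj, rfl⟩ := Finset.mem_image.1 hi
          exact Finset.mem_range.2 (hπ _ j (Finset.mem_range.1 hj))
        · rw [Finset.card_image_of_injOn]
          intro i hi j hj h
          exact hinj _ i (Finset.mem_range.1 hi) j (Finset.mem_range.1 hj) h
      conv_rhs => rw [← himg]
      rw [Finset.sum_image fun i hi j hj h =>
        hinj _ i (Finset.mem_range.1 hi) j (Finset.mem_range.1 hj) h]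
      refine Finset.sum_congr rfl fun j hj => ?_
      have hm := hc ⟨σ, hσ⟩ j (Finset.mem_range.1 hj)
      have hm2 : τ ⟨σ, hσ⟩ j * (alpha j)⁻¹ = (alpha (π ⟨σ, hσ⟩ j))⁻¹ * σ := by
        rw [mul_inv_eq_iff_eq_mul, mul_assoc, eq_inv_mul_iff_mul_eq]
        exact hm.symm
      rw [← distAct_mul hk _ _ (QSigma0_mul (Gamma0_subset (hτ ⟨σ, hσ⟩ j)) (alpha_inv_mem j)),
        ← distAct_mul hk _ _ (QSigma0_mul (alpha_inv_mem _) (Gamma0_subset hσ))]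
      congr 1
    change Φ (g * σ) - distAct k (Φ g) σ (Gamma0_subset hσ) = _
    rw [e1, e2]
    ext1 F
    simp only [sub_apply, sum_apply, distAct_sub, Finset.sum_sub_distrib]

/-- Rigid forms are bounded. -/
lemma IsRigidForm.bounded (hΓ : HasFiniteDoubleCosets Γ) (hΦ : IsRigidForm Γ k Φ) :
    ∃ C, ∀ g, ‖Φ g‖ ≤ C :=
  hΓ.bounded (f := fun g => ‖Φ g‖)
    (fun u γ hγ g => congrArg norm (hΦ.left_invariant u γ hγ g))
    fun σ hσ g => (congrArg norm (hΦ.right_equivariant σ hσ g)).trans_le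
      (norm_distAct_le_of_mem_Gamma0 k _ hσ)

/-- Every eigenform lifts. -/
theorem exists_eigenLift (hk : Even k) (hΓ : HasFiniteDoubleCosets Γ) (hφ : IsForm Γ k φ)
    (he : ∀ g, Up k φ g = (p : ℚ_[p]) ^ (k / 2) • φ g) :
    ∃ Φ, IsEigenLift Γ k φ Φ := by
  obtain ⟨M, hM⟩ := hΓ.bounded (f := fun g => ‖extendForm k (φ g)‖)
    (fun u γ hγ g => by rw [hφ.left_invariant u γ hγ g])
    (fun σ hσ g => by
      rw [hφ.right_equivariant σ hσ g]; exact norm_extendForm_rightAct_le hk _ hσ)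
  obtain ⟨Φ, ⟨C, hC⟩, hs, hfix⟩ := exists_normUp_eq hk hM he
  refine ⟨Φ, ⟨fun u γ hγ g => ?_, fun σ hσ g => equivariant_of_normUp_eq hk hφ.right_equivariant
    hs hC hfix hσ g⟩, hs, fun g => UpRigid_eq_iff.2 (hfix g)⟩
  -- Left translation by `uγ` commutes with `U_p` and preserves `φ`, so the translate of `Φ` is
  -- another bounded fixed point over the same form.
  refine eq_of_normUp_eq hk (S := Set.univ) (C := C)
    (Φ := fun g => Φ (Matrix.GeneralLinearGroup.scalar (Fin 2) u * γ * g)) (Ψ := Φ)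
    (fun _ _ _ _ => trivial) (fun _ _ => hC _) (fun _ _ => hC _) (fun g _ => ?_)
    (fun g _ => ?_) (fun g _ => hfix g) (Set.mem_univ g)
  · rw [hs, hs, hφ.left_invariant u γ hγ]
  · rw [← hfix (Matrix.GeneralLinearGroup.scalar (Fin 2) u * γ * g)]
    exact Finset.sum_congr rfl fun j _ => congrArg
      (fun x => distAct k (Φ x) (alpha j)⁻¹ (alpha_inv_mem j)) (mul_assoc _ _ _).symm

/-- The lift is unique. -/
theorem IsEigenLift.unique (hk : Even k) (hΓ : HasFiniteDoubleCosets Γ) (hΦ : IsEigenLift Γ k φ Φ)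
    (hΨ : IsEigenLift Γ k φ Ψ) : Φ = Ψ := by
  obtain ⟨C, hC⟩ := hΦ.form.bounded hΓ
  obtain ⟨D, hD⟩ := hΨ.form.bounded hΓ
  funext g
  exact eq_of_normUp_eq hk (S := Set.univ) (C := max C D) (fun _ _ _ _ => trivial)
    (fun g _ => (hC g).trans (le_max_left _ _)) (fun g _ => (hD g).trans (le_max_right _ _))
    (fun g _ => by rw [hΦ.lifts, hΨ.lifts]) (fun g _ => UpRigid_eq_iff.1 (hΦ.eigen g))
    (fun g _ => UpRigid_eq_iff.1 (hΨ.eigen g)) (Set.mem_univ g)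

end EigenLift

/-! ### Expansions on balls -/

/-- Rational coordinates on a ball. -/
lemma coe_mem_ball_iff_exists {g : GL (Fin 2) ℚ_[p]} {x : ℚ_[p]} : (x : OnePoint ℚ_[p]) ∈ ball g ↔
    ∃ y, ‖y‖ ≤ 1 ∧ g 1 0 * y + g 1 1 ≠ 0 ∧ x = (g 0 0 * y + g 0 1) / (g 1 0 * y + g 1 1) := by
  have hdet := det_entry_ne_zero g
  rw [coe_mem_ball]
  constructor
  · intro h
    have h0 : g 0 0 - g 1 0 * x ≠ 0 := by
      intro h0
      rw [h0, norm_zero] at h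
      apply hdet
      linear_combination g 1 1 * h0 + g 1 0 * norm_le_zero_iff.1 h
    have e1 : g 1 0 * ((g 1 1 * x - g 0 1) / (g 0 0 - g 1 0 * x)) + g 1 1 =
        (g 0 0 * g 1 1 - g 0 1 * g 1 0) / (g 0 0 - g 1 0 * x) := by
      rw [eq_div_iff h0, add_mul, mul_assoc, div_mul_cancel₀ _ h0]; ring
    have e2 : g 0 0 * ((g 1 1 * x - g 0 1) / (g 0 0 - g 1 0 * x)) + g 0 1 =
        (g 0 0 * g 1 1 - g 0 1 * g 1 0) * x / (g 0 0 - g 1 0 * x) := by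
      rw [eq_div_iff h0, add_mul, mul_assoc, div_mul_cancel₀ _ h0]; ring
    refine ⟨(g 1 1 * x - g 0 1) / (g 0 0 - g 1 0 * x), ?_, ?_, ?_⟩
    · rw [norm_div]
      exact div_le_one_of_le₀ h (norm_nonneg _)
    · rw [e1]
      exact div_ne_zero hdet h0
    · rw [e1, e2, div_div_div_cancel_right₀ h0, mul_div_cancel_left₀ _ hdet]
  · rintro ⟨y, hy, h0, rfl⟩
    have e1 : g 1 1 * ((g 0 0 * y + g 0 1) / (g 1 0 * y + g 1 1)) - g 0 1 =
        (g 0 0 * g 1 1 - g 0 1 * g 1 0) / (g 1 0 * y + g 1 1) * y := by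
      rw [div_mul_eq_mul_div, eq_div_iff h0, sub_mul, mul_assoc, div_mul_cancel₀ _ h0]; ring
    have e2 : g 0 0 - g 1 0 * ((g 0 0 * y + g 0 1) / (g 1 0 * y + g 1 1)) =
        (g 0 0 * g 1 1 - g 0 1 * g 1 0) / (g 1 0 * y + g 1 1) := by
      rw [eq_div_iff h0, sub_mul, mul_assoc, div_mul_cancel₀ _ h0]; ring
    rw [e1, e2, norm_mul]
    exact mul_le_of_le_one_right (norm_nonneg _) hy

lemma denom_ne_zero_of_mem_ball {g : GL (Fin 2) ℚ_[p]} {x : ℚ_[p]}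
    (h : (x : OnePoint ℚ_[p]) ∈ ball g) : g 0 0 - g 1 0 * x ≠ 0 := by
  rw [coe_mem_ball] at h
  intro h0
  rw [h0, norm_zero] at h
  apply det_entry_ne_zero g
  linear_combination g 1 1 * h0 + g 1 0 * norm_le_zero_iff.1 h

lemma inv_denom_ne_zero {g : GL (Fin 2) ℚ_[p]} {x : ℚ_[p]} (h : g 0 0 - g 1 0 * x ≠ 0) :
    g⁻¹ 1 0 * x + g⁻¹ 1 1 ≠ 0 := by
  obtain ⟨e1, e2, e3, e4⟩ := inv_entry g
  rw [e3, e4, show ∀ d a b c : ℚ_[p], -(d * a) * b + d * c = d * (c - a * b) from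
    fun _ _ _ _ => by ring]
  exact mul_ne_zero (inv_ne_zero (det_val_ne_zero g)) h

lemma slash_slash_inv {k : ℕ} (f : ℚ_[p] → ℚ_[p]) {g : GL (Fin 2) ℚ_[p]} {x : ℚ_[p]}
    (h : g 0 0 - g 1 0 * x ≠ 0) : slash k (slash k f g) g⁻¹ x = f x := by
  rw [slash_mul k f g g⁻¹ (inv_denom_ne_zero h), mul_inv_cancel, slash_one]

lemma slash_inv_slash {k : ℕ} (f : ℚ_[p] → ℚ_[p]) {g : GL (Fin 2) ℚ_[p]} {y : ℚ_[p]}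
    (h : g 1 0 * y + g 1 1 ≠ 0) : slash k (slash k f g⁻¹) g y = f y := by
  rw [slash_mul k f g⁻¹ g h, inv_mul_cancel, slash_one]

/-- `F` is the expansion of `f ·_k g` on `ℤ_p`, that is, `f = F ·_k g⁻¹` on the ball `g ℤ_p`. -/
def IsTateExp (k : ℕ) (f : ℚ_[p] → ℚ_[p]) (g : GL (Fin 2) ℚ_[p]) (F : Tate p) : Prop :=
  ∀ z, ‖z‖ ≤ 1 → g 1 0 * z + g 1 1 ≠ 0 → F.eval z = slash k f g z

section

variable {k : ℕ} {f f' : ℚ_[p] → ℚ_[p]} {g h : GL (Fin 2) ℚ_[p]} {F G : Tate p}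

lemma IsTateExp.unique (hF : IsTateExp k f g F) (hG : IsTateExp k f g G) : F = G := by
  refine Tate.ext_eval ?_
  filter_upwards [eventually_linear_ne_zero g] with s hs
  rw [hF _ (norm_p_pow_le_one s) hs, hG _ (norm_p_pow_le_one s) hs]

lemma IsTateExp.congr (hF : IsTateExp k f g F)
    (h : ∀ x : ℚ_[p], (x : OnePoint ℚ_[p]) ∈ ball g → f x = f' x) : IsTateExp k f' g F := by
  intro z hz hd
  rw [hF z hz hd, slash, slash, h _ (coe_mem_ball_iff_exists.2 ⟨z, hz, hd, rfl⟩)]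

lemma IsTateExp.add (hF : IsTateExp k f g F) (hG : IsTateExp k f' g G) :
    IsTateExp k (f + f') g (F + G) := by
  intro z hz hd
  rw [Tate.eval_add _ _ hz, slash_add, hF z hz hd, hG z hz hd]

lemma IsTateExp.smul (r : ℚ_[p]) (hF : IsTateExp k f g F) : IsTateExp k (r • f) g (r • F) := by
  intro z hz hd
  rw [Tate.eval_smul, slash_smul, hF z hz hd]

lemma isTateExp_slash_inv (k : ℕ) (g : GL (Fin 2) ℚ_[p]) (F : Tate p) :
    IsTateExp k (slash k F.eval g⁻¹) g F := fun _ _ hd => (slash_inv_slash F.eval hd).symm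

/-- The expansion is given in the coordinate on `ℤ_p`; undoing the slash by `g` recovers the
function at every finite point of the ball. -/
lemma IsTateExp.eq_of_mem_ball (hF : IsTateExp k f g F) {x : ℚ_[p]}
    (hx : (x : OnePoint ℚ_[p]) ∈ ball g) : f x = slash k F.eval g⁻¹ x := by
  have h0 := denom_ne_zero_of_mem_ball hx
  rw [← slash_slash_inv (k := k) f h0]
  obtain ⟨y, hy, hd, rfl⟩ := coe_mem_ball_iff_exists.1 hx
  have e : ∀ u : ℚ_[p] → ℚ_[p], u y = slash k f g y → slash k (slash k f g) g⁻¹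
      ((g 0 0 * y + g 0 1) / (g 1 0 * y + g 1 1)) = slash k u g⁻¹
      ((g 0 0 * y + g 0 1) / (g 1 0 * y + g 1 1)) := by
    intro u hu
    have hw : (g⁻¹ 0 0 * ((g 0 0 * y + g 0 1) / (g 1 0 * y + g 1 1)) + g⁻¹ 0 1) /
        (g⁻¹ 1 0 * ((g 0 0 * y + g 0 1) / (g 1 0 * y + g 1 1)) + g⁻¹ 1 1) = y := by
      have hdet := det_entry_ne_zero g
      obtain ⟨e1, e2, e3, e4⟩ := inv_entry g
      have hD := inv_ne_zero (det_val_ne_zero g)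
      rw [e1, e2, e3, e4]
      generalize g.1.det⁻¹ = D at *
      rw [show D * g 1 1 * ((g 0 0 * y + g 0 1) / (g 1 0 * y + g 1 1)) + -(D * g 0 1) =
        D * (g 0 0 * g 1 1 - g 0 1 * g 1 0) / (g 1 0 * y + g 1 1) * y by
          rw [div_mul_eq_mul_div, eq_div_iff hd, add_mul, mul_assoc (D * g 1 1),
            div_mul_cancel₀ _ hd]; ring,
        show -(D * g 1 0) * ((g 0 0 * y + g 0 1) / (g 1 0 * y + g 1 1)) + D * g 0 0 =
        D * (g 0 0 * g 1 1 - g 0 1 * g 1 0) / (g 1 0 * y + g 1 1) by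
          rw [eq_div_iff hd, add_mul, mul_assoc (-(D * g 1 0)), div_mul_cancel₀ _ hd]; ring]
      exact mul_div_cancel_left₀ _ (div_ne_zero (mul_ne_zero hD hdet) hd)
    change _ * slash k f g _ = _ * u _
    rw [hw, hu]
  exact e F.eval (hF y hy hd)

/-- The condition on `h⁻¹` means that `h` maps `ℤ_p` into itself without poles, so `gh ℤ_p` is a
subball of `g ℤ_p`. -/
lemma QSigma0.inv_denom (hh : h⁻¹ ∈ QSigma0 p) {z : ℚ_[p]} (hz : ‖z‖ ≤ 1) :
    h 1 0 * z + h 1 1 ≠ 0 ∧ ‖(h 0 0 * z + h 0 1) / (h 1 0 * z + h 1 1)‖ ≤ 1 := by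
  obtain ⟨h0, h1⟩ := QSigma0.denom hh hz
  obtain ⟨e1, e2, e3, e4⟩ := inv_entry h
  have hD := inv_ne_zero (det_val_ne_zero h)
  rw [e1, e3, show ∀ d a b z : ℚ_[p], d * a - -(d * b) * z = d * (b * z + a) from
    fun _ _ _ _ => by ring] at h0 h1
  rw [e2, e4, show ∀ d a b z : ℚ_[p], d * a * z - -(d * b) = d * (a * z + b) from
    fun _ _ _ _ => by ring, mul_div_mul_left _ _ hD] at h1
  exact ⟨right_ne_zero_of_mul h0, h1⟩

/-- Expansions on a ball restrict to expansions on smaller balls. -/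
lemma IsTateExp.mul (hk : Even k) (hF : IsTateExp k f g F) (hh : h⁻¹ ∈ QSigma0 p) :
    IsTateExp k f (g * h) (tateAct k h⁻¹ hh F) := by
  intro z hz hd
  obtain ⟨h0, h1⟩ := QSigma0.inv_denom hh hz
  rw [eval_tateAct hk hh F hz, inv_inv, ← slash_mul k f g h h0]
  have h2 : g 1 0 * ((h 0 0 * z + h 0 1) / (h 1 0 * z + h 1 1)) + g 1 1 ≠ 0 := by
    intro h2
    apply hd
    rw [mul_entry, mul_entry]
    have h3 := congrArg (fun t => t * (h 1 0 * z + h 1 1)) h2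
    simp only [add_mul, zero_mul] at h3
    rw [mul_assoc (g 1 0), div_mul_cancel₀ _ h0] at h3
    linear_combination h3
  rw [slash, slash, hF _ h1 h2]

end

/-! ### Local analyticity -/

lemma Tate.analyticAt_zero (F : Tate p) : AnalyticAt ℚ_[p] F.eval 0 := by
  refine ⟨FormalMultilinearSeries.ofScalars ℚ_[p] (fun n => F n), hasFPowerSeriesAt_iff.2 ?_⟩
  filter_upwards [Metric.ball_mem_nhds (0 : ℚ_[p]) one_pos] with z hz
  rw [zero_add]
  have hz : ‖z‖ ≤ 1 := by simpa using (Metric.mem_ball.1 hz).le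
  refine (F.summable hz).hasSum.congr_fun ?_
  intro n
  rw [FormalMultilinearSeries.coeff_ofScalars, smul_eq_mul, mul_comm]

lemma aff_inv_mem {s : ℕ} {a : ℚ_[p]} (ha : ‖a‖ ≤ 1) : (aff s a)⁻¹ ∈ QSigma0 p := by
  obtain ⟨a, rfl⟩ : ∃ b : ℤ_[p], (b : ℚ_[p]) = a := ⟨⟨a, ha⟩, rfl⟩
  have hp := p_pow_ne_zero (p := p) s
  obtain ⟨a1, a2, a3, a4⟩ := aff_entry (p := p) s (a : ℚ_[p])
  have hd : (aff s (a : ℚ_[p])).1.det = (p : ℚ_[p]) ^ s := by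
    rw [det_entry, a1, a2, a3, a4, zpow_natCast]; ring
  obtain ⟨e1, e2, e3, e4⟩ := inv_entry (aff s (a : ℚ_[p]))
  rw [hd, a4] at e1
  rw [hd, a2] at e2
  rw [hd, a3] at e3
  rw [hd, a1, zpow_natCast] at e4
  refine ⟨(Units.mk0 ((p : ℚ_[p]) ^ s) hp)⁻¹, !![1, -a; 0, (p : ℤ_[p]) ^ s],
    ⟨by simp, by simp, ?_⟩, ?_⟩
  · simp [Matrix.det_fin_two, (Fact.out : p.Prime).ne_zero]
  · ext i j
    rw [Units.val_inv_eq_inv_val, Units.val_mk0]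
    fin_cases i <;> fin_cases j
    · exact e1.trans (by simp)
    · exact e2.trans (by simp)
    · exact e3.trans (by simp)
    · exact e4.trans (by simp)

/-- The weight `0` action of a translation re-expands `F` around `w`, reducing to analyticity at the
origin. -/
lemma Tate.analyticAt (F : Tate p) {w : ℚ_[p]} (hw : ‖w‖ ≤ 1) : AnalyticAt ℚ_[p] F.eval w := by
  have hm : (aff ((0 : ℕ) : ℤ) w)⁻¹ ∈ QSigma0 p := aff_inv_mem hw
  set G := tateAct 0 (aff ((0 : ℕ) : ℤ) w)⁻¹ hm F with hG
  have h1 : AnalyticAt ℚ_[p] (fun z => G.eval (z - w)) w := by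
    refine AnalyticAt.fun_comp ?_ (analyticAt_id.sub analyticAt_const)
    simpa using G.analyticAt_zero
  refine h1.congr ?_
  filter_upwards [Metric.ball_mem_nhds w one_pos] with z hz
  have hz : ‖z - w‖ ≤ 1 := by rw [← dist_eq_norm]; exact (Metric.mem_ball.1 hz).le
  obtain ⟨a1, a2, a3, a4⟩ := aff_entry (p := p) ((0 : ℕ) : ℤ) w
  rw [hG, eval_tateAct (by decide) hm F hz, inv_inv, slash, a1, a2, a3, a4]
  simp

/-- A function analytic at `a` is given by an element of the Tate algebra on a small ball. -/
lemma exists_tate_of_analyticAt {U : ℚ_[p] → ℚ_[p]} {a : ℚ_[p]} (hU : AnalyticAt ℚ_[p] U a) :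
    ∀ᶠ N : ℕ in atTop, ∃ F : Tate p, ∀ z, ‖z‖ ≤ 1 → F.eval z = U (a + (p : ℚ_[p]) ^ N * z) := by
  obtain ⟨q, hq⟩ := hU
  have hq := hasFPowerSeriesAt_iff.1 hq
  obtain ⟨ε, hε, hb⟩ := Metric.eventually_nhds_iff.1 hq
  have hlim : Tendsto (fun N : ℕ => ‖(p : ℚ_[p])‖ ^ N) atTop (𝓝 0) :=
    tendsto_pow_atTop_nhds_zero_of_lt_one (norm_nonneg _) Padic.norm_p_lt_one
  filter_upwards [hlim.eventually (gt_mem_nhds hε)] with N hN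
  have hs : ∀ z : ℚ_[p], ‖z‖ ≤ 1 → HasSum (fun n => ((p : ℚ_[p]) ^ N * z) ^ n • q.coeff n)
      (U (a + (p : ℚ_[p]) ^ N * z)) := by
    intro z hz
    refine hb ?_
    rw [dist_zero_right, norm_mul, norm_pow]
    exact (mul_le_of_le_one_right (by positivity) hz).trans_lt hN
  refine ⟨⟨⟨fun n => ((p : ℚ_[p]) ^ N) ^ n * q.coeff n, continuous_of_discreteTopology⟩, ?_⟩, ?_⟩
  -- Convergence at `z = 1` alone forces the rescaled coefficients to tend to zero.
  · rw [cocompact_eq_atTop]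
    simpa using (hs 1 (by simp)).summable.tendsto_atTop_zero
  · intro z hz
    refine HasSum.tsum_eq ((hs z hz).congr_fun fun n => ?_)
    change ((p : ℚ_[p]) ^ N) ^ n * q.coeff n * z ^ n = _
    rw [smul_eq_mul, mul_pow]
    ring

/-! ### Functions in `A_k^loc` and their expansions -/

section

variable {k : ℕ} {f f' : ℚ_[p] → ℚ_[p]} {g : GL (Fin 2) ℚ_[p]}

/-- Near each point `f ·_k g` agrees with an analytic function, except perhaps at its pole. -/
lemma exists_analyticAt_slash (hf : f ∈ AkLoc p k) (g : GL (Fin 2) ℚ_[p]) (a : ℚ_[p]) :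
    ∃ U : ℚ_[p] → ℚ_[p], AnalyticAt ℚ_[p] U a ∧
      ∀ᶠ y in 𝓝 a, g 1 0 * y + g 1 1 ≠ 0 → slash k f g y = U y := by
  obtain ⟨hf, h, hh, he⟩ := hf
  have hlin : ∀ b c : ℚ_[p], AnalyticAt ℚ_[p] (fun y => b * y + c) a := fun b c =>
    (analyticAt_const.mul analyticAt_id).add analyticAt_const
  by_cases h0 : g 1 0 * a + g 1 1 = 0
  · have hc : g 1 0 ≠ 0 := by
      intro hc
      apply det_entry_ne_zero g
      rw [hc, zero_mul, zero_add] at h0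
      rw [hc, h0]; ring
    have hA : g 0 0 * a + g 0 1 ≠ 0 := by
      intro hA
      apply det_entry_ne_zero g
      linear_combination g 1 1 * 0 + g 0 0 * h0 - g 1 0 * hA
    have ht0 : AnalyticAt ℚ_[p] (fun y => (g 1 0 * y + g 1 1) / (g 0 0 * y + g 0 1)) a :=
      (hlin _ _).div (hlin _ _) hA
    have hval : (g 1 0 * a + g 1 1) / (g 0 0 * a + g 0 1) = 0 := by rw [h0, zero_div]
    -- At the pole put `t = (cy+d)/(ay+b)`. Then `(cy+d)^k f(1/t) = (ay+b)^k t^k f(1/t)`, and `t^k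
    -- f(1/t)` extends analytically by the condition at `∞`.
    refine ⟨fun y => (g.1.det ^ (k / 2))⁻¹ * ((g 0 0 * y + g 0 1) ^ k *
      h ((g 1 0 * y + g 1 1) / (g 0 0 * y + g 0 1))), ?_, ?_⟩
    · refine analyticAt_const.mul (((hlin _ _).pow k).mul (AnalyticAt.fun_comp ?_ ht0))
      rwa [hval]
    · have hcont := ht0.continuousAt.tendsto
      rw [hval] at hcont
      have hA2 : ∀ᶠ y in 𝓝 a, g 0 0 * y + g 0 1 ≠ 0 :=
        (hlin (g 0 0) (g 0 1)).continuousAt.eventually_ne hA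
      filter_upwards [hcont.eventually (eventually_nhdsWithin_iff.1 he), hA2] with y hy hAy hd
      have hne : (g 1 0 * y + g 1 1) / (g 0 0 * y + g 0 1) ≠ 0 := div_ne_zero hd hAy
      rw [← hy hne, slash, inv_div, div_pow, mul_assoc]
      congr 1
      rw [← mul_assoc, mul_div_cancel₀ _ (pow_ne_zero k hAy)]
  · refine ⟨slash k f g, ?_, Eventually.of_forall fun y _ => rfl⟩
    refine (analyticAt_const.mul ((hlin _ _).pow k)).mul (AnalyticAt.fun_comp (hf _) ?_)
    exact (hlin _ _).div (hlin _ _) h0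

lemma slash_aff (N : ℤ) (a : ℚ_[p]) (u : ℚ_[p] → ℚ_[p]) (z : ℚ_[p]) :
    slash k u (aff N a) z = (((p : ℚ_[p]) ^ N) ^ (k / 2))⁻¹ * u (a + (p : ℚ_[p]) ^ N * z) := by
  obtain ⟨a1, a2, a3, a4⟩ := aff_entry (p := p) N a
  rw [slash, det_entry, a1, a2, a3, a4, zero_mul, zero_add, one_pow, mul_one, mul_one, mul_zero,
    sub_zero, div_one, add_comm]

/-- An element of `A_k^loc` has expansions on all small balls around a point. -/
lemma exists_isTateExp_aff (hf : f ∈ AkLoc p k) (g : GL (Fin 2) ℚ_[p]) (a : ℚ_[p]) :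
    ∃ N : ℕ, ∃ F, IsTateExp k f (g * aff N a) F := by
  obtain ⟨U, hU, he⟩ := exists_analyticAt_slash hf g a
  obtain ⟨ε, hε, hb⟩ := Metric.eventually_nhds_iff.1 he
  have hlim : Tendsto (fun N : ℕ => ‖(p : ℚ_[p])‖ ^ N) atTop (𝓝 0) :=
    tendsto_pow_atTop_nhds_zero_of_lt_one (norm_nonneg _) Padic.norm_p_lt_one
  obtain ⟨N, hN, F, hF⟩ := ((hlim.eventually (gt_mem_nhds hε)).and
    (exists_tate_of_analyticAt hU)).exists
  refine ⟨N, (((p : ℚ_[p]) ^ (N : ℤ)) ^ (k / 2))⁻¹ • F, fun z hz hd => ?_⟩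
  obtain ⟨a1, a2, a3, a4⟩ := aff_entry (p := p) N a
  have h1 : aff (N : ℤ) a 1 0 * z + aff (N : ℤ) a 1 1 ≠ 0 := by rw [a3, a4]; simp
  have h2 : g 1 0 * (a + (p : ℚ_[p]) ^ (N : ℤ) * z) + g 1 1 ≠ 0 := by
    rw [mul_entry, mul_entry, a1, a2, a3, a4] at hd
    intro h
    apply hd
    linear_combination h
  have h3 : dist (a + (p : ℚ_[p]) ^ (N : ℤ) * z) a < ε := by
    rw [dist_eq_norm, add_sub_cancel_left, norm_mul, zpow_natCast, norm_pow]
    exact (mul_le_of_le_one_right (by positivity) hz).trans_lt hN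
  rw [Tate.eval_smul, ← slash_mul k f g _ h1, slash_aff, hb h3 h2, hF z hz, zpow_natCast]

/-- `f` has expansions on all the balls `g α_{j₁} ⋯ α_{jₙ} ℤ_p`. -/
def HasExp (k : ℕ) (f : ℚ_[p] → ℚ_[p]) : ℕ → GL (Fin 2) ℚ_[p] → Prop
  | 0, g => ∃ F, IsTateExp k f g F
  | n + 1, g => ∀ j < p, HasExp k f n (g * alpha j)

lemma norm_digit_add_le (j : ℕ) {a : ℚ_[p]} (ha : ‖a‖ ≤ 1) : ‖(j : ℚ_[p]) + p * a‖ ≤ 1 := by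
  refine (IsUltrametricDist.norm_add_le_max _ _).trans
    (max_le (IsUltrametricDist.norm_natCast_le_one _ _) ?_)
  rw [norm_mul]
  exact mul_le_one₀ Padic.norm_p_lt_one.le (norm_nonneg _) ha

lemma aff_zero : aff 0 (0 : ℚ_[p]) = 1 := by
  obtain ⟨a1, a2, a3, a4⟩ := aff_entry (p := p) 0 0
  apply GL_ext <;> simp [a1, a2, a3, a4]

lemma hasExp_of_aff {n : ℕ} : ∀ {g : GL (Fin 2) ℚ_[p]},
    (∀ a : ℚ_[p], ‖a‖ ≤ 1 → ∃ F, IsTateExp k f (g * aff n a) F) → HasExp k f n g := by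
  induction n with
  | zero =>
    intro g h
    obtain ⟨F, hF⟩ := h 0 (by simp)
    rw [Nat.cast_zero, aff_zero, mul_one] at hF
    exact ⟨F, hF⟩
  | succ n ih =>
    intro g h j _
    refine ih fun a ha => ?_
    have := h (j + p * a) (norm_digit_add_le j ha)
    rwa [mul_assoc, alpha_eq_aff, aff_mul, zpow_one, show (1 : ℤ) + n = ((n + 1 : ℕ) : ℤ) by
      push_cast; ring]

/-- Any point of a disc is a centre of it, so an expansion on one disc restricts to all smaller
discs inside it, wherever they are centred. -/
lemma IsTateExp.aff_of_norm_le {a b : ℚ_[p]} {N M : ℕ} {F : Tate p}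
    (hF : IsTateExp k f (g * aff N a) F) (hk : Even k) (hM : N ≤ M)
    (hb : ‖b - a‖ ≤ ‖(p : ℚ_[p]) ^ N‖) : ∃ F, IsTateExp k f (g * aff M b) F := by
  have hw : ‖((p : ℚ_[p]) ^ N)⁻¹ * (b - a)‖ ≤ 1 := by
    rw [norm_mul, norm_inv, inv_mul_le_one₀ (norm_pos_iff.2 (p_pow_ne_zero N))]
    exact hb
  have e : aff (M : ℤ) b = aff (N : ℤ) a *
      aff ((M - N : ℕ) : ℤ) (((p : ℚ_[p]) ^ N)⁻¹ * (b - a)) := by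
    rw [aff_mul, zpow_natCast, mul_inv_cancel_left₀ (p_pow_ne_zero N), add_sub_cancel,
      Nat.cast_sub hM, add_sub_cancel]
  rw [e, ← mul_assoc]
  exact ⟨_, hF.mul hk (aff_inv_mem hw)⟩

/-- By compactness, elements of `A_k^loc` have expansions on the pieces of a finite partition. -/
lemma exists_hasExp (hf : f ∈ AkLoc p k) (hk : Even k) (g : GL (Fin 2) ℚ_[p]) :
    ∃ n, HasExp k f n g := by
  suffices h : ∃ N : ℕ, ∀ M ≥ N, ∀ a ∈ (Set.univ : Set ℤ_[p]),
      ∃ F, IsTateExp k f (g * aff M (a : ℚ_[p])) F by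
    obtain ⟨N, hN⟩ := h
    exact ⟨N, hasExp_of_aff fun a ha => hN N le_rfl ⟨a, ha⟩ trivial⟩
  -- Asking for all radii beyond `N` makes the property stable under unions, by taking the maximum.
  refine IsCompact.induction_on (p := fun s : Set ℤ_[p] => ∃ N : ℕ, ∀ M ≥ N, ∀ a ∈ s,
      ∃ F, IsTateExp k f (g * aff M (a : ℚ_[p])) F) isCompact_univ ⟨0, by simp⟩ ?_ ?_ ?_
  · rintro s t hst ⟨N, hN⟩
    exact ⟨N, fun M hM a ha => hN M hM a (hst ha)⟩
  · rintro s t ⟨N, hN⟩ ⟨N', hN'⟩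
    refine ⟨max N N', fun M hM a ha => ?_⟩
    rcases ha with ha | ha
    · exact hN M ((le_max_left _ _).trans hM) a ha
    · exact hN' M ((le_max_right _ _).trans hM) a ha
  · intro a _
    obtain ⟨N, F, hF⟩ := exists_isTateExp_aff hf g (a : ℚ_[p])
    have hpos : 0 < ‖(p : ℚ_[p]) ^ N‖ := norm_pos_iff.2 (p_pow_ne_zero N)
    refine ⟨{b | ‖(b : ℚ_[p]) - a‖ < ‖(p : ℚ_[p]) ^ N‖}, mem_nhdsWithin_of_mem_nhds ?_, N,
      fun M hM b hb => ?_⟩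
    · refine Filter.mem_of_superset (Metric.ball_mem_nhds a hpos) fun b hb => ?_
      have := Metric.mem_ball.1 hb
      rw [dist_eq_norm] at this
      exact this
    · exact hF.aff_of_norm_le hk hM (le_of_lt hb)

lemma isOpen_compl_ball (g : GL (Fin 2) ℚ_[p]) :
    IsOpen {x : ℚ_[p] | (x : OnePoint ℚ_[p]) ∉ ball g} := by
  have e : {x : ℚ_[p] | (x : OnePoint ℚ_[p]) ∉ ball g} =
      {x | ‖g 0 0 - g 1 0 * x‖ < ‖g 1 1 * x - g 0 1‖} := by
    ext x
    rw [Set.mem_ofPred_eq, Set.mem_ofPred_eq, coe_mem_ball, not_le]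
  rw [e]
  exact isOpen_lt (by fun_prop) (by fun_prop)

lemma isOpen_ball (g : GL (Fin 2) ℚ_[p]) : IsOpen {x : ℚ_[p] | (x : OnePoint ℚ_[p]) ∈ ball g} := by
  have e : {x : ℚ_[p] | (x : OnePoint ℚ_[p]) ∈ ball g} =
      {x : ℚ_[p] | (x : OnePoint ℚ_[p]) ∉ ball (g * g0 p)} := by
    ext x
    rw [Set.mem_ofPred_eq, Set.mem_ofPred_eq, coe_mem_ball_mul_g0, not_not]
  rw [e]
  exact isOpen_compl_ball _

lemma cut_of_mem {U : Set (OnePoint ℚ_[p])} {x : ℚ_[p]} (h : (x : OnePoint ℚ_[p]) ∈ U) :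
    cut U f x = f x := if_pos h

lemma cut_of_notMem {U : Set (OnePoint ℚ_[p])} {x : ℚ_[p]} (h : (x : OnePoint ℚ_[p]) ∉ U) :
    cut U f x = 0 := if_neg h

/-- Balls are open and closed. Near a point of the ball the function is `F` composed with a regular
fraction, and near any other point it is zero. -/
lemma analyticAt_cut_slash (hk : Even k) (g : GL (Fin 2) ℚ_[p]) (F : Tate p) (x : ℚ_[p]) :
    AnalyticAt ℚ_[p] (cut (ball g) (slash k F.eval g⁻¹)) x := by
  by_cases hx : (x : OnePoint ℚ_[p]) ∈ ball g
  · have h0 := denom_ne_zero_of_mem_ball hx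
    have hw : ‖(g 1 1 * x - g 0 1) / (g 0 0 - g 1 0 * x)‖ ≤ 1 := by
      rw [norm_div]
      exact div_le_one_of_le₀ ((coe_mem_ball _ _).1 hx) (norm_nonneg _)
    have hden : AnalyticAt ℚ_[p] (fun y => g 0 0 - g 1 0 * y) x :=
      analyticAt_const.sub (analyticAt_const.mul analyticAt_id)
    have hnum : AnalyticAt ℚ_[p] (fun y => g 1 1 * y - g 0 1) x :=
      (analyticAt_const.mul analyticAt_id).sub analyticAt_const
    have h1 : AnalyticAt ℚ_[p] (fun y => (g.1.det ^ (k / 2))⁻¹ * (g 0 0 - g 1 0 * y) ^ k *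
        F.eval ((g 1 1 * y - g 0 1) / (g 0 0 - g 1 0 * y))) x :=
      (analyticAt_const.mul (hden.pow k)).mul
        (AnalyticAt.fun_comp (F.analyticAt hw) (hnum.div hden h0))
    refine h1.congr ?_
    filter_upwards [(isOpen_ball g).mem_nhds hx] with y hy
    rw [cut_of_mem hy, slash_inv hk]
  · refine (analyticAt_const (v := (0 : ℚ_[p]))).congr ?_
    filter_upwards [(isOpen_compl_ball g).mem_nhds hx] with y hy
    rw [cut_of_notMem hy]

/-- The matrix `(0 1; 1 0)`. -/
def swap (p : ℕ) [Fact p.Prime] : GL (Fin 2) ℚ_[p] :=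
  Matrix.GeneralLinearGroup.mkOfDetNeZero !![0, 1; 1, 0] (by simp [Matrix.det_fin_two])

lemma swap_entry : swap p 0 0 = 0 ∧ swap p 0 1 = 1 ∧ swap p 1 0 = 1 ∧ swap p 1 1 = 0 :=
  ⟨rfl, rfl, rfl, rfl⟩

lemma swap_mul_swap : swap p * swap p = 1 := by
  obtain ⟨a1, a2, a3, a4⟩ := swap_entry (p := p)
  apply GL_ext <;> rw [mul_entry] <;> simp only [a1, a2, a3, a4] <;> simp

lemma coe_mem_ball_swap {x : ℚ_[p]} (hx : x ≠ 0) (g : GL (Fin 2) ℚ_[p]) :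
    (x : OnePoint ℚ_[p]) ∈ ball (swap p * g) ↔ ((x⁻¹ : ℚ_[p]) : OnePoint ℚ_[p]) ∈ ball g := by
  obtain ⟨a1, a2, a3, a4⟩ := swap_entry (p := p)
  have e1 : (swap p * g) 1 1 * x - (swap p * g) 0 1 = -((g 1 1 * x⁻¹ - g 0 1) * x) := by
    rw [mul_entry, mul_entry, a1, a2, a3, a4, sub_mul, mul_assoc _ x⁻¹, inv_mul_cancel₀ hx]; ring
  have e2 : (swap p * g) 0 0 - (swap p * g) 1 0 * x = -((g 0 0 - g 1 0 * x⁻¹) * x) := by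
    rw [mul_entry, mul_entry, a1, a2, a3, a4, sub_mul, mul_assoc _ x⁻¹, inv_mul_cancel₀ hx]; ring
  rw [coe_mem_ball, coe_mem_ball, e1, e2, norm_neg, norm_neg, norm_mul, norm_mul,
    mul_le_mul_iff_left₀ (norm_pos_iff.2 hx)]

lemma slash_swap {x : ℚ_[p]} (u : ℚ_[p] → ℚ_[p]) :
    slash k u (swap p) x = (-1) ^ (k / 2) * (x ^ k * u x⁻¹) := by
  obtain ⟨a1, a2, a3, a4⟩ := swap_entry (p := p)
  rw [slash, det_entry, a1, a2, a3, a4]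
  have h : ((0 * 0 - 1 * 1 : ℚ_[p]) ^ (k / 2))⁻¹ = (-1) ^ (k / 2) := by
    rw [zero_mul, one_mul, zero_sub, ← inv_pow, inv_neg, inv_one]
  rw [h, one_mul, add_zero, zero_mul, zero_add, one_div, mul_assoc]

/-- The matrix `swap p` exchanges `0` and `∞`, so the condition at `∞` for `g` is analyticity at `0`
for `swap p * g`. The sign `(-1)^{k/2}` comes from its determinant. -/
lemma cut_slash_mem (hk : Even k) (g : GL (Fin 2) ℚ_[p]) (F : Tate p) :
    cut (ball g) (slash k F.eval g⁻¹) ∈ AkLoc p k := by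
  refine ⟨analyticAt_cut_slash hk g F, fun t => (-1) ^ (k / 2) *
    cut (ball (swap p * g)) (slash k F.eval (swap p * g)⁻¹) t,
    analyticAt_const.mul (analyticAt_cut_slash hk _ F 0), ?_⟩
  filter_upwards [self_mem_nhdsWithin] with t ht
  have ht : t ≠ 0 := ht
  by_cases h : ((t⁻¹ : ℚ_[p]) : OnePoint ℚ_[p]) ∈ ball g
  · obtain ⟨a1, a2, a3, a4⟩ := swap_entry (p := p)
    have hs : (swap p)⁻¹ = swap p := inv_eq_of_mul_eq_one_left swap_mul_swap
    rw [cut_of_mem h, cut_of_mem ((coe_mem_ball_swap ht g).2 h), mul_inv_rev, hs,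
      ← slash_mul k _ _ (swap p) (by rw [a3, a4]; simpa using ht), slash_swap, ← mul_assoc,
      ← mul_pow, neg_one_mul, neg_neg, one_pow, one_mul]
  · rw [cut_of_notMem h, cut_of_notMem (fun h' => h ((coe_mem_ball_swap ht g).1 h')), mul_zero,
      mul_zero]

lemma cut_congr {U : Set (OnePoint ℚ_[p])} (h : ∀ x : ℚ_[p], (x : OnePoint ℚ_[p]) ∈ U → f x = f' x) :
    cut U f = cut U f' := by
  funext x
  by_cases hx : (x : OnePoint ℚ_[p]) ∈ U
  · rw [cut_of_mem hx, cut_of_mem hx, h x hx]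
  · rw [cut_of_notMem hx, cut_of_notMem hx]

lemma IsTateExp.cut_eq {F : Tate p} (hF : IsTateExp k f g F) :
    cut (ball g) f = cut (ball g) (slash k F.eval g⁻¹) :=
  cut_congr fun _ hx => hF.eq_of_mem_ball hx

lemma cut_eq_sum (g : GL (Fin 2) ℚ_[p]) (f : ℚ_[p] → ℚ_[p]) :
    cut (ball g) f = ∑ j ∈ Finset.range p, cut (ball (g * alpha j)) f := by
  funext x
  rw [Finset.sum_apply]
  by_cases hx : (x : OnePoint ℚ_[p]) ∈ ball g
  · obtain ⟨i, hi, hxi⟩ := exists_mem_ball_mul_alpha_iff.2 hx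
    rw [cut_of_mem hx, Finset.sum_eq_single i, cut_of_mem hxi]
    · intro j hj hji
      exact cut_of_notMem fun hxj =>
        hji (ball_mul_alpha_disjoint (Finset.mem_range.1 hj) hi hxj hxi)
    · exact fun h => absurd (Finset.mem_range.2 hi) h
  · rw [cut_of_notMem hx, Finset.sum_eq_zero]
    exact fun j hj => cut_of_notMem fun h => hx (ball_mul_alpha_subset g (Finset.mem_range.1 hj) h)

end

/-! ### Integration against a family of distributions -/

/-- A family of distributions on the balls `g ℤ_p`, compatible with restriction. -/
structure IsDistFamily (k : ℕ) (Φ : GL (Fin 2) ℚ_[p] → Dk p) : Prop where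
  scalar : ∀ (u : ℚ_[p]ˣ) g, Φ (Matrix.GeneralLinearGroup.scalar (Fin 2) u * g) = Φ g
  equivariant : ∀ σ (hσ : σ ∈ Gamma0 p) g, Φ (g * σ) = distAct k (Φ g) σ (Gamma0_subset hσ)
  fixed : ∀ g, normUp k Φ g = Φ g

open Classical in
/-- The integral of `f` over `g ℤ_p`, if `f` has an expansion there. -/
def intAt (k : ℕ) (Φ : GL (Fin 2) ℚ_[p] → Dk p) (f : ℚ_[p] → ℚ_[p]) (g : GL (Fin 2) ℚ_[p]) :
    ℚ_[p] :=
  if h : ∃ F, IsTateExp k f g F then Φ g h.choose else 0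

/-- The sum of the integrals of `f` over the balls `g α_{j₁} ⋯ α_{jₙ} ℤ_p`. -/
def intSum (k : ℕ) (Φ : GL (Fin 2) ℚ_[p] → Dk p) (f : ℚ_[p] → ℚ_[p]) :
    ℕ → GL (Fin 2) ℚ_[p] → ℚ_[p]
  | 0, g => intAt k Φ f g
  | n + 1, g => ∑ j ∈ Finset.range p, intSum k Φ f n (g * alpha j)

open Classical in
/-- The integral of `f` over `g ℤ_p`. -/
def distInt (k : ℕ) (Φ : GL (Fin 2) ℚ_[p] → Dk p) (f : ℚ_[p] → ℚ_[p]) (g : GL (Fin 2) ℚ_[p]) :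
    ℚ_[p] :=
  if h : ∃ n, HasExp k f n g then intSum k Φ f h.choose g else 0

lemma sum_range_perm {M : Type*} [AddCommMonoid M] {n : ℕ} {π : ℕ → ℕ} (hπ : ∀ j < n, π j < n)
    (hinj : ∀ i < n, ∀ j < n, π i = π j → i = j) (f : ℕ → M) :
    ∑ j ∈ Finset.range n, f (π j) = ∑ j ∈ Finset.range n, f j := by
  have hinj' : Set.InjOn π (Finset.range n) := fun i hi j hj h =>
    hinj i (Finset.mem_range.1 hi) j (Finset.mem_range.1 hj) h
  have himg : (Finset.range n).image π = Finset.range n := by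
    refine Finset.eq_of_subset_of_card_le (fun i hi => ?_) ?_
    · obtain ⟨j, hj, rfl⟩ := Finset.mem_image.1 hi
      exact Finset.mem_range.2 (hπ j (Finset.mem_range.1 hj))
    · rw [Finset.card_image_of_injOn hinj']
  conv_rhs => rw [← himg]
  rw [Finset.sum_image hinj']

section

variable {k : ℕ} {Φ : GL (Fin 2) ℚ_[p] → Dk p} {f f' : ℚ_[p] → ℚ_[p]} {g : GL (Fin 2) ℚ_[p]}
  {F : Tate p} {n : ℕ}

lemma intAt_eq (hF : IsTateExp k f g F) : intAt k Φ f g = Φ g F := by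
  rw [intAt, dif_pos ⟨F, hF⟩, IsTateExp.unique (Exists.choose_spec ⟨F, hF⟩) hF]

lemma HasExp.succ (hk : Even k) : ∀ {n : ℕ} {g : GL (Fin 2) ℚ_[p]},
    HasExp k f n g → HasExp k f (n + 1) g
  | 0, _, ⟨_, hF⟩ => fun j _ => ⟨_, hF.mul hk (alpha_inv_mem j)⟩
  | _ + 1, _, h => fun j hj => (h j hj).succ hk

/-- Refining the subdivision does not change the sum: for one ball this is the fixed-point equation
for `normUp`, since restriction of expansions is the action of `α_j⁻¹`. -/
lemma intSum_succ (hk : Even k) (hΦ : IsDistFamily k Φ) : ∀ {n : ℕ} {g : GL (Fin 2) ℚ_[p]},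
    HasExp k f n g → intSum k Φ f (n + 1) g = intSum k Φ f n g
  | 0, g, ⟨F, hF⟩ => by
    change ∑ j ∈ Finset.range p, intAt k Φ f (g * alpha j) = intAt k Φ f g
    rw [intAt_eq hF, ← hΦ.fixed g, normUp, sum_apply]
    exact Finset.sum_congr rfl fun j _ => intAt_eq (hF.mul hk (alpha_inv_mem j))
  | n + 1, g, h => Finset.sum_congr rfl fun j hj =>
    intSum_succ hk hΦ (h j (Finset.mem_range.1 hj))

lemma HasExp.mono (hk : Even k) (h : HasExp k f n g) {m : ℕ} (hm : n ≤ m) : HasExp k f m g := by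
  induction m, hm using Nat.le_induction with
  | base => exact h
  | succ m _ ih => exact ih.succ hk

lemma intSum_mono (hk : Even k) (hΦ : IsDistFamily k Φ) (h : HasExp k f n g) {m : ℕ} (hm : n ≤ m) :
    intSum k Φ f m g = intSum k Φ f n g := by
  induction m, hm using Nat.le_induction with
  | base => rfl
  | succ m hm ih => rw [intSum_succ hk hΦ (h.mono hk hm), ih]

lemma distInt_eq (hk : Even k) (hΦ : IsDistFamily k Φ) (h : HasExp k f n g) :
    distInt k Φ f g = intSum k Φ f n g := by
  have hex : ∃ n, HasExp k f n g := ⟨n, h⟩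
  rw [distInt, dif_pos hex]
  rcases le_total n hex.choose with hle | hle
  · exact intSum_mono hk hΦ h hle
  · exact (intSum_mono hk hΦ hex.choose_spec hle).symm

lemma distInt_eq_of_isTateExp (hk : Even k) (hΦ : IsDistFamily k Φ) (hF : IsTateExp k f g F) :
    distInt k Φ f g = Φ g F := by
  rw [distInt_eq hk hΦ (n := 0) ⟨F, hF⟩]
  exact intAt_eq hF

lemma HasExp.add : ∀ {n : ℕ} {g : GL (Fin 2) ℚ_[p]}, HasExp k f n g → HasExp k f' n g →
    HasExp k (f + f') n g ∧ intSum k Φ (f + f') n g = intSum k Φ f n g + intSum k Φ f' n g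
  | 0, g, ⟨F, hF⟩, ⟨F', hF'⟩ => ⟨⟨_, hF.add hF'⟩, by
    change intAt _ _ _ _ = intAt _ _ _ _ + intAt _ _ _ _
    rw [intAt_eq hF, intAt_eq hF', intAt_eq (hF.add hF'), map_add]⟩
  | n + 1, g, h, h' => ⟨fun j hj => (HasExp.add (h j hj) (h' j hj)).1, by
    change ∑ j ∈ _, _ = ∑ j ∈ _, _ + ∑ j ∈ _, _
    rw [← Finset.sum_add_distrib]
    exact Finset.sum_congr rfl fun j hj =>
      (HasExp.add (h j (Finset.mem_range.1 hj)) (h' j (Finset.mem_range.1 hj))).2⟩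

lemma HasExp.smul (r : ℚ_[p]) : ∀ {n : ℕ} {g : GL (Fin 2) ℚ_[p]}, HasExp k f n g →
    HasExp k (r • f) n g ∧ intSum k Φ (r • f) n g = r * intSum k Φ f n g
  | 0, g, ⟨F, hF⟩ => ⟨⟨_, hF.smul r⟩, by
    change intAt _ _ _ _ = _ * intAt _ _ _ _
    rw [intAt_eq hF, intAt_eq (hF.smul r), map_smul, smul_eq_mul]⟩
  | n + 1, g, h => ⟨fun j hj => (HasExp.smul r (h j hj)).1, by
    change ∑ j ∈ _, _ = _ * ∑ j ∈ _, _
    rw [Finset.mul_sum]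
    exact Finset.sum_congr rfl fun j hj => (HasExp.smul r (h j (Finset.mem_range.1 hj))).2⟩

/-- The integral depends only on the ball. At depth zero this is equivariance of the family; deeper,
`σ` permutes the subballs up to further elements of `Γ₀(pℤ_p)`. -/
lemma HasExp.mul_Gamma0 (hk : Even k) (hΦ : IsDistFamily k Φ) : ∀ {n : ℕ} {g σ : GL (Fin 2) ℚ_[p]},
    σ ∈ Gamma0 p → HasExp k f n g →
    HasExp k f n (g * σ) ∧ intSum k Φ f n (g * σ) = intSum k Φ f n g
  | 0, g, σ, hσ, ⟨F, hF⟩ => by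
    have hF' := hF.mul hk (Gamma0_subset (Gamma0_inv hσ))
    refine ⟨⟨_, hF'⟩, ?_⟩
    change intAt _ _ _ _ = intAt _ _ _ _
    rw [intAt_eq hF, intAt_eq hF']
    have h := hΦ.equivariant σ⁻¹ (Gamma0_inv hσ) (g * σ)
    rw [mul_inv_cancel_right] at h
    rw [h]
    rfl
  | n + 1, g, σ, hσ, h => by
    obtain ⟨π, τ, hπ, hτ, hc, hinj⟩ := exists_perm_alpha hσ
    have key : ∀ j < p, HasExp k f n (g * σ * alpha j) ∧
        intSum k Φ f n (g * σ * alpha j) = intSum k Φ f n (g * alpha (π j)) := by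
      intro j hj
      rw [mul_assoc, hc j hj, ← mul_assoc]
      exact (h (π j) (hπ j hj)).mul_Gamma0 hk hΦ (hτ j)
    refine ⟨fun j hj => (key j hj).1, ?_⟩
    change ∑ j ∈ _, _ = ∑ j ∈ _, _
    rw [Finset.sum_congr rfl fun j hj => (key j (Finset.mem_range.1 hj)).2]
    exact sum_range_perm hπ hinj fun i => intSum k Φ f n (g * alpha i)

lemma IsTateExp.scalar_mul (hk : Even k) (u : ℚ_[p]ˣ) (hF : IsTateExp k f g F) :
    IsTateExp k f (Matrix.GeneralLinearGroup.scalar (Fin 2) u * g) F := by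
  intro z hz hd
  rw [scalar_mul_entry, scalar_mul_entry, mul_assoc, ← mul_add] at hd
  have hd := right_ne_zero_of_mul hd
  rw [← slash_mul k f _ g hd, hF z hz hd]
  exact congrArg (fun v => slash k v g z) (funext fun x => (slash_scalar hk f u x).symm)

lemma HasExp.scalar_mul (hk : Even k) (hΦ : IsDistFamily k Φ) (u : ℚ_[p]ˣ) :
    ∀ {n : ℕ} {g : GL (Fin 2) ℚ_[p]}, HasExp k f n g →
    HasExp k f n (Matrix.GeneralLinearGroup.scalar (Fin 2) u * g) ∧
      intSum k Φ f n (Matrix.GeneralLinearGroup.scalar (Fin 2) u * g) = intSum k Φ f n g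
  | 0, g, ⟨F, hF⟩ => by
    refine ⟨⟨_, hF.scalar_mul hk u⟩, ?_⟩
    change intAt _ _ _ _ = intAt _ _ _ _
    rw [intAt_eq hF, intAt_eq (hF.scalar_mul hk u), hΦ.scalar]
  | n + 1, g, h => by
    refine ⟨fun j hj => ?_, Finset.sum_congr rfl fun j hj => ?_⟩
    · rw [mul_assoc]
      exact ((h j hj).scalar_mul hk hΦ u).1
    · rw [mul_assoc]
      exact ((h j (Finset.mem_range.1 hj)).scalar_mul hk hΦ u).2

end

/-! ### Matrix relations for the complement of a subball -/

lemma g0_conj_mem {σ : GL (Fin 2) ℚ_[p]} (hσ : σ ∈ Gamma0 p) :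
    (g0 p)⁻¹ * σ * g0 p ∈ Gamma0 p := by
  obtain ⟨h1, h2, h3⟩ := mem_Gamma0.1 hσ
  have hp := coe_p_ne_zero (p := p)
  obtain ⟨b1, b2, b3, b4⟩ := g0_entry (p := p)
  obtain ⟨c1, c2, c3, c4⟩ := g0_inv_entry (p := p)
  set τ := (g0 p)⁻¹ * σ * g0 p with hτ
  have t1 : τ 0 0 = σ 1 1 := by
    rw [hτ, mul_entry, mul_entry, mul_entry, c1, c2, b1, b3]; field_simp; ring
  have t2 : τ 0 1 = σ 1 0 / p := by
    rw [hτ, mul_entry, mul_entry, mul_entry, c1, c2, b2, b4]; field_simp; ring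
  have t3 : τ 1 0 = p * σ 0 1 := by
    rw [hτ, mul_entry, mul_entry, mul_entry, c3, c4, b1, b3]; ring
  have t4 : τ 1 1 = σ 0 0 := by
    rw [hτ, mul_entry, mul_entry, mul_entry, c3, c4, b2, b4]; ring
  have ht3 : ‖τ 1 0‖ < 1 := by
    rw [t3, norm_mul]
    exact mul_lt_one_of_nonneg_of_lt_one_left (norm_nonneg _) Padic.norm_p_lt_one (h1 _ _)
  refine mem_Gamma0.2 ⟨fun r s => ?_, ht3, ?_⟩
  · fin_cases r <;> fin_cases s
    · change ‖τ 0 0‖ ≤ 1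
      rw [t1]; exact h1 _ _
    · change ‖τ 0 1‖ ≤ 1
      rw [t2, norm_div_p_le_one_iff]; exact h2
    · exact ht3.le
    · change ‖τ 1 1‖ ≤ 1
      rw [t4]; exact h1 _ _
  · rw [t1, t2, t3, t4, ← h3]
    congr 1
    field_simp

/-- The product `α₀ g₀` acts by `w ↦ 1/w`, so it carries `ℤ_p` to the complement of `pℤ_p`. Its
piece with digit `0` is the complement of `ℤ_p`. -/
lemma alpha_zero_mul_g0_mul_alpha_zero : alpha 0 * g0 p * alpha 0 =
    Matrix.GeneralLinearGroup.scalar (Fin 2) pUnit * g0 p := by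
  obtain ⟨a1, a2, a3, a4⟩ := alpha_entry (p := p) 0
  obtain ⟨b1, b2, b3, b4⟩ := g0_entry (p := p)
  apply GL_ext <;> rw [mul_entry, mul_entry, mul_entry, scalar_mul_entry, pUnit, Units.val_mk0] <;>
    simp only [a1, a2, a3, a4, b1, b2, b3, b4] <;> simp

/-- Under `w ↦ 1/w` the residue disc of a unit `i` goes to that of `m`, its inverse modulo `p`. -/
lemma exists_alpha_zero_mul_g0_mul_alpha {i m : ℕ} (h : ‖(1 : ℚ_[p]) - m * i‖ < 1) :
    ∃ σ ∈ Gamma0 p, alpha 0 * g0 p * alpha i =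
      Matrix.GeneralLinearGroup.scalar (Fin 2) pUnit * (alpha m * σ) := by
  have hp := coe_p_ne_zero (p := p)
  have hn : ∀ m : ℕ, ‖(m : ℚ_[p])‖ ≤ 1 := fun m => IsUltrametricDist.norm_natCast_le_one _ _
  obtain ⟨σ, s1, s2, s3, s4⟩ : ∃ σ : GL (Fin 2) ℚ_[p], σ 0 0 = -(m : ℚ_[p]) ∧
      σ 0 1 = (1 - m * i) / p ∧ σ 1 0 = p ∧ σ 1 1 = i :=
    ⟨Matrix.GeneralLinearGroup.mkOfDetNeZero !![-(m : ℚ_[p]), (1 - m * i) / p; (p : ℚ_[p]), i] (by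
      rw [Matrix.det_fin_two_of, div_mul_cancel₀ _ hp]
      ring_nf
      exact neg_ne_zero.2 one_ne_zero), rfl, rfl, rfl, rfl⟩
  refine ⟨σ, mem_Gamma0.2 ⟨fun r s => ?_, ?_, ?_⟩, ?_⟩
  · fin_cases r <;> fin_cases s
    · change ‖σ 0 0‖ ≤ 1
      rw [s1, norm_neg]; exact hn m
    · change ‖σ 0 1‖ ≤ 1
      rw [s2, norm_div_p_le_one_iff]; exact h
    · change ‖σ 1 0‖ ≤ 1
      rw [s3]; exact hn p
    · change ‖σ 1 1‖ ≤ 1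
      rw [s4]; exact hn i
  · rw [s3]; exact Padic.norm_p_lt_one
  · rw [s1, s2, s3, s4, div_mul_cancel₀ _ hp, show -(m : ℚ_[p]) * i - (1 - m * i) = -1 by ring,
      norm_neg, norm_one]
  · obtain ⟨a1, a2, a3, a4⟩ := alpha_entry (p := p) 0
    obtain ⟨d1, d2, d3, d4⟩ := alpha_entry (p := p) i
    obtain ⟨e1, e2, e3, e4⟩ := alpha_entry (p := p) m
    obtain ⟨b1, b2, b3, b4⟩ := g0_entry (p := p)
    apply GL_ext <;>
      rw [mul_entry, mul_entry, mul_entry, scalar_mul_entry, mul_entry, pUnit, Units.val_mk0] <;>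
      simp only [a1, a2, a3, a4, b1, b2, b3, b4, d1, d2, d3, d4, e1, e2, e3, e4, s1, s2, s3, s4] <;>
      field_simp <;> simp

lemma norm_natCast_eq_one {i : ℕ} (hi : i < p) (h0 : i ≠ 0) : ‖(i : ℚ_[p])‖ = 1 := by
  refine le_antisymm (IsUltrametricDist.norm_natCast_le_one _ _) (not_lt.1 fun h => h0 ?_)
  refine digit_unique (z := (i : ℚ_[p])) hi (Fact.out : p.Prime).pos ?_ ?_
  · rw [sub_self, norm_zero]; exact one_pos
  · rwa [Nat.cast_zero, sub_zero]

/-- Inversion modulo `p`, as a permutation of the digits. -/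
lemma exists_inv_perm (p : ℕ) [Fact p.Prime] : ∃ π : ℕ → ℕ, (∀ j < p, π j < p) ∧
    (∀ i < p, ∀ j < p, π i = π j → i = j) ∧ π 0 = 0 ∧
      ∀ i < p, i ≠ 0 → ‖(1 : ℚ_[p]) - π i * i‖ < 1 := by
  have hpos := (Fact.out : p.Prime).pos
  -- The convention `0⁻¹ = 0` lets the digit `0` be treated along with the units and makes it a
  -- fixed point.
  have hex : ∀ i : ℕ, ∃ m, i < p → m < p ∧ ‖(i : ℚ_[p])⁻¹ - m‖ < 1 := by
    intro i
    by_cases hi : i < p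
    · obtain ⟨m, hm, h⟩ := exists_digit (p := p) (z := (i : ℚ_[p])⁻¹) (by
        by_cases h0 : i = 0
        · simp [h0]
        · rw [norm_inv, norm_natCast_eq_one hi h0, inv_one])
      exact ⟨m, fun _ => ⟨hm, h⟩⟩
    · exact ⟨0, fun h => absurd h hi⟩
  choose π hπ using hex
  have hdist : ∀ i < p, ∀ j < p, π i = π j → ‖(i : ℚ_[p])⁻¹ - (j : ℚ_[p])⁻¹‖ < 1 := by
    intro i hi j hj h
    have h1 := (hπ i hi).2
    have h2 := (hπ j hj).2
    rw [h] at h1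
    rw [show (i : ℚ_[p])⁻¹ - (j : ℚ_[p])⁻¹ = ((i : ℚ_[p])⁻¹ - π j) - ((j : ℚ_[p])⁻¹ - π j) by ring]
    exact (padic_norm_sub_le_max _ _).trans_lt (max_lt h1 h2)
  have hzero : ∀ j < p, ‖(j : ℚ_[p])⁻¹‖ < 1 → j = 0 := by
    intro j hj h
    by_contra h0
    rw [norm_inv, norm_natCast_eq_one hj h0, inv_one] at h
    exact lt_irrefl _ h
  refine ⟨π, fun j hj => (hπ j hj).1, fun i hi j hj h => ?_, ?_, fun i hi h0 => ?_⟩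
  · have hd := hdist i hi j hj h
    by_cases hi0 : i = 0
    · subst hi0
      rw [Nat.cast_zero, inv_zero, zero_sub, norm_neg] at hd
      exact (hzero j hj hd).symm
    by_cases hj0 : j = 0
    · subst hj0
      rw [Nat.cast_zero, inv_zero, sub_zero] at hd
      exact hzero i hi hd
    have ni := norm_natCast_eq_one hi hi0
    have nj := norm_natCast_eq_one hj hj0
    have zi : (i : ℚ_[p]) ≠ 0 := norm_ne_zero_iff.1 (by rw [ni]; exact one_ne_zero)
    have zj : (j : ℚ_[p]) ≠ 0 := norm_ne_zero_iff.1 (by rw [nj]; exact one_ne_zero)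
    refine digit_unique (z := (i : ℚ_[p])) hi hj (by rw [sub_self, norm_zero]; exact one_pos) ?_
    have e : (i : ℚ_[p]) - j = -(i * j * ((i : ℚ_[p])⁻¹ - (j : ℚ_[p])⁻¹)) := by field_simp; ring
    rw [e, norm_neg, norm_mul, norm_mul, ni, nj, one_mul, one_mul]
    exact hd
  · have h := (hπ 0 hpos).2
    rw [Nat.cast_zero, inv_zero] at h
    exact digit_unique (z := (0 : ℚ_[p])) (hπ 0 hpos).1 hpos h (by simp)
  · have ni := norm_natCast_eq_one hi h0
    have zi : (i : ℚ_[p]) ≠ 0 := norm_ne_zero_iff.1 (by rw [ni]; exact one_ne_zero)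
    have e : (1 : ℚ_[p]) - π i * i = ((i : ℚ_[p])⁻¹ - π i) * i := by field_simp
    rw [e, norm_mul, ni, mul_one]
    exact (hπ i hi).2

/-! ### The total integral and the measure of a family -/

section

variable {k : ℕ} {Φ : GL (Fin 2) ℚ_[p] → Dk p} {f f' : ℚ_[p] → ℚ_[p]}

/-- The integral of `f` over `ℙ¹(ℚ_p) = g ℤ_p ∪ g g₀ ℤ_p`. -/
def totalInt (k : ℕ) (Φ : GL (Fin 2) ℚ_[p] → Dk p) (f : ℚ_[p] → ℚ_[p]) (g : GL (Fin 2) ℚ_[p]) :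
    ℚ_[p] :=
  distInt k Φ f g + distInt k Φ f (g * g0 p)

lemma distInt_mul_Gamma0 (hk : Even k) (hΦ : IsDistFamily k Φ) (hf : ∀ g, ∃ n, HasExp k f n g)
    {σ : GL (Fin 2) ℚ_[p]} (hσ : σ ∈ Gamma0 p) (g : GL (Fin 2) ℚ_[p]) :
    distInt k Φ f (g * σ) = distInt k Φ f g := by
  obtain ⟨n, hn⟩ := hf g
  obtain ⟨h1, h2⟩ := hn.mul_Gamma0 hk hΦ hσ
  rw [distInt_eq hk hΦ hn, distInt_eq hk hΦ h1, h2]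

lemma distInt_scalar_mul (hk : Even k) (hΦ : IsDistFamily k Φ) (hf : ∀ g, ∃ n, HasExp k f n g)
    (u : ℚ_[p]ˣ) (g : GL (Fin 2) ℚ_[p]) :
    distInt k Φ f (Matrix.GeneralLinearGroup.scalar (Fin 2) u * g) = distInt k Φ f g := by
  obtain ⟨n, hn⟩ := hf g
  obtain ⟨h1, h2⟩ := hn.scalar_mul hk hΦ u
  rw [distInt_eq hk hΦ hn, distInt_eq hk hΦ h1, h2]

lemma distInt_eq_sum (hk : Even k) (hΦ : IsDistFamily k Φ) (hf : ∀ g, ∃ n, HasExp k f n g)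
    (g : GL (Fin 2) ℚ_[p]) :
    distInt k Φ f g = ∑ j ∈ Finset.range p, distInt k Φ f (g * alpha j) := by
  obtain ⟨n, hn⟩ := hf g
  rw [distInt_eq hk hΦ (hn.succ hk)]
  exact Finset.sum_congr rfl fun j hj =>
    (distInt_eq hk hΦ (hn.succ hk j (Finset.mem_range.1 hj))).symm

lemma totalInt_mul_Gamma0 (hk : Even k) (hΦ : IsDistFamily k Φ) (hf : ∀ g, ∃ n, HasExp k f n g)
    {σ : GL (Fin 2) ℚ_[p]} (hσ : σ ∈ Gamma0 p) (g : GL (Fin 2) ℚ_[p]) :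
    totalInt k Φ f (g * σ) = totalInt k Φ f g := by
  have h := distInt_mul_Gamma0 hk hΦ hf (g0_conj_mem hσ) (g * g0 p)
  rw [show g * g0 p * ((g0 p)⁻¹ * σ * g0 p) = g * σ * g0 p by group] at h
  rw [totalInt, totalInt, distInt_mul_Gamma0 hk hΦ hf hσ, h]

lemma totalInt_mul_g0 (hk : Even k) (hΦ : IsDistFamily k Φ) (hf : ∀ g, ∃ n, HasExp k f n g)
    (g : GL (Fin 2) ℚ_[p]) : totalInt k Φ f (g * g0 p) = totalInt k Φ f g := by
  rw [totalInt, totalInt, mul_assoc g, g0_mul_g0, ← scalar_comm,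
    distInt_scalar_mul hk hΦ hf, add_comm]

lemma totalInt_scalar_mul (hk : Even k) (hΦ : IsDistFamily k Φ) (hf : ∀ g, ∃ n, HasExp k f n g)
    (u : ℚ_[p]ˣ) (g : GL (Fin 2) ℚ_[p]) :
    totalInt k Φ f (Matrix.GeneralLinearGroup.scalar (Fin 2) u * g) = totalInt k Φ f g := by
  rw [totalInt, totalInt, mul_assoc, distInt_scalar_mul hk hΦ hf, distInt_scalar_mul hk hΦ hf]

/-- Both splittings of the projective line refine to the same partition: the `p` subballs of `g ℤ_p`
and its complement. In one case `g ℤ_p` is cut, in the other the complement of `gα₀ ℤ_p`, whose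
pieces appear with inverted digits. -/
lemma totalInt_mul_alpha_zero (hk : Even k) (hΦ : IsDistFamily k Φ)
    (hf : ∀ g, ∃ n, HasExp k f n g) (g : GL (Fin 2) ℚ_[p]) :
    totalInt k Φ f (g * alpha 0) = totalInt k Φ f g := by
  obtain ⟨π, hπ, hinj, hπ0, hπi⟩ := exists_inv_perm p
  have h0 : 0 ∈ Finset.range p := Finset.mem_range.2 (Fact.out : p.Prime).pos
  have e : distInt k Φ f (g * alpha 0 * g0 p) = distInt k Φ f (g * g0 p) +
      ∑ j ∈ (Finset.range p).erase 0, distInt k Φ f (g * alpha (π j)) := by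
    rw [distInt_eq_sum hk hΦ hf, ← Finset.add_sum_erase _ _ h0]
    congr 1
    · rw [mul_assoc, mul_assoc, ← mul_assoc (alpha 0), alpha_zero_mul_g0_mul_alpha_zero,
        scalar_comm, ← mul_assoc, ← scalar_comm, distInt_scalar_mul hk hΦ hf]
    · refine Finset.sum_congr rfl fun i hi => ?_
      obtain ⟨hi0, hi⟩ := Finset.mem_erase.1 hi
      obtain ⟨σ, hσ, h⟩ := exists_alpha_zero_mul_g0_mul_alpha (hπi i (Finset.mem_range.1 hi) hi0)
      rw [mul_assoc, mul_assoc, ← mul_assoc (alpha 0), h, scalar_comm, ← mul_assoc, ← scalar_comm,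
        distInt_scalar_mul hk hΦ hf, ← mul_assoc, distInt_mul_Gamma0 hk hΦ hf hσ]
  have e2 : distInt k Φ f g = distInt k Φ f (g * alpha 0) +
      ∑ j ∈ (Finset.range p).erase 0, distInt k Φ f (g * alpha (π j)) := by
    rw [distInt_eq_sum hk hΦ hf g, ← sum_range_perm hπ hinj fun j => distInt k Φ f (g * alpha j),
      ← Finset.add_sum_erase _ _ h0, hπ0]
  rw [totalInt, totalInt, e, e2]
  ring

lemma totalInt_aff (hk : Even k) (hΦ : IsDistFamily k Φ) (hf : ∀ g, ∃ n, HasExp k f n g) (s : ℤ)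
    (x : ℚ_[p]) : totalInt k Φ f (aff s x) = totalInt k Φ f 1 := by
  have step : ∀ (s : ℤ) (x : ℚ_[p]), totalInt k Φ f (aff (s + 1) x) = totalInt k Φ f (aff s x) := by
    intro s x
    have e : aff s x * alpha 0 = aff (s + 1) x := by
      rw [alpha_eq_aff, aff_mul, Nat.cast_zero, mul_zero, add_zero]
    rw [← e, totalInt_mul_alpha_zero hk hΦ hf]
  have steps : ∀ (x : ℚ_[p]) (s : ℤ) (n : ℕ),
      totalInt k Φ f (aff (s + n) x) = totalInt k Φ f (aff s x) := by
    intro x s n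
    induction n with
    | zero => rw [Nat.cast_zero, add_zero]
    | succ n ih => rw [Nat.cast_succ, ← add_assoc, step, ih]
  have all : ∀ (x : ℚ_[p]) (s t : ℤ), totalInt k Φ f (aff s x) = totalInt k Φ f (aff t x) := by
    intro x s t
    rcases le_total s t with h | h
    · obtain ⟨n, rfl⟩ := Int.le.dest h
      exact (steps x s n).symm
    · obtain ⟨n, rfl⟩ := Int.le.dest h
      exact steps x t n
  -- The radius may be changed freely around a fixed centre; on a disc so large that it contains
  -- both `x` and `0`, the centre can be moved to `0`.
  obtain ⟨n, hn⟩ : ∃ n : ℕ, ‖(p : ℚ_[p]) ^ n * x‖ ≤ 1 := by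
    have hlim : Tendsto (fun n : ℕ => ‖(p : ℚ_[p]) ^ n * x‖) atTop (𝓝 0) := by
      have h := (tendsto_pow_atTop_nhds_zero_of_norm_lt_one
        (Padic.norm_p_lt_one (p := p))).mul_const x
      rw [zero_mul] at h
      simpa using h.norm
    exact ((hlim.eventually (gt_mem_nhds one_pos)).mono fun n h => le_of_lt h).exists
  have hσ : aff 0 ((p : ℚ_[p]) ^ n * x) ∈ Gamma0 p := by
    obtain ⟨a1, a2, a3, a4⟩ := aff_entry 0 ((p : ℚ_[p]) ^ n * x)
    refine mem_Gamma0.2 ⟨fun i j => ?_, ?_, ?_⟩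
    · fin_cases i <;> fin_cases j
      · change ‖aff 0 ((p : ℚ_[p]) ^ n * x) 0 0‖ ≤ 1
        rw [a1]; simp
      · change ‖aff 0 ((p : ℚ_[p]) ^ n * x) 0 1‖ ≤ 1
        rw [a2]; exact hn
      · change ‖aff 0 ((p : ℚ_[p]) ^ n * x) 1 0‖ ≤ 1
        rw [a3]; simp
      · change ‖aff 0 ((p : ℚ_[p]) ^ n * x) 1 1‖ ≤ 1
        rw [a4]; simp
    · rw [a3]; simp
    · rw [a1, a3, a4]; simp
  have e : aff (-(n : ℤ)) x = aff (-(n : ℤ)) 0 * aff 0 ((p : ℚ_[p]) ^ n * x) := by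
    rw [aff_mul, add_zero, zero_add, ← mul_assoc, zpow_neg, zpow_natCast,
      inv_mul_cancel₀ (p_pow_ne_zero n), one_mul]
  rw [all x s (-(n : ℤ)), e, totalInt_mul_Gamma0 hk hΦ hf hσ, all 0 _ 0, aff_zero]

/-- One of `g ℤ_p` and its complement avoids `∞`, and by `exists_aff` it is then a disc. -/
lemma totalInt_eq (hk : Even k) (hΦ : IsDistFamily k Φ) (hf : ∀ g, ∃ n, HasExp k f n g)
    (g : GL (Fin 2) ℚ_[p]) : totalInt k Φ f g = totalInt k Φ f 1 := by
  have key : ∀ g : GL (Fin 2) ℚ_[p], OnePoint.infty ∉ ball g →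
      totalInt k Φ f g = totalInt k Φ f 1 := by
    intro g hg
    obtain ⟨x, hx⟩ := exists_mem_ball_of_infty_notMem hg
    obtain ⟨u, s, σ, hσ, rfl⟩ := exists_aff hg hx
    rw [totalInt_mul_Gamma0 hk hΦ hf hσ, totalInt_scalar_mul hk hΦ hf, totalInt_aff hk hΦ hf]
  by_cases hg : OnePoint.infty ∈ ball g
  · rw [← totalInt_mul_g0 hk hΦ hf]
    exact key _ fun h => (infty_mem_ball_mul_g0 g).1 h hg
  · exact key g hg

lemma distInt_add (hk : Even k) (hΦ : IsDistFamily k Φ)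
    (hf : ∀ g, ∃ n, HasExp k f n g) (hf' : ∀ g, ∃ n, HasExp k f' n g) (g : GL (Fin 2) ℚ_[p]) :
    distInt k Φ (f + f') g = distInt k Φ f g + distInt k Φ f' g := by
  obtain ⟨n, hn⟩ := hf g
  obtain ⟨m, hm⟩ := hf' g
  have h1 := hn.mono hk (le_max_left n m)
  have h2 := hm.mono hk (le_max_right n m)
  obtain ⟨h3, h4⟩ := HasExp.add (Φ := Φ) h1 h2
  rw [distInt_eq hk hΦ h1, distInt_eq hk hΦ h2, distInt_eq hk hΦ h3, h4]

lemma distInt_smul (hk : Even k) (hΦ : IsDistFamily k Φ) (hf : ∀ g, ∃ n, HasExp k f n g)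
    (r : ℚ_[p]) (g : GL (Fin 2) ℚ_[p]) : distInt k Φ (r • f) g = r * distInt k Φ f g := by
  obtain ⟨n, hn⟩ := hf g
  obtain ⟨h1, h2⟩ := HasExp.smul (Φ := Φ) r hn
  rw [distInt_eq hk hΦ hn, distInt_eq hk hΦ h1, h2]

/-- The measure on `ℙ¹(ℚ_p)` defined by a compatible family of distributions. -/
def measureOf (hk : Even k) (hΦ : IsDistFamily k Φ) : AkLoc p k →ₗ[ℚ_[p]] ℚ_[p] where
  toFun f := totalInt k Φ f.1 1
  map_add' f f' := by
    have h := fun g => exists_hasExp f.2 hk g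
    have h' := fun g => exists_hasExp f'.2 hk g
    change distInt k Φ (f.1 + f'.1) _ + distInt k Φ (f.1 + f'.1) _ = _
    rw [distInt_add hk hΦ h h', distInt_add hk hΦ h h', totalInt, totalInt]
    ring
  map_smul' r f := by
    have h := fun g => exists_hasExp f.2 hk g
    change distInt k Φ (r • f.1) _ + distInt k Φ (r • f.1) _ = r * _
    rw [distInt_smul hk hΦ h, distInt_smul hk hΦ h, totalInt]
    ring

lemma isTateExp_cut (g : GL (Fin 2) ℚ_[p]) (F : Tate p) :
    IsTateExp k (cut (ball g) (slash k F.eval g⁻¹)) g F :=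
  (isTateExp_slash_inv k g F).congr fun _ hx => (cut_of_mem hx).symm

lemma isTateExp_cut_mul_g0 (g : GL (Fin 2) ℚ_[p]) (f : ℚ_[p] → ℚ_[p]) :
    IsTateExp k (cut (ball g) f) (g * g0 p) 0 := by
  have h : IsTateExp k (fun _ => (0 : ℚ_[p])) (g * g0 p) 0 := by
    intro z _ _
    rw [Tate.eval_zero, slash, mul_zero]
  exact h.congr fun x hx => (cut_of_notMem ((coe_mem_ball_mul_g0 g x).1 hx)).symm

lemma integral_slash_inv {μ : AkLoc p k →ₗ[ℚ_[p]] ℚ_[p]} (hk : Even k) (g : GL (Fin 2) ℚ_[p])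
    (F : Tate p) : integral μ (ball g) (slash k F.eval g⁻¹) = μ ⟨_, cut_slash_mem hk g F⟩ :=
  dif_pos (cut_slash_mem hk g F)

/-- The total integral is computed on the splitting given by `g` itself, where the cut-off function
has the expansion `F` on the ball and `0` on the complement. -/
lemma integral_measureOf (hk : Even k) (hΦ : IsDistFamily k Φ) (g : GL (Fin 2) ℚ_[p]) (F : Tate p) :
    integral (measureOf hk hΦ) (ball g) (slash k F.eval g⁻¹) = Φ g F := by
  rw [integral_slash_inv hk]
  change totalInt k Φ (cut (ball g) (slash k F.eval g⁻¹)) 1 = _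
  rw [← totalInt_eq hk hΦ (fun h => exists_hasExp (cut_slash_mem hk g F) hk h) g, totalInt,
    distInt_eq_of_isTateExp hk hΦ (isTateExp_cut g F),
    distInt_eq_of_isTateExp hk hΦ (isTateExp_cut_mul_g0 g _), map_zero, add_zero]

end

/-! ### From measures to families of distributions -/

section

variable {k : ℕ} {f f' : ℚ_[p] → ℚ_[p]} {g : GL (Fin 2) ℚ_[p]} {F : Tate p}
  {μ μ' : AkLoc p k →ₗ[ℚ_[p]] ℚ_[p]}

lemma integral_of_mem {U : Set (OnePoint ℚ_[p])} (h : cut U f ∈ AkLoc p k) :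
    integral μ U f = μ ⟨cut U f, h⟩ := dif_pos h

lemma integral_congr {U : Set (OnePoint ℚ_[p])} (h : cut U f = cut U f') :
    integral μ U f = integral μ U f' := by
  classical
  exact congrArg (fun u => if h : u ∈ AkLoc p k then μ ⟨u, h⟩ else 0) h

lemma cut_smul (U : Set (OnePoint ℚ_[p])) (r : ℚ_[p]) (f : ℚ_[p] → ℚ_[p]) :
    cut U (r • f) = r • cut U f := by
  funext x
  by_cases hx : (x : OnePoint ℚ_[p]) ∈ U
  · rw [cut_of_mem hx, Pi.smul_apply, Pi.smul_apply, cut_of_mem hx]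
  · rw [cut_of_notMem hx, Pi.smul_apply, cut_of_notMem hx, smul_zero]

lemma integral_smul {U : Set (OnePoint ℚ_[p])} (h : cut U f ∈ AkLoc p k) (r : ℚ_[p]) :
    integral μ U (r • f) = r * integral μ U f := by
  have h' : cut U (r • f) ∈ AkLoc p k := by
    rw [cut_smul]; exact Submodule.smul_mem _ r h
  rw [integral_of_mem h', integral_of_mem h, ← smul_eq_mul, ← map_smul]
  exact congrArg μ (Subtype.ext (cut_smul U r f))

/-- The distribution `F ↦ ∫_{g ℤ_p} F ·_k g⁻¹ dμ`. -/
def distOf (hk : Even k) (hμ : IsMeasure μ) (g : GL (Fin 2) ℚ_[p]) : Dk p :=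
  LinearMap.mkContinuousOfExistsBound
    { toFun := fun F => integral μ (ball g) (slash k F.eval g⁻¹)
      map_add' := fun F G => by
        rw [integral_slash_inv hk, integral_slash_inv hk, integral_slash_inv hk, ← map_add]
        refine congrArg μ (Subtype.ext ?_)
        change cut _ _ = cut _ _ + cut _ _
        rw [← ((isTateExp_slash_inv k g F).add (isTateExp_slash_inv k g G)).cut_eq]
        funext x
        by_cases hx : (x : OnePoint ℚ_[p]) ∈ ball g
        · rw [cut_of_mem hx]
          exact (congrArg₂ (· + ·) (cut_of_mem hx) (cut_of_mem hx)).symm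
        · rw [cut_of_notMem hx]
          exact ((congrArg₂ (· + ·) (cut_of_notMem hx) (cut_of_notMem hx)).trans (add_zero 0)).symm
      map_smul' := fun r F => by
        rw [RingHom.id_apply, smul_eq_mul, ← integral_smul (cut_slash_mem hk g F)]
        exact integral_congr ((isTateExp_slash_inv k g F).smul r).cut_eq.symm } (hμ g)

lemma distOf_apply (hk : Even k) (hμ : IsMeasure μ) (g : GL (Fin 2) ℚ_[p]) (F : Tate p) :
    distOf hk hμ g F = integral μ (ball g) (slash k F.eval g⁻¹) := rfl

lemma IsTateExp.integral_eq (hF : IsTateExp k f g F) (hk : Even k) (hμ : IsMeasure μ) :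
    integral μ (ball g) f = distOf hk hμ g F := integral_congr hF.cut_eq

lemma IsTateExp.cut_mem (hF : IsTateExp k f g F) (hk : Even k) : cut (ball g) f ∈ AkLoc p k := by
  rw [hF.cut_eq]; exact cut_slash_mem hk g F

lemma integral_ball_eq_sum (h : ∀ j < p, cut (ball (g * alpha j)) f ∈ AkLoc p k) :
    cut (ball g) f ∈ AkLoc p k ∧
      integral μ (ball g) f = ∑ j ∈ Finset.range p, integral μ (ball (g * alpha j)) f := by
  have hm : cut (ball g) f ∈ AkLoc p k := by
    rw [cut_eq_sum]
    exact Submodule.sum_mem _ fun j hj => h j (Finset.mem_range.1 hj)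
  refine ⟨hm, ?_⟩
  have e : (⟨cut (ball g) f, hm⟩ : AkLoc p k) = ∑ j ∈ (Finset.range p).attach,
      ⟨cut (ball (g * alpha j.1)) f, h j.1 (Finset.mem_range.1 j.2)⟩ := by
    refine Subtype.ext ?_
    rw [AddSubmonoidClass.coe_finsetSum]
    exact (cut_eq_sum g f).trans (Finset.sum_attach (Finset.range p)
      fun j => cut (ball (g * alpha j)) f).symm
  rw [integral_of_mem hm, e, map_sum,
    ← Finset.sum_attach _ fun j => integral μ (ball (g * alpha j)) f]
  exact Finset.sum_congr rfl fun j _ => (integral_of_mem _).symm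

/-- Scalars and `Γ₀(pℤ_p)` do not change the ball, and the fixed-point equation is additivity of the
measure over the subballs. -/
lemma isDistFamily_distOf (hk : Even k) (hμ : IsMeasure μ) : IsDistFamily k (distOf hk hμ) where
  scalar u g := by
    ext1 F
    have h := isTateExp_slash_inv k g F
    rw [← h.integral_eq hk hμ, ← (h.scalar_mul hk u).integral_eq hk hμ, ball_scalar_mul]
  equivariant σ hσ g := by
    ext1 F
    have h := isTateExp_slash_inv k (g * σ) F
    have h2 := h.mul hk (h := σ⁻¹) (by rw [inv_inv]; exact Gamma0_subset hσ)
    have h3 := h2.integral_eq hk hμ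
    rw [ball_mul_Gamma0 _ (Gamma0_inv hσ)] at h3
    rw [← h.integral_eq hk hμ, h3]
    simp only [mul_inv_cancel_right, inv_inv]
    rfl
  fixed g := by
    ext1 F
    have h := isTateExp_slash_inv k g F
    have h2 : ∀ j, IsTateExp k (slash k F.eval g⁻¹) (g * alpha j) _ :=
      fun j => h.mul hk (alpha_inv_mem j)
    rw [normUp, sum_apply, ← h.integral_eq hk hμ,
      (integral_ball_eq_sum fun j _ => (h2 j).cut_mem hk).2]
    exact Finset.sum_congr rfl fun j _ => ((h2 j).integral_eq hk hμ).symm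

/-- Since expansions exist after finitely many subdivisions, a measure is recovered exactly from its
distributions on balls. -/
lemma HasExp.integral_eq (hk : Even k) (hμ : IsMeasure μ) : ∀ {n : ℕ} {g : GL (Fin 2) ℚ_[p]},
    HasExp k f n g → cut (ball g) f ∈ AkLoc p k ∧
      integral μ (ball g) f = intSum k (distOf hk hμ) f n g
  | 0, _, ⟨_, hF⟩ => ⟨hF.cut_mem hk, (hF.integral_eq hk hμ).trans (intAt_eq hF).symm⟩
  | n + 1, g, h => by
    obtain ⟨h1, h2⟩ := integral_ball_eq_sum (μ := μ)
      fun j hj => (HasExp.integral_eq hk hμ (h j hj)).1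
    refine ⟨h1, h2.trans (Finset.sum_congr rfl fun j hj => ?_)⟩
    exact (HasExp.integral_eq hk hμ (h j (Finset.mem_range.1 hj))).2

lemma cut_ball_mem (hk : Even k) (hμ : IsMeasure μ) (hf : f ∈ AkLoc p k) (g : GL (Fin 2) ℚ_[p]) :
    cut (ball g) f ∈ AkLoc p k :=
  ((exists_hasExp hf hk g).choose_spec.integral_eq hk hμ).1

lemma apply_eq_integral_add (hk : Even k) (hμ : IsMeasure μ) (f : AkLoc p k)
    (g : GL (Fin 2) ℚ_[p]) :
    μ f = integral μ (ball g) f.1 + integral μ (ball (g * g0 p)) f.1 := by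
  rw [integral_of_mem (cut_ball_mem hk hμ f.2 g), integral_of_mem (cut_ball_mem hk hμ f.2 _),
    ← map_add]
  refine congrArg μ (Subtype.ext (funext fun x => ?_))
  change f.1 x = cut _ _ _ + cut _ _ _
  by_cases hx : (x : OnePoint ℚ_[p]) ∈ ball g
  · rw [cut_of_mem hx, cut_of_notMem fun h => (coe_mem_ball_mul_g0 g x).1 h hx, add_zero]
  · rw [cut_of_notMem hx, cut_of_mem ((coe_mem_ball_mul_g0 g x).2 hx), zero_add]

/-- Measures are determined by their distributions on a family of balls that is stable under
subdivision and contains two complementary balls. -/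
lemma eq_of_distOf_eq (hk : Even k) (hμ : IsMeasure μ) (hμ' : IsMeasure μ')
    {S : Set (GL (Fin 2) ℚ_[p])} (hS : ∀ g ∈ S, ∀ j < p, g * alpha j ∈ S) (hg : g ∈ S)
    (hg' : g * g0 p ∈ S) (h : ∀ g ∈ S, distOf hk hμ g = distOf hk hμ' g) : μ = μ' := by
  have key : ∀ (f : ℚ_[p] → ℚ_[p]) (n : ℕ), ∀ g ∈ S, HasExp k f n g →
      intSum k (distOf hk hμ) f n g = intSum k (distOf hk hμ') f n g := by
    intro f n
    induction n with
    | zero =>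
      rintro g hg ⟨F, hF⟩
      change intAt _ _ _ _ = intAt _ _ _ _
      rw [intAt_eq hF, intAt_eq hF, h g hg]
    | succ n ih =>
      exact fun g hg hn => Finset.sum_congr rfl fun j hj =>
        ih _ (hS g hg j (Finset.mem_range.1 hj)) (hn j (Finset.mem_range.1 hj))
  have key' : ∀ (f : AkLoc p k), ∀ g ∈ S, integral μ (ball g) f.1 = integral μ' (ball g) f.1 := by
    intro f g hg
    obtain ⟨n, hn⟩ := exists_hasExp f.2 hk g
    rw [(hn.integral_eq hk hμ).2, (hn.integral_eq hk hμ').2, key _ _ _ hg hn]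
  ext1 f
  rw [apply_eq_integral_add hk hμ f g, apply_eq_integral_add hk hμ' f g, key' f g hg,
    key' f _ hg']

/-- Integrals of polynomials of degree at most `k` over balls. -/
lemma integral_eval (hk : Even k) (hμ : IsMeasure μ) (g : GL (Fin 2) ℚ_[p]) (P : Pk p k) :
    integral μ (ball g) (fun x => P.1.eval x) = leftAct k g (specialize k (distOf hk hμ g)) P := by
  have h : IsTateExp k (fun x => P.1.eval x) g (polyToTate (polyAct k g P).1) := by
    intro z _ hd
    rw [eval_polyToTate, eval_polyAct k g P hd]
  exact h.integral_eq hk hμ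

lemma leftAct_injective (k : ℕ) (g : GL (Fin 2) ℚ_[p]) : Function.Injective (leftAct k g) := by
  intro ω η h
  have h' := congrArg (leftAct k g⁻¹) h
  rwa [← leftAct_mul, ← leftAct_mul, inv_mul_cancel, leftAct_one, leftAct_one] at h'

end

/-! ### Growth -/

lemma Dk.norm_mom_le (ω : Dk p) (i : ℕ) : ‖ω.mom i‖ ≤ ‖ω‖ := by
  refine (ω.le_opNorm _).trans (mul_le_of_le_one_right (norm_nonneg ω) ?_)
  refine Tate.norm_le zero_le_one fun n => ?_
  rw [polyToTate_apply, Polynomial.coeff_X_pow]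
  split_ifs <;> simp

lemma norm_p_zpow_pos (s : ℤ) : 0 < ‖(p : ℚ_[p]) ^ s‖ :=
  norm_pos_iff.2 (zpow_ne_zero s coe_p_ne_zero)

section

variable {k : ℕ} {μ μ' : AkLoc p k →ₗ[ℚ_[p]] ℚ_[p]}

/-- In the coordinate of the disc, `(x - a)ⁿ` is `xⁿ` times the power `n - k/2` of the radius
parameter `p^s`. The growth bound is therefore a uniform bound on moments. -/
lemma norm_integral_sub_pow (hk : Even k) (hμ : IsMeasure μ) (s : ℤ) (a : ℚ_[p]) (n : ℕ) :
    ‖integral μ (ball (aff s a)) fun x => (x - a) ^ n‖ =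
      ‖(p : ℚ_[p]) ^ s‖ ^ ((n : ℤ) - (k / 2 : ℕ)) * ‖(distOf hk hμ (aff s a)).mom n‖ := by
  have h0 : (p : ℚ_[p]) ^ s ≠ 0 := zpow_ne_zero s coe_p_ne_zero
  have h : IsTateExp k (fun x : ℚ_[p] => (x - a) ^ n) (aff s a)
      ((((p : ℚ_[p]) ^ s) ^ ((n : ℤ) - (k / 2 : ℕ))) • polyToTate (Polynomial.X ^ n)) := by
    intro z _ _
    rw [slash_aff, Tate.eval_smul, eval_polyToTate, Polynomial.eval_pow, Polynomial.eval_X,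
      add_sub_cancel_left, mul_pow, zpow_sub₀ h0, zpow_natCast, zpow_natCast]
    ring
  rw [h.integral_eq hk hμ, map_smul, smul_eq_mul, norm_mul, norm_zpow]
  rfl

lemma swap_aff_entry (s : ℤ) : (swap p * aff s 0 : GL (Fin 2) ℚ_[p]) 0 0 = 0 ∧
    (swap p * aff s 0 : GL (Fin 2) ℚ_[p]) 0 1 = 1 ∧
    (swap p * aff s 0 : GL (Fin 2) ℚ_[p]) 1 0 = (p : ℚ_[p]) ^ s ∧
    (swap p * aff s 0 : GL (Fin 2) ℚ_[p]) 1 1 = 0 := by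
  obtain ⟨a1, a2, a3, a4⟩ := aff_entry s (0 : ℚ_[p])
  obtain ⟨b1, b2, b3, b4⟩ := swap_entry (p := p)
  rw [mul_entry, mul_entry, mul_entry, mul_entry, a1, a2, a3, a4, b1, b2, b3, b4]
  simp

/-- Around `∞` the weight `k` factor turns `x^{k-m}` into the `m`-th monomial of the coordinate, so
the exponents `n ≤ k` in the growth condition are again all the moments. -/
lemma norm_integral_zpow (hk : Even k) (hμ : IsMeasure μ) (s : ℤ) (m : ℕ) :
    ‖integral μ (ball (swap p * aff s 0)) fun x => x ^ ((k : ℤ) - m)‖ =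
      ‖(p : ℚ_[p]) ^ s‖ ^ ((m : ℤ) - (k / 2 : ℕ)) *
        ‖(distOf hk hμ (swap p * aff s 0)).mom m‖ := by
  have h0 : (p : ℚ_[p]) ^ s ≠ 0 := zpow_ne_zero s coe_p_ne_zero
  obtain ⟨a1, a2, a3, a4⟩ := swap_aff_entry (p := p) s
  have h : IsTateExp k (fun x : ℚ_[p] => x ^ ((k : ℤ) - m)) (swap p * aff s 0)
      (((-1) ^ (k / 2) * ((p : ℚ_[p]) ^ s) ^ ((m : ℤ) - (k / 2 : ℕ))) •
        polyToTate (Polynomial.X ^ m)) := by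
    intro z _ hd
    rw [a3, a4, add_zero] at hd
    have hz := right_ne_zero_of_mul hd
    have e : ((-(p : ℚ_[p]) ^ s) ^ (k / 2))⁻¹ = (-1) ^ (k / 2) * (((p : ℚ_[p]) ^ s) ^ (k / 2))⁻¹ := by
      rw [neg_pow, mul_inv, ← inv_pow, inv_neg, inv_one]
    rw [Tate.eval_smul, eval_polyToTate, Polynomial.eval_pow, Polynomial.eval_X, slash, det_entry,
      a1, a2, a3, a4, zero_mul, zero_mul, one_mul, zero_sub, zero_add, add_zero, e, one_div,
      inv_zpow, ← zpow_natCast (_ * z) k, zpow_sub₀ hd, zpow_sub₀ h0]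
    simp only [zpow_natCast, mul_pow]
    field_simp
  rw [h.integral_eq hk hμ, map_smul, smul_eq_mul, norm_mul, norm_mul, norm_pow, norm_neg, norm_one,
    one_pow, one_mul, norm_zpow]
  rfl

lemma coe_mem_ball_aff {s : ℤ} {a x : ℚ_[p]} :
    (x : OnePoint ℚ_[p]) ∈ ball (aff s a) ↔ ‖x - a‖ ≤ ‖(p : ℚ_[p]) ^ s‖ := by
  obtain ⟨a1, a2, a3, a4⟩ := aff_entry s a
  rw [coe_mem_ball, a1, a2, a3, a4, one_mul, zero_mul, sub_zero]

lemma diam_ball_aff (s : ℤ) (a : ℚ_[p]) :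
    Metric.diam {x : ℚ_[p] | (x : OnePoint ℚ_[p]) ∈ ball (aff s a)} = ‖(p : ℚ_[p]) ^ s‖ := by
  have hd : ∀ x ∈ {x : ℚ_[p] | (x : OnePoint ℚ_[p]) ∈ ball (aff s a)},
      ∀ y ∈ {x : ℚ_[p] | (x : OnePoint ℚ_[p]) ∈ ball (aff s a)}, dist x y ≤ ‖(p : ℚ_[p]) ^ s‖ := by
    intro x hx y hy
    rw [dist_eq_norm, show x - y = (x - a) - (y - a) by ring]
    exact (padic_norm_sub_le_max _ _).trans
      (max_le (coe_mem_ball_aff.1 hx) (coe_mem_ball_aff.1 hy))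
  refine le_antisymm (Metric.diam_le_of_forall_dist_le (norm_nonneg _) hd) ?_
  have h1 : a + (p : ℚ_[p]) ^ s ∈ {x : ℚ_[p] | (x : OnePoint ℚ_[p]) ∈ ball (aff s a)} :=
    coe_mem_ball_aff.2 (by rw [add_sub_cancel_left])
  have h2 : a ∈ {x : ℚ_[p] | (x : OnePoint ℚ_[p]) ∈ ball (aff s a)} :=
    coe_mem_ball_aff.2 (by rw [sub_self, norm_zero]; exact norm_nonneg _)
  have h := Metric.dist_le_diam_of_mem (Metric.isBounded_iff.2 ⟨_, fun x hx y hy => hd x hx y hy⟩) h1 h2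
  rwa [dist_eq_norm, add_sub_cancel_left] at h

lemma coe_mem_ball_swap_aff {s : ℤ} {x : ℚ_[p]} :
    (x : OnePoint ℚ_[p]) ∈ ball (swap p * aff s 0) ↔ 1 ≤ ‖(p : ℚ_[p]) ^ s * x‖ := by
  obtain ⟨a1, a2, a3, a4⟩ := swap_aff_entry (p := p) s
  rw [coe_mem_ball, a1, a2, a3, a4, zero_mul, zero_sub, zero_sub, norm_neg, norm_neg, norm_one]

lemma sSup_ball_swap_aff (s : ℤ) :
    sSup {r : ℝ | ∃ x : ℚ_[p], (x : OnePoint ℚ_[p]) ∈ ball (swap p * aff s 0) ∧ r = ‖x⁻¹‖} =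
      ‖(p : ℚ_[p]) ^ s‖ := by
  have h0 : (p : ℚ_[p]) ^ s ≠ 0 := zpow_ne_zero s coe_p_ne_zero
  refine IsGreatest.csSup_eq ⟨⟨((p : ℚ_[p]) ^ s)⁻¹, coe_mem_ball_swap_aff.2 ?_, ?_⟩, ?_⟩
  · rw [mul_inv_cancel₀ h0, norm_one]
  · rw [inv_inv]
  · rintro _ ⟨x, hx, rfl⟩
    have hx := coe_mem_ball_swap_aff.1 hx
    rw [norm_mul] at hx
    have hx0 : 0 < ‖x‖ := by
      refine (norm_nonneg x).lt_of_ne fun h => ?_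
      rw [← h, mul_zero] at hx
      exact not_le.2 one_pos hx
    rw [norm_inv, inv_eq_one_div]
    exact (div_le_iff₀ hx0).2 hx

lemma infty_mem_ball_swap_mul (g : GL (Fin 2) ℚ_[p]) :
    OnePoint.infty ∈ ball (swap p * g) ↔ ((0 : ℚ_[p]) : OnePoint ℚ_[p]) ∈ ball g := by
  obtain ⟨b1, b2, b3, b4⟩ := swap_entry (p := p)
  rw [infty_mem_ball, coe_mem_ball, mul_entry, mul_entry, b3, b4]
  simp

lemma zero_mem_ball_swap_mul (g : GL (Fin 2) ℚ_[p]) :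
    ((0 : ℚ_[p]) : OnePoint ℚ_[p]) ∈ ball (swap p * g) ↔ OnePoint.infty ∈ ball g := by
  rw [← infty_mem_ball_swap_mul, ← mul_assoc, swap_mul_swap, one_mul]

/-- The balls that contain `∞` but not `0` are `{x | ‖p^s x‖ ≥ 1}`. -/
lemma exists_swap_aff {g : GL (Fin 2) ℚ_[p]} (h : OnePoint.infty ∈ ball g)
    (h0 : ((0 : ℚ_[p]) : OnePoint ℚ_[p]) ∉ ball g) :
    ∃ (u : ℚ_[p]ˣ) (s : ℤ), ∃ σ ∈ Gamma0 p,
      g = Matrix.GeneralLinearGroup.scalar (Fin 2) u * (swap p * aff s 0) * σ := by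
  obtain ⟨u, s, σ, hσ, e⟩ := exists_aff (g := swap p * g)
    (fun h' => h0 ((infty_mem_ball_swap_mul g).1 h')) ((zero_mem_ball_swap_mul g).2 h)
  refine ⟨u, s, σ, hσ, ?_⟩
  have e' : g = swap p * (swap p * g) := by rw [← mul_assoc, swap_mul_swap, one_mul]
  rw [e', e, ← mul_assoc, ← mul_assoc, ← scalar_comm, mul_assoc _ (swap p)]

lemma IsDistFamily.norm_le {Φ : GL (Fin 2) ℚ_[p] → Dk p} (hΦ : IsDistFamily k Φ) (u : ℚ_[p]ˣ)
    {σ : GL (Fin 2) ℚ_[p]} (hσ : σ ∈ Gamma0 p) (g : GL (Fin 2) ℚ_[p]) :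
    ‖Φ (Matrix.GeneralLinearGroup.scalar (Fin 2) u * g * σ)‖ ≤ ‖Φ g‖ := by
  rw [hΦ.equivariant σ hσ, hΦ.scalar]
  exact norm_distAct_le_of_mem_Gamma0 k _ hσ

variable (p) in
/-- The elements `g` such that the ball `g ℤ_p` does not contain both `0` and `∞`. -/
def smallBalls : Set (GL (Fin 2) ℚ_[p]) :=
  {g | OnePoint.infty ∉ ball g ∨ ((0 : ℚ_[p]) : OnePoint ℚ_[p]) ∉ ball g}

lemma smallBalls_mul_alpha {g : GL (Fin 2) ℚ_[p]} (hg : g ∈ smallBalls p) {j : ℕ} (hj : j < p) :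
    g * alpha j ∈ smallBalls p :=
  hg.imp (fun h h' => h (ball_mul_alpha_subset g hj h')) fun h h' =>
    h (ball_mul_alpha_subset g hj h')

/-- Bounded distributions have bounded moments. Since `exists_aff` accepts any point as centre, the
estimate holds for every `a` in the ball at once. -/
lemma growth_of_bounded (hk : Even k) (hμ : IsMeasure μ) {C : ℝ}
    (hC : ∀ g ∈ smallBalls p, ‖distOf hk hμ g‖ ≤ C) (e : Edge p) :
    (OnePoint.infty ∈ edgeBall e → ((0 : ℚ_[p]) : OnePoint ℚ_[p]) ∉ edgeBall e →
      ∀ n : ℤ, n ≤ k → ‖integral μ (edgeBall e) (fun x => x ^ n)‖ ≤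
        C * sSup {r : ℝ | ∃ x : ℚ_[p], (x : OnePoint ℚ_[p]) ∈ edgeBall e ∧ r = ‖x⁻¹‖} ^
          (-n + (k / 2 : ℕ))) ∧
    (OnePoint.infty ∉ edgeBall e →
      ∀ a : ℚ_[p], (a : OnePoint ℚ_[p]) ∈ edgeBall e →
      ∀ n : ℕ, ‖integral μ (edgeBall e) (fun x => (x - a) ^ n)‖ ≤
        C * Metric.diam {x : ℚ_[p] | (x : OnePoint ℚ_[p]) ∈ edgeBall e} ^
          ((n : ℤ) - (k / 2 : ℕ))) := by
  obtain ⟨g, rfl⟩ := exists_smul_e0 e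
  rw [edgeBall_smul_e0]
  have hk2 : ((k / 2 : ℕ) : ℤ) + (k / 2 : ℕ) = k := by
    obtain ⟨r, rfl⟩ := hk; omega
  constructor
  · intro h1 h0 n hn
    obtain ⟨u, s, σ, hσ, rfl⟩ := exists_swap_aff h1 h0
    rw [ball_mul_Gamma0 _ hσ, ball_scalar_mul] at h0 ⊢
    obtain ⟨m, hm⟩ := Int.eq_ofNat_of_zero_le (sub_nonneg.2 hn)
    obtain rfl : n = k - m := by omega
    rw [norm_integral_zpow hk hμ, sSup_ball_swap_aff, mul_comm,
      show -((k : ℤ) - m) + (k / 2 : ℕ) = m - (k / 2 : ℕ) by omega]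
    exact mul_le_mul_of_nonneg_right ((Dk.norm_mom_le _ _).trans (hC _ (Or.inr h0)))
      (zpow_nonneg (norm_nonneg _) _)
  · intro h1 a ha n
    obtain ⟨u, s, σ, hσ, rfl⟩ := exists_aff h1 ha
    rw [ball_mul_Gamma0 _ hσ, ball_scalar_mul] at h1 ⊢
    rw [norm_integral_sub_pow hk hμ, diam_ball_aff, mul_comm]
    exact mul_le_mul_of_nonneg_right ((Dk.norm_mom_le _ _).trans (hC _ (Or.inl h1)))
      (zpow_nonneg (norm_nonneg _) _)

/-- This is the converse of `growth_of_bounded`: the powers of the radius cancel exactly, so growth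
bounds all moments, and these bound the norm by `Dk.norm_le_of_mom`. -/
lemma IsMeasureOf.bounded {c : Edge p → Vk p k} (hk : Even k) (h : IsMeasureOf c μ) :
    ∃ C, ∀ g ∈ smallBalls p, ‖distOf hk h.continuous g‖ ≤ C := by
  obtain ⟨C, hC0, hC⟩ := h.growth
  have hΦ := isDistFamily_distOf hk h.continuous
  refine ⟨C, fun g hg => ?_⟩
  by_cases h1 : OnePoint.infty ∈ ball g
  · have h0 := hg.resolve_left (not_not.2 h1)
    obtain ⟨u, s, σ, hσ, rfl⟩ := exists_swap_aff h1 h0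
    refine (hΦ.norm_le u hσ _).trans (Dk.norm_le_of_mom hC0 fun m => ?_)
    rw [ball_mul_Gamma0 _ hσ, ball_scalar_mul] at h0 h1
    have hm := (hC ((swap p * aff s 0) • e0 p)).1
    rw [edgeBall_smul_e0] at hm
    have hm := hm h1 h0 (k - m) (by omega)
    have hk2 : ((k / 2 : ℕ) : ℤ) + (k / 2 : ℕ) = k := by
      obtain ⟨r, rfl⟩ := hk; omega
    rw [norm_integral_zpow hk h.continuous, sSup_ball_swap_aff, mul_comm,
      show -((k : ℤ) - m) + (k / 2 : ℕ) = m - (k / 2 : ℕ) by omega] at hm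
    exact le_of_mul_le_mul_right hm (zpow_pos (norm_p_zpow_pos s) _)
  · obtain ⟨x, hx⟩ := exists_mem_ball_of_infty_notMem h1
    obtain ⟨u, s, σ, hσ, rfl⟩ := exists_aff h1 hx
    refine (hΦ.norm_le u hσ _).trans (Dk.norm_le_of_mom hC0 fun m => ?_)
    rw [ball_mul_Gamma0 _ hσ, ball_scalar_mul] at h1 hx
    have hm := (hC (aff s x • e0 p)).2
    rw [edgeBall_smul_e0] at hm
    have hm := hm h1 x hx m
    rw [norm_integral_sub_pow hk h.continuous, diam_ball_aff, mul_comm] at hm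
    exact le_of_mul_le_mul_right hm (zpow_pos (norm_p_zpow_pos s) _)

/-- The interpolation property fixes the restriction of each distribution to `𝒫_k`, which is the
input of the contraction argument. -/
lemma IsMeasureOf.leftAct_specialize {c : Edge p → Vk p k} (hk : Even k) (h : IsMeasureOf c μ)
    (g : GL (Fin 2) ℚ_[p]) :
    leftAct k g (specialize k (distOf hk h.continuous g)) = c (g • e0 p) := by
  ext1 P
  rw [← integral_eval hk h.continuous, ← h.interpolation, edgeBall_smul_e0]

/-- A measure is determined by its values on polynomials of degree at most `k` and its growth. -/
theorem IsMeasureOf.unique {c : Edge p → Vk p k} (hk : Even k) (h : IsMeasureOf c μ)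
    (h' : IsMeasureOf c μ') : μ = μ' := by
  obtain ⟨C, hC⟩ := h.bounded hk
  obtain ⟨C', hC'⟩ := h'.bounded hk
  have hS : ∀ g ∈ smallBalls p, ∀ j < p, g * alpha j ∈ smallBalls p :=
    fun _ hg _ hj => smallBalls_mul_alpha hg hj
  have h1 : OnePoint.infty ∉ ball (1 : GL (Fin 2) ℚ_[p]) := by
    rw [infty_mem_ball]; simp
  have h2 : ((0 : ℚ_[p]) : OnePoint ℚ_[p]) ∉ ball (1 * g0 p) := by
    rw [coe_mem_ball_mul_g0, not_not, coe_mem_ball]; simp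
  -- The splitting into `ℤ_p`, which misses `∞`, and its complement, which misses `0`, stays among
  -- the balls where the growth condition gives bounds.
  refine eq_of_distOf_eq hk h.continuous h'.continuous hS (Or.inl h1) (Or.inr h2) fun g hg => ?_
  exact eq_of_normUp_eq hk hS (C := max C C') (fun g hg => (hC g hg).trans (le_max_left _ _))
    (fun g hg => (hC' g hg).trans (le_max_right _ _))
    (fun g _ => leftAct_injective k g
      ((h.leftAct_specialize hk g).trans (h'.leftAct_specialize hk g).symm))
    (fun g _ => (isDistFamily_distOf hk h.continuous).fixed g)
    (fun g _ => (isDistFamily_distOf hk h'.continuous).fixed g) hg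

lemma IsEigenLift.isDistFamily {Γ : Subgroup (GL (Fin 2) ℚ_[p])} {φ : GL (Fin 2) ℚ_[p] → Vk p k}
    {Φ : GL (Fin 2) ℚ_[p] → Dk p} (hΦ : IsEigenLift Γ k φ Φ) : IsDistFamily k Φ where
  scalar u g := by
    have h := hΦ.form.left_invariant u 1 Γ.one_mem g
    rwa [mul_one] at h
  equivariant σ hσ g := hΦ.form.right_equivariant σ hσ g
  fixed g := UpRigid_eq_iff.1 (hΦ.eigen g)

lemma isMeasure_measureOf (hk : Even k) {Φ : GL (Fin 2) ℚ_[p] → Dk p} (hΦ : IsDistFamily k Φ) :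
    IsMeasure (measureOf hk hΦ) := by
  intro g
  refine ⟨‖Φ g‖, fun F => ?_⟩
  rw [integral_measureOf]
  exact (Φ g).le_opNorm F

/-- The eigenlift of the form attached to a harmonic cocycle gives its measure. -/
theorem isMeasureOf_measureOf {Γ : Subgroup (GL (Fin 2) ℚ_[p])} {c : Edge p → Vk p k}
    {φ : GL (Fin 2) ℚ_[p] → Vk p k} {Φ : GL (Fin 2) ℚ_[p] → Dk p} (hk : Even k)
    (hΓ : HasFiniteDoubleCosets Γ) (hφ : Corresponds Γ k c φ) (hΦ : IsEigenLift Γ k φ Φ) :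
    IsMeasureOf c (measureOf hk hΦ.isDistFamily) := by
  have hμ := isMeasure_measureOf hk hΦ.isDistFamily
  have e : ∀ g, distOf hk hμ g = Φ g := fun g => by
    ext1 F
    rw [distOf_apply, integral_measureOf]
  refine ⟨hμ, fun c' P => ?_, ?_⟩
  · obtain ⟨g, rfl⟩ := exists_smul_e0 c'
    rw [edgeBall_smul_e0, integral_eval hk hμ, e, hΦ.lifts, hφ.cocycle]
  · obtain ⟨C, hC⟩ := hΦ.form.bounded hΓ
    refine ⟨C, (norm_nonneg (Φ 1)).trans (hC 1), growth_of_bounded hk hμ fun g _ => ?_⟩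
    rw [e]
    exact hC g

lemma mom_eq_integral {Φ : GL (Fin 2) ℚ_[p] → Dk p} (hk : Even k) (hΦ : IsDistFamily k Φ)
    (g : GL (Fin 2) ℚ_[p]) (i : ℕ) :
    cut (ball g) (slash k (fun x => x ^ i) g⁻¹) ∈ AkLoc p k ∧
      (Φ g).mom i = integral (measureOf hk hΦ) (ball g) (slash k (fun x => x ^ i) g⁻¹) := by
  have e : (fun x : ℚ_[p] => x ^ i) = (polyToTate (Polynomial.X ^ i) : Tate p).eval := by
    funext x
    rw [eval_polyToTate, Polynomial.eval_pow, Polynomial.eval_X]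
  rw [e, integral_measureOf]
  exact ⟨cut_slash_mem hk g _, rfl⟩

end

end OverconvergentLift

end

/-! ### The correspondence between the cocycle, its measure and its lift -/

theorem theorem3 (p : ℕ) [Fact p.Prime] (a b : ℚ) (ha : a < 0) (hb : b < 0)
    (R : Subring ℍ[ℚ,a,b]) (hR : OverconvergentLift.IsOrder R)
    (ι : ℍ[ℚ,a,b] →ₐ[ℚ] Matrix (Fin 2) (Fin 2) ℚ_[p]) (hι : OverconvergentLift.IsSplitting R ι)
    (k : ℕ) (hk : Even k) (c : OverconvergentLift.Edge p → OverconvergentLift.Vk p k)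
    (hc : OverconvergentLift.IsHarmonicCocycle (OverconvergentLift.Gam R ι) k c) :
    (∃! φ : GL (Fin 2) ℚ_[p] → OverconvergentLift.Vk p k,
      OverconvergentLift.Corresponds (OverconvergentLift.Gam R ι) k c φ) ∧
    (∃! μ : OverconvergentLift.AkLoc p k →ₗ[ℚ_[p]] ℚ_[p], OverconvergentLift.IsMeasureOf c μ) ∧
    ∀ (φ : GL (Fin 2) ℚ_[p] → OverconvergentLift.Vk p k)
      (μ : OverconvergentLift.AkLoc p k →ₗ[ℚ_[p]] ℚ_[p]),
      OverconvergentLift.Corresponds (OverconvergentLift.Gam R ι) k c φ →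
      OverconvergentLift.IsMeasureOf c μ →
      ∃ Φ : GL (Fin 2) ℚ_[p] → OverconvergentLift.Dk p,
        OverconvergentLift.IsEigenLift (OverconvergentLift.Gam R ι) k φ Φ ∧
        (∀ Ψ, OverconvergentLift.IsEigenLift (OverconvergentLift.Gam R ι) k φ Ψ → Ψ = Φ) ∧
        ∀ (g : GL (Fin 2) ℚ_[p]) (i : ℕ),
          OverconvergentLift.cut (OverconvergentLift.ball g)
              (OverconvergentLift.slash k (fun x => x ^ i) g⁻¹) ∈ OverconvergentLift.AkLoc p k ∧
          (Φ g).mom i = OverconvergentLift.integral μ (OverconvergentLift.ball g)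
            (OverconvergentLift.slash k (fun x => x ^ i) g⁻¹) := by
  have hΓ : OverconvergentLift.HasFiniteDoubleCosets (OverconvergentLift.Gam R ι) :=
    OverconvergentLift.exists_finite_invariant ha hb hR hι
  have hex : ∀ φ, OverconvergentLift.Corresponds (OverconvergentLift.Gam R ι) k c φ →
      ∃ Φ, ∃ hΦ : OverconvergentLift.IsEigenLift (OverconvergentLift.Gam R ι) k φ Φ,
        OverconvergentLift.IsMeasureOf c (OverconvergentLift.measureOf hk hΦ.isDistFamily) := by
    intro φ hφ
    obtain ⟨Φ, hΦ⟩ := OverconvergentLift.exists_eigenLift hk hΓ hφ.form hφ.eigen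
    exact ⟨Φ, hΦ, OverconvergentLift.isMeasureOf_measureOf hk hΓ hφ hΦ⟩
  have hφ := OverconvergentLift.existsUnique_corresponds hk hc
  refine ⟨hφ, ?_, fun φ μ h hμ => ?_⟩
  · obtain ⟨φ, h, -⟩ := hφ
    obtain ⟨Φ, hΦ, hμ⟩ := hex φ h
    exact ⟨_, hμ, fun μ' hμ' => hμ'.unique hk hμ⟩
  · obtain ⟨Φ, hΦ, hμΦ⟩ := hex φ h
    -- By uniqueness the given measure is the one built from the lift, for which the moment formula
    -- holds by construction.
    obtain rfl := hμ.unique hk hμΦ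
    exact ⟨Φ, hΦ, fun Ψ hΨ => hΨ.unique hk hΓ hΦ,
      OverconvergentLift.mom_eq_integral hk hΦ.isDistFamily⟩
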